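/- **Setting.** Let $\ell_1,\ell_2\ge 1$ and let $\Gamma$ be the lattice with basis $\gamma_1,\dots,\gamma_{\ell_1},\eta_1,\dots,\eta_{\ell_2}$ and the skew form with $\langle\gamma_i,\gamma_j\rangle=\langle\eta_i,\eta_j\rangle=0$, $\langle\gamma_i,\eta_j\rangle=1$. Let $\pi:\Gamma\to\mathbb Z^2$, $\pi(\gamma_i)=(0,1)$, $\pi(\eta_j)=(1,0)$. Let $Z^{\pm}:\Gamma\to\mathbb C$ be homomorphisms such that $Z^\pm(\gamma_i)=:Z^\pm(\gamma)$ and $Z^\pm(\eta_j)=:Z^\pm(\eta)$ do not depend on $i,j$, are non-zero and satisfy $0\le\arg Z^+(\eta)<\arg Z^-(\gamma)<\arg Z^-(\eta)<\arg Z^+(\gamma)\le\pi/2$. Put $Z^\tau=(1-\tau)Z^++\tau Z^-$ and let $\tau_0\in[0,1]$ be the point for which $Z^{\tau_0}(\Gamma)$ lies in a real line. Let $\zeta\in\mathbb C$ lie outside the closed cone spanned by $Z^+(\gamma),Z^+(\eta)$ and outside its opposite. **The invariants.** Let $R_k=\mathbb C[[s_1,\dots,s_{\ell_1},t_1,\dots,t_{\ell_2}]]/(s_i^{k+1},t_j^{k+1})$,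 and let $\widehat{\mathfrak g}$ be the free $R_k$-module on $e_\alpha$ ($\alpha\in\Gamma$) with the commutative product $e_\alpha e_\beta=(-1)^{\langle\alpha,\beta\rangle}e_{\alpha+\beta}$. For $\beta=\sum a_i\gamma_i+\sum b_j\eta_j$ put $(s,t)^\beta=\prod s_i^{|a_i|}\prod t_j^{|b_j|}$. A spectrum is an even function $\Omega:\Gamma\to\mathbb Z$ with $\Omega(0)=0$; put $\mathrm{DT}(\beta)=\sum_{p>0,\,p\mid\beta}\Omega(\beta/p)/p^2$. For a central charge $Z$, a radius $R>0$ and a spectrum $\Omega$, let $\psi^0_\alpha(\zeta)=\exp(\pi R(\zeta^{-1}Z(\alpha)+\zeta\overline{Z(\alpha)}))\,e_\alpha$, $\rho(\zeta,\zeta')=\frac1{4\pi i}\frac{\zeta'+\zeta}{\zeta'-\zeta}$ and $$\Phi(\psi)_\alpha(\zeta)=\psi^0_\alpha(\zeta)\exp\Big(\sum_{\beta}\langle \mathrm{DT}(\beta)\beta,\alpha\rangle\int_{\mathbb R_{<0}Z(\beta)}\frac{d\zeta'}{\zeta'}\rho(\zeta,\zeta')(s,t)^{\beta}\psi_{\beta}(\zeta')\Big).$$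 The iterates of $\psi^0$ under $\Phi$ stabilise to a solution $\psi^\infty(\zeta,Z)$ of $\psi=\Phi(\psi)$. Let $\Omega_{Z^+}$ be the spectrum with $\Omega_{Z^+}(\pm\gamma_i)=\Omega_{Z^+}(\pm\eta_j)=1$ which vanishes elsewhere. A spectrum $\Omega_{Z^-}$ solves the wall-crossing problem over $R_k$ if for all $R\gg1$ the family $\psi^\infty(\zeta,Z^\tau)$, formed with $\Omega_{Z^+}$ for $\tau<\tau_0$ and with $\Omega_{Z^-}$ for $\tau>\tau_0$, extends to a continuous family, $\tau\in[0,1]$, of $R_k$-algebra automorphisms $e_\alpha\mapsto\psi_\alpha$ of $\widehat{\mathfrak g}$ (each image of an $e_\alpha$ is a combination of finitely many $re_\beta$, $r\in R_k$, with continuous complex coefficients). Write $\mathrm{DT}_{Z^-}$ for the function $\mathrm{DT}$ of such an $\Omega_{Z^-}$. **Trees.** Let $\mathcal T$ be a rooted tree with vertices $v$ decorated by $\alpha(v)$, each a positive multiple of some $\gamma_i$ or $\eta_j$. Its charge is $c(\mathcal T)=\sum_v\alpha(v)$, its root label is $\gamma_{\mathcal T}$, and $$\mathcal W_{\mathcal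 T}=(-1)^{\#\mathrm{edges}}\frac{\mathrm{DT}_{Z^+}(\gamma_{\mathcal T})}{|\mathrm{Aut}\,\mathcal T|}\prod_{v\to w}\langle\alpha(v),\mathrm{DT}_{Z^+}(\alpha(w))\alpha(w)\rangle .$$ **Signed tropical types.** Choose a total order (labelling) of the vertices of $\mathcal T$, and let $\ell^\pm_\beta=\mathbb R_{<0}Z^\pm(\beta)$. Put the contour of each vertex $v$ on $\ell^+_{\alpha(v)}$ and repeat the following: take the first vertex $v$ whose contour is not $\ell^-_{\alpha(v)}$ and move its contour to $\ell^-_{\alpha(v)}$, through the sector spanned by $\ell^+_\gamma,\ell^+_\eta$, stopping short of (infinitesimally before) the contours that already lie there; contours on a common ray keep this infinitesimal order. The process branches: in one branch the contour has just moved; in addition there is one branch for each vertex $w$ adjacent to $v$ whose contour was crossed, in which the edge joining $v,w$ is contracted to $w$, which keeps its contour and its place in the order and gets the decoration $\alpha(v)+\alpha(w)$. Such a contraction has the sign $(-1)^{\langle\alpha(v),\alpha(w)\rangle}\epsilon$, where, for a clockwise move, $\epsilon=-1$ if $w$ is the parent of $v$ and $\epsilon=+1$ if $w$ is a child, and the other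 way round for a counterclockwise move. A branch ends when every contour is $\ell^-_{\alpha(v)}$. Each branch that ends with a single vertex gives the combinatorial type $[\Upsilon_j]$ of a rational plane tropical curve, whose incoming ends are the $\pi(\alpha(v))$ and whose trivalent vertices, with outgoing weighted directions $-\pi(\beta_1),-\pi(\beta_2),\pi(\beta_1+\beta_2)$, are the contractions of vertices decorated by $\beta_1,\beta_2$; its sign $(-1)^{[\Upsilon_j]}$ is the product of the signs of the contractions. (For a tree with one vertex there is one type, with sign $+1$.) Types are counted once for each branch. **Statement.** Let $\alpha\in\Gamma$ have non-negative coordinates, with $\pi(\alpha)$ primitive, and let $i\in\{1,\dots,\ell_1\}$ be such that the coordinate $\alpha_{\gamma_i}$ of $\alpha$ along $\gamma_i$ is positive. Let $k$ be such that $(s,t)^\alpha\ne0$ in $R_k$, and let $\Omega_{Z^-}$ be a solution of the wall-crossing problem over $R_k$. Then, for every choice of labellings of the trees, $$\mathrm{DT}_{Z^-}(\alpha)=\sum_{c(\mathcal T)=\alpha,\ \gamma_{\mathcal T}=p_{\mathcal T}\gamma_i}\frac{p_{\mathcal T}}{c(\mathcal T)_{\gamma_i}}\,\mathcal W_{\mathcal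 T}\sum_{\{[\Upsilon_j]\}_{\mathcal T}}(-1)^{[\Upsilon_j]},$$ where the sum is over the finitely many isomorphism classes of decorated rooted trees $\mathcal T$ as above with $c(\mathcal T)=\alpha$ and $\gamma_{\mathcal T}=p_{\mathcal T}\gamma_i$ for some integer $p_{\mathcal T}>0$, and $c(\mathcal T)_{\gamma_i}$ is the component of $c(\mathcal T)$ along $\gamma_i$. -/

import Mathlib

open MeasureTheory Filter Topology

noncomputable section

namespace InstantonTBA

/-! ### The lattice, its pairing, and central charges -/

/-- Index set of the basis `γ_1, …, γ_{l1}, η_1, …, η_{l2}`. -/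
abbrev Idx (l1 l2 : ℕ) : Type := Fin l1 ⊕ Fin l2

/-- The lattice `Γ`, free on the `γ_i` and the `η_j`; an element is its vector of coordinates. -/
abbrev Lat (l1 l2 : ℕ) : Type := Idx l1 l2 → ℤ

variable {l1 l2 : ℕ}

/-- The basis vector with index `v`: `basisVec (Sum.inl i) = γ_i`, `basisVec (Sum.inr j) = η_j`. -/
def basisVec (v : Idx l1 l2) : Lat l1 l2 := Pi.single v 1

/-- Sum of the coordinates along the `γ_i`. -/
def gPart (a : Lat l1 l2) : ℤ := ∑ i : Fin l1, a (Sum.inl i)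

/-- Sum of the coordinates along the `η_j`. -/
def hPart (a : Lat l1 l2) : ℤ := ∑ j : Fin l2, a (Sum.inr j)

/-- The projection `π : Γ → ℤ²` with `π(γ_i) = (0, 1)` and `π(η_j) = (1, 0)`. -/
def proj (a : Lat l1 l2) : ℤ × ℤ := (hPart a, gPart a)

/-- The skew-symmetric form: `⟨γ_i, γ_j⟩ = ⟨η_i, η_j⟩ = 0` and `⟨γ_i, η_j⟩ = 1`. -/
def pairing (a b : Lat l1 l2) : ℤ := gPart a * hPart b - hPart a * gPart b

/-- The central charge `Γ → ℂ` that takes the value `zg` on all `γ_i` and `zh` on all `η_j`. -/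
def central (zg zh : ℂ) (a : Lat l1 l2) : ℂ := (gPart a : ℂ) * zg + (hPart a : ℂ) * zh

/-- A pair of central charges `Z⁺, Z⁻` on the two sides of the wall, given by their common values
on the `γ_i` and on the `η_j`. All values lie in the (closed) first quadrant, `Z⁺(γ)` precedes
`Z⁺(η)` in the clockwise order, `Z⁻(η)` precedes `Z⁻(γ)`, and the cone spanned by `Z⁺(γ), Z⁺(η)`
strictly contains the cone spanned by `Z⁻(γ), Z⁻(η)`. -/
structure ChargePair where
  gPlus : ℂ
  hPlus : ℂ
  gMinus : ℂ
  hMinus : ℂ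
  hPlus_ne : hPlus ≠ 0
  arg_nonneg : 0 ≤ hPlus.arg
  arg_lt_one : hPlus.arg < gMinus.arg
  arg_lt_two : gMinus.arg < hMinus.arg
  arg_lt_three : hMinus.arg < gPlus.arg
  arg_le : gPlus.arg ≤ Real.pi / 2

namespace ChargePair

/-- `Z⁺`. -/
def plus (P : ChargePair) (a : Lat l1 l2) : ℂ := central P.gPlus P.hPlus a

/-- `Z⁻`. -/
def minus (P : ChargePair) (a : Lat l1 l2) : ℂ := central P.gMinus P.hMinus a

/-- The family `Z^τ = (1 - τ) Z⁺ + τ Z⁻`. -/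
def interp (P : ChargePair) (τ : ℝ) (a : Lat l1 l2) : ℂ :=
  (1 - (τ : ℂ)) * P.plus a + (τ : ℂ) * P.minus a

/-- The union of the closed cone spanned by `Z⁺(γ), Z⁺(η)` and its opposite. -/
def cones (P : ChargePair) : Set ℂ :=
  {z | ∃ x y : ℝ, ((0 ≤ x ∧ 0 ≤ y) ∨ (x ≤ 0 ∧ y ≤ 0)) ∧ z = x * P.gPlus + y * P.hPlus}

end ChargePair

/-! ### The algebra over the Artin ring `R_k` -/

/-- `R_k = ℂ[[s_1, …, s_{l1}, t_1, …, t_{l2}]] / (s_i^{k+1}, t_j^{k+1})`. -/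
abbrev ArtinR (l1 l2 k : ℕ) : Type :=
  MvPowerSeries (Idx l1 l2) ℂ ⧸
    Ideal.span (Set.range fun v : Idx l1 l2 => (MvPowerSeries.X v : MvPowerSeries _ ℂ) ^ (k + 1))

/-- The monomial `(s, t)^a = ∏ s_i^{|a_i|} ∏ t_j^{|b_j|}` in `R_k`. -/
def stMonomial (k : ℕ) (a : Lat l1 l2) : ArtinR l1 l2 k :=
  Ideal.Quotient.mk _ (∏ v, (MvPowerSeries.X v : MvPowerSeries _ ℂ) ^ (a v).natAbs)

/-- The commutative algebra `𝔤 ⊗ R_k` (which is complete, as `R_k` is Artinian). It is realised as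
the group algebra of `Γ`, and the twisted basis is `basisE` below. -/
abbrev GHat (l1 l2 k : ℕ) : Type := AddMonoidAlgebra (ArtinR l1 l2 k) (Lat l1 l2)

/-- The basis element `e_a`. The sign is a quadratic refinement, so that the `e_a` multiply by
`e_a e_b = (-1)^{⟨a, b⟩} e_{a + b}`, see `basisE_mul`. -/
def basisE (k : ℕ) (a : Lat l1 l2) : GHat l1 l2 k :=
  AddMonoidAlgebra.single a (((Int.negOnePow (gPart a * hPart a) : ℤˣ) : ℤ) : ArtinR l1 l2 k)

lemma gPart_add (a b : Lat l1 l2) : gPart (a + b) = gPart a + gPart b := by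
  simp [gPart, Finset.sum_add_distrib]

lemma hPart_add (a b : Lat l1 l2) : hPart (a + b) = hPart a + hPart b := by
  simp [hPart, Finset.sum_add_distrib]

theorem basisE_mul (k : ℕ) (a b : Lat l1 l2) :
    basisE k a * basisE k b =
      (((Int.negOnePow (pairing a b) : ℤˣ) : ℤ) : ArtinR l1 l2 k) • basisE k (a + b) := by
  have h : Int.negOnePow (gPart a * hPart a) * Int.negOnePow (gPart b * hPart b) =
      Int.negOnePow (pairing a b) *
        Int.negOnePow (gPart (a + b) * hPart (a + b)) := by
    rw [← Int.negOnePow_add, ← Int.negOnePow_add, Int.negOnePow_eq_iff, gPart_add, hPart_add,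
      pairing]
    refine ⟨-(gPart a * hPart b), ?_⟩
    ring
  have h2 := congrArg (fun u : ℤˣ => (((u : ℤˣ) : ℤ) : ArtinR l1 l2 k)) h
  simp only [Units.val_mul, Int.cast_mul] at h2
  rw [basisE, basisE, basisE, AddMonoidAlgebra.single_mul_single, AddMonoidAlgebra.smul_single,
    smul_eq_mul, h2]

/-- Continuity on `S` of a family of automorphisms: each `Ψ(τ)(e_a)` is a linear combination of
finitely many `r e_b` with continuous complex coefficients. -/
def ContinuousFamily {k : ℕ} (S : Set ℝ)
    (Ψ : ℝ → (GHat l1 l2 k ≃ₐ[ArtinR l1 l2 k] GHat l1 l2 k)) : Prop :=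
  ∀ a : Lat l1 l2, ∃ (m : ℕ) (r : Fin m → ArtinR l1 l2 k) (b : Fin m → Lat l1 l2)
    (c : Fin m → ℝ → ℂ), (∀ j, ContinuousOn (c j) S) ∧
      ∀ τ ∈ S, Ψ τ (basisE k a) = ∑ j, c j τ • (r j • basisE k (b j))

/-! ### BPS spectra and the TBA operator -/

/-- A BPS spectrum: an even integer-valued function on `Γ` which vanishes at `0`. -/
def IsSpectrum (Ω : Lat l1 l2 → ℤ) : Prop := (∀ a, Ω (-a) = Ω a) ∧ Ω 0 = 0

/-- `DT(a) = ∑_{p > 0, p ∣ a} Ω(a / p) / p²`. -/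
def DT (Ω : Lat l1 l2 → ℤ) (a : Lat l1 l2) : ℚ :=
  ∑ᶠ q ∈ {q : ℕ × Lat l1 l2 | 0 < q.1 ∧ q.1 • q.2 = a}, (Ω q.2 : ℚ) / (q.1 : ℚ) ^ 2

open Classical in
/-- The spectrum before the wall: `Ω(±γ_i) = Ω(±η_j) = 1`, and `Ω = 0` elsewhere. -/
def plusSpectrum (a : Lat l1 l2) : ℤ :=
  if ∃ v, a = basisVec v ∨ a = -basisVec v then 1 else 0

open Classical in
/-- The integral over `ℝ` of a function with values in a complex vector space, defined through all
linear functionals. -/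
def weakIntegral {V : Type*} [AddCommGroup V] [Module ℂ V] (F : ℝ → V) : V :=
  if h : ∃ y : V, ∀ φ : V →ₗ[ℂ] ℂ,
      Integrable (fun x => φ (F x)) ∧ ∫ x, φ (F x) = φ y
  then h.choose else 0

/-- `∫_ℓ F(ζ') dζ'/ζ'` over the ray `ℓ = ℝ_{<0} z`, parametrised by `ζ' = -e^x z`. -/
def rayIntegral {V : Type*} [AddCommGroup V] [Module ℂ V] (z : ℂ) (F : ℂ → V) : V :=
  weakIntegral fun x : ℝ => F (-(Real.exp x : ℂ) * z)

/-- The kernel `ρ(ζ, ζ') = (1 / 4πi) (ζ' + ζ) / (ζ' - ζ)`. -/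
def rho (ζ ζ' : ℂ) : ℂ := 1 / (4 * Real.pi * Complex.I) * ((ζ' + ζ) / (ζ' - ζ))

/-- The semiflat family `ψ⁰_a(ζ) = exp(πR(ζ⁻¹ Z(a) + ζ conj Z(a))) e_a`. -/
def semiflat (k : ℕ) (R : ℝ) (Z : Lat l1 l2 → ℂ) (a : Lat l1 l2) (ζ : ℂ) : GHat l1 l2 k :=
  Complex.exp (Real.pi * R * (ζ⁻¹ * Z a + ζ * (starRingEnd ℂ) (Z a))) • basisE k a

/-- The TBA operator, acting on families `ψ_a(ζ)`:
`Φ(ψ)_a(ζ) = ψ⁰_a(ζ) exp(∑_b ⟨DT(b) b, a⟩ ∫_{ℓ_b} (dζ'/ζ') ρ(ζ, ζ') (s, t)^b ψ_b(ζ'))`,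
with `ℓ_b = ℝ_{<0} Z(b)`. The argument of the exponential is nilpotent. -/
def tbaOp (k : ℕ) (R : ℝ) (Z : Lat l1 l2 → ℂ) (Ω : Lat l1 l2 → ℤ)
    (ψ : Lat l1 l2 → ℂ → GHat l1 l2 k) : Lat l1 l2 → ℂ → GHat l1 l2 k :=
  fun a ζ => semiflat k R Z a ζ *
    IsNilpotent.exp (∑ᶠ b : Lat l1 l2,
      ((DT Ω b : ℂ) * (pairing b a : ℂ)) •
        rayIntegral (Z b) fun ζ' => rho ζ ζ' • (stMonomial k b • ψ b ζ'))

open Classical in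
/-- The spectrum `Ω` solves the wall-crossing problem over `R_k`: for all large `R`, the solutions
`ψ^∞(ζ, Z^τ)` of the TBA equation obtained by iterating the operator from `ψ⁰` (the iteration
stabilises), with the spectrum `plusSpectrum` for `τ < τ₀` and `Ω` for `τ > τ₀`, extend to a
continuous family of automorphisms on `[0, 1]`. -/
def SolvesWallCrossing (P : ChargePair) (τ₀ : ℝ) (ζ : ℂ) (k : ℕ) (Ω : Lat l1 l2 → ℤ) : Prop :=
  IsSpectrum Ω ∧ ∀ᶠ R : ℝ in atTop,
    ∃ Ψ : ℝ → (GHat l1 l2 k ≃ₐ[ArtinR l1 l2 k] GHat l1 l2 k),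
      ContinuousFamily (Set.Icc 0 1) Ψ ∧
      ∀ τ ∈ Set.Icc (0 : ℝ) 1, τ ≠ τ₀ → ∀ a : Lat l1 l2, ∀ᶠ m : ℕ in atTop,
        ((tbaOp k R (P.interp τ) (if τ < τ₀ then plusSpectrum else Ω))^[m]
          (semiflat k R (P.interp τ))) a ζ = Ψ τ (basisE k a)

/-! ### Decorated rooted trees -/

/-- A decorated rooted tree with a labelling: the vertices are labelled by `0, …, n - 1`, in an
order that need not be compatible with the root. `par v` is the parent of `v`. -/
structure LTree (l1 l2 : ℕ) where
  n : ℕ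
  root : Fin n
  par : Fin n → Option (Fin n)
  dec : Fin n → Lat l1 l2
  par_eq_none : ∀ v, par v = none ↔ v = root
  reach : ∀ v, ∃ m : ℕ, (fun o : Option (Fin n) => o.bind par)^[m] (some v) = some root

namespace LTree

/-- A bijection of the vertices which respects the edges (hence the roots) and the decorations. -/
def IsIso (S T : LTree l1 l2) (σ : Fin S.n ≃ Fin T.n) : Prop :=
  (∀ v, T.par (σ v) = (S.par v).map σ) ∧ ∀ v, T.dec (σ v) = S.dec v

/-- Isomorphism of decorated rooted trees; the labellings are forgotten. -/
instance isoSetoid (l1 l2 : ℕ) : Setoid (LTree l1 l2) where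
  r S T := ∃ σ, IsIso S T σ
  iseqv :=
    { refl := fun S => ⟨Equiv.refl _, by simp [IsIso]⟩
      symm := by
        rintro S T ⟨σ, h1, h2⟩
        refine ⟨σ.symm, fun v => ?_, fun v => ?_⟩
        · have h := h1 (σ.symm v)
          rw [Equiv.apply_symm_apply] at h
          rw [h, Option.map_map]
          simp
        · have h := h2 (σ.symm v)
          rw [Equiv.apply_symm_apply] at h
          exact h.symm
      trans := by
        rintro S T U ⟨σ, h1, h2⟩ ⟨ρ, h3, h4⟩
        refine ⟨σ.trans ρ, fun v => ?_, fun v => ?_⟩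
        · simp [h3, h1, Option.map_map]
        · simp [h4, h2] }

/-- Order of the automorphism group of the decorated rooted tree. -/
def autCard (T : LTree l1 l2) : ℕ := Nat.card {σ : Equiv.Perm (Fin T.n) // IsIso T T σ}

/-- The charge `c(T) = ∑_v α(v)`. -/
def charge (T : LTree l1 l2) : Lat l1 l2 := ∑ v, T.dec v

/-- The label of the root. -/
def rootLabel (T : LTree l1 l2) : Lat l1 l2 := T.dec T.root

/-- A positive tree: every vertex is decorated by a positive multiple of some `γ_i` or `η_j`. -/
def Positive (T : LTree l1 l2) : Prop :=
  ∀ v, ∃ (u : Idx l1 l2) (p : ℕ), 0 < p ∧ T.dec v = p • basisVec u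

/-- The weight
`W_T = (-1)^{#edges} (DT(γ_T) / |Aut T|) ∏_{v → w} ⟨α(v), DT(α(w)) α(w)⟩`,
for the spectrum before the wall. -/
def weight (T : LTree l1 l2) : ℚ :=
  (-1) ^ (T.n - 1) * (DT plusSpectrum T.rootLabel / (T.autCard : ℚ)) *
    ∏ w, (match T.par w with
      | none => 1
      | some v => (pairing (T.dec v) (T.dec w) : ℚ) * DT plusSpectrum (T.dec w))

end LTree

/-- Isomorphism classes of decorated rooted trees. -/
abbrev TreeClass (l1 l2 : ℕ) : Type := Quotient (LTree.isoSetoid l1 l2)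

/-! ### Tropical types -/

/-- A rooted binary tree, viewed as a rational plane tropical curve up to deformation: a leaf `d` is
an incoming unbounded edge with direction times weight `d`, and the root edge is the outgoing
unbounded edge. -/
inductive TropTree : Type
  | ending (d : ℤ × ℤ)
  | vertex (A B : TropTree)

/-- Weight times direction of the outgoing edge. At a trivalent vertex joining `A` and `B` the
weighted outgoing vectors are `-A.out`, `-B.out`, `A.out + B.out`, and they balance. -/
def TropTree.out : TropTree → ℤ × ℤ
  | ending d => d
  | vertex A B => A.out + B.out

/-- Isomorphism of such trees: the two edges that enter a vertex are not ordered. -/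
inductive TropTree.Iso : TropTree → TropTree → Prop
  | refl (A : TropTree) : Iso A A
  | symm {A B : TropTree} : Iso A B → Iso B A
  | trans {A B C : TropTree} : Iso A B → Iso B C → Iso A C
  | swap (A B : TropTree) : Iso (vertex A B) (vertex B A)
  | congr {A A' B B' : TropTree} : Iso A A' → Iso B B' → Iso (vertex A B) (vertex A' B')

instance tropSetoid : Setoid TropTree := ⟨TropTree.Iso, ⟨.refl, .symm, .trans⟩⟩

/-- Combinatorial types of (unmarked) rational tropical curves with one outgoing end. -/
abbrev TropType : Type := Quotient tropSetoid

/-! ### The contraction process: moving the contours across the wall -/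

/-- Clockwise position of the ray `ℝ_{<0} z` among the rays opposite to the first quadrant. -/
def clock (z : ℂ) : ℝ := -z.arg

/-- A stage of the process of moving the integration contours of the propagator of a tree from the
rays `ℓ⁺` to the rays `ℓ⁻`. It records the current contracted tree (surviving vertices `alive`,
parents, decorations), and for each vertex `v` the ray `ray v` on which its contour lies, given by
its clockwise position. If several contours lie on one ray they are limits of nearby rays, and the
integers `side` give their clockwise order. `hist v` is the tropical curve of the contractions that
formed `v`, `sign` is the accumulated sign, and `time` counts the steps. -/
structure Stage (l1 l2 n : ℕ) where
  alive : Finset (Fin n)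
  par : Fin n → Option (Fin n)
  dec : Fin n → Lat l1 l2
  ray : Fin n → ℝ
  side : Fin n → ℤ
  hist : Fin n → TropTree
  sign : ℤˣ
  time : ℕ

namespace Stage

variable {n : ℕ}

/-- Clockwise position of the ray `ℓ⁻` of the current decoration of `v`. -/
def target (P : ChargePair) (s : Stage l1 l2 n) (v : Fin n) : ℝ := clock (P.minus (s.dec v))

open Classical in
/-- The vertices `v` whose contour is not yet `ℓ⁻_{α(v)}`. -/
def pending (P : ChargePair) (s : Stage l1 l2 n) : Finset (Fin n) :=
  s.alive.filter fun v => s.ray v ≠ s.target P v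

/-- The contour of `v` has to move clockwise. -/
def MovesClockwise (P : ChargePair) (s : Stage l1 l2 n) (v : Fin n) : Prop :=
  s.ray v < s.target P v

/-- The contour of `v` strictly precedes that of `w` in the clockwise order. -/
def Before (s : Stage l1 l2 n) (v w : Fin n) : Prop :=
  s.ray v < s.ray w ∨ (s.ray v = s.ray w ∧ s.side v < s.side w)

open Classical in
/-- The neighbours `w` of `v` whose contour is crossed when that of `v` moves to its target; the
contours on the target ray itself are not crossed. -/
def crossed (P : ChargePair) (s : Stage l1 l2 n) (v : Fin n) : Finset (Fin n) :=
  s.alive.filter fun w => (s.par v = some w ∨ s.par w = some v) ∧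
    ((s.MovesClockwise P v ∧ s.Before v w ∧ s.ray w < s.target P v) ∨
      (¬ s.MovesClockwise P v ∧ s.Before w v ∧ s.target P v < s.ray w))

open Classical in
/-- The main term: the contour of `v` is moved to its target ray, where it stops at the side it
comes from, before all contours that were already there. -/
def move (P : ChargePair) (s : Stage l1 l2 n) (v : Fin n) : Stage l1 l2 n :=
  { s with
    ray := Function.update s.ray v (s.target P v)
    side := Function.update s.side v
      (if s.MovesClockwise P v then -((s.time : ℤ) + 1) else (s.time : ℤ) + 1)
    time := s.time + 1 }

open Classical in
/-- The residue term at a crossed neighbour `w` of `v`: the edge between `v` and `w` is contracted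
to `w`, which keeps its contour and gets the sum of the decorations. If the contour of `v` moves
clockwise, the sign of the residue is `-` when `w` is the parent of `v` and `+` when `w` is a child;
if it moves counterclockwise the two signs are exchanged. The product `ψ⁰_{α(v)} ψ⁰_{α(w)}`
contributes `(-1)^{⟨α(v), α(w)⟩}`. -/
def contract (P : ChargePair) (s : Stage l1 l2 n) (v w : Fin n) : Stage l1 l2 n :=
  { s with
    alive := s.alive.erase v
    par := fun x => if s.par x = some v then (if x = w then s.par v else some w) else s.par x
    dec := Function.update s.dec w (s.dec v + s.dec w)
    hist := Function.update s.hist w (.vertex (s.hist v) (s.hist w))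
    sign := s.sign *
      ((if s.MovesClockwise P v then -1 else 1) * (if s.par v = some w then 1 else -1)) *
      Int.negOnePow (pairing (s.dec v) (s.dec w))
    time := s.time + 1 }

open Classical in
/-- The leaves of the tree of stages with root `s`, explored up to depth `m`. At each stage the first
pending vertex in the order of the labels is treated. -/
def leaves (P : ChargePair) : ℕ → Stage l1 l2 n → Multiset (Stage l1 l2 n)
  | 0, s => {s}
  | m + 1, s =>
    if h : (s.pending P).Nonempty then
      leaves P m (s.move P ((s.pending P).min' h)) +
        (s.crossed P ((s.pending P).min' h)).val.bind fun w =>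
          leaves P m (s.contract P ((s.pending P).min' h) w)
    else {s}

end Stage

namespace LTree

/-- The initial stage: the contour of `v` is `ℓ⁺_{α(v)}`. -/
def initial (P : ChargePair) (T : LTree l1 l2) : Stage l1 l2 T.n where
  alive := Finset.univ
  par := T.par
  dec := T.dec
  ray v := clock (P.plus (T.dec v))
  side _ := 0
  hist v := .ending (proj (T.dec v))
  sign := 1
  time := 0

/-- The tropical types attached to a labelled tree, with their signs: one for each leaf of the tree
of stages where a single vertex is left (these are the leaves of maximal depth). Each step lowers
(number of vertices) + (number of pending vertices), so depth `2n` reaches all leaves. -/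
def signedTypes (P : ChargePair) (T : LTree l1 l2) : Multiset (TropType × ℤˣ) :=
  ((Stage.leaves P (2 * T.n) (T.initial P)).filter fun s => s.alive.card = 1).bind
    fun s => s.alive.val.map fun v => (Quotient.mk _ (s.hist v), s.sign)

/-- The sum of the signs `∑_j (-1)^{[Υ_j]}` over the tropical types attached to `T`. -/
def signSum (P : ChargePair) (T : LTree l1 l2) : ℤ :=
  ((T.signedTypes P).map fun x => ((x.2 : ℤˣ) : ℤ)).sum

end LTree

end InstantonTBA

end

open MeasureTheory Filter Topology

noncomputable section

namespace InstantonTBA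

/-! ### Truncated power series -/

section Trunc

variable {ι : Type*}

/-- Power series whose coefficients vanish in all degrees `d ≤ m`. -/
def truncIdeal (m : ι →₀ ℕ) : Ideal (MvPowerSeries ι ℂ) where
  carrier := {f | ∀ d ≤ m, MvPowerSeries.coeff d f = 0}
  zero_mem' := by simp
  add_mem' := by
    intro f g hf hg d hd
    simp [hf d hd, hg d hd]
  smul_mem' := by
    classical
    intro c f hf d hd
    rw [smul_eq_mul, MvPowerSeries.coeff_mul]
    refine Finset.sum_eq_zero fun p hp => ?_
    have h1 : p.1 + p.2 = d := Finset.HasAntidiagonal.mem_antidiagonal.1 hp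
    rw [hf p.2 (le_trans (by rw [← h1]; exact le_add_self) hd), mul_zero]

/-- Power series truncated to degrees `d ≤ m`. -/
abbrev Trunc (m : ι →₀ ℕ) : Type _ := MvPowerSeries ι ℂ ⧸ truncIdeal m

variable {m : ι →₀ ℕ}

lemma trunc_mk_eq_iff {f g : MvPowerSeries ι ℂ} :
    (Ideal.Quotient.mk (truncIdeal m) f = Ideal.Quotient.mk (truncIdeal m) g) ↔
      ∀ d ≤ m, MvPowerSeries.coeff d f = MvPowerSeries.coeff d g := by
  rw [Ideal.Quotient.eq]
  constructor
  · intro h d hd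
    have := h d hd
    rwa [map_sub, sub_eq_zero] at this
  · intro h d hd
    rw [map_sub, h d hd, sub_self]

open Classical in
/-- The coefficient in degree `d`, which is zero by convention unless `d ≤ m`. -/
def tcoeffFun (d : ι →₀ ℕ) (x : Trunc m) : ℂ :=
  if d ≤ m then MvPowerSeries.coeff d (Quotient.out x : MvPowerSeries ι ℂ) else 0

open Classical in
lemma tcoeffFun_mk (d : ι →₀ ℕ) (f : MvPowerSeries ι ℂ) :
    tcoeffFun d (Ideal.Quotient.mk (truncIdeal m) f) =
      if d ≤ m then MvPowerSeries.coeff d f else 0 := by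
  unfold tcoeffFun
  split_ifs with h
  · refine trunc_mk_eq_iff.1 ?_ d h
    exact Quotient.out_eq _
  · rfl

/-- The coefficient in degree `d`, as a linear map. -/
def tcoeff (d : ι →₀ ℕ) : Trunc m →ₗ[ℂ] ℂ where
  toFun := tcoeffFun d
  map_add' x y := by
    obtain ⟨f, rfl⟩ := Ideal.Quotient.mk_surjective x
    obtain ⟨g, rfl⟩ := Ideal.Quotient.mk_surjective y
    rw [← map_add, tcoeffFun_mk, tcoeffFun_mk, tcoeffFun_mk]
    split_ifs <;> simp
  map_smul' c x := by
    obtain ⟨f, rfl⟩ := Ideal.Quotient.mk_surjective x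
    have : c • (Ideal.Quotient.mk (truncIdeal m) f) = Ideal.Quotient.mk (truncIdeal m) (c • f) := rfl
    rw [this, tcoeffFun_mk, tcoeffFun_mk]
    split_ifs <;> simp

open Classical in
lemma tcoeff_mk (d : ι →₀ ℕ) (f : MvPowerSeries ι ℂ) :
    tcoeff d (Ideal.Quotient.mk (truncIdeal m) f) =
      if d ≤ m then MvPowerSeries.coeff d f else 0 := tcoeffFun_mk d f

lemma tcoeff_of_not_le {d : ι →₀ ℕ} (h : ¬ d ≤ m) (x : Trunc m) : tcoeff d x = 0 := by
  classical
  obtain ⟨f, rfl⟩ := Ideal.Quotient.mk_surjective x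
  rw [tcoeff_mk, if_neg h]

lemma trunc_ext {x y : Trunc m} (h : ∀ d ≤ m, tcoeff d x = tcoeff d y) : x = y := by
  classical
  obtain ⟨f, rfl⟩ := Ideal.Quotient.mk_surjective x
  obtain ⟨g, rfl⟩ := Ideal.Quotient.mk_surjective y
  rw [trunc_mk_eq_iff]
  intro d hd
  simpa [tcoeff_mk, hd] using h d hd

/-- The truncated power series with given coefficients. -/
def tof (m : ι →₀ ℕ) (f : (ι →₀ ℕ) → ℂ) : Trunc m := Ideal.Quotient.mk (truncIdeal m) f

lemma tcoeff_tof {d : ι →₀ ℕ} (hd : d ≤ m) (f : (ι →₀ ℕ) → ℂ) : tcoeff d (tof m f) = f d := by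
  classical
  have h := tcoeff_mk (m := m) d (f : MvPowerSeries ι ℂ)
  rw [if_pos hd] at h
  exact h

variable [DecidableEq ι]

lemma tcoeff_mul {d : ι →₀ ℕ} (hd : d ≤ m) (x y : Trunc m) :
    tcoeff d (x * y) = ∑ p ∈ Finset.HasAntidiagonal.antidiagonal d, tcoeff p.1 x * tcoeff p.2 y := by
  classical
  obtain ⟨f, rfl⟩ := Ideal.Quotient.mk_surjective x
  obtain ⟨g, rfl⟩ := Ideal.Quotient.mk_surjective y
  rw [← map_mul, tcoeff_mk, if_pos hd, MvPowerSeries.coeff_mul]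
  refine Finset.sum_congr (by congr!) fun p hp => ?_
  have h1 : p.1 + p.2 = d := Finset.HasAntidiagonal.mem_antidiagonal.1 hp
  rw [tcoeff_mk, tcoeff_mk, if_pos (le_trans (by rw [← h1]; exact le_self_add) hd),
    if_pos (le_trans (by rw [← h1]; exact le_add_self) hd)]

lemma tcoeff_one {d : ι →₀ ℕ} (hd : d ≤ m) : tcoeff d (1 : Trunc m) = if d = 0 then 1 else 0 := by
  classical
  rw [← map_one (Ideal.Quotient.mk (truncIdeal m)), tcoeff_mk, if_pos hd, MvPowerSeries.coeff_one]

/-- The monomial `x^d`. -/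
def tmono (m d : ι →₀ ℕ) : Trunc m := Ideal.Quotient.mk (truncIdeal m) (MvPowerSeries.monomial d 1)

lemma tcoeff_tmono {d e : ι →₀ ℕ} (hd : d ≤ m) : tcoeff d (tmono m e) = if d = e then 1 else 0 := by
  classical
  rw [tmono, tcoeff_mk, if_pos hd, MvPowerSeries.coeff_monomial]

lemma tmono_add (d e : ι →₀ ℕ) : tmono m (d + e) = tmono m d * tmono m e := by
  rw [tmono, tmono, tmono, ← map_mul, MvPowerSeries.monomial_mul_monomial, mul_one]

lemma tmono_zero : tmono m 0 = 1 := by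
  rw [tmono, MvPowerSeries.monomial_zero_one, map_one]

lemma tmono_eq_zero {e : ι →₀ ℕ} (h : ¬ e ≤ m) : tmono m e = 0 :=
  trunc_ext fun d hd => by
    rw [tcoeff_tmono hd, map_zero, if_neg]
    rintro rfl
    exact h hd

open Classical in
lemma tcoeff_tmono_mul {d e : ι →₀ ℕ} (hd : d ≤ m) (x : Trunc m) :
    tcoeff d (tmono m e * x) = if e ≤ d then tcoeff (d - e) x else 0 := by
  rw [tcoeff_mul hd]
  split_ifs with h
  · rw [Finset.sum_eq_single (e, d - e)]
    · simp [tcoeff_tmono (h.trans hd)]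
    · rintro ⟨p, q⟩ hp hne
      have h1 : p + q = d := Finset.HasAntidiagonal.mem_antidiagonal.1 hp
      rw [tcoeff_tmono (le_trans (by rw [← h1]; exact le_self_add) hd), if_neg, zero_mul]
      rintro rfl
      apply hne
      rw [← h1, add_tsub_cancel_left]
    · intro hn
      exact absurd (Finset.HasAntidiagonal.mem_antidiagonal.2 (add_tsub_cancel_of_le h)) hn
  · refine Finset.sum_eq_zero fun p hp => ?_
    have h1 : p.1 + p.2 = d := Finset.HasAntidiagonal.mem_antidiagonal.1 hp
    rw [tcoeff_tmono (le_trans (by rw [← h1]; exact le_self_add) hd), if_neg, zero_mul]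
    rintro rfl
    exact h (by rw [← h1]; exact le_self_add)

/-- The ideal of truncated power series without terms of total degree less than `n`. -/
def tfilt (m : ι →₀ ℕ) (n : ℕ) : Ideal (Trunc m) where
  carrier := {x | ∀ d : ι →₀ ℕ, d.degree < n → tcoeff d x = 0}
  zero_mem' := by simp
  add_mem' := by
    intro f g hf hg d hd
    rw [map_add, hf d hd, hg d hd, add_zero]
  smul_mem' := by
    intro c f hf d hd
    by_cases h : d ≤ m
    · rw [smul_eq_mul, tcoeff_mul h]
      refine Finset.sum_eq_zero fun p hp => ?_
      have h1 : p.1 + p.2 = d := Finset.HasAntidiagonal.mem_antidiagonal.1 hp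
      rw [hf p.2 (by rw [← h1, map_add] at hd; omega), mul_zero]
    · exact tcoeff_of_not_le h _

lemma mem_tfilt {n : ℕ} {x : Trunc m} :
    x ∈ tfilt m n ↔ ∀ d : ι →₀ ℕ, d.degree < n → tcoeff d x = 0 := Iff.rfl

lemma mul_mem_tfilt {a b : ℕ} {x y : Trunc m} (hx : x ∈ tfilt m a) (hy : y ∈ tfilt m b) :
    x * y ∈ tfilt m (a + b) := by
  intro d hd
  by_cases h : d ≤ m
  · rw [tcoeff_mul h]
    refine Finset.sum_eq_zero fun p hp => ?_
    have h1 : p.1 + p.2 = d := Finset.HasAntidiagonal.mem_antidiagonal.1 hp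
    rw [← h1, map_add] at hd
    by_cases h2 : p.1.degree < a
    · rw [hx _ h2, zero_mul]
    · rw [hy p.2 (by omega), mul_zero]
  · exact tcoeff_of_not_le h _

lemma tfilt_anti {a b : ℕ} (h : a ≤ b) : tfilt m b ≤ tfilt m a :=
  fun _ hx d hd => hx d (lt_of_lt_of_le hd h)

lemma mem_tfilt_zero (x : Trunc m) : x ∈ tfilt m 0 := fun d hd => absurd hd (by omega)

lemma smul_mem_tfilt {n : ℕ} (c : ℂ) {x : Trunc m} (hx : x ∈ tfilt m n) : c • x ∈ tfilt m n := by
  intro d hd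
  rw [map_smul, hx d hd, smul_zero]

lemma tmono_mem_tfilt {n : ℕ} {e : ι →₀ ℕ} (h : n ≤ e.degree) : tmono m e ∈ tfilt m n := by
  intro d hd
  by_cases hm : d ≤ m
  · rw [tcoeff_tmono hm, if_neg]
    rintro rfl
    omega
  · exact tcoeff_of_not_le hm _

lemma eq_zero_of_mem_tfilt {n : ℕ} (hn : m.degree < n) {x : Trunc m} (hx : x ∈ tfilt m n) :
    x = 0 :=
  trunc_ext fun d hd => by
    rw [map_zero]
    exact hx d (lt_of_le_of_lt (Finsupp.degree_mono hd) hn)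

lemma pow_mem_tfilt {x : Trunc m} (hx : x ∈ tfilt m 1) (n : ℕ) : x ^ n ∈ tfilt m n := by
  induction n with
  | zero => exact mem_tfilt_zero _
  | succ n ih => rw [pow_succ]; exact mul_mem_tfilt ih hx

lemma pow_eq_zero_of_tfilt {x : Trunc m} (hx : x ∈ tfilt m 1) {n : ℕ} (hn : m.degree < n) :
    x ^ n = 0 := eq_zero_of_mem_tfilt hn (pow_mem_tfilt hx n)

lemma isNilpotent_of_tfilt {x : Trunc m} (hx : x ∈ tfilt m 1) : IsNilpotent x :=
  ⟨m.degree + 1, pow_eq_zero_of_tfilt hx (Nat.lt_succ_self _)⟩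

lemma nexp_eq_sum {A : Type*} [CommRing A] [Algebra ℂ A] [Module ℚ A] {x : A} {n : ℕ}
    (hx : x ^ n = 0) :
    IsNilpotent.exp x = ∑ i ∈ Finset.range n, ((i.factorial : ℂ)⁻¹) • x ^ i := by
  rw [IsNilpotent.exp_eq_sum hx]
  refine Finset.sum_congr rfl fun i _ => ?_
  have h : ((i.factorial : ℂ)⁻¹) = (((i.factorial : ℚ)⁻¹ : ℚ) : ℂ) := by push_cast; rfl
  rw [h]
  exact (Rat.cast_smul_eq_qsmul ℂ _ _).symm

lemma texp_eq_sum {x : Trunc m} (hx : x ∈ tfilt m 1) {n : ℕ} (hn : m.degree < n) :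
    IsNilpotent.exp x = ∑ i ∈ Finset.range n, ((i.factorial : ℂ)⁻¹) • x ^ i :=
  nexp_eq_sum (pow_eq_zero_of_tfilt hx hn)

lemma texp_add {x y : Trunc m} (hx : x ∈ tfilt m 1) (hy : y ∈ tfilt m 1) :
    IsNilpotent.exp (x + y) = IsNilpotent.exp x * IsNilpotent.exp y :=
  IsNilpotent.exp_add_of_commute (Commute.all _ _) (isNilpotent_of_tfilt hx)
    (isNilpotent_of_tfilt hy)

lemma pow_sub_pow_mem {I : Ideal (Trunc m)} {x y : Trunc m} (h : x - y ∈ I) (n : ℕ) :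
    x ^ n - y ^ n ∈ I := by
  obtain ⟨c, hc⟩ := sub_dvd_pow_sub_pow x y n
  rw [hc]
  exact I.mul_mem_right _ h

lemma texp_sub_mem {x y : Trunc m} (hx : x ∈ tfilt m 1) (hy : y ∈ tfilt m 1) {n : ℕ}
    (h : x - y ∈ tfilt m n) : IsNilpotent.exp x - IsNilpotent.exp y ∈ tfilt m n := by
  rw [texp_eq_sum hx (Nat.lt_succ_self _), texp_eq_sum hy (Nat.lt_succ_self _),
    ← Finset.sum_sub_distrib]
  refine Ideal.sum_mem _ fun i _ => ?_
  rw [← smul_sub]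
  exact smul_mem_tfilt _ (pow_sub_pow_mem h i)

lemma texp_sub_one_mem {x : Trunc m} (hx : x ∈ tfilt m 1) :
    IsNilpotent.exp x - 1 ∈ tfilt m 1 := by
  have := texp_sub_mem hx (Ideal.zero_mem _) (n := 1) (by simpa using hx)
  rwa [IsNilpotent.exp_zero] at this

lemma texp_injective {x y : Trunc m} (hx : x ∈ tfilt m 1) (hy : y ∈ tfilt m 1)
    (h : IsNilpotent.exp x = IsNilpotent.exp y) : x = y := by
  have key : ∀ n, x - y ∈ tfilt m (n + 1) := by
    intro n
    induction n with
    | zero => exact Ideal.sub_mem _ hx hy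
    | succ n ih =>
      have hz : IsNilpotent.exp (x - y) = 1 := by
        rw [sub_eq_add_neg, texp_add hx (neg_mem hy), h]
        exact IsNilpotent.exp_mul_exp_neg_self (isNilpotent_of_tfilt hy)
      have hxy : x - y ∈ tfilt m 1 := Ideal.sub_mem _ hx hy
      rw [texp_eq_sum hxy (n := m.degree + 2) (by omega), Finset.sum_range_succ',
        Finset.sum_range_succ'] at hz
      simp only [zero_add, Nat.factorial_one, Nat.cast_one, inv_one, pow_one, one_smul,
        Nat.factorial_zero, pow_zero, add_eq_right] at hz
      rw [add_eq_zero_iff_neg_eq] at hz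
      rw [← hz]
      refine neg_mem (Ideal.sum_mem _ fun i _ => smul_mem_tfilt _ ?_)
      have : (x - y) ^ (i + 1 + 1) = (x - y) ^ i * (x - y) * (x - y) := by ring
      rw [this]
      have h2 := mul_mem_tfilt ih hxy
      rw [mul_assoc]
      refine Ideal.mul_mem_left _ _ ?_
      exact h2
  exact sub_eq_zero.1 (eq_zero_of_mem_tfilt (Nat.lt_succ_self _) (key _))

/-- Functions with values in the truncated ring whose coefficients lie in a given algebra of
functions. -/
def CoeffIn {Ω : Type*} (D : Subalgebra ℂ (Ω → ℂ)) (f : Ω → Trunc m) : Prop :=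
  ∀ d ≤ m, (fun ω => tcoeff d (f ω)) ∈ D

namespace CoeffIn

variable {Ω : Type*} {D : Subalgebra ℂ (Ω → ℂ)} {f g : Ω → Trunc m}

lemma const (x : Trunc m) : CoeffIn D fun _ => x := fun d _ => D.algebraMap_mem (tcoeff d x)

lemma add (hf : CoeffIn D f) (hg : CoeffIn D g) : CoeffIn D fun ω => f ω + g ω := by
  intro d hd
  simp only [map_add]
  exact D.add_mem (hf d hd) (hg d hd)

lemma fun_smul {c : Ω → ℂ} (hc : c ∈ D) (hf : CoeffIn D f) : CoeffIn D fun ω => c ω • f ω := by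
  intro d hd
  simp only [map_smul, smul_eq_mul]
  exact D.mul_mem hc (hf d hd)

lemma smul (c : ℂ) (hf : CoeffIn D f) : CoeffIn D fun ω => c • f ω :=
  fun_smul (D.algebraMap_mem c) hf

lemma mul (hf : CoeffIn D f) (hg : CoeffIn D g) : CoeffIn D fun ω => f ω * g ω := by
  intro d hd
  have : (fun ω => tcoeff d (f ω * g ω)) =
      ∑ p ∈ Finset.HasAntidiagonal.antidiagonal d, (fun ω => tcoeff p.1 (f ω)) * fun ω => tcoeff p.2 (g ω) := by
    ext ω
    rw [tcoeff_mul hd]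
    simp
  rw [this]
  refine D.sum_mem fun p hp => ?_
  have h1 : p.1 + p.2 = d := Finset.HasAntidiagonal.mem_antidiagonal.1 hp
  exact D.mul_mem (hf _ (le_trans (by rw [← h1]; exact le_self_add) hd))
    (hg _ (le_trans (by rw [← h1]; exact le_add_self) hd))

lemma sum {κ : Type*} {s : Finset κ} {f : κ → Ω → Trunc m} (hf : ∀ i ∈ s, CoeffIn D (f i)) :
    CoeffIn D fun ω => ∑ i ∈ s, f i ω := by
  intro d hd
  have : (fun ω => tcoeff d (∑ i ∈ s, f i ω)) = ∑ i ∈ s, fun ω => tcoeff d (f i ω) := by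
    ext ω
    simp
  rw [this]
  exact D.sum_mem fun i hi => hf i hi d hd

lemma pow (hf : CoeffIn D f) (n : ℕ) : CoeffIn D fun ω => f ω ^ n := by
  induction n with
  | zero => simpa using const (D := D) (1 : Trunc m)
  | succ n ih => simpa only [pow_succ] using ih.mul hf

lemma exp (hf : CoeffIn D f) (h1 : ∀ ω, f ω ∈ tfilt m 1) :
    CoeffIn D fun ω => IsNilpotent.exp (f ω) := by
  simp only [fun ω => texp_eq_sum (h1 ω) (Nat.lt_succ_self m.degree)]
  exact sum fun i _ => (hf.pow i).smul _

end CoeffIn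

/-! ### Derivations and evaluations of truncated power series -/

/-- The derivation which multiplies the coefficient in degree `d` by `l d`. -/
def tderiv (m : ι →₀ ℕ) (l : (ι →₀ ℕ) →+ ℂ) : Derivation ℂ (Trunc m) (Trunc m) :=
  Derivation.mk'
    { toFun := fun x => tof m fun d => l d * tcoeff d x
      map_add' := fun x y => trunc_ext fun d hd => by
        simp only [map_add, tcoeff_tof hd]; ring
      map_smul' := fun c x => trunc_ext fun d hd => by
        simp only [map_smul, tcoeff_tof hd, RingHom.id_apply, smul_eq_mul]; ring }
    (by
      intro x y
      refine trunc_ext fun d hd => ?_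
      simp only [LinearMap.coe_mk, AddHom.coe_mk, smul_eq_mul, map_add]
      rw [tcoeff_tof hd, mul_comm y, tcoeff_mul hd, tcoeff_mul hd, tcoeff_mul hd, Finset.mul_sum,
        ← Finset.sum_add_distrib]
      refine Finset.sum_congr rfl fun p hp => ?_
      have h1 : p.1 + p.2 = d := Finset.HasAntidiagonal.mem_antidiagonal.1 hp
      have h2 : p.1 ≤ d := by rw [← h1]; exact le_self_add
      have h3 : p.2 ≤ d := by rw [← h1]; exact le_add_self
      rw [tcoeff_tof (h2.trans hd), tcoeff_tof (h3.trans hd), ← h1, map_add]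
      ring)

lemma tcoeff_tderiv {l : (ι →₀ ℕ) →+ ℂ} {d : ι →₀ ℕ} (hd : d ≤ m) (x : Trunc m) :
    tcoeff d (tderiv m l x) = l d * tcoeff d x := by
  change tcoeff d (tof m fun d => l d * tcoeff d x) = _
  rw [tcoeff_tof hd]

lemma tderiv_tmono (l : (ι →₀ ℕ) →+ ℂ) (e : ι →₀ ℕ) :
    tderiv m l (tmono m e) = l e • tmono m e :=
  trunc_ext fun d hd => by
    rw [tcoeff_tderiv hd, map_smul, tcoeff_tmono hd]
    split_ifs with h
    · rw [h, smul_eq_mul]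
    · simp

lemma tderiv_exp (l : (ι →₀ ℕ) →+ ℂ) {x : Trunc m} (hx : x ∈ tfilt m 1) :
    tderiv m l (IsNilpotent.exp x) = IsNilpotent.exp x * tderiv m l x := by
  rw [texp_eq_sum hx (n := m.degree + 2) (by omega), map_sum, Finset.sum_range_succ']
  have h0 : tderiv m l (((Nat.factorial 0 : ℂ)⁻¹) • x ^ 0) = 0 := by simp
  rw [h0, add_zero, ← texp_eq_sum hx (n := m.degree + 2) (by omega),
    texp_eq_sum hx (n := m.degree + 1) (by omega), Finset.sum_mul]
  refine Finset.sum_congr rfl fun i _ => ?_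
  rw [Derivation.map_smul, Derivation.leibniz_pow, Nat.add_sub_cancel, smul_mul_assoc, smul_eq_mul,
    ← Nat.cast_smul_eq_nsmul ℂ, smul_smul, Nat.factorial_succ]
  congr 1
  have : (i.factorial : ℂ) ≠ 0 := by exact_mod_cast i.factorial_ne_zero
  have h2 : ((i : ℂ) + 1) ≠ 0 := by exact_mod_cast Nat.succ_ne_zero i
  push_cast
  field_simp

end Trunc


/-! ### Fixed point systems in the truncated ring -/

section Systems

variable {ι : Type*} [DecidableEq ι] {m : ι →₀ ℕ} {κ : Type*}

/-- A map which does not lower the order of differences. -/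
def Filtered (T : Trunc m → Trunc m) : Prop :=
  (∀ n x y, x - y ∈ tfilt m n → T x - T y ∈ tfilt m n) ∧ ∀ x ∈ tfilt m 1, T x ∈ tfilt m 1

lemma Filtered.smul (c : ℂ) {T : Trunc m → Trunc m} (hT : Filtered T) :
    Filtered fun x => c • T x :=
  ⟨fun n x y h => by rw [← smul_sub]; exact smul_mem_tfilt _ (hT.1 n x y h),
    fun x h => smul_mem_tfilt _ (hT.2 x h)⟩

lemma Filtered.id : Filtered fun x : Trunc m => x := ⟨fun _ _ _ h => h, fun _ h => h⟩

lemma Filtered.add {T U : Trunc m → Trunc m} (hT : Filtered T) (hU : Filtered U) :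
    Filtered fun x => T x + U x :=
  ⟨fun n x y h => by
      rw [add_sub_add_comm]
      exact Ideal.add_mem _ (hT.1 n x y h) (hU.1 n x y h),
    fun x h => Ideal.add_mem _ (hT.2 x h) (hU.2 x h)⟩

/-- `X` solves `X_b = Y_b exp (∑ T_{b', b} X_{b'})`, without constant terms. -/
def IsSystemSol (S : Finset κ) (T : κ → κ → Trunc m → Trunc m) (Y X : κ → Trunc m) : Prop :=
  (∀ b ∈ S, X b ∈ tfilt m 1) ∧
    ∀ b ∈ S, X b = Y b * IsNilpotent.exp (∑ b' ∈ S, T b' b (X b'))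

variable {S : Finset κ} {T : κ → κ → Trunc m → Trunc m} {Y : κ → Trunc m}

lemma system_step (hT : ∀ b' ∈ S, ∀ b ∈ S, Filtered (T b' b)) (hY : ∀ b ∈ S, Y b ∈ tfilt m 1)
    {X X' : κ → Trunc m} (hX : ∀ b ∈ S, X b ∈ tfilt m 1) (hX' : ∀ b ∈ S, X' b ∈ tfilt m 1)
    {n : ℕ} (h : ∀ b ∈ S, X b - X' b ∈ tfilt m n) {b : κ} (hb : b ∈ S) :
    Y b * IsNilpotent.exp (∑ b' ∈ S, T b' b (X b')) -
      Y b * IsNilpotent.exp (∑ b' ∈ S, T b' b (X' b')) ∈ tfilt m (n + 1) := by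
  rw [← mul_sub, add_comm]
  refine mul_mem_tfilt (hY b hb) (texp_sub_mem
    (Ideal.sum_mem _ fun b' hb' => (hT b' hb' b hb).2 _ (hX b' hb'))
    (Ideal.sum_mem _ fun b' hb' => (hT b' hb' b hb).2 _ (hX' b' hb')) ?_)
  rw [← Finset.sum_sub_distrib]
  exact Ideal.sum_mem _ fun b' hb' => (hT b' hb' b hb).1 _ _ _ (h b' hb')

lemma IsSystemSol.unique (hT : ∀ b' ∈ S, ∀ b ∈ S, Filtered (T b' b))
    (hY : ∀ b ∈ S, Y b ∈ tfilt m 1) {X X' : κ → Trunc m}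
    (hX : IsSystemSol S T Y X) (hX' : IsSystemSol S T Y X') {b : κ} (hb : b ∈ S) :
    X b = X' b := by
  have key : ∀ n, ∀ b ∈ S, X b - X' b ∈ tfilt m n := by
    intro n
    induction n with
    | zero => exact fun b _ => mem_tfilt_zero _
    | succ n ih =>
      intro b hb
      rw [hX.2 b hb, hX'.2 b hb]
      exact system_step hT hY hX.1 hX'.1 ih hb
  exact sub_eq_zero.1 (eq_zero_of_mem_tfilt (Nat.lt_succ_self _) (key _ b hb))

variable (S) in
/-- The iterates of a system, starting from zero. -/
def systemIter (T : κ → κ → Trunc m → Trunc m) (Y : κ → Trunc m) : ℕ → κ → Trunc m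
  | 0 => fun _ => 0
  | n + 1 => fun b => Y b * IsNilpotent.exp (∑ b' ∈ S, T b' b (systemIter T Y n b'))

lemma IsSystemSol.exists (hT : ∀ b' ∈ S, ∀ b ∈ S, Filtered (T b' b))
    (hY : ∀ b ∈ S, Y b ∈ tfilt m 1) : ∃ X, IsSystemSol S T Y X := by
  have hZ1 : ∀ n, ∀ b ∈ S, systemIter S T Y n b ∈ tfilt m 1 := by
    intro n b hb
    cases n with
    | zero => exact Ideal.zero_mem _
    | succ n => exact Ideal.mul_mem_right _ _ (hY b hb)
  have key : ∀ n, ∀ b ∈ S, systemIter S T Y (n + 1) b - systemIter S T Y n b ∈ tfilt m n := by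
    intro n
    induction n with
    | zero => exact fun b _ => mem_tfilt_zero _
    | succ n ih => exact fun b hb => system_step hT hY (hZ1 _) (hZ1 _) ih hb
  refine ⟨systemIter S T Y (m.degree + 1), hZ1 _, fun b hb => ?_⟩
  exact (sub_eq_zero.1 (eq_zero_of_mem_tfilt (Nat.lt_succ_self _) (key _ b hb))).symm

variable (S) in
/-- The solution of a system. -/
def systemSol (T : κ → κ → Trunc m → Trunc m) (Y : κ → Trunc m) : κ → Trunc m :=
  open Classical in
  if h : ∃ X, IsSystemSol S T Y X then h.choose else 0

lemma isSystemSol_systemSol (hT : ∀ b' ∈ S, ∀ b ∈ S, Filtered (T b' b))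
    (hY : ∀ b ∈ S, Y b ∈ tfilt m 1) : IsSystemSol S T Y (systemSol S T Y) := by
  have h := IsSystemSol.exists hT hY
  rw [systemSol, dif_pos h]
  exact h.choose_spec

/-! ### Evaluation homomorphisms -/

/-- The endomorphism of the truncated ring which maps `x^d` to `x^d U_d`, for a multiplicative
family `U`. -/
def evalHom (U : (ι →₀ ℕ) → Trunc m) (U0 : U 0 = 1) (Uadd : ∀ d e, U (d + e) = U d * U e) :
    Trunc m →ₐ[ℂ] Trunc m :=
  AlgHom.ofLinearMap
    { toFun := fun x => ∑ d ∈ Finset.Iic m, tcoeff d x • (tmono m d * U d)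
      map_add' := fun x y => by simp [add_smul, Finset.sum_add_distrib]
      map_smul' := fun c x => by simp [mul_smul, Finset.smul_sum] }
    (by
      change ∑ d ∈ Finset.Iic m, tcoeff d (1 : Trunc m) • (tmono m d * U d) = 1
      rw [Finset.sum_eq_single 0]
      · rw [tcoeff_one (zero_le), if_pos rfl, U0, tmono_zero, mul_one, one_smul]
      · intro d hd hd0
        rw [tcoeff_one (Finset.mem_Iic.1 hd), if_neg hd0, zero_smul]
      · simp)
    (by
      intro x y
      change ∑ d ∈ Finset.Iic m, tcoeff d (x * y) • (tmono m d * U d) =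
        (∑ d ∈ Finset.Iic m, tcoeff d x • (tmono m d * U d)) *
          ∑ d ∈ Finset.Iic m, tcoeff d y • (tmono m d * U d)
      rw [Finset.sum_mul_sum, ← Finset.sum_product']
      have h1 : ∀ d ∈ Finset.Iic m, tcoeff d (x * y) • (tmono m d * U d) =
          ∑ p ∈ Finset.HasAntidiagonal.antidiagonal d,
            (tcoeff p.1 x * tcoeff p.2 y) • (tmono m (p.1 + p.2) * U (p.1 + p.2)) := by
        intro d hd
        rw [tcoeff_mul (Finset.mem_Iic.1 hd), Finset.sum_smul]
        refine Finset.sum_congr rfl fun p hp => ?_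
        rw [Finset.HasAntidiagonal.mem_antidiagonal.1 hp]
      rw [Finset.sum_congr rfl h1, Finset.sum_sigma']
      have h2 : ∀ p ∈ Finset.Iic m ×ˢ Finset.Iic m,
          (tcoeff p.1 x • (tmono m p.1 * U p.1)) * (tcoeff p.2 y • (tmono m p.2 * U p.2)) =
          if p.1 + p.2 ≤ m then
            (tcoeff p.1 x * tcoeff p.2 y) • (tmono m (p.1 + p.2) * U (p.1 + p.2)) else 0 := by
        intro p _
        have : (tcoeff p.1 x • (tmono m p.1 * U p.1)) * (tcoeff p.2 y • (tmono m p.2 * U p.2)) =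
            (tcoeff p.1 x * tcoeff p.2 y) • (tmono m (p.1 + p.2) * U (p.1 + p.2)) := by
          rw [smul_mul_smul_comm, tmono_add, Uadd]
          congr 1
          ring
        rw [this]
        split_ifs with h
        · rfl
        · rw [tmono_eq_zero h, zero_mul, smul_zero]
      rw [Finset.sum_congr rfl h2, ← Finset.sum_filter]
      refine Finset.sum_bij' (fun p _ => p.2) (fun p _ => ⟨p.1 + p.2, p⟩) ?_ ?_ ?_ ?_ ?_
      · rintro ⟨d, p⟩ hp
        simp only [Finset.mem_sigma, Finset.mem_Iic, Finset.HasAntidiagonal.mem_antidiagonal] at hp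
        obtain ⟨hd, rfl⟩ := hp
        simp only [Finset.mem_filter, Finset.mem_product, Finset.mem_Iic]
        exact ⟨⟨le_trans le_self_add hd, le_trans le_add_self hd⟩, hd⟩
      · intro p hp
        simp only [Finset.mem_filter] at hp
        simp [hp.2]
      · rintro ⟨d, p⟩ hp
        simp only [Finset.mem_sigma, Finset.mem_Iic, Finset.HasAntidiagonal.mem_antidiagonal] at hp
        obtain ⟨hd, rfl⟩ := hp
        rfl
      · intro p hp
        rfl
      · intro p hp
        rfl)

lemma evalHom_apply {U : (ι →₀ ℕ) → Trunc m} (U0 : U 0 = 1)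
    (Uadd : ∀ d e, U (d + e) = U d * U e) (x : Trunc m) :
    evalHom U U0 Uadd x = ∑ d ∈ Finset.Iic m, tcoeff d x • (tmono m d * U d) := rfl

lemma evalHom_tmono {U : (ι →₀ ℕ) → Trunc m} (U0 : U 0 = 1)
    (Uadd : ∀ d e, U (d + e) = U d * U e) (d : ι →₀ ℕ) :
    evalHom U U0 Uadd (tmono m d) = tmono m d * U d := by
  by_cases h : d ≤ m
  · rw [evalHom_apply, Finset.sum_eq_single d]
    · rw [tcoeff_tmono h, if_pos rfl, one_smul]
    · intro e he hed
      rw [tcoeff_tmono (Finset.mem_Iic.1 he), if_neg hed, zero_smul]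
    · intro hn
      exact absurd (Finset.mem_Iic.2 h) hn
  · rw [tmono_eq_zero h, map_zero, zero_mul]

lemma evalHom_mem_tfilt {U : (ι →₀ ℕ) → Trunc m} (U0 : U 0 = 1)
    (Uadd : ∀ d e, U (d + e) = U d * U e) {x : Trunc m} {n : ℕ} (hx : x ∈ tfilt m n) :
    evalHom U U0 Uadd x ∈ tfilt m n := by
  rw [evalHom_apply]
  refine Ideal.sum_mem _ fun d _ => ?_
  by_cases h : d.degree < n
  · rw [hx d h, zero_smul]
    exact Ideal.zero_mem _
  · exact smul_mem_tfilt _ (Ideal.mul_mem_right _ _ (tmono_mem_tfilt (not_lt.1 h)))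

/-- The leading difference of two evaluations. -/
lemma tcoeff_evalHom_sub {U U' V V' : (ι →₀ ℕ) → Trunc m} (U0 : U 0 = 1)
    (Uadd : ∀ d e, U (d + e) = U d * U e) (U0' : U' 0 = 1)
    (Uadd' : ∀ d e, U' (d + e) = U' d * U' e) {E : (ι →₀ ℕ) → ℂ}
    (hU : ∀ d, U d = E d • V d) (hU' : ∀ d, U' d = E d • V' d) {n : ℕ}
    (hV : ∀ d, V d - V' d ∈ tfilt m n) (hV0 : V 0 = V' 0) (hV1 : ∀ d, V' d - 1 ∈ tfilt m 1)
    {C C' : Trunc m} (hC : C - C' ∈ tfilt m n) {d : ι →₀ ℕ} (hd : d ≤ m) (hdn : d.degree = n) :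
    tcoeff d (evalHom U U0 Uadd C) - tcoeff d (evalHom U' U0' Uadd' C') =
      (tcoeff d C - tcoeff d C') * E d := by
  have h1 : evalHom U U0 Uadd C - evalHom U' U0' Uadd' C' -
      ∑ e ∈ Finset.Iic m, ((tcoeff e C - tcoeff e C') * E e) • tmono m e ∈ tfilt m (n + 1) := by
    rw [evalHom_apply, evalHom_apply, ← Finset.sum_sub_distrib, ← Finset.sum_sub_distrib]
    refine Ideal.sum_mem _ fun e _ => ?_
    have h2 : tcoeff e C • (tmono m e * U e) - tcoeff e C' • (tmono m e * U' e) -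
        ((tcoeff e C - tcoeff e C') * E e) • tmono m e =
        (tcoeff e C * E e) • (tmono m e * (V e - V' e)) +
        ((tcoeff e C - tcoeff e C') * E e) • (tmono m e * (V' e - 1)) := by
      rw [hU, hU', mul_sub, mul_sub, mul_one]
      simp only [mul_smul_comm, smul_smul, smul_sub, sub_mul, sub_smul]
      abel
    rw [h2]
    refine Ideal.add_mem _ (smul_mem_tfilt _ ?_) ?_
    · by_cases he : e = 0
      · rw [he, hV0, sub_self, mul_zero]
        exact Ideal.zero_mem _
      · rw [add_comm]
        refine mul_mem_tfilt (tmono_mem_tfilt ?_) (hV e)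
        exact Nat.one_le_iff_ne_zero.2 fun h => he ((Finsupp.degree_eq_zero_iff e).1 h)
    · by_cases hen : e.degree < n
      · have := hC e hen
        rw [map_sub] at this
        rw [this, zero_mul, zero_smul]
        exact Ideal.zero_mem _
      · exact smul_mem_tfilt _ (mul_mem_tfilt (tmono_mem_tfilt (not_lt.1 hen)) (hV1 e))
  have h3 := h1 d (by omega)
  rw [map_sub, map_sub, sub_eq_zero] at h3
  rw [h3, map_sum, Finset.sum_eq_single d]
  · rw [map_smul, tcoeff_tmono hd, if_pos rfl, smul_eq_mul, mul_one]
  · intro e _ hed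
    rw [map_smul, tcoeff_tmono hd, if_neg (Ne.symm hed), smul_zero]
  · intro hn
    exact absurd (Finset.mem_Iic.2 hd) hn

end Systems


section Models

variable {l1 l2 : ℕ}

/-- Non-negative elements of the lattice, as exponents of monomials. -/
abbrev Deg (l1 l2 : ℕ) : Type := Idx l1 l2 →₀ ℕ

/-- The inclusion of the non-negative elements. -/
def toLat (d : Deg l1 l2) : Lat l1 l2 := fun v => (d v : ℤ)

lemma toLat_add (d e : Deg l1 l2) : toLat (d + e) = toLat d + toLat e := by
  ext v
  simp [toLat]

lemma toLat_zero : toLat (0 : Deg l1 l2) = 0 := by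
  ext v
  simp [toLat]

lemma toLat_injective : Function.Injective (toLat : Deg l1 l2 → Lat l1 l2) := by
  intro d e h
  ext v
  have := congrFun h v
  simpa [toLat] using this

/-- Total degree along the `γ_i`. -/
def gD (d : Deg l1 l2) : ℤ := gPart (toLat d)

/-- Total degree along the `η_j`. -/
def hD (d : Deg l1 l2) : ℤ := hPart (toLat d)

/-- The skew form on exponents. -/
def pr (d e : Deg l1 l2) : ℤ := pairing (toLat d) (toLat e)

lemma pr_eq (d e : Deg l1 l2) : pr d e = gD d * hD e - hD d * gD e := rfl

lemma gD_add (d e : Deg l1 l2) : gD (d + e) = gD d + gD e := by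
  rw [gD, toLat_add, gPart_add]; rfl

lemma hD_add (d e : Deg l1 l2) : hD (d + e) = hD d + hD e := by
  rw [hD, toLat_add, hPart_add]; rfl

lemma gD_zero : gD (0 : Deg l1 l2) = 0 := by simp [gD, gPart, toLat]

lemma hD_zero : hD (0 : Deg l1 l2) = 0 := by simp [hD, hPart, toLat]

lemma gD_nonneg (d : Deg l1 l2) : 0 ≤ gD d := by
  unfold gD gPart toLat
  positivity

lemma hD_nonneg (d : Deg l1 l2) : 0 ≤ hD d := by
  unfold hD hPart toLat
  positivity

lemma gD_add_hD_pos {d : Deg l1 l2} (hd : d ≠ 0) : 0 < gD d + hD d := by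
  obtain ⟨v, hv⟩ := DFunLike.ne_iff.1 hd
  have hv' : 0 < d v := Nat.pos_of_ne_zero hv
  rcases v with i | j
  · have h1 : toLat d (Sum.inl i) ≤ gD d := by
      unfold gD gPart
      exact Finset.single_le_sum (f := fun i => toLat d (Sum.inl i))
        (fun i _ => Int.natCast_nonneg _) (Finset.mem_univ i)
    have h2 : 0 < toLat d (Sum.inl i) := by simpa [toLat] using hv'
    have := hD_nonneg d
    omega
  · have h1 : toLat d (Sum.inr j) ≤ hD d := by
      unfold hD hPart
      exact Finset.single_le_sum (f := fun i => toLat d (Sum.inr i))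
        (fun i _ => Int.natCast_nonneg _) (Finset.mem_univ j)
    have h2 : 0 < toLat d (Sum.inr j) := by simpa [toLat] using hv'
    have := gD_nonneg d
    omega

lemma pr_add_left (d e f : Deg l1 l2) : pr (d + e) f = pr d f + pr e f := by
  simp only [pr_eq, gD_add, hD_add]; ring

lemma pr_swap (d e : Deg l1 l2) : pr d e = -pr e d := by
  simp only [pr_eq]; ring

lemma pr_self (d : Deg l1 l2) : pr d d = 0 := by
  simp only [pr_eq]; ring

lemma pr_zero_left (d : Deg l1 l2) : pr 0 d = 0 := by simp [pr_eq, gD_zero, hD_zero]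

/-- The order by slope on non-zero vectors of the first quadrant is transitive. -/
lemma slope_trans {g1 h1 g2 h2 g3 h3 : ℤ} (_hg1 : 0 ≤ g1) (_hh1 : 0 ≤ h1) (hg2 : 0 ≤ g2)
    (hh2 : 0 ≤ h2) (hg3 : 0 ≤ g3) (hh3 : 0 ≤ h3) (hz : 0 < g3 + h3)
    (hxy : 0 < g1 * h2 - h1 * g2) (hyz : 0 ≤ g2 * h3 - h2 * g3) : 0 < g1 * h3 - h1 * g3 := by
  have e1 : g2 * (g1 * h3 - h1 * g3) =
      (g2 * h3 - h2 * g3) * g1 + (g1 * h2 - h1 * g2) * g3 := by ring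
  have e2 : h2 * (g1 * h3 - h1 * g3) =
      (g2 * h3 - h2 * g3) * h1 + (g1 * h2 - h1 * g2) * h3 := by ring
  by_contra hn
  push Not at hn
  rcases hg3.lt_or_eq with h | h
  · have : 0 < (g1 * h2 - h1 * g2) * g3 := mul_pos hxy h
    nlinarith [mul_nonneg hyz _hg1, mul_nonneg hg2 (neg_nonneg.2 hn)]
  · have : 0 < (g1 * h2 - h1 * g2) * h3 := mul_pos hxy (by omega)
    nlinarith [mul_nonneg hyz _hh1, mul_nonneg hh2 (neg_nonneg.2 hn)]

lemma pr_trans {x y z : Deg l1 l2} (hz : z ≠ 0) (hxy : 0 < pr x y) (hyz : 0 ≤ pr y z) :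
    0 < pr x z := by
  rw [pr_eq] at *
  exact slope_trans (gD_nonneg x) (hD_nonneg x) (gD_nonneg y) (hD_nonneg y) (gD_nonneg z)
    (hD_nonneg z) (gD_add_hD_pos hz) hxy hyz

lemma pr_trans' {x y z : Deg l1 l2} (hx : x ≠ 0) (hxy : 0 ≤ pr x y) (hyz : 0 < pr y z) :
    0 < pr x z := by
  rw [pr_eq] at *
  have := slope_trans (hD_nonneg z) (gD_nonneg z) (hD_nonneg y) (gD_nonneg y) (hD_nonneg x)
    (gD_nonneg x) (by have := gD_add_hD_pos hx; omega) (by linarith) (by linarith)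
  linarith

/-- The non-zero exponents up to `m`. -/
def posIic (m : Deg l1 l2) : Finset (Deg l1 l2) := (Finset.Iic m).erase 0

lemma mem_posIic {m d : Deg l1 l2} : d ∈ posIic m ↔ d ≠ 0 ∧ d ≤ m := by
  simp [posIic]

lemma degree_pos_of_ne {d : Deg l1 l2} (hd : d ≠ 0) : 1 ≤ d.degree :=
  Nat.one_le_iff_ne_zero.2 fun h => hd ((Finsupp.degree_eq_zero_iff d).1 h)

lemma tmono_mem_one {m d : Deg l1 l2} (hd : d ∈ posIic m) : tmono m d ∈ tfilt m 1 :=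
  tmono_mem_tfilt (degree_pos_of_ne (mem_posIic.1 hd).1)

/-- The system without propagation: `N_b = x^b exp (∑ c_{b'} ⟨b', b⟩ ε_{b', b} N_{b'})`. -/
def numSol (m : Deg l1 l2) (c : Deg l1 l2 → ℂ) (ε : Deg l1 l2 → Deg l1 l2 → ℂ) :
    Deg l1 l2 → Trunc m :=
  systemSol (posIic m) (fun b' b x => (c b' * pr b' b * ε b' b) • x) (tmono m)

lemma numSol_spec (m : Deg l1 l2) (c : Deg l1 l2 → ℂ) (ε : Deg l1 l2 → Deg l1 l2 → ℂ) :
    IsSystemSol (posIic m) (fun b' b x => (c b' * pr b' b * ε b' b) • x) (tmono m)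
      (numSol m c ε) :=
  isSystemSol_systemSol (fun _ _ _ _ => Filtered.id.smul _) fun _ hb => tmono_mem_one hb

/-- The total jump of the system without propagation, weighted by `ω`. -/
def numJump (m : Deg l1 l2) (c : Deg l1 l2 → ℂ) (ε : Deg l1 l2 → Deg l1 l2 → ℂ)
    (ω : Deg l1 l2 → ℤ) : Trunc m :=
  ∑ b ∈ posIic m, (c b * ω b) • numSol m c ε b

/-- A solution of the equation
`X_b = x^b E_b exp (∑ c_{b'} ⟨b', b⟩ (L_{b'} + ε_{b', b} X_{b'}))` over a set of points. -/
structure TBAModel (m : Deg l1 l2) {Ω : Type*} (E : Deg l1 l2 → Ω → ℂ) (c : Deg l1 l2 → ℂ)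
    (ε : Deg l1 l2 → Deg l1 l2 → ℂ) where
  X : Deg l1 l2 → Ω → Trunc m
  L : Deg l1 l2 → Ω → Trunc m
  memX : ∀ b ∈ posIic m, ∀ w, X b w ∈ tfilt m 1
  memL : ∀ b ∈ posIic m, ∀ w, L b w ∈ tfilt m 1
  eq : ∀ b ∈ posIic m, ∀ w, X b w = E b w • tmono m b * IsNilpotent.exp
    (∑ b' ∈ posIic m, (c b' * pr b' b) • (L b' w + ε b' b • X b' w))

namespace TBAModel

variable {m : Deg l1 l2} {Ω : Type*} {E : Deg l1 l2 → Ω → ℂ} {c c' : Deg l1 l2 → ℂ}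
  {ε ε' : Deg l1 l2 → Deg l1 l2 → ℂ}

/-- The jump, weighted by `ω`. -/
def jump (M : TBAModel m E c ε) (ω : Deg l1 l2 → ℤ) (w : Ω) : Trunc m :=
  ∑ b ∈ posIic m, (c b * ω b) • M.X b w

/-- The propagated jump, weighted by `ω`. -/
def prop (M : TBAModel m E c ε) (ω : Deg l1 l2 → ℤ) (w : Ω) : Trunc m :=
  ∑ b ∈ posIic m, (c b * ω b) • M.L b w

lemma prop_mem (M : TBAModel m E c ε) (ω : Deg l1 l2 → ℤ) (w : Ω) : M.prop ω w ∈ tfilt m 1 :=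
  Ideal.sum_mem _ fun b hb => smul_mem_tfilt _ (M.memL b hb w)

/-- The exponent of the gauge factor in degree `d`. -/
def gaugeLog (M : TBAModel m E c ε) (w : Ω) (d : Deg l1 l2) : Trunc m :=
  (hD d : ℂ) • M.prop gD w - (gD d : ℂ) • M.prop hD w

lemma gaugeLog_mem (M : TBAModel m E c ε) (w : Ω) (d : Deg l1 l2) :
    M.gaugeLog w d ∈ tfilt m 1 :=
  Ideal.sub_mem _ (smul_mem_tfilt _ (M.prop_mem _ w)) (smul_mem_tfilt _ (M.prop_mem _ w))

lemma gaugeLog_zero (M : TBAModel m E c ε) (w : Ω) : M.gaugeLog w 0 = 0 := by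
  simp [gaugeLog, gD_zero, hD_zero]

lemma gaugeLog_add (M : TBAModel m E c ε) (w : Ω) (d e : Deg l1 l2) :
    M.gaugeLog w (d + e) = M.gaugeLog w d + M.gaugeLog w e := by
  simp only [gaugeLog, gD_add, hD_add]
  push_cast
  simp only [add_smul]
  abel

lemma gaugeLog_eq (M : TBAModel m E c ε) (w : Ω) (d : Deg l1 l2) :
    M.gaugeLog w d = ∑ b' ∈ posIic m, (c b' * pr b' d) • M.L b' w := by
  simp only [gaugeLog, prop, Finset.smul_sum, smul_smul, ← Finset.sum_sub_distrib, ← sub_smul]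
  refine Finset.sum_congr rfl fun b _ => ?_
  congr 1
  rw [pr_eq]
  push_cast
  ring

/-- The gauge factors. -/
def gauge (M : TBAModel m E c ε) (w : Ω) (d : Deg l1 l2) : Trunc m :=
  E d w • IsNilpotent.exp (M.gaugeLog w d)

lemma gauge_zero (M : TBAModel m E c ε) (hE0 : ∀ w, E 0 w = 1) (w : Ω) : M.gauge w 0 = 1 := by
  rw [gauge, gaugeLog_zero, IsNilpotent.exp_zero, hE0, one_smul]

lemma gauge_add (M : TBAModel m E c ε) (hEadd : ∀ d e w, E (d + e) w = E d w * E e w) (w : Ω)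
    (d e : Deg l1 l2) : M.gauge w (d + e) = M.gauge w d * M.gauge w e := by
  rw [gauge, gauge, gauge, gaugeLog_add, texp_add (M.gaugeLog_mem w d) (M.gaugeLog_mem w e),
    hEadd, smul_mul_smul_comm]

/-- The solution is obtained from the numerical solution by a gauge transformation. -/
lemma X_eq_evalHom (M : TBAModel m E c ε) (hE0 : ∀ w, E 0 w = 1)
    (hEadd : ∀ d e w, E (d + e) w = E d w * E e w) (w : Ω) {b : Deg l1 l2} (hb : b ∈ posIic m) :
    M.X b w = evalHom (M.gauge w) (M.gauge_zero hE0 w) (M.gauge_add hEadd w) (numSol m c ε b) := by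
  set ev := evalHom (M.gauge w) (M.gauge_zero hE0 w) (M.gauge_add hEadd w)
  have hN := numSol_spec m c ε
  refine IsSystemSol.unique (S := posIic m) (T := fun b' b x => (c b' * pr b' b * ε b' b) • x)
    (Y := fun b => tmono m b * M.gauge w b) (fun _ _ _ _ => Filtered.id.smul _)
    (fun b hb => Ideal.mul_mem_right _ _ (tmono_mem_one hb)) (X := fun b => M.X b w)
    (X' := fun b => ev (numSol m c ε b)) ⟨fun b hb => M.memX b hb w, fun b hb => ?_⟩
    ⟨fun b hb => evalHom_mem_tfilt _ _ (hN.1 b hb), fun b hb => ?_⟩ hb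
  · simp only
    rw [M.eq b hb w, gauge]
    simp only [smul_add, Finset.sum_add_distrib]
    rw [← gaugeLog_eq, texp_add (M.gaugeLog_mem w b)]
    · simp only [smul_smul, smul_mul_assoc, mul_smul_comm, mul_assoc]
    · exact Ideal.sum_mem _ fun b' hb' =>
        smul_mem_tfilt _ (smul_mem_tfilt _ (M.memX b' hb' w))
  · simp only
    conv_lhs => rw [hN.2 b hb]
    rw [map_mul, IsNilpotent.map_exp (isNilpotent_of_tfilt
      (Ideal.sum_mem _ fun b' hb' => smul_mem_tfilt _ (hN.1 b' hb'))), map_sum, evalHom_tmono]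
    simp only [map_smul]

lemma jump_eq_evalHom (M : TBAModel m E c ε) (hE0 : ∀ w, E 0 w = 1)
    (hEadd : ∀ d e w, E (d + e) w = E d w * E e w) (ω : Deg l1 l2 → ℤ) (w : Ω) :
    M.jump ω w =
      evalHom (M.gauge w) (M.gauge_zero hE0 w) (M.gauge_add hEadd w) (numJump m c ε ω) := by
  rw [jump, numJump, map_sum]
  refine Finset.sum_congr rfl fun b hb => ?_
  rw [map_smul, M.X_eq_evalHom hE0 hEadd w hb]

lemma tcoeff_jump_sub (M : TBAModel m E c ε) (M' : TBAModel m E c' ε') (hE0 : ∀ w, E 0 w = 1)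
    (hEadd : ∀ d e w, E (d + e) w = E d w * E e w) (ω : Deg l1 l2 → ℤ) {n : ℕ} {w : Ω}
    (hg : M.prop gD w - M'.prop gD w ∈ tfilt m n) (hh : M.prop hD w - M'.prop hD w ∈ tfilt m n)
    (hC : numJump m c ε ω - numJump m c' ε' ω ∈ tfilt m n) {d : Deg l1 l2} (hd : d ≤ m)
    (hdn : d.degree = n) :
    tcoeff d (M.jump ω w) - tcoeff d (M'.jump ω w) =
      (tcoeff d (numJump m c ε ω) - tcoeff d (numJump m c' ε' ω)) * E d w := by
  rw [M.jump_eq_evalHom hE0 hEadd, M'.jump_eq_evalHom hE0 hEadd]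
  refine tcoeff_evalHom_sub _ _ _ _ (E := fun d => E d w)
    (V := fun d => IsNilpotent.exp (M.gaugeLog w d))
    (V' := fun d => IsNilpotent.exp (M'.gaugeLog w d)) (fun _ => rfl) (fun _ => rfl) (fun d => ?_)
    ?_ (fun d => texp_sub_one_mem (M'.gaugeLog_mem w d)) hC hd hdn
  · refine texp_sub_mem (M.gaugeLog_mem w d) (M'.gaugeLog_mem w d) ?_
    have : M.gaugeLog w d - M'.gaugeLog w d = (hD d : ℂ) • (M.prop gD w - M'.prop gD w) -
        (gD d : ℂ) • (M.prop hD w - M'.prop hD w) := by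
      simp only [gaugeLog, smul_sub]
      abel
    rw [this]
    exact Ideal.sub_mem _ (smul_mem_tfilt _ hg) (smul_mem_tfilt _ hh)
  · simp only [gaugeLog_zero]

lemma numJump_mem (c : Deg l1 l2 → ℂ) (ε : Deg l1 l2 → Deg l1 l2 → ℂ) (ω : Deg l1 l2 → ℤ) :
    numJump m c ε ω ∈ tfilt m 1 :=
  Ideal.sum_mem _ fun b hb => smul_mem_tfilt _ ((numSol_spec m c ε).1 b hb)

/-- Compatibility of the propagators of two models: the propagated jumps agree to every order to
which the jumps agree. -/
def PropCompat (M : TBAModel m E c ε) (M' : TBAModel m E c' ε') : Prop :=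
  ∀ ω : Deg l1 l2 → ℤ, ∀ n, (∀ w, M.jump ω w - M'.jump ω w ∈ tfilt m n) →
    ∀ w, M.prop ω w - M'.prop ω w ∈ tfilt m n

/-- If the jumps of two models with the same propagator cannot differ by a multiple of the leading
term, then their numerical jumps agree. -/
theorem numJump_eq (M : TBAModel m E c ε) (M' : TBAModel m E c' ε') (hE0 : ∀ w, E 0 w = 1)
    (hEadd : ∀ d e w, E (d + e) w = E d w * E e w) (hP : PropCompat M M')
    (hQ : ∀ ω ∈ ({gD, hD} : Set (Deg l1 l2 → ℤ)), ∀ d ∈ posIic m, ∀ κ : ℂ,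
      (∀ w, tcoeff d (M.jump ω w) - tcoeff d (M'.jump ω w) = κ * E d w) → κ = 0) :
    ∀ ω ∈ ({gD, hD} : Set (Deg l1 l2 → ℤ)), numJump m c ε ω = numJump m c' ε' ω := by
  have key : ∀ n, ∀ ω ∈ ({gD, hD} : Set (Deg l1 l2 → ℤ)),
      numJump m c ε ω - numJump m c' ε' ω ∈ tfilt m n ∧
        ∀ w, M.jump ω w - M'.jump ω w ∈ tfilt m n := by
    intro n
    induction n with
    | zero => exact fun ω _ => ⟨mem_tfilt_zero _, fun w => mem_tfilt_zero _⟩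
    | succ n ih =>
      intro ω hω
      have hstep : ∀ d ≤ m, d.degree = n → ∀ w,
          tcoeff d (M.jump ω w) - tcoeff d (M'.jump ω w) =
          (tcoeff d (numJump m c ε ω) - tcoeff d (numJump m c' ε' ω)) * E d w := by
        intro d hd hdn w
        refine M.tcoeff_jump_sub M' hE0 hEadd ω ?_ ?_ (ih ω hω).1 hd hdn
        · exact hP _ n (ih gD (by simp)).2 w
        · exact hP _ n (ih hD (by simp)).2 w
      have hz : ∀ d ≤ m, d.degree = n →
          tcoeff d (numJump m c ε ω) - tcoeff d (numJump m c' ε' ω) = 0 := by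
        intro d hd hdn
        by_cases hd0 : d = 0
        · subst hd0
          rw [numJump_mem c ε ω 0 (by simp), numJump_mem c' ε' ω 0 (by simp), sub_zero]
        · exact hQ ω hω d (mem_posIic.2 ⟨hd0, hd⟩) _ (hstep d hd hdn)
      constructor
      · intro d hdn
        rcases Nat.lt_succ_iff_lt_or_eq.1 hdn with h | h
        · exact (ih ω hω).1 d h
        · by_cases hd : d ≤ m
          · rw [map_sub, hz d hd h]
          · exact tcoeff_of_not_le hd _
      · intro w d hdn
        rcases Nat.lt_succ_iff_lt_or_eq.1 hdn with h | h
        · exact (ih ω hω).2 w d h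
        · by_cases hd : d ≤ m
          · rw [map_sub, hstep d hd h w, hz d hd h, zero_mul]
          · exact tcoeff_of_not_le hd _
  intro ω hω
  exact sub_eq_zero.1 (eq_zero_of_mem_tfilt (Nat.lt_succ_self _) (key _ ω hω).1)

/-- Models with the same propagator and the same numerical jumps have the same jumps. -/
theorem jump_eq (M : TBAModel m E c ε) (M' : TBAModel m E c' ε') (hE0 : ∀ w, E 0 w = 1)
    (hEadd : ∀ d e w, E (d + e) w = E d w * E e w) (hP : PropCompat M M')
    (hC : ∀ ω ∈ ({gD, hD} : Set (Deg l1 l2 → ℤ)), numJump m c ε ω = numJump m c' ε' ω) :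
    ∀ ω ∈ ({gD, hD} : Set (Deg l1 l2 → ℤ)), ∀ w, M.jump ω w = M'.jump ω w := by
  have key : ∀ n, ∀ ω ∈ ({gD, hD} : Set (Deg l1 l2 → ℤ)),
      ∀ w, M.jump ω w - M'.jump ω w ∈ tfilt m n := by
    intro n
    induction n with
    | zero => exact fun ω _ w => mem_tfilt_zero _
    | succ n ih =>
      intro ω hω w d hdn
      rcases Nat.lt_succ_iff_lt_or_eq.1 hdn with h | h
      · exact ih ω hω w d h
      · by_cases hd : d ≤ m
        · rw [map_sub, M.tcoeff_jump_sub M' hE0 hEadd ω (hP _ n (ih gD (by simp)) w)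
            (hP _ n (ih hD (by simp)) w) (by rw [hC ω hω, sub_self]; exact Ideal.zero_mem _) hd h,
            hC ω hω, sub_self, zero_mul]
        · exact tcoeff_of_not_le hd _
  intro ω hω w
  exact sub_eq_zero.1 (eq_zero_of_mem_tfilt (Nat.lt_succ_self _) (key _ ω hω w))

end TBAModel

/-! ### The scalar model -/

/-- Multiplication of the coefficient in degree `d` by `p d`. -/
def pscale {m : Deg l1 l2} (p : Deg l1 l2 → ℂ) (x : Trunc m) : Trunc m :=
  tof m fun d => p d * tcoeff d x

lemma tcoeff_pscale {m : Deg l1 l2} (p : Deg l1 l2 → ℂ) (x : Trunc m) {d : Deg l1 l2}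
    (hd : d ≤ m) : tcoeff d (pscale p x) = p d * tcoeff d x := tcoeff_tof hd _

lemma pscale_mem {m : Deg l1 l2} (p : Deg l1 l2 → ℂ) {x : Trunc m} {n : ℕ} (hx : x ∈ tfilt m n) :
    pscale p x ∈ tfilt m n := by
  intro d hd
  by_cases h : d ≤ m
  · rw [tcoeff_pscale p x h, hx d hd, mul_zero]
  · exact tcoeff_of_not_le h _

lemma pscale_sub {m : Deg l1 l2} (p : Deg l1 l2 → ℂ) (x y : Trunc m) :
    pscale p (x - y) = pscale p x - pscale p y :=
  trunc_ext fun d hd => by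
    rw [map_sub, tcoeff_pscale _ _ hd, tcoeff_pscale _ _ hd, tcoeff_pscale _ _ hd, map_sub, mul_sub]

lemma pscale_filtered {m : Deg l1 l2} (p : Deg l1 l2 → ℂ) : Filtered (pscale (m := m) p) :=
  ⟨fun n x y h => by rw [← pscale_sub]; exact pscale_mem p h, fun x h => pscale_mem p h⟩

/-- The propagator of the scalar model: `-1` on the degrees of slope greater than that of `m`. -/
def upScalar (m d : Deg l1 l2) : ℂ := if 0 < pr d m then -1 else 0

/-- The incoming solution of the scalar model, for orderings given by `ε`. -/
def scalarSol (m : Deg l1 l2) (c : Deg l1 l2 → ℂ) (ε : Deg l1 l2 → Deg l1 l2 → ℂ) :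
    Deg l1 l2 → Trunc m :=
  systemSol (posIic m)
    (fun b' b x => (c b' * pr b' b) • (pscale (upScalar m) x + ε b' b • x)) (tmono m)

lemma scalarSol_spec (m : Deg l1 l2) (c : Deg l1 l2 → ℂ) (ε : Deg l1 l2 → Deg l1 l2 → ℂ) :
    IsSystemSol (posIic m)
      (fun b' b x => (c b' * pr b' b) • (pscale (upScalar m) x + ε b' b • x)) (tmono m)
      (scalarSol m c ε) :=
  isSystemSol_systemSol
    (fun _ _ _ _ => ((pscale_filtered _).add (Filtered.id.smul _)).smul _)
    fun _ hb => tmono_mem_one hb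

/-- The scalar model. -/
def scalarModel (m : Deg l1 l2) (c : Deg l1 l2 → ℂ) (ε : Deg l1 l2 → Deg l1 l2 → ℂ) :
    TBAModel m (fun _ (_ : Unit) => 1) c ε where
  X b _ := scalarSol m c ε b
  L b _ := pscale (upScalar m) (scalarSol m c ε b)
  memX b hb _ := (scalarSol_spec m c ε).1 b hb
  memL b hb _ := pscale_mem _ ((scalarSol_spec m c ε).1 b hb)
  eq b hb _ := by
    rw [one_smul]
    exact (scalarSol_spec m c ε).2 b hb

lemma scalarModel_prop {m : Deg l1 l2} {c : Deg l1 l2 → ℂ} {ε : Deg l1 l2 → Deg l1 l2 → ℂ}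
    (ω : Deg l1 l2 → ℤ) (w : Unit) :
    (scalarModel m c ε).prop ω w = pscale (upScalar m) ((scalarModel m c ε).jump ω w) :=
  trunc_ext fun d hd => by
    rw [tcoeff_pscale _ _ hd, TBAModel.prop, TBAModel.jump, map_sum, map_sum, Finset.mul_sum]
    refine Finset.sum_congr rfl fun b _ => ?_
    change tcoeff d (_ • pscale _ _) = _ * tcoeff d (_ • _)
    rw [map_smul, map_smul, tcoeff_pscale _ _ hd, smul_eq_mul, smul_eq_mul]
    change _ = _ * (_ * tcoeff d (scalarSol m c ε b))
    ring

lemma scalarModel_compat (m : Deg l1 l2) (c c' : Deg l1 l2 → ℂ)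
    (ε ε' : Deg l1 l2 → Deg l1 l2 → ℂ) :
    TBAModel.PropCompat (scalarModel m c ε) (scalarModel m c' ε') := by
  intro ω n h w
  rw [scalarModel_prop, scalarModel_prop, ← pscale_sub]
  exact pscale_mem _ (h w)

/-- The order of the rays before the wall. -/
def plusEps (b' b : Deg l1 l2) : ℂ := if pr b' b < 0 then 1 else 0

/-- The order of the rays after the wall. -/
def minusEps (b' b : Deg l1 l2) : ℂ := if 0 < pr b' b then 1 else 0

end Models


section ScalarModel

variable {l1 l2 : ℕ} {m : Deg l1 l2}

/-- All terms of degree less than `n` satisfy `p`. -/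
def SuppBelow (n : ℕ) (p : Deg l1 l2 → Prop) (x : Trunc m) : Prop :=
  ∀ d, d.degree < n → tcoeff d x ≠ 0 → p d

lemma SuppBelow.zero {n : ℕ} {p : Deg l1 l2 → Prop} : SuppBelow n p (0 : Trunc m) := by
  intro d _ h
  simp at h

lemma SuppBelow.add {n : ℕ} {p : Deg l1 l2 → Prop} {x y : Trunc m} (hx : SuppBelow n p x)
    (hy : SuppBelow n p y) : SuppBelow n p (x + y) := by
  intro d hd h
  by_cases h1 : tcoeff d x = 0
  · refine hy d hd fun h2 => h ?_
    rw [map_add, h1, h2, add_zero]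
  · exact hx d hd h1

lemma SuppBelow.smul {n : ℕ} {p : Deg l1 l2 → Prop} {x : Trunc m} (hx : SuppBelow n p x) (a : ℂ) :
    SuppBelow n p (a • x) := by
  intro d hd h
  refine hx d hd fun h2 => h ?_
  rw [map_smul, h2, smul_zero]

lemma SuppBelow.sum {n : ℕ} {p : Deg l1 l2 → Prop} {κ : Type*} {s : Finset κ} {x : κ → Trunc m}
    (hx : ∀ i ∈ s, SuppBelow n p (x i)) : SuppBelow n p (∑ i ∈ s, x i) :=
  Finset.sum_induction _ _ (fun _ _ => SuppBelow.add) SuppBelow.zero hx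

lemma SuppBelow.mul {n : ℕ} {p q r : Deg l1 l2 → Prop} (hp : ∀ d e, p d → q e → r (d + e))
    {x y : Trunc m} (hx : SuppBelow n p x) (hy : SuppBelow n q y) : SuppBelow n r (x * y) := by
  intro d hd h
  have hdm : d ≤ m := by
    by_contra h1
    exact h (tcoeff_of_not_le h1 _)
  rw [tcoeff_mul hdm] at h
  obtain ⟨⟨a, b⟩, hab, hne⟩ := Finset.exists_ne_zero_of_sum_ne_zero h
  have h1 : a + b = d := Finset.HasAntidiagonal.mem_antidiagonal.1 hab
  have h2 : a.degree + b.degree = d.degree := by rw [← h1, map_add]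
  rw [← h1]
  exact hp _ _ (hx a (by omega) (left_ne_zero_of_mul hne)) (hy b (by omega)
    (right_ne_zero_of_mul hne))

lemma SuppBelow.exp {n : ℕ} {p : Deg l1 l2 → Prop} (h0 : p 0) (hp : ∀ d e, p d → p e → p (d + e))
    {x : Trunc m} (hx1 : x ∈ tfilt m 1) (hx : SuppBelow n p x) :
    SuppBelow n p (IsNilpotent.exp x) := by
  have h1 : SuppBelow n p (1 : Trunc m) := by
    intro d _ h
    by_cases hd : d = 0
    · rw [hd]; exact h0
    · by_cases hm : d ≤ m
      · rw [tcoeff_one hm, if_neg hd] at h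
        exact absurd rfl h
      · exact absurd (tcoeff_of_not_le hm _) h
  rw [texp_eq_sum hx1 (Nat.lt_succ_self _)]
  refine SuppBelow.sum fun i hi => SuppBelow.smul ?_ _
  clear hi
  induction i with
  | zero => rw [pow_zero]; exact h1
  | succ i ih => rw [pow_succ]; exact ih.mul hp hx

lemma SuppBelow.tmono_mul {n : ℕ} {p r : Deg l1 l2 → Prop} {b : Deg l1 l2} (hb : b ≠ 0)
    (hp : ∀ d, p d → r (b + d)) {x : Trunc m} (hx : SuppBelow n p x) :
    SuppBelow (n + 1) r (tmono m b * x) := by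
  intro d hd h
  have hdm : d ≤ m := by
    by_contra h1
    exact h (tcoeff_of_not_le h1 _)
  rw [tcoeff_tmono_mul hdm] at h
  split_ifs at h with hbd
  · have h2 : b + (d - b) = d := add_tsub_cancel_of_le hbd
    rw [← h2]
    refine hp _ (hx _ ?_ h)
    have h3 : b.degree + (d - b).degree = d.degree := by rw [← map_add, h2]
    have := degree_pos_of_ne hb
    omega
  · exact absurd rfl h

/-- The support of the outgoing solution of the scalar model. -/
lemma scalarSol_minus_supp (hm : m ≠ 0) (c : Deg l1 l2 → ℂ) (n : ℕ) :
    ∀ b ∈ posIic m,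
      (0 < pr b m → SuppBelow n (fun d => 0 < pr d m) (scalarSol m c minusEps b)) ∧
      (pr b m < 0 → SuppBelow n (fun d => pr d m < 0) (scalarSol m c minusEps b)) ∧
      (pr b m = 0 → SuppBelow n (fun d => d = b) (scalarSol m c minusEps b)) := by
  induction n with
  | zero =>
    exact fun b _ => ⟨fun _ d hd => absurd hd (by omega), fun _ d hd => absurd hd (by omega),
      fun _ d hd => absurd hd (by omega)⟩
  | succ n ih =>
    intro b hb
    have hspec := scalarSol_spec m c minusEps
    have hb0 := (mem_posIic.1 hb).1
    set u := ∑ b' ∈ posIic m, (c b' * pr b' b) •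
      (pscale (upScalar m) (scalarSol m c minusEps b') +
        minusEps b' b • scalarSol m c minusEps b') with hu
    have hX : scalarSol m c minusEps b = tmono m b * IsNilpotent.exp u := hspec.2 b hb
    have hu1 : u ∈ tfilt m 1 := Ideal.sum_mem _ fun b' hb' => smul_mem_tfilt _
      (Ideal.add_mem _ (pscale_mem _ (hspec.1 b' hb')) (smul_mem_tfilt _ (hspec.1 b' hb')))
    have hfac : ∀ b' d, tcoeff d (pscale (upScalar m) (scalarSol m c minusEps b') +
        minusEps b' b • scalarSol m c minusEps b') =
        (upScalar m d + minusEps b' b) * tcoeff d (scalarSol m c minusEps b') := by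
      intro b' d
      by_cases hd : d ≤ m
      · rw [map_add, tcoeff_pscale _ _ hd, map_smul, smul_eq_mul]
        ring
      · rw [tcoeff_of_not_le hd, tcoeff_of_not_le hd, mul_zero]
    -- the support of the exponent, from the supports of the factors
    have hterm : ∀ q : Deg l1 l2 → Prop, (∀ b' ∈ posIic m, ∀ d, d.degree < n → d ≤ m →
        pr b' b ≠ 0 → upScalar m d + minusEps b' b ≠ 0 →
        tcoeff d (scalarSol m c minusEps b') ≠ 0 → q d) → SuppBelow n q u := by
      intro q hq
      refine SuppBelow.sum fun b' hb' => ?_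
      intro d hd hne
      rw [map_smul, hfac, smul_eq_mul] at hne
      have hdm : d ≤ m := by
        by_contra h1
        exact hne (by rw [tcoeff_of_not_le h1, mul_zero, mul_zero])
      refine hq b' hb' d hd hdm ?_ (left_ne_zero_of_mul (right_ne_zero_of_mul hne))
        (right_ne_zero_of_mul (right_ne_zero_of_mul hne))
      intro h0
      rw [h0] at hne
      simp at hne
    have hcase : ∀ b' ∈ posIic m, ∀ d, d.degree < n → pr b' b ≠ 0 →
        upScalar m d + minusEps b' b ≠ 0 → tcoeff d (scalarSol m c minusEps b') ≠ 0 →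
        (0 < pr b' b ∧ pr d m ≤ 0 ∧ pr b' m ≤ 0) ∨ (pr b' b < 0 ∧ 0 < pr d m ∧ 0 < pr b' m) := by
      intro b' hb' d hd h1 h2 h3
      rcases lt_or_gt_of_ne h1 with h | h
      · right
        have h4 : 0 < pr d m := by
          by_contra hn
          exact h2 (by simp [upScalar, minusEps, hn, h.le])
        refine ⟨h, h4, ?_⟩
        by_contra hn
        rcases lt_or_eq_of_le (not_lt.1 hn) with h5 | h5
        · have := (ih b' hb').2.1 h5 d hd h3
          omega
        · have := (ih b' hb').2.2 h5 d hd h3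
          rw [this] at h4
          omega
      · left
        have h4 : pr d m ≤ 0 := by
          by_contra hn
          exact h2 (by simp [upScalar, minusEps, not_le.1 hn, h])
        refine ⟨h, h4, ?_⟩
        by_contra hn
        have := (ih b' hb').1 (not_le.1 hn) d hd h3
        omega
    refine ⟨fun hpos => ?_, fun hneg => ?_, fun hzero => ?_⟩
    · rw [hX]
      refine SuppBelow.tmono_mul (p := fun d => 0 ≤ pr d m) hb0 ?_ (SuppBelow.exp ?_ ?_ hu1 ?_)
      · intro d hd
        rw [pr_add_left]
        omega
      · rw [pr_zero_left]
      · intro d e hd he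
        rw [pr_add_left]
        omega
      · refine hterm _ fun b' hb' d hd hdm h1 h2 h3 => ?_
        rcases hcase b' hb' d hd h1 h2 h3 with ⟨h4, _, h6⟩ | ⟨_, h5, _⟩
        · have := pr_trans hm h4 hpos.le
          omega
        · exact h5.le
    · rw [hX]
      refine SuppBelow.tmono_mul (p := fun d => pr d m ≤ 0) hb0 ?_ (SuppBelow.exp ?_ ?_ hu1 ?_)
      · intro d hd
        rw [pr_add_left]
        omega
      · rw [pr_zero_left]
      · intro d e hd he
        rw [pr_add_left]
        omega
      · refine hterm _ fun b' hb' d hd hdm h1 h2 h3 => ?_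
        rcases hcase b' hb' d hd h1 h2 h3 with ⟨_, h5, _⟩ | ⟨h4, _, h6⟩
        · exact h5
        · rw [pr_swap] at h4 hneg
          have := pr_trans' hm (by omega : 0 ≤ pr m b) (by omega : 0 < pr b b')
          rw [pr_swap] at this
          omega
    · rw [hX]
      refine SuppBelow.tmono_mul (p := fun d => d = 0) hb0 ?_ (SuppBelow.exp (p := fun d => d = 0) rfl ?_ hu1 ?_)
      · intro d hd
        rw [hd, add_zero]
      · intro d e hd he
        rw [hd, he, add_zero]
      · refine hterm _ fun b' hb' d hd hdm h1 h2 h3 => ?_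
        exfalso
        rcases hcase b' hb' d hd h1 h2 h3 with ⟨h4, h5, h6⟩ | ⟨h4, h5, h6⟩
        · have := pr_trans hm h4 hzero.ge
          omega
        · rw [pr_swap] at h4
          have := pr_trans hm (by omega : 0 < pr b b') h6.le
          omega

lemma scalarSol_coeff_self (c : Deg l1 l2 → ℂ) (ε : Deg l1 l2 → Deg l1 l2 → ℂ) {b : Deg l1 l2}
    (hb : b ∈ posIic m) : tcoeff b (scalarSol m c ε b) = 1 := by
  have hspec := scalarSol_spec m c ε
  have hbm := (mem_posIic.1 hb).2
  rw [hspec.2 b hb, tcoeff_tmono_mul hbm, if_pos le_rfl, tsub_self]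
  have h := texp_sub_one_mem (m := m) (x := ∑ b' ∈ posIic m,
    (c b' * pr b' b) • (pscale (upScalar m) (scalarSol m c ε b') + ε b' b • scalarSol m c ε b'))
    (Ideal.sum_mem _ fun b' hb' => smul_mem_tfilt _
      (Ideal.add_mem _ (pscale_mem _ (hspec.1 b' hb')) (smul_mem_tfilt _ (hspec.1 b' hb')))) 0
    (by simp)
  rw [map_sub, sub_eq_zero] at h
  rw [h, tcoeff_one zero_le, if_pos rfl]

/-- The outgoing jump of the scalar model in the top degree. -/
lemma scalarModel_minus_jump (hm : m ≠ 0) (c : Deg l1 l2 → ℂ) (ω : Deg l1 l2 → ℤ) (w : Unit) :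
    tcoeff m ((scalarModel m c minusEps).jump ω w) = c m * ω m := by
  have hmm : m ∈ posIic m := mem_posIic.2 ⟨hm, le_rfl⟩
  rw [TBAModel.jump, map_sum, Finset.sum_eq_single m]
  · rw [map_smul]
    change _ • tcoeff m (scalarSol m c minusEps m) = _
    rw [scalarSol_coeff_self c minusEps hmm, smul_eq_mul, mul_one]
  · intro b hb hbm
    rw [map_smul]
    change _ • tcoeff m (scalarSol m c minusEps b) = _
    by_contra hne
    have hne' : tcoeff m (scalarSol m c minusEps b) ≠ 0 := fun h => hne (by rw [h, smul_zero])
    have h := scalarSol_minus_supp hm c (m.degree + 1) b hb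
    have hself := pr_self m
    rcases lt_trichotomy (pr b m) 0 with h1 | h1 | h1
    · have := h.2.1 h1 m (by omega) hne'
      omega
    · exact hbm (h.2.2 h1 m (by omega) hne').symm
    · have := h.1 h1 m (by omega) hne'
      omega
  · intro h
    exact absurd hmm h

/-- Differentiation along a coordinate. -/
def coordDeg (v : Idx l1 l2) : Deg l1 l2 →+ ℂ :=
  (Nat.castAddMonoidHom ℂ).comp (Finsupp.applyAddHom v)

lemma coordDeg_apply (v : Idx l1 l2) (d : Deg l1 l2) : coordDeg v d = d v := rfl

/-- The incoming jump of the scalar model derives from a potential: up to the coordinate of `m`,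
its component along `v` does not depend on `v`. -/
lemma scalarSol_plus_potential (hprim : ∀ d ∈ posIic m, d ≠ m → pr d m ≠ 0) (c : Deg l1 l2 → ℂ) :
    ∃ K : ℂ, ∀ v : Idx l1 l2,
      ∑ b ∈ posIic m, (c b * b v) * tcoeff m (scalarSol m c plusEps b) = m v * K := by
  set X := scalarSol m c plusEps
  have hspec := scalarSol_spec m c plusEps
  let P : Deg l1 l2 → Deg l1 l2 → Deg l1 l2 → ℂ := fun b' b d => upScalar m d + plusEps b' b
  let A : Finset (Deg l1 l2 × Deg l1 l2) := Finset.HasAntidiagonal.antidiagonal m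
  let Q : ℂ := ∑ b ∈ posIic m, ∑ b' ∈ posIic m, ∑ e ∈ A,
    (c b * c b' * pr b' b * P b' b e.2) * (tcoeff e.1 (X b) * tcoeff e.2 (X b'))
  refine ⟨∑ b ∈ posIic m, c b * tcoeff m (X b) - Q / 2, fun v => ?_⟩
  have hD : ∀ b ∈ posIic m, tderiv m (coordDeg v) (X b) = (b v : ℂ) • X b +
      X b * ∑ b' ∈ posIic m, (c b' * pr b' b) •
        tderiv m (coordDeg v) (pscale (upScalar m) (X b') + plusEps b' b • X b') := by
    intro b hb
    set u := ∑ b' ∈ posIic m, (c b' * pr b' b) •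
      (pscale (upScalar m) (X b') + plusEps b' b • X b') with hu
    have hX : X b = tmono m b * IsNilpotent.exp u := hspec.2 b hb
    have hu1 : u ∈ tfilt m 1 := Ideal.sum_mem _ fun b' hb' => smul_mem_tfilt _
      (Ideal.add_mem _ (pscale_mem _ (hspec.1 b' hb')) (smul_mem_tfilt _ (hspec.1 b' hb')))
    have hDu : tderiv m (coordDeg v) u = ∑ b' ∈ posIic m, (c b' * pr b' b) •
        tderiv m (coordDeg v) (pscale (upScalar m) (X b') + plusEps b' b • X b') := by
      rw [hu, map_sum]
      exact Finset.sum_congr rfl fun b' _ => Derivation.map_smul _ _ _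
    rw [← hDu]
    conv_lhs => rw [hX, Derivation.leibniz, tderiv_exp _ hu1, tderiv_tmono]
    rw [hX, coordDeg_apply, smul_eq_mul, smul_eq_mul, mul_smul_comm]
    ring_nf
  have hcoef : ∀ b ∈ posIic m, (m v : ℂ) * tcoeff m (X b) = b v * tcoeff m (X b) +
      ∑ b' ∈ posIic m, ∑ e ∈ A,
        (c b' * pr b' b * P b' b e.2) * (e.2 v * (tcoeff e.1 (X b) * tcoeff e.2 (X b'))) := by
    intro b hb
    have h1 := congrArg (tcoeff m) (hD b hb)
    rw [tcoeff_tderiv le_rfl, coordDeg_apply, map_add, map_smul, smul_eq_mul, Finset.mul_sum,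
      map_sum] at h1
    rw [h1]
    congr 1
    refine Finset.sum_congr rfl fun b' _ => ?_
    rw [tcoeff_mul le_rfl]
    refine Finset.sum_congr rfl fun e he => ?_
    have he' : e.1 + e.2 = m := Finset.HasAntidiagonal.mem_antidiagonal.1 he
    have he2 : e.2 ≤ m := by rw [← he']; exact le_add_self
    rw [map_smul, tcoeff_tderiv he2, map_add, tcoeff_pscale _ _ he2, map_smul, coordDeg_apply]
    simp only [smul_eq_mul, P]
    ring
  -- the quadratic term is symmetric
  let R : Deg l1 l2 → Deg l1 l2 → (Deg l1 l2 × Deg l1 l2) → ℂ := fun b b' e =>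
    (c b * c b' * pr b' b * P b' b e.2) * (tcoeff e.1 (X b) * tcoeff e.2 (X b'))
  have hsymm : ∀ b ∈ posIic m, ∀ b' ∈ posIic m, ∀ e ∈ A, R b' b e.swap = R b b' e := by
    intro b hb b' hb' e he
    have he' : e.1 + e.2 = m := Finset.HasAntidiagonal.mem_antidiagonal.1 he
    by_cases h1 : e.1 = 0
    · have : tcoeff e.1 (X b) = 0 := by rw [h1]; exact hspec.1 b hb 0 (by simp)
      simp [R, this]
    by_cases h2 : e.2 = 0
    · have : tcoeff e.2 (X b') = 0 := by rw [h2]; exact hspec.1 b' hb' 0 (by simp)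
      simp [R, this]
    have hne : pr e.2 m ≠ 0 := by
      refine hprim e.2 (mem_posIic.2 ⟨h2, by rw [← he']; exact le_add_self⟩) fun h => h1 ?_
      rw [h] at he'
      simpa using he'
    have hsum : pr e.1 m + pr e.2 m = 0 := by rw [← pr_add_left, he', pr_self]
    have hpr : pr b b' = -pr b' b := pr_swap _ _
    have hP : (pr b b' : ℂ) * P b b' e.1 = pr b' b * P b' b e.2 := by
      have hprc : (pr b b' : ℂ) = -(pr b' b : ℂ) := by rw [hpr]; push_cast; rfl
      rw [hprc]
      simp only [P, upScalar, plusEps]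
      rcases eq_or_ne (pr b' b) 0 with h3 | h3
      · rw [h3]
        simp
      · split_ifs <;> first | (exfalso; omega) | ring
    simp only [R, Prod.fst_swap, Prod.snd_swap]
    linear_combination (c b * c b') * (tcoeff e.1 (X b) * tcoeff e.2 (X b')) * hP
  have hswapA : ∀ f : Deg l1 l2 × Deg l1 l2 → ℂ, ∑ e ∈ A, f e = ∑ e ∈ A, f e.swap := fun f =>
    (Finset.sum_equiv (Equiv.prodComm _ _) (by simp [A, add_comm]) (by simp)).symm
  have hquad : ∑ b ∈ posIic m, ∑ b' ∈ posIic m, ∑ e ∈ A, e.2 v * R b b' e = m v * (Q / 2) := by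
    have h1 : ∑ b ∈ posIic m, ∑ b' ∈ posIic m, ∑ e ∈ A, (e.2 v : ℂ) * R b b' e =
        ∑ b ∈ posIic m, ∑ b' ∈ posIic m, ∑ e ∈ A, (e.1 v : ℂ) * R b b' e := by
      rw [Finset.sum_comm]
      refine Finset.sum_congr rfl fun b hb => Finset.sum_congr rfl fun b' hb' => ?_
      rw [hswapA]
      refine Finset.sum_congr rfl fun e he => ?_
      rw [hsymm b hb b' hb' e he, Prod.snd_swap]
    have h2 : ∑ b ∈ posIic m, ∑ b' ∈ posIic m, ∑ e ∈ A, (e.1 v : ℂ) * R b b' e +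
        ∑ b ∈ posIic m, ∑ b' ∈ posIic m, ∑ e ∈ A, (e.2 v : ℂ) * R b b' e = m v * Q := by
      simp only [Q, Finset.mul_sum, ← Finset.sum_add_distrib]
      refine Finset.sum_congr rfl fun b hb => Finset.sum_congr rfl fun b' hb' =>
        Finset.sum_congr rfl fun e he => ?_
      have he' : e.1 + e.2 = m := Finset.HasAntidiagonal.mem_antidiagonal.1 he
      have h3 : (m v : ℂ) = e.1 v + e.2 v := by
        rw [← he']
        push_cast [Finsupp.add_apply]
        rfl
      rw [h3]
      simp only [R]
      ring
    linear_combination h2 / 2 + h1 / 2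
  have hall : ∑ b ∈ posIic m, c b * ((m v : ℂ) * tcoeff m (X b)) =
      ∑ b ∈ posIic m, c b * (b v * tcoeff m (X b)) +
      ∑ b ∈ posIic m, ∑ b' ∈ posIic m, ∑ e ∈ A, e.2 v * R b b' e := by
    rw [← Finset.sum_add_distrib]
    refine Finset.sum_congr rfl fun b hb => ?_
    rw [hcoef b hb, mul_add, Finset.mul_sum]
    congr 1
    refine Finset.sum_congr rfl fun b' _ => ?_
    rw [Finset.mul_sum]
    refine Finset.sum_congr rfl fun e _ => ?_
    simp only [R]
    ring
  rw [hquad] at hall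
  rw [mul_sub, Finset.mul_sum]
  have h4 : ∑ b ∈ posIic m, (m v : ℂ) * (c b * tcoeff m (X b)) =
      ∑ b ∈ posIic m, c b * ((m v : ℂ) * tcoeff m (X b)) :=
    Finset.sum_congr rfl fun b _ => by ring
  rw [h4, hall]
  have h5 : ∑ b ∈ posIic m, c b * (b v : ℂ) * tcoeff m (X b) =
      ∑ b ∈ posIic m, c b * (b v * tcoeff m (X b)) := Finset.sum_congr rfl fun b _ => by ring
  rw [h5]
  ring

/-- Equality of numerical jumps determines the top coefficient after the wall. -/
theorem coeff_eq_of_numJump_eq (hprim : ∀ d ∈ posIic m, d ≠ m → pr d m ≠ 0) (hg : gD m ≠ 0)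
    {c c' : Deg l1 l2 → ℂ}
    (hC : ∀ ω ∈ ({gD, hD} : Set (Deg l1 l2 → ℤ)),
      numJump m c plusEps ω = numJump m c' minusEps ω) (v : Idx l1 l2) :
    ∑ b ∈ posIic m, (c b * b v) * tcoeff m (scalarSol m c plusEps b) = m v * c' m := by
  have hm : m ≠ 0 := by
    rintro rfl
    exact hg gD_zero
  obtain ⟨K, hK⟩ := scalarSol_plus_potential hprim c
  have h1 := TBAModel.jump_eq (scalarModel m c plusEps) (scalarModel m c' minusEps)
    (fun _ => rfl) (fun _ _ _ => (mul_one _).symm) (scalarModel_compat _ _ _ _ _) hC gD (by simp) ()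
  have h2 := congrArg (tcoeff m) h1
  rw [scalarModel_minus_jump hm, TBAModel.jump, map_sum] at h2
  have h3 : ∑ b ∈ posIic m, tcoeff m ((c b * gD b) • (scalarModel m c plusEps).X b ()) =
      ∑ i : Fin l1, ∑ b ∈ posIic m,
        (c b * b (Sum.inl i)) * tcoeff m (scalarSol m c plusEps b) := by
    rw [Finset.sum_comm]
    refine Finset.sum_congr rfl fun b _ => ?_
    rw [map_smul, ← Finset.sum_mul, ← Finset.mul_sum, smul_eq_mul]
    congr 2
    simp [gD, gPart, toLat]
  rw [h3] at h2
  simp only [hK] at h2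
  have h4 : ∑ i : Fin l1, ((m (Sum.inl i) : ℂ) * K) = gD m * K := by
    rw [← Finset.sum_mul]
    congr 1
    simp [gD, gPart, toLat]
  rw [h4, mul_comm] at h2
  have h5 : K = c' m := mul_right_cancel₀ (Int.cast_ne_zero.2 hg) h2
  rw [hK, h5]

end ScalarModel


/-! ### Positions of rays -/

section Args

/-- The cross product of two complex numbers. -/
def cross (z w : ℂ) : ℝ := z.re * w.im - z.im * w.re

lemma cross_eq_sin (z w : ℂ) : cross z w = ‖z‖ * ‖w‖ * Real.sin (w.arg - z.arg) := by
  rw [Real.sin_sub, cross]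
  linear_combination -w.im * Complex.norm_mul_cos_arg z + w.re * Complex.norm_mul_sin_arg z +
    ‖z‖ * Real.sin z.arg * Complex.norm_mul_cos_arg w -
    ‖z‖ * Real.cos z.arg * Complex.norm_mul_sin_arg w

lemma arg_lt_arg_iff {z w : ℂ} (hz : z ≠ 0) (hw : w ≠ 0) (hz1 : 0 ≤ z.re) (hz2 : 0 ≤ z.im)
    (hw1 : 0 ≤ w.re) (hw2 : 0 ≤ w.im) : z.arg < w.arg ↔ 0 < cross z w := by
  have hz3 : 0 ≤ z.arg := Complex.arg_nonneg_iff.2 hz2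
  have hw3 : 0 ≤ w.arg := Complex.arg_nonneg_iff.2 hw2
  have hz4 : z.arg ≤ Real.pi / 2 := (abs_le.1 (Complex.abs_arg_le_pi_div_two_iff.2 hz1)).2
  have hw4 : w.arg ≤ Real.pi / 2 := (abs_le.1 (Complex.abs_arg_le_pi_div_two_iff.2 hw1)).2
  have hpos : 0 < ‖z‖ * ‖w‖ := mul_pos (norm_pos_iff.2 hz) (norm_pos_iff.2 hw)
  have hpi := Real.pi_pos
  rw [cross_eq_sin]
  constructor
  · intro hlt
    exact mul_pos hpos (Real.sin_pos_of_pos_of_lt_pi (by linarith) (by linarith))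
  · intro h1
    by_contra hn
    have h2 : Real.sin (w.arg - z.arg) ≤ 0 :=
      Real.sin_nonpos_of_nonpos_of_neg_pi_le (by linarith) (by linarith)
    nlinarith

lemma re_nonneg_of_arg {z : ℂ} (h0 : 0 ≤ z.arg) (h1 : z.arg ≤ Real.pi / 2) : 0 ≤ z.re :=
  Complex.abs_arg_le_pi_div_two_iff.1 (abs_le.2 ⟨by linarith [Real.pi_pos], h1⟩)

variable {l1 l2 : ℕ}

/-- Non-negative non-zero lattice elements. -/
def IsPos (a : Lat l1 l2) : Prop := (∀ v, 0 ≤ a v) ∧ a ≠ 0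

lemma IsPos.g_nonneg {a : Lat l1 l2} (ha : IsPos a) : 0 ≤ gPart a :=
  Finset.sum_nonneg fun i _ => ha.1 _

lemma IsPos.h_nonneg {a : Lat l1 l2} (ha : IsPos a) : 0 ≤ hPart a :=
  Finset.sum_nonneg fun i _ => ha.1 _

lemma IsPos.add_pos {a : Lat l1 l2} (ha : IsPos a) : 0 < gPart a + hPart a := by
  obtain ⟨v, hv⟩ := Function.ne_iff.1 ha.2
  have hv' : 0 < a v := lt_of_le_of_ne (ha.1 v) (Ne.symm hv)
  have h1 := ha.g_nonneg
  have h2 := ha.h_nonneg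
  rcases v with i | j
  · have : a (Sum.inl i) ≤ gPart a :=
      Finset.single_le_sum (f := fun i => a (Sum.inl i)) (fun i _ => ha.1 _) (Finset.mem_univ i)
    omega
  · have : a (Sum.inr j) ≤ hPart a :=
      Finset.single_le_sum (f := fun i => a (Sum.inr i)) (fun i _ => ha.1 _) (Finset.mem_univ j)
    omega

lemma IsPos.add {a b : Lat l1 l2} (ha : IsPos a) (hb : IsPos b) : IsPos (a + b) := by
  refine ⟨fun v => add_nonneg (ha.1 v) (hb.1 v), fun h => ?_⟩
  have h1 := ha.add_pos
  have h2 := hb.add_pos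
  have h3 : gPart (a + b) + hPart (a + b) = 0 := by rw [h]; simp [gPart, hPart]
  rw [gPart_add, hPart_add] at h3
  omega

lemma central_re (zg zh : ℂ) (a : Lat l1 l2) :
    (central zg zh a).re = gPart a * zg.re + hPart a * zh.re := by
  simp [central]

lemma central_im (zg zh : ℂ) (a : Lat l1 l2) :
    (central zg zh a).im = gPart a * zg.im + hPart a * zh.im := by
  simp [central]

lemma cross_central (zg zh : ℂ) (a b : Lat l1 l2) :
    cross (central zg zh a) (central zg zh b) = pairing a b * cross zg zh := by
  simp only [cross, central_re, central_im, pairing]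
  push_cast
  ring

namespace ChargePair

variable (P : ChargePair)

lemma gPlus_ne : P.gPlus ≠ 0 := by
  intro h
  have h1 := P.arg_lt_three
  have h2 := P.arg_lt_two
  have h3 := P.arg_lt_one
  have h4 := P.arg_nonneg
  rw [h, Complex.arg_zero] at h1
  linarith

lemma gMinus_ne : P.gMinus ≠ 0 := by
  intro h
  have h3 := P.arg_lt_one
  have h4 := P.arg_nonneg
  rw [h, Complex.arg_zero] at h3
  linarith

lemma hMinus_ne : P.hMinus ≠ 0 := by
  intro h
  have h2 := P.arg_lt_two
  have h3 := P.arg_lt_one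
  have h4 := P.arg_nonneg
  rw [h, Complex.arg_zero] at h2
  linarith

lemma quadrant : (0 ≤ P.gPlus.re ∧ 0 ≤ P.gPlus.im) ∧ (0 ≤ P.hPlus.re ∧ 0 ≤ P.hPlus.im) ∧
    (0 ≤ P.gMinus.re ∧ 0 ≤ P.gMinus.im) ∧ (0 ≤ P.hMinus.re ∧ 0 ≤ P.hMinus.im) := by
  have h0 := P.arg_nonneg
  have h1 := P.arg_lt_one
  have h2 := P.arg_lt_two
  have h3 := P.arg_lt_three
  have h4 := P.arg_le
  refine ⟨⟨?_, ?_⟩, ⟨?_, ?_⟩, ⟨?_, ?_⟩, ⟨?_, ?_⟩⟩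
  all_goals first
    | exact re_nonneg_of_arg (by linarith) (by linarith)
    | exact Complex.arg_nonneg_iff.1 (by linarith)

lemma cross_minus : 0 < cross P.gMinus P.hMinus := by
  obtain ⟨_, _, ⟨h1, h2⟩, h3, h4⟩ := P.quadrant
  exact (arg_lt_arg_iff P.gMinus_ne P.hMinus_ne h1 h2 h3 h4).1 P.arg_lt_two

lemma cross_plus : 0 < cross P.hPlus P.gPlus := by
  obtain ⟨⟨h1, h2⟩, ⟨h3, h4⟩, _⟩ := P.quadrant
  refine (arg_lt_arg_iff P.hPlus_ne P.gPlus_ne h3 h4 h1 h2).1 ?_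
  linarith [P.arg_lt_one, P.arg_lt_two, P.arg_lt_three]

lemma minus_quadrant {a : Lat l1 l2} (ha : IsPos a) :
    0 ≤ (P.minus a).re ∧ 0 ≤ (P.minus a).im := by
  obtain ⟨_, _, ⟨h1, h2⟩, h3, h4⟩ := P.quadrant
  have hg : (0 : ℝ) ≤ gPart a := by exact_mod_cast ha.g_nonneg
  have hh : (0 : ℝ) ≤ hPart a := by exact_mod_cast ha.h_nonneg
  rw [minus, central_re, central_im]
  constructor <;> positivity

lemma cross_hPlus_minus {a : Lat l1 l2} (ha : IsPos a) : 0 < cross P.hPlus (P.minus a) := by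
  obtain ⟨_, ⟨q1, q2⟩, ⟨h1, h2⟩, h3, h4⟩ := P.quadrant
  have e1 := (arg_lt_arg_iff P.hPlus_ne P.gMinus_ne q1 q2 h1 h2).1 P.arg_lt_one
  have e2 := (arg_lt_arg_iff P.hPlus_ne P.hMinus_ne q1 q2 h3 h4).1
    (P.arg_lt_one.trans P.arg_lt_two)
  have h : cross P.hPlus (P.minus a) =
      gPart a * cross P.hPlus P.gMinus + hPart a * cross P.hPlus P.hMinus := by
    simp only [cross, minus, central_re, central_im]
    ring
  have hg : (0 : ℝ) ≤ gPart a := by exact_mod_cast ha.g_nonneg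
  have hh : (0 : ℝ) ≤ hPart a := by exact_mod_cast ha.h_nonneg
  have hs : (0 : ℝ) < gPart a + hPart a := by exact_mod_cast ha.add_pos
  rw [h]
  rcases hg.lt_or_eq with h5 | h5
  · have := mul_pos h5 e1
    have := mul_nonneg hh e2.le
    linarith
  · have := mul_pos (show (0 : ℝ) < hPart a by linarith) e2
    rw [← h5]
    linarith

lemma cross_minus_gPlus {a : Lat l1 l2} (ha : IsPos a) : 0 < cross (P.minus a) P.gPlus := by
  obtain ⟨⟨q1, q2⟩, _, ⟨h1, h2⟩, h3, h4⟩ := P.quadrant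
  have e1 := (arg_lt_arg_iff P.gMinus_ne P.gPlus_ne h1 h2 q1 q2).1
    (P.arg_lt_two.trans P.arg_lt_three)
  have e2 := (arg_lt_arg_iff P.hMinus_ne P.gPlus_ne h3 h4 q1 q2).1 P.arg_lt_three
  have h : cross (P.minus a) P.gPlus =
      gPart a * cross P.gMinus P.gPlus + hPart a * cross P.hMinus P.gPlus := by
    simp only [cross, minus, central_re, central_im]
    ring
  have hg : (0 : ℝ) ≤ gPart a := by exact_mod_cast ha.g_nonneg
  have hh : (0 : ℝ) ≤ hPart a := by exact_mod_cast ha.h_nonneg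
  have hs : (0 : ℝ) < gPart a + hPart a := by exact_mod_cast ha.add_pos
  rw [h]
  rcases hg.lt_or_eq with h5 | h5
  · have := mul_pos h5 e1
    have := mul_nonneg hh e2.le
    linarith
  · have := mul_pos (show (0 : ℝ) < hPart a by linarith) e2
    rw [← h5]
    linarith

lemma minus_ne {a : Lat l1 l2} (ha : IsPos a) : P.minus a ≠ 0 := by
  intro h
  have := P.cross_hPlus_minus ha
  rw [h] at this
  simp [cross] at this

lemma clock_minus_lt_iff {a b : Lat l1 l2} (ha : IsPos a) (hb : IsPos b) :
    clock (P.minus a) < clock (P.minus b) ↔ 0 < pairing b a := by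
  obtain ⟨h1, h2⟩ := P.minus_quadrant ha
  obtain ⟨h3, h4⟩ := P.minus_quadrant hb
  rw [clock, clock, neg_lt_neg_iff, arg_lt_arg_iff (P.minus_ne hb) (P.minus_ne ha) h3 h4 h1 h2,
    minus, minus, cross_central, mul_pos_iff_of_pos_right P.cross_minus, Int.cast_pos]

lemma clock_minus_mem {a : Lat l1 l2} (ha : IsPos a) :
    clock P.gPlus < clock (P.minus a) ∧ clock (P.minus a) < clock P.hPlus := by
  obtain ⟨⟨q1, q2⟩, ⟨q3, q4⟩, _⟩ := P.quadrant
  obtain ⟨h1, h2⟩ := P.minus_quadrant ha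
  rw [clock, clock, clock, neg_lt_neg_iff, neg_lt_neg_iff]
  exact ⟨(arg_lt_arg_iff (P.minus_ne ha) P.gPlus_ne h1 h2 q1 q2).2 (P.cross_minus_gPlus ha),
    (arg_lt_arg_iff P.hPlus_ne (P.minus_ne ha) q3 q4 h1 h2).2 (P.cross_hPlus_minus ha)⟩

end ChargePair

lemma gPart_smul_basis (p : ℕ) (u : Idx l1 l2) :
    gPart (p • basisVec u) = (match u with | Sum.inl _ => (p : ℤ) | Sum.inr _ => 0) := by
  rcases u with i | j
  · simp [gPart, basisVec, Pi.single_apply, Sum.inl.injEq]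
  · simp [gPart, basisVec, Pi.single_apply]

lemma hPart_smul_basis (p : ℕ) (u : Idx l1 l2) :
    hPart (p • basisVec u) = (match u with | Sum.inl _ => 0 | Sum.inr _ => (p : ℤ)) := by
  rcases u with i | j
  · simp [hPart, basisVec, Pi.single_apply]
  · simp [hPart, basisVec, Pi.single_apply, Sum.inr.injEq]

lemma isPos_smul_basis {p : ℕ} (hp : 0 < p) (u : Idx l1 l2) :
    IsPos (p • basisVec u : Lat l1 l2) := by
  constructor
  · intro v
    by_cases h : u = v
    · subst h; simp [basisVec]
    · simp [basisVec, Pi.single_apply, Ne.symm h]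
  · intro h
    have := congrFun h u
    simp [basisVec] at this
    omega

lemma clock_plus_smul_basis (P : ChargePair) {p : ℕ} (hp : 0 < p) (u : Idx l1 l2) :
    clock (P.plus (p • basisVec u)) =
      (match u with | Sum.inl _ => clock P.gPlus | Sum.inr _ => clock P.hPlus) := by
  have hp' : (0 : ℝ) < p := by exact_mod_cast hp
  rw [ChargePair.plus, central, gPart_smul_basis, hPart_smul_basis]
  rcases u with i | j
  · simp only [Int.cast_natCast, Int.cast_zero, zero_mul, add_zero, clock]
    have := Complex.arg_real_mul P.gPlus hp'
    rw [Complex.ofReal_natCast] at this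
    rw [this]
  · simp only [Int.cast_natCast, Int.cast_zero, zero_mul, zero_add, clock]
    have := Complex.arg_real_mul P.hPlus hp'
    rw [Complex.ofReal_natCast] at this
    rw [this]

/-- The quadratic refinement of the parity of the skew form. -/
def quadSign (a : Lat l1 l2) : ℤˣ := Int.negOnePow (gPart a * hPart a)

lemma quadSign_add (a b : Lat l1 l2) :
    quadSign (a + b) = Int.negOnePow (pairing a b) * (quadSign a * quadSign b) := by
  rw [quadSign, quadSign, quadSign, ← Int.negOnePow_add, ← Int.negOnePow_add,
    Int.negOnePow_eq_iff, gPart_add, hPart_add, pairing]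
  refine ⟨hPart a * gPart b, ?_⟩
  ring

end Args

/-! ### Moving one contour past its neighbours -/

section Telescope

variable {ι L : Type*} [DecidableEq ι] [LinearOrder L]

lemma prod_sub_prod_telescope (C : Finset ι) (p : ι → L) (hp : Set.InjOn p C) (a a' : ι → ℤ) :
    ∏ x ∈ C, a x - ∏ x ∈ C, a' x = ∑ w ∈ C, (a w - a' w) *
      ∏ x ∈ C.erase w, (if p x < p w then a' x else a x) := by
  induction C using Finset.induction_on_max_value p with
  | empty => simp
  | insert y s hy hmax ih =>
    have hlt : ∀ x ∈ s, p x < p y := fun x hx => lt_of_le_of_ne (hmax x hx) fun h =>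
      hy (hp (Finset.mem_coe.2 (Finset.mem_insert_of_mem hx))
        (Finset.mem_coe.2 (Finset.mem_insert_self y s)) h ▸ hx)
    rw [Finset.prod_insert hy, Finset.prod_insert hy, Finset.sum_insert hy,
      Finset.erase_insert hy]
    have h1 : ∏ x ∈ s, (if p x < p y then a' x else a x) = ∏ x ∈ s, a' x :=
      Finset.prod_congr rfl fun x hx => if_pos (hlt x hx)
    have h2 : ∀ w ∈ s, ∏ x ∈ (insert y s).erase w, (if p x < p w then a' x else a x) =
        a y * ∏ x ∈ s.erase w, (if p x < p w then a' x else a x) := by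
      intro w hw
      have hyw : y ≠ w := fun h => hy (h ▸ hw)
      rw [Finset.erase_insert_of_ne hyw, Finset.prod_insert (fun h => hy (Finset.mem_of_mem_erase h)),
        if_neg (hlt w hw).not_gt]
    rw [h1, Finset.sum_congr rfl fun w hw => by rw [h2 w hw]]
    have h3 := ih (hp.mono (by simp))
    have h4 : ∑ w ∈ s, (a w - a' w) * (a y * ∏ x ∈ s.erase w, (if p x < p w then a' x else a x)) =
        a y * ∑ w ∈ s, (a w - a' w) * ∏ x ∈ s.erase w, (if p x < p w then a' x else a x) := by
      rw [Finset.mul_sum]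
      exact Finset.sum_congr rfl fun w _ => by ring
    rw [h4, ← h3]
    ring

open Classical in
/-- The factor of an edge from a vertex at position `y` to a neighbour at position `p`; the
neighbour is a child if `ch` holds and the parent otherwise. -/
def edgeFactor (ch : Prop) (p y : L) (q : ℤ) : ℤ :=
  (if ch then (if p < y then 0 else 1) else (if y < p then 0 else 1)) - q

open Classical in
lemma prod_edgeFactor_sub (N : Finset ι) (p : ι → L) (ch : ι → Prop) (q : ι → ℤ) {z z' : L}
    (hzz : z < z') (hz : ∀ x ∈ N, p x ≠ z) (hz' : ∀ x ∈ N, p x ≠ z')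
    (hp : Set.InjOn p (N.filter fun x => z < p x ∧ p x < z')) :
    ∏ x ∈ N, edgeFactor (ch x) (p x) z (q x) - ∏ x ∈ N, edgeFactor (ch x) (p x) z' (q x) =
      ∑ w ∈ N.filter (fun x => z < p x ∧ p x < z'), (if ch w then 1 else -1) *
        ∏ x ∈ N.erase w, edgeFactor (ch x) (p x) (p w) (q x) := by
  set C := N.filter fun x => z < p x ∧ p x < z' with hC
  have hsplit : ∀ f : ι → ℤ, ∏ x ∈ N, f x = (∏ x ∈ C, f x) * ∏ x ∈ N \ C, f x := by
    intro f
    rw [mul_comm, Finset.prod_sdiff (Finset.filter_subset _ _)]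
  have hout : ∀ x ∈ N \ C, p x < z ∨ z' < p x := by
    intro x hx
    rw [Finset.mem_sdiff, hC, Finset.mem_filter] at hx
    by_contra hn
    push Not at hn
    exact hx.2 ⟨hx.1, lt_of_le_of_ne hn.1 (Ne.symm (hz x hx.1)), lt_of_le_of_ne hn.2 (hz' x hx.1)⟩
  have hsame : ∀ x ∈ N \ C, ∀ y, z ≤ y → y ≤ z' →
      edgeFactor (ch x) (p x) y (q x) = edgeFactor (ch x) (p x) z (q x) := by
    intro x hx y h1 h2
    unfold edgeFactor
    rcases hout x hx with h | h
    · rw [if_pos h, if_pos (lt_of_lt_of_le h h1), if_neg h.not_gt,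
        if_neg (lt_of_lt_of_le h h1).not_gt]
    · rw [if_neg (hzz.trans h).not_gt, if_neg (lt_of_le_of_lt h2 h).not_gt, if_pos (hzz.trans h),
        if_pos (lt_of_le_of_lt h2 h)]
  rw [hsplit, hsplit (fun x => edgeFactor (ch x) (p x) z' (q x)),
    Finset.prod_congr rfl (fun x hx => hsame x hx z' hzz.le le_rfl), ← sub_mul,
    prod_sub_prod_telescope C p hp, Finset.sum_mul]
  refine Finset.sum_congr rfl fun w hw => ?_
  have hwN : w ∈ N := Finset.mem_of_mem_filter w hw
  have hw' : z < p w ∧ p w < z' := (Finset.mem_filter.1 hw).2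
  have h1 : N.erase w = (C.erase w) ∪ (N \ C) := by
    ext x
    simp only [Finset.mem_erase, Finset.mem_union, Finset.mem_sdiff]
    constructor
    · rintro ⟨h1, h2⟩
      by_cases h3 : x ∈ C
      · exact Or.inl ⟨h1, h3⟩
      · exact Or.inr ⟨h2, h3⟩
    · rintro (⟨h1, h2⟩ | ⟨h1, h2⟩)
      · exact ⟨h1, Finset.mem_of_mem_filter x h2⟩
      · exact ⟨fun h => h2 (h ▸ hw), h1⟩
  have hdisj : Disjoint (C.erase w) (N \ C) := by
    rw [Finset.disjoint_left]
    intro x hx hx'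
    exact (Finset.mem_sdiff.1 hx').2 (Finset.mem_of_mem_erase hx)
  rw [h1, Finset.prod_union hdisj,
    Finset.prod_congr rfl (fun x hx => hsame x hx (p w) hw'.1.le hw'.2.le), mul_assoc]
  congr 1
  · unfold edgeFactor
    rw [if_neg hw'.1.not_gt, if_pos hw'.1, if_pos hw'.2, if_neg hw'.2.not_gt]
    split_ifs <;> ring
  · congr 1
    refine Finset.prod_congr rfl fun x hx => ?_
    have hxC := Finset.mem_of_mem_erase hx
    have hx' : z < p x ∧ p x < z' := (Finset.mem_filter.1 hxC).2
    have hne : p x ≠ p w := fun h => (Finset.ne_of_mem_erase hx) (hp hxC hw h)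
    unfold edgeFactor
    rcases lt_or_gt_of_ne hne with h | h
    · rw [if_pos h, if_pos hx'.2, if_neg hx'.2.not_gt, if_pos h, if_neg h.not_gt]
    · rw [if_neg h.not_gt, if_neg hx'.1.not_gt, if_pos hx'.1, if_neg h.not_gt, if_pos h]

end Telescope


/-! ### The value of a stage of the contraction process -/

namespace Stage

variable {l1 l2 n : ℕ} {P : ChargePair} {α : Lat l1 l2} {s : Stage l1 l2 n} {sub : Fin n → Lat l1 l2}

/-- The position of a contour. -/
def pos (s : Stage l1 l2 n) (v : Fin n) : ℝ ×ₗ ℤ := toLex (s.ray v, s.side v)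

lemma before_iff {v w : Fin n} : s.Before v w ↔ s.pos v < s.pos w := by
  rw [Before, pos, pos, Prod.Lex.toLex_lt_toLex]

lemma pos_lt_iff {v : Fin n} {a : ℝ} {b : ℤ} :
    s.pos v < toLex (a, b) ↔ s.ray v < a ∨ s.ray v = a ∧ s.side v < b := by
  rw [pos, Prod.Lex.toLex_lt_toLex]

lemma lt_pos_iff {v : Fin n} {a : ℝ} {b : ℤ} :
    toLex (a, b) < s.pos v ↔ a < s.ray v ∨ a = s.ray v ∧ b < s.side v := by
  rw [pos, Prod.Lex.toLex_lt_toLex]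

open Classical in
/-- Indicator of the subtree charges of slope greater than that of `α`. -/
def slopeInd (α b : Lat l1 l2) : ℤ := if 0 < pairing b α then 1 else 0

/-- The factor of the edge above a vertex. -/
def edgeVal (α : Lat l1 l2) (s : Stage l1 l2 n) (sub : Fin n → Lat l1 l2) (v : Fin n) : ℤ :=
  match s.par v with
  | none => 1
  | some u => edgeFactor True (s.pos v) (s.pos u) (slopeInd α (sub v))

lemma edgeVal_none {v : Fin n} (h : s.par v = none) : edgeVal α s sub v = 1 := by
  rw [edgeVal, h]

lemma edgeVal_some {v u : Fin n} (h : s.par v = some u) :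
    edgeVal α s sub v = edgeFactor True (s.pos v) (s.pos u) (slopeInd α (sub v)) := by
  rw [edgeVal, h]

/-- The value of a stage. -/
def val (α : Lat l1 l2) (s : Stage l1 l2 n) (sub : Fin n → Lat l1 l2) : ℤ :=
  (s.sign : ℤ) * (∏ v ∈ s.alive, (quadSign (s.dec v) : ℤ)) * ∏ v ∈ s.alive, edgeVal α s sub v

/-- The invariants of the process; `sub` records the charges of the subtrees. -/
structure Good (P : ChargePair) (α : Lat l1 l2) (s : Stage l1 l2 n) (sub : Fin n → Lat l1 l2) :
    Prop where
  pos : ∀ v ∈ s.alive, IsPos (s.dec v)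
  par_alive : ∀ v ∈ s.alive, ∀ u, s.par v = some u → u ∈ s.alive
  sum_eq : ∑ v ∈ s.alive, s.dec v = α
  root : ∃ r ∈ s.alive, s.par r = none ∧ sub r = α ∧ ∀ v ∈ s.alive, s.par v = none → v = r
  sub_eq : ∀ v ∈ s.alive, sub v = s.dec v + ∑ x ∈ s.alive with s.par x = some v, sub x
  prim : ∀ v ∈ s.alive, s.par v ≠ none → pairing (sub v) α ≠ 0
  lt : ∀ v ∈ s.alive, ∀ u, s.par v = some u →
    gPart (sub v) + hPart (sub v) < gPart (sub u) + hPart (sub u)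
  loc : ∀ v ∈ s.alive, (s.side v = 0 ∧ (s.ray v = clock P.gPlus ∨ s.ray v = clock P.hPlus)) ∨
    (s.side v ≠ 0 ∧ |s.side v| ≤ s.time ∧ clock P.gPlus < s.ray v ∧ s.ray v < clock P.hPlus)
  inj : ∀ v ∈ s.alive, ∀ w ∈ s.alive, v ≠ w → s.side v ≠ 0 → s.side v ≠ s.side w
  adj : ∀ v ∈ s.alive, ∀ u, s.par v = some u → s.side v = 0 → s.side u = 0 → s.ray v ≠ s.ray u

lemma Good.par_ne_self (h : Good P α s sub) {v : Fin n} (hv : v ∈ s.alive) :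
    s.par v ≠ some v := fun h1 => lt_irrefl _ (h.lt v hv v h1)

lemma Good.par_asymm (h : Good P α s sub) {v u : Fin n} (hv : v ∈ s.alive)
    (hu : s.par v = some u) : s.par u ≠ some v := fun h1 =>
  lt_asymm (h.lt v hv u hu) (h.lt u (h.par_alive v hv u hu) v h1)

lemma Good.pos_ne (h : Good P α s sub) {v u : Fin n} (hv : v ∈ s.alive) (hu : s.par v = some u) :
    s.pos v ≠ s.pos u := by
  intro he
  have h1 : s.ray v = s.ray u := congrArg (fun x => (ofLex x).1) he
  have h2 : s.side v = s.side u := congrArg (fun x => (ofLex x).2) he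
  have hne : v ≠ u := fun e => h.par_ne_self hv (e ▸ hu)
  by_cases h0 : s.side v = 0
  · exact h.adj v hv u hu h0 (h2 ▸ h0) h1
  · exact h.inj v hv u (h.par_alive v hv u hu) hne h0 h2

lemma Good.target_mem (h : Good P α s sub) {v : Fin n} (hv : v ∈ s.alive) :
    clock P.gPlus < s.target P v ∧ s.target P v < clock P.hPlus := P.clock_minus_mem (h.pos v hv)

lemma Good.abs_side (h : Good P α s sub) {v : Fin n} (hv : v ∈ s.alive) :
    |s.side v| ≤ s.time := by
  rcases h.loc v hv with ⟨h1, _⟩ | ⟨_, h1, _⟩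
  · rw [h1, abs_zero]; positivity
  · exact h1

/-- The neighbours of a vertex. -/
def nbrs (s : Stage l1 l2 n) (v : Fin n) : Finset (Fin n) :=
  s.alive.filter fun x => s.par v = some x ∨ s.par x = some v

lemma Good.nbr_ne (h : Good P α s sub) {v w : Fin n} (hv : v ∈ s.alive) (hw : w ∈ s.nbrs v) :
    w ≠ v := by
  rintro rfl
  rcases (Finset.mem_filter.1 hw).2 with h3 | h3 <;> exact h.par_ne_self hv h3

/-- The vertices whose upper edge does not meet `v`. -/
def others (s : Stage l1 l2 n) (v : Fin n) : Finset (Fin n) :=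
  s.alive.filter fun x => x ≠ v ∧ s.par x ≠ some v

/-- The slope indicator of the edge between `v` and its neighbour `x`. -/
def nbrInd (α : Lat l1 l2) (s : Stage l1 l2 n) (sub : Fin n → Lat l1 l2) (v x : Fin n) : ℤ :=
  if s.par x = some v then slopeInd α (sub x) else slopeInd α (sub v)

/-- The product of the factors of the edges at `v`, if its contour were at `z`. -/
def nbrProd (α : Lat l1 l2) (s : Stage l1 l2 n) (sub : Fin n → Lat l1 l2) (v : Fin n)
    (A : Finset (Fin n)) (z : ℝ ×ₗ ℤ) : ℤ :=
  ∏ x ∈ A, edgeFactor (s.par x = some v) (s.pos x) z (nbrInd α s sub v x)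

lemma edgeFactor_parent {L : Type*} [LinearOrder L] {c : Prop} (hc : ¬ c) (p y : L) (q : ℤ) :
    edgeFactor c y p q = edgeFactor True p y q := by
  simp [edgeFactor, hc]

lemma edgeFactor_child {L : Type*} [LinearOrder L] {c : Prop} (hc : c) (p y : L) (q : ℤ) :
    edgeFactor c p y q = edgeFactor True p y q := by
  simp [edgeFactor, hc]

lemma prod_edgeVal_split {v : Fin n} (hv : v ∈ s.alive)
    (hself : s.par v ≠ some v) (hpar : ∀ u, s.par v = some u → u ∈ s.alive ∧ s.par u ≠ some v) :
    ∏ x ∈ s.alive, edgeVal α s sub x =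
      nbrProd α s sub v (s.nbrs v) (s.pos v) * ∏ x ∈ s.others v, edgeVal α s sub x := by
  have h1 : s.alive = insert v ((s.alive.filter fun x => s.par x = some v) ∪ s.others v) := by
    ext x
    simp only [others, Finset.mem_insert, Finset.mem_union, Finset.mem_filter]
    grind
  have h2 : v ∉ (s.alive.filter fun x => s.par x = some v) ∪ s.others v := by
    simp [others, hself]
  have h3 : Disjoint (s.alive.filter fun x => s.par x = some v) (s.others v) := by
    rw [Finset.disjoint_left]
    intro x hx hx'
    exact (Finset.mem_filter.1 hx').2.2 (Finset.mem_filter.1 hx).2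
  conv_lhs => rw [h1]
  rw [Finset.prod_insert h2, Finset.prod_union h3, ← mul_assoc]
  congr 1
  have h4 : ∏ x ∈ s.alive with s.par x = some v, edgeVal α s sub x =
      nbrProd α s sub v (s.alive.filter fun x => s.par x = some v) (s.pos v) := by
    refine Finset.prod_congr rfl fun x hx => ?_
    have hx' := (Finset.mem_filter.1 hx).2
    rw [edgeVal_some hx', edgeFactor_child hx', nbrInd, if_pos hx']
  rw [h4]
  cases hp : s.par v with
  | none =>
    rw [edgeVal_none hp, one_mul]
    congr 1
    ext x
    simp [nbrs, hp]
  | some u =>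
    obtain ⟨hu, hu'⟩ := hpar u hp
    have h5 : s.nbrs v = insert u (s.alive.filter fun x => s.par x = some v) := by
      ext x
      simp only [nbrs, hp, Finset.mem_filter, Finset.mem_insert, Option.some.injEq]
      grind
    rw [h5, nbrProd, nbrProd, Finset.prod_insert (by simp [hu']), edgeVal_some hp,
      edgeFactor_parent hu', nbrInd, if_neg hu']

lemma Good.split (h : Good P α s sub) {v : Fin n} (hv : v ∈ s.alive) :
    ∏ x ∈ s.alive, edgeVal α s sub x =
      nbrProd α s sub v (s.nbrs v) (s.pos v) * ∏ x ∈ s.others v, edgeVal α s sub x :=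
  prod_edgeVal_split hv (h.par_ne_self hv) fun u hu =>
    ⟨h.par_alive v hv u hu, h.par_asymm hv hu⟩

lemma move_pos_self (v : Fin n) : (s.move P v).pos v =
    toLex (s.target P v,
      open Classical in if s.MovesClockwise P v then -((s.time : ℤ) + 1) else (s.time : ℤ) + 1) := by
  simp [pos, move]

lemma move_pos_ne {v x : Fin n} (hx : x ≠ v) : (s.move P v).pos x = s.pos x := by
  simp [pos, move, hx]

/-- The value of a stage after a move. -/
lemma Good.val_move (h : Good P α s sub) {v : Fin n} (hv : v ∈ s.alive) :
    val α (s.move P v) sub = (s.sign : ℤ) * (∏ x ∈ s.alive, (quadSign (s.dec x) : ℤ)) *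
      (nbrProd α s sub v (s.nbrs v) ((s.move P v).pos v) *
        ∏ x ∈ s.others v, edgeVal α s sub x) := by
  have h1 := prod_edgeVal_split (s := s.move P v) (α := α) (sub := sub) (v := v) hv
    (h.par_ne_self hv) (fun u hu => ⟨h.par_alive v hv u hu, h.par_asymm hv hu⟩)
  have h2 : nbrProd α (s.move P v) sub v ((s.move P v).nbrs v) ((s.move P v).pos v) =
      nbrProd α s sub v (s.nbrs v) ((s.move P v).pos v) := by
    refine Finset.prod_congr rfl fun x hx => ?_
    rw [move_pos_ne (h.nbr_ne hv hx)]
    rfl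
  have h3 : ∏ x ∈ (s.move P v).others v, edgeVal α (s.move P v) sub x =
      ∏ x ∈ s.others v, edgeVal α s sub x := by
    refine Finset.prod_congr rfl fun x hx => ?_
    obtain ⟨_, h4, h5⟩ := Finset.mem_filter.1 hx
    have h5' : s.par x ≠ some v := h5
    cases hp : s.par x with
    | none => rw [edgeVal_none hp, edgeVal_none (s := s.move P v) hp]
    | some u =>
      have huv : u ≠ v := fun e => h5' (by rw [hp, e])
      rw [edgeVal_some hp, edgeVal_some (s := s.move P v) hp, move_pos_ne h4, move_pos_ne huv]
  rw [h2, h3] at h1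
  rw [val, h1]
  rfl

/-- The subtree charges after a contraction. -/
def contractSub (s : Stage l1 l2 n) (sub : Fin n → Lat l1 l2) (v w : Fin n) : Fin n → Lat l1 l2 :=
  if s.par v = some w then sub else Function.update sub w (sub v)

lemma contract_pos (v w x : Fin n) : (s.contract P v w).pos x = s.pos x := rfl

lemma contract_par_of_ne {v w x : Fin n} (h : s.par x ≠ some v) :
    (s.contract P v w).par x = s.par x := by
  simp [contract, h]

lemma contract_par_child {v w x : Fin n} (h : s.par x = some v) (hx : x ≠ w) :
    (s.contract P v w).par x = some w := by
  simp [contract, h, hx]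

lemma contract_par_self {v w : Fin n} (h : s.par w = some v) :
    (s.contract P v w).par w = s.par v := by
  simp [contract, h]

lemma contractSub_of_ne {v w x : Fin n} (hx : x ≠ w) : contractSub s sub v w x = sub x := by
  unfold contractSub
  split_ifs
  · rfl
  · rw [Function.update_of_ne hx]

lemma contractSub_parent {v w : Fin n} (hw : s.par v = some w) : contractSub s sub v w = sub :=
  if_pos hw

lemma contractSub_child {v w : Fin n} (hw : s.par v ≠ some w) :
    contractSub s sub v w w = sub v := by
  rw [contractSub, if_neg hw, Function.update_self]

lemma Good.contract_edges (h : Good P α s sub) {v w : Fin n} (hv : v ∈ s.alive)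
    (hw : w ∈ s.nbrs v) :
    ∏ x ∈ s.alive.erase v, edgeVal α (s.contract P v w) (contractSub s sub v w) x =
      nbrProd α s sub v ((s.nbrs v).erase w) (s.pos w) * ∏ x ∈ s.others v, edgeVal α s sub x := by
  obtain ⟨hwA, hw'⟩ := Finset.mem_filter.1 hw
  have hwv := h.nbr_ne hv hw
  have hchild : ∀ x, s.par x = some v → x ≠ w →
      edgeVal α (s.contract P v w) (contractSub s sub v w) x =
      edgeFactor (s.par x = some v) (s.pos x) (s.pos w) (nbrInd α s sub v x) := by
    intro x hx hxw
    rw [edgeVal_some (contract_par_child hx hxw), contract_pos, contract_pos,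
      contractSub_of_ne hxw, edgeFactor_child hx, nbrInd, if_pos hx]
  have hother : ∀ x ∈ s.others v, (x = w → s.par v = some w) →
      edgeVal α (s.contract P v w) (contractSub s sub v w) x = edgeVal α s sub x := by
    intro x hx hxw
    obtain ⟨_, h4, h5⟩ := Finset.mem_filter.1 hx
    have hsub : contractSub s sub v w x = sub x := by
      by_cases hxw' : x = w
      · rw [contractSub_parent (hxw hxw')]
      · exact contractSub_of_ne hxw'
    cases hp : s.par x with
    | none => rw [edgeVal_none hp, edgeVal_none (by rw [contract_par_of_ne h5, hp])]
    | some u =>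
      rw [edgeVal_some hp, edgeVal_some (s := s.contract P v w)
        (by rw [contract_par_of_ne h5, hp]), contract_pos, contract_pos, hsub]
  rcases hw' with hpar | hch
  · -- `w` is the parent of `v`
    have hwch : s.par w ≠ some v := h.par_asymm hv hpar
    have h1 : s.alive.erase v = ((s.nbrs v).erase w) ∪ s.others v := by
      ext x
      simp only [nbrs, others, Finset.mem_erase, Finset.mem_union, Finset.mem_filter, hpar,
        Option.some.injEq]
      have hvv := h.par_ne_self hv
      grind
    have h2 : Disjoint ((s.nbrs v).erase w) (s.others v) := by
      rw [Finset.disjoint_left]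
      intro x hx hx'
      obtain ⟨hxw, hx1⟩ := Finset.mem_erase.1 hx
      rcases (Finset.mem_filter.1 hx1).2 with h3 | h3
      · rw [hpar, Option.some.injEq] at h3
        exact hxw h3.symm
      · exact (Finset.mem_filter.1 hx').2.2 h3
    rw [h1, Finset.prod_union h2, nbrProd]
    congr 1
    · refine Finset.prod_congr rfl fun x hx => ?_
      obtain ⟨hxw, hx1⟩ := Finset.mem_erase.1 hx
      rcases (Finset.mem_filter.1 hx1).2 with h3 | h3
      · rw [hpar, Option.some.injEq] at h3
        exact absurd h3.symm hxw
      · exact hchild x h3 hxw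
    · exact Finset.prod_congr rfl fun x hx => hother x hx fun _ => hpar
  · -- `w` is a child of `v`
    have hpw : s.par v ≠ some w := fun h1 => h.par_asymm hv h1 hch
    have hwo : w ∉ s.others v := fun hx => (Finset.mem_filter.1 hx).2.2 hch
    set Ch := (s.alive.filter fun x => s.par x = some v).erase w with hCh
    have h1 : s.alive.erase v = insert w (Ch ∪ s.others v) := by
      ext x
      simp only [hCh, others, Finset.mem_erase, Finset.mem_union, Finset.mem_filter,
        Finset.mem_insert]
      have hvv := h.par_ne_self hv
      grind
    have h2 : Disjoint Ch (s.others v) := by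
      rw [Finset.disjoint_left]
      intro x hx hx'
      exact (Finset.mem_filter.1 hx').2.2 (Finset.mem_filter.1 (Finset.mem_of_mem_erase hx)).2
    have h3 : w ∉ Ch ∪ s.others v := by
      rw [Finset.mem_union]
      rintro (h4 | h4)
      · exact Finset.notMem_erase w _ h4
      · exact hwo h4
    rw [h1, Finset.prod_insert h3, Finset.prod_union h2, ← mul_assoc]
    congr 1
    · have h4 : ∏ x ∈ Ch, edgeVal α (s.contract P v w) (contractSub s sub v w) x =
          nbrProd α s sub v Ch (s.pos w) := by
        refine Finset.prod_congr rfl fun x hx => ?_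
        obtain ⟨hxw, hx1⟩ := Finset.mem_erase.1 hx
        exact hchild x (Finset.mem_filter.1 hx1).2 hxw
      rw [h4]
      cases hp : s.par v with
      | none =>
        rw [edgeVal_none (by rw [contract_par_self hch, hp]), one_mul]
        congr 1
        ext x
        simp [hCh, nbrs, hp]
      | some u =>
        have hu := h.par_alive v hv u hp
        have hu' := h.par_asymm hv hp
        have huw : u ≠ w := fun e => hpw (by rw [hp, e])
        have h5 : (s.nbrs v).erase w = insert u Ch := by
          ext x
          simp only [hCh, nbrs, hp, Finset.mem_erase, Finset.mem_filter, Finset.mem_insert,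
            Option.some.injEq]
          grind
        rw [h5, nbrProd, nbrProd, Finset.prod_insert (by simp [hCh, hu']),
          edgeVal_some (by rw [contract_par_self hch, hp]), edgeFactor_parent hu', nbrInd,
          if_neg hu', contractSub_child hpw, contract_pos, contract_pos]
    · exact Finset.prod_congr rfl fun x hx => hother x hx fun e => absurd (e ▸ hx) hwo

open Classical in
/-- The value of a stage after a contraction. -/
lemma Good.val_contract (h : Good P α s sub) {v w : Fin n} (hv : v ∈ s.alive)
    (hw : w ∈ s.nbrs v) :
    val α (s.contract P v w) (contractSub s sub v w) =
      (s.sign : ℤ) * (∏ x ∈ s.alive, (quadSign (s.dec x) : ℤ)) *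
        (((if s.MovesClockwise P v then -1 else 1) * (if s.par v = some w then 1 else -1)) *
        (nbrProd α s sub v ((s.nbrs v).erase w) (s.pos w) *
          ∏ x ∈ s.others v, edgeVal α s sub x)) := by
  obtain ⟨hwA, hw'⟩ := Finset.mem_filter.1 hw
  have hwv := h.nbr_ne hv hw
  have h1 : ((s.contract P v w).sign : ℤ) *
      ∏ x ∈ s.alive.erase v, (quadSign ((s.contract P v w).dec x) : ℤ) =
      (s.sign : ℤ) * (∏ x ∈ s.alive, (quadSign (s.dec x) : ℤ)) *
      ((if s.MovesClockwise P v then -1 else 1) * (if s.par v = some w then 1 else -1)) := by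
    have hwe : w ∈ s.alive.erase v := Finset.mem_erase.2 ⟨hwv, hwA⟩
    rw [← Finset.mul_prod_erase s.alive _ hv,
      ← Finset.mul_prod_erase (s.alive.erase v) (fun x => (quadSign (s.dec x) : ℤ)) hwe,
      ← Finset.mul_prod_erase (s.alive.erase v)
        (fun x => (quadSign ((s.contract P v w).dec x) : ℤ)) hwe]
    have h2 : ∏ x ∈ (s.alive.erase v).erase w, (quadSign ((s.contract P v w).dec x) : ℤ) =
        ∏ x ∈ (s.alive.erase v).erase w, (quadSign (s.dec x) : ℤ) := by
      refine Finset.prod_congr rfl fun x hx => ?_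
      have hxw : x ≠ w := Finset.ne_of_mem_erase hx
      simp [contract, hxw]
    rw [h2]
    have h3 : (s.contract P v w).dec w = s.dec v + s.dec w := by simp [contract]
    have h4 : (s.contract P v w).sign = s.sign *
      ((if s.MovesClockwise P v then -1 else 1) * (if s.par v = some w then 1 else -1)) *
      Int.negOnePow (pairing (s.dec v) (s.dec w)) := by simp [contract]
    rw [h3, h4, quadSign_add]
    have h5 : ((Int.negOnePow (pairing (s.dec v) (s.dec w)) : ℤˣ) : ℤ) *
        ((Int.negOnePow (pairing (s.dec v) (s.dec w)) : ℤˣ) : ℤ) = 1 := by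
      rw [← Units.val_mul, Int.units_mul_self, Units.val_one]
    simp only [Units.val_mul]
    have h6 : (((if s.MovesClockwise P v then -1 else 1 : ℤˣ)) : ℤ) =
        if s.MovesClockwise P v then -1 else 1 := by split_ifs <;> rfl
    have h7 : (((if s.par v = some w then 1 else -1 : ℤˣ)) : ℤ) =
        if s.par v = some w then 1 else -1 := by split_ifs <;> rfl
    rw [h6, h7]
    linear_combination (s.sign * ((if s.MovesClockwise P v then -1 else 1) *
      (if s.par v = some w then 1 else -1)) * ((quadSign (s.dec v) : ℤ) * (quadSign (s.dec w) : ℤ)) *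
      ∏ x ∈ (s.alive.erase v).erase w, (quadSign (s.dec x) : ℤ)) * h5
  have h0 : (s.contract P v w).alive = s.alive.erase v := by
    ext x
    simp [contract]
  rw [val, h0, h1, h.contract_edges hv hw]
  ring

lemma mem_pending {v : Fin n} : v ∈ s.pending P ↔ v ∈ s.alive ∧ s.ray v ≠ s.target P v := by
  simp [pending]

open Classical in
lemma Good.crossed_eq (h : Good P α s sub) {v : Fin n} (hv : v ∈ s.pending P) :
    s.crossed P v = (s.nbrs v).filter fun x =>
      (s.MovesClockwise P v ∧ s.pos v < s.pos x ∧ s.pos x < (s.move P v).pos v) ∨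
      (¬ s.MovesClockwise P v ∧ (s.move P v).pos v < s.pos x ∧ s.pos x < s.pos v) := by
  ext x
  simp only [crossed, nbrs, Finset.mem_filter, and_assoc, before_iff]
  refine and_congr_right fun hx => and_congr_right fun _ => ?_
  have habs := abs_le.1 (h.abs_side hx)
  rw [move_pos_self, pos_lt_iff, lt_pos_iff]
  refine or_congr (and_congr_right fun h1 => and_congr_right fun _ => ?_)
    (and_congr_right fun h1 => ?_)
  · simp only [h1, if_true]
    exact (or_iff_left fun h2 => by omega).symm
  · simp only [h1, if_false]
    rw [and_comm]
    refine and_congr_left fun _ => ?_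
    exact (or_iff_left fun h2 => by omega).symm

/-- Contours that have not moved yet are never crossed. -/
lemma Good.side_ne_of_crossed (h : Good P α s sub) {v w : Fin n} (hv : v ∈ s.pending P)
    (hw : w ∈ s.crossed P v) : s.side w ≠ 0 := by
  intro h0
  simp only [crossed, Finset.mem_filter] at hw
  obtain ⟨hwA, _, hw2⟩ := hw
  have hvA := (mem_pending.1 hv).1
  have ht := h.target_mem hvA
  have hlv := h.loc v hvA
  have hlw : s.ray w = clock P.gPlus ∨ s.ray w = clock P.hPlus := by
    rcases h.loc w hwA with h1 | h1
    · exact h1.2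
    · exact absurd h0 h1.1
  have hlt : clock P.gPlus < clock P.hPlus := ht.1.trans ht.2
  have hbounds : clock P.gPlus ≤ s.ray v ∧ s.ray v ≤ clock P.hPlus := by
    rcases hlv with ⟨_, h1 | h1⟩ | ⟨_, _, h1, h2⟩
    · rw [h1]; exact ⟨le_rfl, hlt.le⟩
    · rw [h1]; exact ⟨hlt.le, le_rfl⟩
    · exact ⟨h1.le, h2.le⟩
  rcases hw2 with ⟨_, h1, h2⟩ | ⟨_, h1, h2⟩
  · rcases hlw with h3 | h3
    · rcases h1 with h1 | ⟨h1, h4⟩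
      · linarith
      · rcases hlv with ⟨h5, _⟩ | ⟨_, _, h5, _⟩
        · omega
        · rw [h1, h3] at h5; exact lt_irrefl _ h5
    · linarith
  · rcases hlw with h3 | h3
    · linarith
    · rcases h1 with h1 | ⟨h1, h4⟩
      · linarith
      · rcases hlv with ⟨h5, _⟩ | ⟨_, _, _, h5⟩
        · omega
        · rw [← h1, h3] at h5; exact lt_irrefl _ h5

lemma Good.nbr_pos_ne (h : Good P α s sub) {v x : Fin n} (hv : v ∈ s.alive) (hx : x ∈ s.nbrs v) :
    s.pos x ≠ s.pos v := by
  obtain ⟨hxA, h1 | h1⟩ := Finset.mem_filter.1 hx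
  · exact (h.pos_ne hv h1).symm
  · exact h.pos_ne hxA h1

lemma Good.move_pos_ne' (h : Good P α s sub) {v x : Fin n} (hx : x ∈ s.alive) :
    s.pos x ≠ (s.move P v).pos v := by
  intro he
  rw [move_pos_self] at he
  have h2 : s.side x = _ := congrArg (fun x => (ofLex x).2) he
  simp only [ofLex_toLex] at h2
  have habs := abs_le.1 (h.abs_side hx)
  split_ifs at h2 <;> omega

open Classical in
/-- The value of a stage is the sum of the values of its successors. -/
theorem Good.val_eq (h : Good P α s sub) {v : Fin n} (hv : v ∈ s.pending P) :
    val α s sub = val α (s.move P v) sub +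
      ∑ w ∈ s.crossed P v, val α (s.contract P v w) (contractSub s sub v w) := by
  have hvA := (mem_pending.1 hv).1
  have hcr := h.crossed_eq hv
  have hnb : ∀ w ∈ s.crossed P v, w ∈ s.nbrs v := fun w hw => by
    rw [hcr] at hw
    exact Finset.mem_of_mem_filter w hw
  have hinj : Set.InjOn s.pos (s.crossed P v) := by
    intro x hx y hy hxy
    by_contra hne
    have h2 : s.side x = s.side y := congrArg (fun x => (ofLex x).2) hxy
    exact h.inj x (Finset.mem_of_mem_filter x (hnb x hx)) y
      (Finset.mem_of_mem_filter y (hnb y hy)) hne (h.side_ne_of_crossed hv hx) h2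
  have key : nbrProd α s sub v (s.nbrs v) (s.pos v) -
      nbrProd α s sub v (s.nbrs v) ((s.move P v).pos v) =
      ∑ w ∈ s.crossed P v, ((if s.MovesClockwise P v then -1 else 1) *
        (if s.par v = some w then 1 else -1)) *
        nbrProd α s sub v ((s.nbrs v).erase w) (s.pos w) := by
    by_cases hcw : s.MovesClockwise P v
    · have hlt : s.pos v < (s.move P v).pos v := by
        rw [move_pos_self, Stage.pos, Prod.Lex.toLex_lt_toLex]
        exact Or.inl hcw
      simp only [hcw, true_and, not_true_eq_false, false_and, or_false] at hcr
      rw [hcr] at hinj ⊢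
      unfold nbrProd
      rw [prod_edgeFactor_sub (s.nbrs v) s.pos (fun x => s.par x = some v) _ hlt
        (fun x hx => h.nbr_pos_ne hvA hx)
        (fun x hx => h.move_pos_ne' (Finset.mem_of_mem_filter x hx)) hinj]
      refine Finset.sum_congr rfl fun w hw => ?_
      congr 1
      rcases (Finset.mem_filter.1 (Finset.mem_of_mem_filter w hw)).2 with h1 | h1
      · rw [if_neg (h.par_asymm hvA h1), if_pos h1, if_pos hcw]; rfl
      · rw [if_pos h1, if_neg (fun h2 => h.par_asymm hvA h2 h1), if_pos hcw]; rfl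
    · have hlt : (s.move P v).pos v < s.pos v := by
        rw [move_pos_self, Stage.pos, Prod.Lex.toLex_lt_toLex]
        left
        exact lt_of_le_of_ne (not_lt.1 hcw) (Ne.symm (mem_pending.1 hv).2)
      simp only [hcw, not_false_eq_true, true_and, false_and, false_or] at hcr
      rw [hcr] at hinj ⊢
      unfold nbrProd
      rw [← neg_sub, prod_edgeFactor_sub (s.nbrs v) s.pos (fun x => s.par x = some v) _ hlt
        (fun x hx => h.move_pos_ne' (Finset.mem_of_mem_filter x hx))
        (fun x hx => h.nbr_pos_ne hvA hx) hinj, ← Finset.sum_neg_distrib]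
      refine Finset.sum_congr rfl fun w hw => ?_
      rw [← neg_mul]
      congr 1
      rcases (Finset.mem_filter.1 (Finset.mem_of_mem_filter w hw)).2 with h1 | h1
      · rw [if_neg (h.par_asymm hvA h1), if_pos h1, if_neg hcw]; rfl
      · rw [if_pos h1, if_neg (fun h2 => h.par_asymm hvA h2 h1), if_neg hcw]; rfl
  rw [Finset.sum_congr rfl fun w hw => h.val_contract hvA (hnb w hw), h.val_move hvA, val,
    h.split hvA, ← Finset.mul_sum]
  have h9 : ∑ w ∈ s.crossed P v, ((if s.MovesClockwise P v then -1 else 1) *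
        (if s.par v = some w then 1 else -1)) *
        (nbrProd α s sub v ((s.nbrs v).erase w) (s.pos w) *
          ∏ x ∈ s.others v, edgeVal α s sub x) =
      (∑ w ∈ s.crossed P v, ((if s.MovesClockwise P v then -1 else 1) *
        (if s.par v = some w then 1 else -1)) *
        nbrProd α s sub v ((s.nbrs v).erase w) (s.pos w)) *
          ∏ x ∈ s.others v, edgeVal α s sub x := by
    rw [Finset.sum_mul]
    exact Finset.sum_congr rfl fun w _ => by ring
  rw [h9, ← key]
  ring

end Stage


/-! ### Evaluation of the contraction process -/

namespace Stage

variable {l1 l2 n : ℕ} {P : ChargePair} {α : Lat l1 l2} {s : Stage l1 l2 n} {sub : Fin n → Lat l1 l2}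

lemma Good.move (h : Good P α s sub) {v : Fin n} (hv : v ∈ s.alive) : Good P α (s.move P v) sub where
  pos := h.pos
  par_alive := h.par_alive
  sum_eq := h.sum_eq
  root := h.root
  sub_eq := h.sub_eq
  prim := h.prim
  lt := h.lt
  loc x hx := by
    have ht := h.target_mem hv
    by_cases hxv : x = v
    · subst hxv
      right
      simp only [Stage.move, Function.update_self]
      refine ⟨?_, ?_, ht.1, ht.2⟩
      · split_ifs <;> omega
      · split_ifs
        · rw [abs_neg, abs_of_nonneg (by omega)]; push_cast; exact le_rfl
        · rw [abs_of_nonneg (by omega)]; push_cast; exact le_rfl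
    · simp only [Stage.move, Function.update_of_ne hxv]
      rcases h.loc x hx with h1 | ⟨h1, h2, h3⟩
      · exact Or.inl h1
      · exact Or.inr ⟨h1, by push_cast; omega, h3⟩
  inj x hx y hy hxy h0 := by
    have hax := abs_le.1 (h.abs_side hx)
    have hay := abs_le.1 (h.abs_side hy)
    by_cases hxv : x = v
    · have hyv : y ≠ v := fun e => hxy (hxv.trans e.symm)
      subst hxv
      simp only [Stage.move, Function.update_self, Function.update_of_ne hyv]
      split_ifs <;> omega
    · by_cases hyv : y = v
      · subst hyv
        simp only [Stage.move, Function.update_self, Function.update_of_ne hxv]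
        split_ifs <;> omega
      · simp only [Stage.move, Function.update_of_ne hxv, Function.update_of_ne hyv] at h0 ⊢
        exact h.inj x hx y hy hxy h0
  adj x hx u hu h1 h2 := by
    have hne : ∀ y, (s.move P v).side y = 0 → y ≠ v := by
      rintro y hy rfl
      simp only [Stage.move, Function.update_self] at hy
      split_ifs at hy <;> omega
    have hxv := hne x h1
    have huv := hne u h2
    simp only [Stage.move, Function.update_of_ne hxv, Function.update_of_ne huv] at h1 h2 ⊢
    exact h.adj x hx u hu h1 h2

lemma Good.contract_sub_eq (h : Good P α s sub) {v w : Fin n} (hv : v ∈ s.alive)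
    (hw : w ∈ s.nbrs v) : ∀ x ∈ s.alive.erase v, contractSub s sub v w x =
      (s.contract P v w).dec x +
        ∑ y ∈ s.alive.erase v with (s.contract P v w).par y = some x, contractSub s sub v w y := by
  intro x hx
  obtain ⟨hxv, hxA⟩ := Finset.mem_erase.1 hx
  obtain ⟨hwA, hw'⟩ := Finset.mem_filter.1 hw
  have hwv := h.nbr_ne hv hw
  have hvv := h.par_ne_self hv
  have hsv := h.sub_eq v hv
  have hsw := h.sub_eq w hwA
  have hsx := h.sub_eq x hxA
  rw [Finset.sum_filter] at hsv hsw hsx ⊢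
  rw [← Finset.add_sum_erase _ _ hv] at hsv hsw hsx
  rw [if_neg hvv, zero_add] at hsv
  rcases hw' with hpar | hch
  · rw [contractSub_parent hpar]
    have hwch : s.par w ≠ some v := h.par_asymm hv hpar
    by_cases hxw : x = w
    · subst hxw
      have h1 : ∑ y ∈ s.alive.erase v, (if (s.contract P v x).par y = some x then sub y else 0) =
          ∑ y ∈ s.alive.erase v, ((if s.par y = some x then sub y else 0) +
            (if s.par y = some v then sub y else 0)) := by
        refine Finset.sum_congr rfl fun y hy => ?_
        by_cases hyv : s.par y = some v
        · have hyx : y ≠ x := fun e => hwch (e ▸ hyv)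
          rw [contract_par_child hyv hyx, if_pos rfl, if_pos hyv, if_neg, zero_add]
          rw [hyv, Option.some.injEq]
          exact fun e => hwv e.symm
        · rw [contract_par_of_ne hyv, if_neg hyv, add_zero]
      rw [h1, Finset.sum_add_distrib]
      rw [if_pos hpar, hsv] at hsw
      have h2 : (s.contract P v x).dec x = s.dec v + s.dec x := by simp [contract]
      rw [h2, hsw]
      abel
    · have h1 : ∑ y ∈ s.alive.erase v, (if (s.contract P v w).par y = some x then sub y else 0) =
          ∑ y ∈ s.alive.erase v, (if s.par y = some x then sub y else 0) := by
        refine Finset.sum_congr rfl fun y hy => ?_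
        by_cases hyv : s.par y = some v
        · have hyw : y ≠ w := fun e => hwch (e ▸ hyv)
          rw [contract_par_child hyv hyw, hyv]
          simp [Ne.symm hxw, Ne.symm hxv]
        · rw [contract_par_of_ne hyv]
      have h2 : (s.contract P v w).dec x = s.dec x := by simp [contract, hxw]
      have h3 : s.par v ≠ some x := by
        rw [hpar]
        simpa using Ne.symm hxw
      rw [if_neg h3, zero_add] at hsx
      rw [h1, h2]
      exact hsx
  · have hpw : s.par v ≠ some w := fun h1 => h.par_asymm hv h1 hch
    have hww := h.par_ne_self hwA
    have hwe : w ∈ s.alive.erase v := Finset.mem_erase.2 ⟨hwv, hwA⟩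
    by_cases hxw : x = w
    · subst hxw
      have h1 : ∑ y ∈ s.alive.erase v,
          (if (s.contract P v x).par y = some x then contractSub s sub v x y else 0) =
          ∑ y ∈ s.alive.erase v, ((if s.par y = some x then sub y else 0) +
            (if s.par y = some v then sub y else 0) - (if y = x then sub x else 0)) := by
        refine Finset.sum_congr rfl fun y hy => ?_
        by_cases hyx : y = x
        · subst hyx
          rw [contract_par_self hch, if_neg hpw, if_neg hww, if_pos hch, if_pos rfl]
          abel
        · rw [contractSub_of_ne hyx, if_neg hyx, sub_zero]
          by_cases hyv : s.par y = some v
          · rw [contract_par_child hyv hyx, if_pos rfl, if_pos hyv, if_neg, zero_add]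
            rw [hyv, Option.some.injEq]
            exact fun e => hwv e.symm
          · rw [contract_par_of_ne hyv, if_neg hyv, add_zero]
      rw [h1, Finset.sum_sub_distrib, Finset.sum_add_distrib, Finset.sum_ite_eq' (s.alive.erase v),
        if_pos hwe, contractSub_child hpw]
      rw [if_neg hpw, zero_add] at hsw
      have h2 : (s.contract P v x).dec x = s.dec v + s.dec x := by simp [contract]
      rw [h2, hsw, hsv]
      abel
    · have h1 : ∑ y ∈ s.alive.erase v,
          (if (s.contract P v w).par y = some x then contractSub s sub v w y else 0) =
          ∑ y ∈ s.alive.erase v, ((if s.par y = some x then sub y else 0) +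
            (if y = w then (if s.par v = some x then sub v else 0) else 0)) := by
        refine Finset.sum_congr rfl fun y hy => ?_
        by_cases hyw : y = w
        · subst hyw
          have hvx : ¬ (some v = some x) := by simpa using Ne.symm hxv
          rw [contract_par_self hch, contractSub_child hpw, if_pos rfl, hch, if_neg hvx, zero_add]
        · rw [contractSub_of_ne hyw, if_neg hyw, add_zero]
          by_cases hyv : s.par y = some v
          · rw [contract_par_child hyv hyw, hyv]
            simp [Ne.symm hxw, Ne.symm hxv]
          · rw [contract_par_of_ne hyv]
      have h2 : (s.contract P v w).dec x = s.dec x := by simp [contract, hxw]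
      rw [h1, Finset.sum_add_distrib, Finset.sum_ite_eq' (s.alive.erase v), if_pos hwe,
        contractSub_of_ne hxw, h2, hsx]
      abel

lemma contract_alive (v w : Fin n) : (s.contract P v w).alive = s.alive.erase v := by
  ext x
  simp [contract]

lemma contract_par_eq_some {v w x u : Fin n} (hu : (s.contract P v w).par x = some u) :
    (s.par x = some v ∧ x = w ∧ s.par v = some u) ∨ (s.par x = some v ∧ x ≠ w ∧ u = w) ∨
      (s.par x = some u ∧ u ≠ v) := by
  by_cases h1 : s.par x = some v
  · by_cases h2 : x = w
    · subst h2
      rw [contract_par_self h1] at hu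
      exact Or.inl ⟨h1, rfl, hu⟩
    · rw [contract_par_child h1 h2, Option.some.injEq] at hu
      exact Or.inr (Or.inl ⟨h1, h2, hu.symm⟩)
  · rw [contract_par_of_ne h1] at hu
    exact Or.inr (Or.inr ⟨hu, fun e => h1 (e ▸ hu)⟩)

lemma Good.contract (h : Good P α s sub) {v w : Fin n} (hv : v ∈ s.alive)
    (hw : w ∈ s.nbrs v) (hside : s.side w ≠ 0) :
    Good P α (s.contract P v w) (contractSub s sub v w) := by
  have hw2 := hw
  obtain ⟨hwA, hw'⟩ := Finset.mem_filter.1 hw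
  have hwv := h.nbr_ne hv hw
  have hvv := h.par_ne_self hv
  have hww := h.par_ne_self hwA
  have hsubw : ∀ x, (x = w → s.par v = some w) → contractSub s sub v w x = sub x := by
    intro x hx
    by_cases hxw : x = w
    · rw [contractSub_parent (hx hxw)]
    · exact contractSub_of_ne hxw
  constructor
  · intro x hx
    rw [contract_alive, Finset.mem_erase] at hx
    by_cases hxw : x = w
    · subst hxw
      have h2 : (s.contract P v x).dec x = s.dec v + s.dec x := by simp [Stage.contract]
      rw [h2]
      exact (h.pos v hv).add (h.pos x hwA)
    · have h2 : (s.contract P v w).dec x = s.dec x := by simp [Stage.contract, hxw]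
      rw [h2]
      exact h.pos x hx.2
  · intro x hx u hu
    rw [contract_alive, Finset.mem_erase] at hx ⊢
    rcases contract_par_eq_some hu with ⟨_, _, h1⟩ | ⟨_, _, h1⟩ | ⟨h1, h2⟩
    · exact ⟨fun e => hvv (e ▸ h1), h.par_alive v hv u h1⟩
    · subst h1
      exact ⟨hwv, hwA⟩
    · exact ⟨h2, h.par_alive x hx.2 u h1⟩
  · rw [contract_alive, ← h.sum_eq, ← Finset.add_sum_erase _ _ hv]
    have hwe : w ∈ s.alive.erase v := Finset.mem_erase.2 ⟨hwv, hwA⟩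
    rw [← Finset.add_sum_erase _ _ hwe, ← Finset.add_sum_erase (s.alive.erase v) s.dec hwe,
      ← add_assoc]
    congr 1
    · simp [Stage.contract]
    · refine Finset.sum_congr rfl fun x hx => ?_
      simp [Stage.contract, Finset.ne_of_mem_erase hx]
  · obtain ⟨r, hr, hr1, hr2, hr3⟩ := h.root
    by_cases hrv : r = v
    · subst hrv
      have hch : s.par w = some r := by
        rcases hw' with h1 | h1
        · rw [hr1] at h1; cases h1
        · exact h1
      refine ⟨w, ?_, ?_, ?_, ?_⟩
      · rw [contract_alive]; exact Finset.mem_erase.2 ⟨hwv, hwA⟩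
      · rw [contract_par_self hch, hr1]
      · rw [contractSub_child (by rw [hr1]; simp), hr2]
      · intro x hx hx'
        rw [contract_alive, Finset.mem_erase] at hx
        by_contra hxw
        by_cases h1 : s.par x = some r
        · rw [contract_par_child h1 hxw] at hx'; cases hx'
        · rw [contract_par_of_ne h1] at hx'
          exact hx.1 (hr3 x hx.2 hx')
    · refine ⟨r, ?_, ?_, ?_, ?_⟩
      · rw [contract_alive]; exact Finset.mem_erase.2 ⟨hrv, hr⟩
      · rw [contract_par_of_ne (by rw [hr1]; simp), hr1]
      · rw [hsubw r, hr2]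
        rintro rfl
        rcases hw' with h1 | h1
        · exact h1
        · rw [hr1] at h1; cases h1
      · intro x hx hx'
        rw [contract_alive, Finset.mem_erase] at hx
        by_cases h1 : s.par x = some v
        · by_cases hxw : x = w
          · subst hxw
            rw [contract_par_self h1] at hx'
            exact absurd (hr3 v hv hx').symm hrv
          · rw [contract_par_child h1 hxw] at hx'; cases hx'
        · rw [contract_par_of_ne h1] at hx'
          exact hr3 x hx.2 hx'
  · rw [contract_alive]
    exact h.contract_sub_eq hv hw2
  · intro x hx hx'
    rw [contract_alive, Finset.mem_erase] at hx
    by_cases hxw : x = w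
    · subst hxw
      rcases hw' with h1 | h1
      · rw [contractSub_parent h1]
        refine h.prim x hx.2 ?_
        rwa [contract_par_of_ne (h.par_asymm hv h1)] at hx'
      · rw [contractSub_child fun h2 => h.par_asymm hv h2 h1]
        rw [contract_par_self h1] at hx'
        exact h.prim v hv hx'
    · rw [contractSub_of_ne hxw]
      refine h.prim x hx.2 fun h1 => hx' ?_
      rw [contract_par_of_ne (by rw [h1]; simp), h1]
  · intro x hx u hu
    rw [contract_alive, Finset.mem_erase] at hx
    rcases hw' with hpar | hch
    · rw [contractSub_parent hpar]
      rcases contract_par_eq_some hu with ⟨h0, h2, h1⟩ | ⟨h0, _, h1⟩ | ⟨h1, h2⟩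
      · exact absurd (h2 ▸ h0) (h.par_asymm hv hpar)
      · rw [h1]
        exact (h.lt x hx.2 v h0).trans (h.lt v hv w hpar)
      · exact h.lt x hx.2 u h1
    · have hpw : s.par v ≠ some w := fun h1 => h.par_asymm hv h1 hch
      rcases contract_par_eq_some hu with ⟨h0, h2, h1⟩ | ⟨h0, h3, h1⟩ | ⟨h1, h2⟩
      · rw [h2, contractSub_child hpw, contractSub_of_ne]
        · exact h.lt v hv u h1
        · rintro rfl
          exact hpw h1
      · rw [h1, contractSub_child hpw, contractSub_of_ne h3]
        exact h.lt x hx.2 v h0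
      · have hxw : x ≠ w := by
          rintro rfl
          rw [hch, Option.some.injEq] at h1
          exact h2 h1.symm
        rw [contractSub_of_ne hxw]
        by_cases huw : u = w
        · rw [huw, contractSub_child hpw]
          exact (h.lt x hx.2 w (huw ▸ h1)).trans (h.lt w hwA v hch)
        · rw [contractSub_of_ne huw]
          exact h.lt x hx.2 u h1
  · intro x hx
    rw [contract_alive, Finset.mem_erase] at hx
    rcases h.loc x hx.2 with h1 | ⟨h1, h2, h3⟩
    · exact Or.inl h1
    · exact Or.inr ⟨h1, by simp only [Stage.contract]; push_cast; omega, h3⟩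
  · intro x hx y hy
    rw [contract_alive, Finset.mem_erase] at hx hy
    exact h.inj x hx.2 y hy.2
  · intro x hx u hu h1 h2
    rw [contract_alive, Finset.mem_erase] at hx
    rcases contract_par_eq_some hu with ⟨_, h3, _⟩ | ⟨_, _, h3⟩ | ⟨h3, _⟩
    · exact absurd (h3 ▸ h1) hside
    · exact absurd (h3 ▸ h2) hside
    · exact h.adj x hx.2 u h3 h1 h2

lemma pending_move {v : Fin n} (hv : v ∈ s.pending P) :
    ((s.move P v).pending P).card < (s.pending P).card := by
  refine Finset.card_lt_card ⟨fun x hx => ?_, fun hsub => ?_⟩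
  · rw [mem_pending] at hx ⊢
    have hxv : x ≠ v := by
      rintro rfl
      exact hx.2 (by simp [Stage.move, target])
    refine ⟨hx.1, ?_⟩
    have h2 := hx.2
    simpa [Stage.move, target, hxv] using h2
  · have h1 := (mem_pending.1 (hsub hv)).2
    exact h1 (by simp [Stage.move, target])

lemma pending_contract {v w : Fin n} (hv : v ∈ s.pending P) :
    ((s.contract P v w).pending P).card ≤ (s.pending P).card := by
  have h1 : (s.contract P v w).pending P ⊆ insert w ((s.pending P).erase v) := by
    intro x hx
    rw [mem_pending, contract_alive, Finset.mem_erase] at hx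
    rw [Finset.mem_insert, Finset.mem_erase, mem_pending]
    by_cases hxw : x = w
    · exact Or.inl hxw
    · refine Or.inr ⟨hx.1.1, hx.1.2, ?_⟩
      have h2 := hx.2
      simpa [Stage.contract, target, hxw] using h2
  refine (Finset.card_le_card h1).trans ((Finset.card_insert_le _ _).trans ?_)
  rw [Finset.card_erase_of_mem hv]
  have := Finset.card_pos.2 ⟨v, hv⟩
  omega

lemma pairing_add_left (a b c : Lat l1 l2) : pairing (a + b) c = pairing a c + pairing b c := by
  simp only [pairing, gPart_add, hPart_add]; ring

/-- The pairing with a fixed element. -/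
def pairHom (c : Lat l1 l2) : Lat l1 l2 →+ ℤ where
  toFun a := pairing a c
  map_zero' := by simp [pairing, gPart, hPart]
  map_add' a b := pairing_add_left a b c

lemma pairHom_apply (a c : Lat l1 l2) : pairHom c a = pairing a c := rfl

lemma pairing_swap (a b : Lat l1 l2) : pairing b a = -pairing a b := by
  simp only [pairing]; ring

/-- The sum of the coordinates. -/
def sizeHom (l1 l2 : ℕ) : Lat l1 l2 →+ ℤ where
  toFun a := gPart a + hPart a
  map_zero' := by simp [gPart, hPart]
  map_add' a b := by rw [gPart_add, hPart_add]; ring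

lemma IsPos_size_pos {a : Lat l1 l2} (ha : IsPos a) : 0 < sizeHom l1 l2 a :=
  ha.add_pos

/-- The value of a terminal stage. -/
lemma Good.val_terminal (h : Good P α s sub) (hp : s.pending P = ∅) :
    val α s sub = if s.alive.card = 1 then (s.sign : ℤ) * (quadSign α : ℤ) else 0 := by
  obtain ⟨r, hr, hr1, hr2, hr3⟩ := h.root
  split_ifs with hc
  · obtain ⟨a, ha⟩ := Finset.card_eq_one.1 hc
    have hra : r = a := by rw [ha] at hr; exact Finset.mem_singleton.1 hr
    subst hra
    have h1 := h.sum_eq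
    rw [ha, Finset.sum_singleton] at h1
    rw [val, ha, Finset.prod_singleton, Finset.prod_singleton, edgeVal_none hr1, h1, mul_one]
  · have hray : ∀ v ∈ s.alive, s.ray v = s.target P v := fun v hv => by
      by_contra hne
      have h1 : v ∈ s.pending P := mem_pending.2 ⟨hv, hne⟩
      rw [hp] at h1
      exact absurd h1 (Finset.notMem_empty v)
    obtain ⟨v, hv, hmax⟩ := Finset.exists_max_image s.alive s.pos ⟨r, hr⟩
    by_contra hval
    have hedge : ∀ x ∈ s.alive, edgeVal α s sub x ≠ 0 := fun x hx h0 => hval (by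
      rw [val, Finset.prod_eq_zero hx h0, mul_zero])
    have hchild : ∀ x ∈ s.alive, s.par x = some v → 0 < pairing (sub x) α := by
      intro x hx hxv
      have h1 := hedge x hx
      have hlt : s.pos x < s.pos v := lt_of_le_of_ne (hmax x hx) (h.pos_ne hx hxv)
      rw [edgeVal_some hxv, slopeInd] at h1
      by_contra h2
      rw [if_neg h2] at h1
      simp [edgeFactor, hlt, not_lt.2 hlt.le] at h1
    have hlt : pairing (s.dec v) α < 0 := by
      have h1 := congrArg (pairHom α) (h.sub_eq v hv)
      rw [map_add, map_sum] at h1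
      simp only [pairHom_apply] at h1
      have h2 : 0 ≤ ∑ x ∈ s.alive with s.par x = some v, pairing (sub x) α :=
        Finset.sum_nonneg fun x hx =>
          (hchild x (Finset.mem_filter.1 hx).1 (Finset.mem_filter.1 hx).2).le
      by_cases hvr : s.par v = none
      · have hvr' := hr3 v hv hvr
        subst hvr'
        have h3 : pairing (sub v) α = 0 := by rw [hr2, pairing]; ring
        have h4 : 0 < ∑ x ∈ s.alive with s.par x = some v, pairing (sub x) α := by
          refine Finset.sum_pos (fun x hx =>
            hchild x (Finset.mem_filter.1 hx).1 (Finset.mem_filter.1 hx).2) ?_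
          by_contra hne
          rw [Finset.not_nonempty_iff_eq_empty] at hne
          have h5 := h.sub_eq v hv
          rw [hne, Finset.sum_empty, add_zero, hr2, ← h.sum_eq, ← Finset.add_sum_erase _ _ hv,
            add_eq_left] at h5
          have h6 := congrArg (sizeHom l1 l2) h5
          rw [map_sum, map_zero] at h6
          have h7 : (s.alive.erase v).Nonempty := by
            rw [← Finset.card_pos, Finset.card_erase_of_mem hv]
            have := Finset.card_pos.2 ⟨v, hv⟩
            omega
          exact absurd h6 (Finset.sum_pos (fun x hx =>
            IsPos_size_pos (h.pos x (Finset.mem_of_mem_erase hx))) h7).ne'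
        linarith
      · obtain ⟨u, hu⟩ := Option.ne_none_iff_exists'.1 hvr
        have h3 := hedge v hv
        have hlt : s.pos u < s.pos v :=
          lt_of_le_of_ne (hmax u (h.par_alive v hv u hu)) (h.pos_ne hv hu).symm
        have h4 : pairing (sub v) α < 0 := by
          refine lt_of_le_of_ne (not_lt.1 fun h5 => h3 ?_) (h.prim v hv hvr)
          rw [edgeVal_some hu, slopeInd, if_pos h5]
          simp [edgeFactor, hlt, not_lt.2 hlt.le]
        linarith
    have hge : 0 ≤ pairing (s.dec v) α := by
      have h1 : pairing α (s.dec v) ≤ 0 := by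
        rw [← pairHom_apply, ← h.sum_eq, map_sum]
        refine Finset.sum_nonpos fun y hy => ?_
        rw [pairHom_apply]
        refine not_lt.1 fun h2 => ?_
        rw [← P.clock_minus_lt_iff (h.pos v hv) (h.pos y hy)] at h2
        have h3 : s.ray v < s.ray y := by rw [hray v hv, hray y hy]; exact h2
        exact absurd (hmax y hy) (not_le.2 (lt_pos_iff.2 (Or.inl h3)))
      rw [pairing_swap]
      linarith
    exact absurd hlt (not_lt.2 hge)

/-- The contribution of a leaf of the process. -/
def leafVal (α : Lat l1 l2) (s : Stage l1 l2 n) : ℤ :=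
  if s.alive.card = 1 then (s.sign : ℤ) * (quadSign α : ℤ) else 0

lemma sum_leafVal (M : Multiset (Stage l1 l2 n)) :
    (M.map (leafVal α)).sum = (quadSign α : ℤ) *
      ((((M.filter fun s => s.alive.card = 1).bind fun s =>
        s.alive.val.map fun v => ((Quotient.mk _ (s.hist v) : TropType), s.sign)).map
          fun x => ((x.2 : ℤˣ) : ℤ)).sum) := by
  induction M using Multiset.induction_on with
  | empty => simp
  | cons s M ih =>
    rw [Multiset.map_cons, Multiset.sum_cons, ih, leafVal]
    split_ifs with h
    · obtain ⟨a, ha⟩ := Finset.card_eq_one.1 h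
      rw [Multiset.filter_cons_of_pos (p := fun s : Stage l1 l2 n => s.alive.card = 1) M h, Multiset.cons_bind, Multiset.map_add, Multiset.sum_add,
        ha]
      simp
      ring
    · rw [Multiset.filter_cons_of_neg (p := fun s : Stage l1 l2 n => s.alive.card = 1) M h, zero_add]

open Classical in
theorem Good.val_eq_leaves {m : ℕ} : ∀ {s : Stage l1 l2 n} {sub : Fin n → Lat l1 l2},
    Good P α s sub → s.alive.card + (s.pending P).card ≤ m →
    val α s sub = ((leaves P m s).map (leafVal α)).sum := by
  induction m with
  | zero =>
    intro s sub h hm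
    have h1 : s.pending P = ∅ := by
      rw [← Finset.card_eq_zero]; omega
    rw [h.val_terminal h1, leaves]
    simp [leafVal]
  | succ m ih =>
    intro s sub h hm
    rw [leaves]
    split_ifs with hne
    · set v := (s.pending P).min' hne
      have hv : v ∈ s.pending P := Finset.min'_mem _ hne
      have hvA := (mem_pending.1 hv).1
      have hnb : ∀ w ∈ s.crossed P v, w ∈ s.nbrs v := fun w hw => by
        rw [h.crossed_eq hv] at hw
        exact Finset.mem_of_mem_filter w hw
      rw [h.val_eq hv, Multiset.map_add, Multiset.sum_add, Multiset.map_bind, Multiset.sum_bind]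
      congr 1
      · refine ih (h.move hvA) ?_
        have := pending_move hv
        change s.alive.card + _ ≤ _
        omega
      · rw [Finset.sum]
        congr 1
        refine Multiset.map_congr rfl fun w hw => ?_
        refine ih (h.contract hvA (hnb w hw) (h.side_ne_of_crossed hv hw)) ?_
        have h1 := pending_contract (w := w) hv
        rw [contract_alive, Finset.card_erase_of_mem hvA]
        have := Finset.card_pos.2 ⟨v, hvA⟩
        omega
    · rw [h.val_terminal (Finset.not_nonempty_iff_eq_empty.1 hne)]
      simp [leafVal]

end Stage

namespace LTree

variable {l1 l2 : ℕ} {P : ChargePair} {α : Lat l1 l2}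

lemma Positive.isPos {T : LTree l1 l2} (hT : T.Positive) (v : Fin T.n) : IsPos (T.dec v) := by
  obtain ⟨u, p, hp, h⟩ := hT v
  rw [h]
  exact isPos_smul_basis hp u

open Classical in
/-- The factor of the edge above `v` in the initial stage. -/
def initVal (P : ChargePair) (α : Lat l1 l2) (T : LTree l1 l2) (sub : Fin T.n → Lat l1 l2)
    (v : Fin T.n) : ℤ :=
  match T.par v with
  | none => 1
  | some u => (if clock (P.plus (T.dec v)) < clock (P.plus (T.dec u)) then 0 else 1) -
      Stage.slopeInd α (sub v)

/-- The signed number of tropical types of a tree as a product over its edges. -/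
theorem signSum_eq {T : LTree l1 l2} (hT : T.Positive) (hα : T.charge = α)
    {sub : Fin T.n → Lat l1 l2} (hroot : sub T.root = α)
    (hsub : ∀ v, sub v = T.dec v + ∑ x with T.par x = some v, sub x)
    (hpos : ∀ v, IsPos (sub v)) (hprim : ∀ v, v ≠ T.root → pairing (sub v) α ≠ 0)
    (hadj : ∀ v u, T.par v = some u → pairing (T.dec u) (T.dec v) ≠ 0) :
    (quadSign α : ℤ) * T.signSum P = ∏ v, initVal P α T sub v := by
  have hlt0 : clock P.gPlus < clock P.hPlus :=
    neg_lt_neg (P.arg_lt_one.trans (P.arg_lt_two.trans P.arg_lt_three))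
  have hclock : ∀ v u, T.par v = some u →
      clock (P.plus (T.dec v)) ≠ clock (P.plus (T.dec u)) := by
    intro v u hu he
    refine hadj v u hu ?_
    obtain ⟨a, p, hp, ha⟩ := hT v
    obtain ⟨b, q, hq, hb⟩ := hT u
    rw [ha, hb, clock_plus_smul_basis P hp, clock_plus_smul_basis P hq] at he
    rw [ha, hb, pairing]
    simp only [gPart_smul_basis, hPart_smul_basis]
    rcases a with a | a <;> rcases b with b | b
    · simp
    · exact absurd he hlt0.ne
    · exact absurd he hlt0.ne'
    · simp
  have hgood : Stage.Good P α (T.initial P) sub := by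
    refine ⟨fun v _ => hT.isPos v, fun v _ u _ => Finset.mem_univ u, hα,
      ⟨T.root, Finset.mem_univ _, (T.par_eq_none _).2 rfl, hroot,
        fun v _ hv => (T.par_eq_none v).1 hv⟩, fun v _ => hsub v,
      fun v _ hv => hprim v fun e => hv ((T.par_eq_none v).2 e), ?_, ?_, ?_, ?_⟩
    · intro v _ u hu
      have h1 := congrArg (Stage.sizeHom l1 l2) (hsub u)
      rw [map_add, map_sum] at h1
      have h2 : Stage.sizeHom l1 l2 (sub v) ≤
          ∑ x with T.par x = some u, Stage.sizeHom l1 l2 (sub x) :=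
        Finset.single_le_sum (f := fun x => Stage.sizeHom l1 l2 (sub x))
          (fun x _ => (Stage.IsPos_size_pos (hpos x)).le)
          (Finset.mem_filter.2 ⟨Finset.mem_univ v, hu⟩)
      have h3 := Stage.IsPos_size_pos (hT.isPos u)
      change Stage.sizeHom l1 l2 (sub v) < Stage.sizeHom l1 l2 (sub u)
      linarith
    · intro v _
      left
      refine ⟨rfl, ?_⟩
      obtain ⟨a, p, hp, ha⟩ := hT v
      change clock (P.plus (T.dec v)) = _ ∨ clock (P.plus (T.dec v)) = _
      rw [ha, clock_plus_smul_basis P hp]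
      rcases a with a | a
      · exact Or.inl rfl
      · exact Or.inr rfl
    · intro v _ w _ _ h0
      exact absurd rfl h0
    · intro v _ u hu _ _
      exact hclock v u hu
  have h1 := hgood.val_eq_leaves (m := 2 * T.n) (by
    have h2 : (T.initial P).alive.card = T.n := by simp [initial]
    have h3 := Finset.card_le_card (Finset.filter_subset
      (fun v => (T.initial P).ray v ≠ (T.initial P).target P v) (T.initial P).alive)
    have h4 : ((T.initial P).pending P).card ≤ (T.initial P).alive.card := by
      unfold Stage.pending
      convert h3
    omega)
  have h2 : Stage.val α (T.initial P) sub = ∏ v, initVal P α T sub v := by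
    rw [Stage.val]
    have h3 : ∏ v ∈ (T.initial P).alive, (quadSign ((T.initial P).dec v) : ℤ) = 1 := by
      refine Finset.prod_eq_one fun v _ => ?_
      obtain ⟨u, p, hp, h⟩ := hT v
      have h4 : (T.initial P).dec v = p • basisVec u := h
      rw [h4, quadSign, gPart_smul_basis, hPart_smul_basis]
      rcases u with u | u <;> simp
    rw [h3]
    change ((1 : ℤˣ) : ℤ) * 1 * _ = _
    rw [Units.val_one, one_mul, one_mul]
    refine Finset.prod_congr rfl fun v _ => ?_
    cases hp : T.par v with
    | none =>
      rw [Stage.edgeVal_none (show (T.initial P).par v = none from hp), initVal, hp]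
    | some u =>
      rw [Stage.edgeVal_some (show (T.initial P).par v = some u from hp), initVal, hp]
      have hlt : (T.initial P).pos v < (T.initial P).pos u ↔
          clock (P.plus (T.dec v)) < clock (P.plus (T.dec u)) := by
        refine (Stage.lt_pos_iff (s := T.initial P) (v := u)).trans ?_
        exact or_iff_left fun h => lt_irrefl _ h.2
      simp only [edgeFactor, if_true, hlt]
  rw [← h2, h1, Stage.sum_leafVal]
  rfl

end LTree


/-! ### Labelled forests -/

section Forest

open Classical

variable {V V' : Type*} [Fintype V] [Fintype V']

/-- A parent function whose graph is a forest with vertices in `A`. -/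
def IsForest (A : Finset V) (par : V → Option V) : Prop :=
  (∀ x y, par x = some y → x ∈ A ∧ y ∈ A) ∧ ∃ h : V → ℕ, ∀ x y, par x = some y → h y < h x

/-- A forest with exactly one root. -/
def IsTree (A : Finset V) (par : V → Option V) : Prop :=
  IsForest A par ∧ ∃ r ∈ A, par r = none ∧ ∀ x ∈ A, par x = none → x = r

/-- The descendants of a vertex, including itself. -/
def desc (par : V → Option V) (v : V) : Finset V :=
  Finset.univ.filter fun x => Relation.ReflTransGen (fun x y => par x = some y) x v

lemma mem_desc {par : V → Option V} {v x : V} :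
    x ∈ desc par v ↔ Relation.ReflTransGen (fun x y => par x = some y) x v := by
  simp [desc]

lemma self_mem_desc (par : V → Option V) (v : V) : v ∈ desc par v :=
  mem_desc.2 Relation.ReflTransGen.refl

lemma mem_desc_iff {par : V → Option V} {v x : V} :
    x ∈ desc par v ↔ x = v ∨ ∃ y, par x = some y ∧ y ∈ desc par v := by
  simp only [mem_desc]
  exact Relation.ReflTransGen.cases_head_iff

lemma desc_subset_of_closed {par par' : V → Option V} {C : Finset V}
    (hcl : ∀ x, ∀ y ∈ C, par x = some y → x ∈ C)
    (hag : ∀ x, ∀ y ∈ C, par x = some y → par' x = some y) {v : V} (hv : v ∈ C) :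
    desc par v ⊆ C ∩ desc par' v := by
  intro x hx
  rw [mem_desc] at hx
  induction hx using Relation.ReflTransGen.head_induction_on with
  | refl => exact Finset.mem_inter.2 ⟨hv, self_mem_desc _ _⟩
  | head h _ ih =>
    obtain ⟨h1, h2⟩ := Finset.mem_inter.1 ih
    exact Finset.mem_inter.2 ⟨hcl _ _ h1 h, mem_desc_iff.2 (Or.inr ⟨_, hag _ _ h1 h, h2⟩)⟩

lemma desc_congr {par par' : V → Option V} {C : Finset V}
    (hcl : ∀ x, ∀ y ∈ C, par x = some y → x ∈ C)
    (hag : ∀ x, ∀ y ∈ C, par x = some y ↔ par' x = some y) {v : V} (hv : v ∈ C) :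
    desc par v = desc par' v := by
  refine Finset.Subset.antisymm ?_ ?_
  · exact (desc_subset_of_closed hcl (fun x y hy => (hag x y hy).1) hv).trans
      Finset.inter_subset_right
  · exact (desc_subset_of_closed (fun x y hy h => hcl x y hy ((hag x y hy).2 h))
      (fun x y hy => (hag x y hy).2) hv).trans Finset.inter_subset_right

lemma IsForest.desc_subset {A : Finset V} {par : V → Option V} (h : IsForest A par) {v : V}
    (hv : v ∈ A) : desc par v ⊆ A :=
  (desc_subset_of_closed (par' := par) (fun x y _ hxy => (h.1 x y hxy).1)
    (fun _ _ _ h => h) hv).trans Finset.inter_subset_left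

lemma IsForest.exists_root {A : Finset V} {par : V → Option V} (h : IsForest A par) {x : V}
    (hx : x ∈ A) : ∃ r ∈ A, par r = none ∧ x ∈ desc par r := by
  obtain ⟨h1, ht, h2⟩ := h
  induction hn : ht x using Nat.strong_induction_on generalizing x with
  | _ n ih =>
    cases hp : par x with
    | none => exact ⟨x, hx, hp, self_mem_desc _ _⟩
    | some y =>
      obtain ⟨r, hr, hr1, hr2⟩ := ih (ht y) (hn ▸ h2 x y hp) (h1 x y hp).2 rfl
      exact ⟨r, hr, hr1, mem_desc_iff.2 (Or.inr ⟨y, hp, hr2⟩)⟩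

lemma eq_of_mem_desc_root {par : V → Option V} {r r' x : V} (hr : par r = none)
    (hr' : par r' = none) (hx : x ∈ desc par r) (hx' : x ∈ desc par r') : r = r' := by
  rw [mem_desc] at hx hx'
  have huniq : ∀ {a b : V}, par a = none →
      Relation.ReflTransGen (fun x y => par x = some y) a b → a = b := by
    intro a b ha hab
    rcases Relation.ReflTransGen.cases_head hab with h | ⟨c, h, _⟩
    · exact h
    · rw [ha] at h; cases h
  rcases Relation.ReflTransGen.total_of_right_unique (fun a b c h1 h2 => by
    rw [h1] at h2; exact Option.some.inj h2) hx hx' with h | h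
  · exact huniq hr h
  · exact (huniq hr' h).symm

lemma IsForest.sum_roots {A : Finset V} {par : V → Option V} (h : IsForest A par)
    {M : Type*} [AddCommMonoid M] (f : V → M) :
    ∑ r ∈ A with par r = none, ∑ x ∈ desc par r, f x = ∑ x ∈ A, f x := by
  rw [← Finset.sum_biUnion]
  · refine Finset.sum_congr ?_ fun _ _ => rfl
    ext x
    simp only [Finset.mem_biUnion, Finset.mem_filter]
    exact ⟨fun ⟨r, ⟨hr, _⟩, hx⟩ => h.desc_subset hr hx, fun hx =>
      let ⟨r, hr, hr1, hr2⟩ := h.exists_root hx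
      ⟨r, ⟨hr, hr1⟩, hr2⟩⟩
  · intro r hr r' hr' hne
    simp only [Finset.coe_filter, Set.mem_setOf_eq] at hr hr'
    rw [Function.onFun, Finset.disjoint_left]
    exact fun x hx hx' => hne (eq_of_mem_desc_root hr.2 hr'.2 hx hx')

variable {l1 l2 : ℕ} {m : Deg l1 l2}

/-- The charge of the subtree above a vertex. -/
def subSum (f : (V → Option V) × (V → Deg l1 l2)) (v : V) : Deg l1 l2 := ∑ x ∈ desc f.1 v, f.2 x

/-- The product of the factors of the vertices, with `κ` for the roots. -/
def forestWeight (κ : Deg l1 l2 → Deg l1 l2 → ℂ) (K : Deg l1 l2 → Deg l1 l2 → Deg l1 l2 → ℂ)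
    (A : Finset V) (f : (V → Option V) × (V → Deg l1 l2)) : ℂ :=
  ∏ w ∈ A, match f.1 w with
    | none => κ (f.2 w) (subSum f w)
    | some u => K (f.2 u) (f.2 w) (subSum f w)

/-- The decorations of the vertices in `A`. -/
def decs (m : Deg l1 l2) (A : Finset V) : Finset (V → Deg l1 l2) :=
  Fintype.piFinset fun x => if x ∈ A then posIic m else {0}

lemma mem_decs {A : Finset V} {dec : V → Deg l1 l2} :
    dec ∈ decs m A ↔ (∀ x ∈ A, dec x ∈ posIic m) ∧ ∀ x ∉ A, dec x = 0 := by
  simp only [decs, Fintype.mem_piFinset]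
  constructor
  · refine fun h => ⟨fun x hx => ?_, fun x hx => ?_⟩
    · have := h x; rwa [if_pos hx] at this
    · have := h x; rw [if_neg hx] at this; exact Finset.mem_singleton.1 this
  · rintro ⟨h1, h2⟩ x
    split_ifs with hx
    · exact h1 x hx
    · exact Finset.mem_singleton.2 (h2 x hx)

/-- Decorated forests on `A`. -/
def forests (m : Deg l1 l2) (A : Finset V) : Finset ((V → Option V) × (V → Deg l1 l2)) :=
  (Finset.univ ×ˢ decs m A).filter fun f => IsForest A f.1

/-- Decorated trees on `A`. -/
def trees (m : Deg l1 l2) (A : Finset V) : Finset ((V → Option V) × (V → Deg l1 l2)) :=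
  (Finset.univ ×ˢ decs m A).filter fun f => IsTree A f.1

lemma mem_forests {A : Finset V} {f : (V → Option V) × (V → Deg l1 l2)} :
    f ∈ forests m A ↔ f.2 ∈ decs m A ∧ IsForest A f.1 := by
  simp [forests]

lemma mem_trees {A : Finset V} {f : (V → Option V) × (V → Deg l1 l2)} :
    f ∈ trees m A ↔ f.2 ∈ decs m A ∧ IsTree A f.1 := by
  simp [trees]

/-- The sum of the contributions of the forests on `A`. -/
def forestSum (m : Deg l1 l2) (κ : Deg l1 l2 → Deg l1 l2 → ℂ)
    (K : Deg l1 l2 → Deg l1 l2 → Deg l1 l2 → ℂ) (A : Finset V) : Trunc m :=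
  ∑ f ∈ forests m A, forestWeight κ K A f • tmono m (∑ x ∈ A, f.2 x)

/-- The sum of the contributions of the trees on `A`. -/
def treeSum (m : Deg l1 l2) (κ : Deg l1 l2 → Deg l1 l2 → ℂ)
    (K : Deg l1 l2 → Deg l1 l2 → Deg l1 l2 → ℂ) (A : Finset V) : Trunc m :=
  ∑ f ∈ trees m A, forestWeight κ K A f • tmono m (∑ x ∈ A, f.2 x)

variable {κ : Deg l1 l2 → Deg l1 l2 → ℂ} {K : Deg l1 l2 → Deg l1 l2 → Deg l1 l2 → ℂ}

/-- The restriction of a decorated forest to a set of vertices. -/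
def restrictF (C : Finset V) (f : (V → Option V) × (V → Deg l1 l2)) :
    (V → Option V) × (V → Deg l1 l2) :=
  (fun x => if x ∈ C then f.1 x else none, fun x => if x ∈ C then f.2 x else 0)

lemma forestWeight_congr {A : Finset V} {f g : (V → Option V) × (V → Deg l1 l2)}
    (hcl : ∀ x, ∀ y ∈ A, f.1 x = some y → x ∈ A)
    (hcl' : ∀ x ∈ A, ∀ y, f.1 x = some y → y ∈ A)
    (hag : ∀ x, ∀ y ∈ A, f.1 x = some y ↔ g.1 x = some y)
    (hpar : ∀ x ∈ A, f.1 x = g.1 x) (hdec : ∀ x ∈ A, f.2 x = g.2 x) :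
    forestWeight κ K A f = forestWeight κ K A g := by
  have hsub : ∀ v ∈ A, subSum f v = subSum g v := by
    intro v hv
    rw [subSum, subSum, ← desc_congr hcl hag hv]
    refine Finset.sum_congr rfl fun x hx => hdec x ?_
    exact (Finset.mem_inter.1 (desc_subset_of_closed hcl (fun x y hy => (hag x y hy).1) hv hx)).1
  refine Finset.prod_congr rfl fun w hw => ?_
  rw [← hpar w hw, ← hdec w hw, ← hsub w hw]
  cases hp : f.1 w with
  | none => rfl
  | some u => simp only [hdec u (hcl' w hw u hp)]

/-- Gluing of two decorated forests. -/
def glueF (C : Finset V) (f g : (V → Option V) × (V → Deg l1 l2)) :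
    (V → Option V) × (V → Deg l1 l2) :=
  (fun x => if x ∈ C then f.1 x else g.1 x, fun x => if x ∈ C then f.2 x else g.2 x)

lemma glueF_par_left {C A : Finset V} {f g : (V → Option V) × (V → Deg l1 l2)}
    (hf : IsForest C f.1) (hg : IsForest (A \ C) g.1) (x y : V) (hy : y ∈ C) :
    (glueF C f g).1 x = some y ↔ f.1 x = some y := by
  simp only [glueF]
  split_ifs with hx
  · rfl
  · constructor
    · intro h
      exact absurd hy (Finset.mem_sdiff.1 (hg.1 x y h).2).2
    · intro h
      exact absurd (hf.1 x y h).1 hx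

lemma glueF_par_right {C A : Finset V} {f g : (V → Option V) × (V → Deg l1 l2)}
    (hf : IsForest C f.1) (hg : IsForest (A \ C) g.1) (x y : V) (hy : y ∉ C) :
    (glueF C f g).1 x = some y ↔ g.1 x = some y := by
  simp only [glueF]
  split_ifs with hx
  · constructor
    · intro h
      exact absurd (hf.1 x y h).2 hy
    · intro h
      exact absurd hx (Finset.mem_sdiff.1 (hg.1 x y h).1).2
  · rfl

lemma glueF_isForest {C A : Finset V} (hC : C ⊆ A) {f g : (V → Option V) × (V → Deg l1 l2)}
    (hf : IsForest C f.1) (hg : IsForest (A \ C) g.1) : IsForest A (glueF C f g).1 := by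
  obtain ⟨hf1, h1, hf2⟩ := id hf
  obtain ⟨hg1, h2, hg2⟩ := id hg
  refine ⟨fun x y h => ?_, fun x => if x ∈ C then h1 x else h2 x, fun x y h => ?_⟩
  · by_cases hy : y ∈ C
    · rw [glueF_par_left hf hg x y hy] at h
      exact ⟨hC (hf1 x y h).1, hC hy⟩
    · rw [glueF_par_right hf hg x y hy] at h
      exact ⟨(Finset.mem_sdiff.1 (hg1 x y h).1).1, (Finset.mem_sdiff.1 (hg1 x y h).2).1⟩
  · by_cases hy : y ∈ C
    · rw [glueF_par_left hf hg x y hy] at h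
      simp only [if_pos hy, if_pos (hf1 x y h).1]
      exact hf2 x y h
    · rw [glueF_par_right hf hg x y hy] at h
      simp only [if_neg hy, if_neg (Finset.mem_sdiff.1 (hg1 x y h).1).2]
      exact hg2 x y h

lemma glueF_mem_forests {C A : Finset V} (hC : C ⊆ A) {f g : (V → Option V) × (V → Deg l1 l2)}
    (hf : f ∈ forests m C) (hg : g ∈ forests m (A \ C)) : glueF C f g ∈ forests m A := by
  rw [mem_forests, mem_decs] at hf hg ⊢
  refine ⟨⟨fun x hx => ?_, fun x hx => ?_⟩, glueF_isForest hC hf.2 hg.2⟩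
  · simp only [glueF]
    split_ifs with h
    · exact hf.1.1 x h
    · exact hg.1.1 x (Finset.mem_sdiff.2 ⟨hx, h⟩)
  · simp only [glueF]
    rw [if_neg fun h => hx (hC h)]
    exact hg.1.2 x fun h => hx (Finset.mem_sdiff.1 h).1

lemma forestWeight_glueF {C A : Finset V} (hC : C ⊆ A) {f g : (V → Option V) × (V → Deg l1 l2)}
    (hf : IsForest C f.1) (hg : IsForest (A \ C) g.1) :
    forestWeight κ K A (glueF C f g) = forestWeight κ K C f * forestWeight κ K (A \ C) g := by
  have h1 : forestWeight κ K C (glueF C f g) = forestWeight κ K C f := by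
    refine (forestWeight_congr (fun x y _ h => (hf.1 x y h).1) (fun x _ y h => (hf.1 x y h).2)
      (fun x y hy => (glueF_par_left hf hg x y hy).symm) ?_ ?_).symm
    · intro x hx; simp only [glueF, if_pos hx]
    · intro x hx; simp only [glueF, if_pos hx]
  have h2 : forestWeight κ K (A \ C) (glueF C f g) = forestWeight κ K (A \ C) g := by
    refine (forestWeight_congr (fun x y _ h => (hg.1 x y h).1) (fun x _ y h => (hg.1 x y h).2)
      (fun x y hy => (glueF_par_right hf hg x y (Finset.mem_sdiff.1 hy).2).symm) ?_ ?_).symm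
    · intro x hx; simp only [glueF, if_neg (Finset.mem_sdiff.1 hx).2]
    · intro x hx; simp only [glueF, if_neg (Finset.mem_sdiff.1 hx).2]
  rw [← h1, ← h2]
  unfold forestWeight
  rw [mul_comm, Finset.prod_sdiff hC]

lemma sum_glueF {C A : Finset V} (hC : C ⊆ A) (f g : (V → Option V) × (V → Deg l1 l2)) :
    ∑ x ∈ A, (glueF C f g).2 x = ∑ x ∈ C, f.2 x + ∑ x ∈ A \ C, g.2 x := by
  rw [← Finset.sum_sdiff hC, add_comm]
  congr 1
  · exact Finset.sum_congr rfl fun x hx => by simp only [glueF, if_pos hx]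
  · exact Finset.sum_congr rfl fun x hx => by
      simp only [glueF, if_neg (Finset.mem_sdiff.1 hx).2]

lemma restrictF_mem_forests {A C : Finset V} (hC : C ⊆ A) {f : (V → Option V) × (V → Deg l1 l2)}
    (hf : f ∈ forests m A) (hcl : ∀ x y, f.1 x = some y → x ∈ C → y ∈ C) :
    restrictF C f ∈ forests m C := by
  rw [mem_forests, mem_decs] at hf ⊢
  obtain ⟨⟨hd1, hd2⟩, hf1, h, hf2⟩ := hf
  have hkey : ∀ x y, (restrictF C f).1 x = some y → x ∈ C ∧ f.1 x = some y := by
    intro x y hxy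
    simp only [restrictF] at hxy
    split_ifs at hxy with hx
    exact ⟨hx, hxy⟩
  refine ⟨⟨fun x hx => ?_, fun x hx => ?_⟩, fun x y hxy => ?_, h, fun x y hxy => ?_⟩
  · simp only [restrictF, if_pos hx]; exact hd1 x (hC hx)
  · simp only [restrictF, if_neg hx]
  · obtain ⟨h1, h2⟩ := hkey x y hxy
    exact ⟨h1, hcl x y h2 h1⟩
  · exact hf2 x y (hkey x y hxy).2

lemma glueF_restrictF {A C : Finset V} {f : (V → Option V) × (V → Deg l1 l2)}
    (hf : f ∈ forests m A) : glueF C (restrictF C f) (restrictF (A \ C) f) = f := by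
  rw [mem_forests, mem_decs] at hf
  refine Prod.ext (funext fun x => ?_) (funext fun x => ?_)
  · simp only [glueF, restrictF]
    by_cases h1 : x ∈ C
    · simp [h1]
    · by_cases h2 : x ∈ A
      · simp [h1, h2]
      · cases hp : f.1 x with
        | none => simp [h1]
        | some y => exact absurd (hf.2.1 x y hp).1 h2
  · simp only [glueF, restrictF]
    by_cases h1 : x ∈ C
    · simp [h1]
    · by_cases h2 : x ∈ A
      · simp [h1, h2]
      · simp [h1, h2, hf.1.2 x h2]

lemma mem_trees_forests {A : Finset V} {f : (V → Option V) × (V → Deg l1 l2)}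
    (hf : f ∈ trees m A) : f ∈ forests m A := by
  rw [mem_trees] at hf
  rw [mem_forests]
  exact ⟨hf.1, hf.2.1⟩

lemma IsTree.desc_root {A : Finset V} {par : V → Option V} (h : IsTree A par) {r : V} (hr : r ∈ A)
    (hr1 : par r = none) : desc par r = A := by
  refine Finset.Subset.antisymm (h.1.desc_subset hr) fun x hx => ?_
  obtain ⟨r', hr', h1, h2⟩ := h.1.exists_root hx
  obtain ⟨r0, _, _, h3⟩ := h.2
  rw [h3 r hr hr1, ← h3 r' hr' h1]
  exact h2

/-- Forests with a marked root. -/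
theorem sum_marked (A : Finset V) (F : ((V → Option V) × (V → Deg l1 l2)) → V → Trunc m)
    (G : Finset V → ((V → Option V) × (V → Deg l1 l2)) → ((V → Option V) × (V → Deg l1 l2)) →
      Trunc m)
    (hFG : ∀ C ⊆ A, ∀ f ∈ trees m C, ∀ g ∈ forests m (A \ C), ∀ r ∈ C, f.1 r = none →
      F (glueF C f g) r = G C f g) :
    ∑ f ∈ forests m A, ∑ r ∈ A with f.1 r = none, F f r =
      ∑ C ∈ A.powerset, ∑ f ∈ trees m C, ∑ g ∈ forests m (A \ C), G C f g := by
  simp_rw [← Finset.sum_product']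
  rw [Finset.sum_sigma', Finset.sum_sigma']
  have hdesc : ∀ f ∈ forests m A, ∀ r ∈ A, f.1 r = none → desc f.1 r ⊆ A ∧
      restrictF (desc f.1 r) f ∈ trees m (desc f.1 r) ∧
      restrictF (A \ desc f.1 r) f ∈ forests m (A \ desc f.1 r) := by
    intro f hf r hr hr1
    have hF := (mem_forests.1 hf).2
    have hs := hF.desc_subset hr
    have hcl : ∀ x y, f.1 x = some y → (x ∈ desc f.1 r ↔ y ∈ desc f.1 r) := by
      intro x y hxy
      constructor
      · intro hx
        rcases mem_desc_iff.1 hx with rfl | ⟨z, hz, hz'⟩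
        · rw [hr1] at hxy; cases hxy
        · rw [hxy] at hz; rwa [Option.some.inj hz]
      · intro hy
        exact mem_desc_iff.2 (Or.inr ⟨y, hxy, hy⟩)
    refine ⟨hs, ?_, ?_⟩
    · have h1 := restrictF_mem_forests hs hf fun x y hxy hx => (hcl x y hxy).1 hx
      rw [mem_forests] at h1
      rw [mem_trees]
      refine ⟨h1.1, h1.2, r, self_mem_desc _ _, ?_, ?_⟩
      · simp only [restrictF, if_pos (self_mem_desc _ _), hr1]
      · intro x hx hx1
        simp only [restrictF, if_pos hx] at hx1
        exact eq_of_mem_desc_root hx1 hr1 (self_mem_desc _ _) hx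
    · refine restrictF_mem_forests Finset.sdiff_subset hf fun x y hxy hx => ?_
      rw [Finset.mem_sdiff] at hx ⊢
      exact ⟨(hF.1 x y hxy).2, fun hy => hx.2 ((hcl x y hxy).2 hy)⟩
  refine Finset.sum_bij (fun p _ => ⟨desc p.1.1 p.2, restrictF (desc p.1.1 p.2) p.1,
    restrictF (A \ desc p.1.1 p.2) p.1⟩) ?_ ?_ ?_ ?_
  · rintro ⟨f, r⟩ hp
    simp only [Finset.mem_sigma, Finset.mem_filter] at hp
    obtain ⟨h1, h2, h3⟩ := hdesc f hp.1 r hp.2.1 hp.2.2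
    simp only [Finset.mem_sigma, Finset.mem_powerset, Finset.mem_product]
    exact ⟨h1, h2, h3⟩
  · rintro ⟨f, r⟩ hp ⟨f', r'⟩ hp' he
    simp only [Finset.mem_sigma, Finset.mem_filter] at hp hp'
    simp only [Sigma.mk.injEq, heq_eq_eq, Prod.mk.injEq] at he
    obtain ⟨he1, he2, he3⟩ := he
    have hff : f = f' := by
      rw [← glueF_restrictF (C := desc f.1 r) hp.1, he2, he3, he1, glueF_restrictF hp'.1]
    subst hff
    have hrr : r = r' := eq_of_mem_desc_root hp.2.2 hp'.2.2 (self_mem_desc _ _)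
      (he1 ▸ self_mem_desc _ _)
    rw [hrr]
  · rintro ⟨C, f, g⟩ hp
    simp only [Finset.mem_sigma, Finset.mem_powerset, Finset.mem_product] at hp
    obtain ⟨hC, hf, hg⟩ := hp
    have hfF := (mem_forests.1 (mem_trees_forests hf)).2
    have hgF := (mem_forests.1 hg).2
    obtain ⟨r, hr, hr1, _⟩ := (mem_trees.1 hf).2.2
    have hd : desc (glueF C f g).1 r = C := by
      rw [← desc_congr (fun x y _ h => (hfF.1 x y h).1)
        (fun x y hy => (glueF_par_left hfF hgF x y hy).symm) hr]
      exact (mem_trees.1 hf).2.desc_root hr hr1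
    refine ⟨⟨glueF C f g, r⟩, ?_, ?_⟩
    · simp only [Finset.mem_sigma, Finset.mem_filter]
      refine ⟨glueF_mem_forests hC (mem_trees_forests hf) hg, hC hr, ?_⟩
      simp only [glueF, if_pos hr, hr1]
    · have e1 : restrictF C (glueF C f g) = f := by
        have hd := (mem_decs.1 (mem_trees.1 hf).1).2
        refine Prod.ext (funext fun x => ?_) (funext fun x => ?_)
        · simp only [restrictF, glueF]
          by_cases hx : x ∈ C
          · simp [hx]
          · cases hp : f.1 x with
            | none => simp [hx]
            | some y => exact absurd (hfF.1 x y hp).1 hx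
        · simp only [restrictF, glueF]
          by_cases hx : x ∈ C
          · simp [hx]
          · simp [hx, hd x hx]
      have e2 : restrictF (A \ C) (glueF C f g) = g := by
        have hd := (mem_decs.1 (mem_forests.1 hg).1).2
        refine Prod.ext (funext fun x => ?_) (funext fun x => ?_)
        · simp only [restrictF, glueF]
          by_cases hx : x ∈ A \ C
          · rw [if_pos hx, if_neg (Finset.mem_sdiff.1 hx).2]
          · cases hp : g.1 x with
            | none => rw [if_neg hx]
            | some y => exact absurd (hgF.1 x y hp).1 hx
        · simp only [restrictF, glueF]
          by_cases hx : x ∈ A \ C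
          · rw [if_pos hx, if_neg (Finset.mem_sdiff.1 hx).2]
          · rw [if_neg hx, hd x hx]
      simp only [hd, e1, e2]
  · rintro ⟨f, r⟩ hp
    simp only [Finset.mem_sigma, Finset.mem_filter] at hp
    obtain ⟨h1, h2, h3⟩ := hdesc f hp.1 r hp.2.1 hp.2.2
    have h4 := hFG _ h1 _ h2 _ h3 r (self_mem_desc _ _)
      (by simp only [restrictF, if_pos (self_mem_desc _ _), hp.2.2])
    rw [glueF_restrictF hp.1] at h4
    exact h4

/-- The derivation rule for the sum over forests. -/
theorem tderiv_forestSum (l : Deg l1 l2 →+ ℂ) (A : Finset V) :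
    tderiv m l (forestSum m κ K A) =
      ∑ C ∈ A.powerset, tderiv m l (treeSum m κ K C) * forestSum m κ K (A \ C) := by
  have h1 : tderiv m l (forestSum m κ K A) = ∑ f ∈ forests m A, ∑ r ∈ A with f.1 r = none,
      l (subSum f r) • (forestWeight κ K A f • tmono m (∑ x ∈ A, f.2 x)) := by
    rw [forestSum, map_sum]
    refine Finset.sum_congr rfl fun f hf => ?_
    rw [Derivation.map_smul, tderiv_tmono, ← Finset.sum_smul]
    have h2 : ∑ r ∈ A with f.1 r = none, l (subSum f r) = l (∑ x ∈ A, f.2 x) := by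
      rw [← (mem_forests.1 hf).2.sum_roots, map_sum]
      rfl
    rw [h2, smul_comm]
  rw [h1, sum_marked A _ (fun C f g => l (∑ x ∈ C, f.2 x) •
    ((forestWeight κ K C f * forestWeight κ K (A \ C) g) •
      (tmono m (∑ x ∈ C, f.2 x) * tmono m (∑ x ∈ A \ C, g.2 x))))]
  · refine Finset.sum_congr rfl fun C _ => ?_
    rw [treeSum, forestSum, map_sum, Finset.sum_mul_sum]
    refine Finset.sum_congr rfl fun f _ => Finset.sum_congr rfl fun g _ => ?_
    rw [Derivation.map_smul, tderiv_tmono, smul_mul_smul_comm, smul_mul_assoc, smul_smul, smul_smul,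
      mul_comm]
  · intro C hC f hf g hg r hr hr1
    have hfF := (mem_forests.1 (mem_trees_forests hf)).2
    have hgF := (mem_forests.1 hg).2
    rw [forestWeight_glueF hC hfF hgF, sum_glueF hC, tmono_add]
    congr 2
    rw [subSum, ← desc_congr (fun x y _ h => (hfF.1 x y h).1)
        (fun x y hy => (glueF_par_left hfF hgF x y hy).symm) hr,
        (mem_trees.1 hf).2.desc_root hr hr1]
    exact Finset.sum_congr rfl fun x hx => by simp only [glueF, if_pos hx]

end Forest


section ForestCount

open Classical

variable {V V' : Type*} [Fintype V] [Fintype V'] {l1 l2 : ℕ} {m : Deg l1 l2}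
  {κ : Deg l1 l2 → Deg l1 l2 → ℂ} {K : Deg l1 l2 → Deg l1 l2 → Deg l1 l2 → ℂ}

/-! ### Removing the root of a tree -/

/-- The tree with root `r`, decorated by `b`, above which lies the forest `f`. -/
def rootF (A : Finset V) (r : V) (b : Deg l1 l2) (f : (V → Option V) × (V → Deg l1 l2)) :
    (V → Option V) × (V → Deg l1 l2) :=
  (fun x => if x ∈ A.erase r then some ((f.1 x).getD r) else none, Function.update f.2 r b)

lemma rootF_par_iff {A : Finset V} {r : V} {b : Deg l1 l2}
    {f : (V → Option V) × (V → Deg l1 l2)} (hf : IsForest (A.erase r) f.1) {x y : V} :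
    (rootF A r b f).1 x = some y ↔
      f.1 x = some y ∨ (x ∈ A.erase r ∧ f.1 x = none ∧ y = r) := by
  simp only [rootF]
  split_ifs with hx
  · cases hp : f.1 x with
    | none => simp [hx, eq_comm]
    | some z => simp
  · constructor
    · intro h; cases h
    · rintro (h | h)
      · exact absurd (hf.1 x y h).1 hx
      · exact absurd h.1 hx

lemma rootF_par_of_mem {A : Finset V} {r : V} {b : Deg l1 l2}
    {f : (V → Option V) × (V → Deg l1 l2)} (hf : IsForest (A.erase r) f.1) (x y : V)
    (hy : y ∈ A.erase r) : f.1 x = some y ↔ (rootF A r b f).1 x = some y := by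
  rw [rootF_par_iff hf]
  exact ⟨Or.inl, fun h => h.resolve_right fun h => Finset.ne_of_mem_erase hy h.2.2⟩

lemma rootF_root {A : Finset V} {r : V} {b : Deg l1 l2}
    {f : (V → Option V) × (V → Deg l1 l2)} : (rootF A r b f).1 r = none := by
  simp [rootF]

lemma rootF_mem_trees {A : Finset V} {r : V} (hr : r ∈ A) {b : Deg l1 l2} (hb : b ∈ posIic m)
    {f : (V → Option V) × (V → Deg l1 l2)} (hf : f ∈ forests m (A.erase r)) :
    rootF A r b f ∈ trees m A := by
  rw [mem_forests, mem_decs] at hf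
  rw [mem_trees, mem_decs]
  obtain ⟨⟨hd1, hd2⟩, hF⟩ := hf
  obtain ⟨hf1, h, hf2⟩ := id hF
  have hdec : ∀ x, x ≠ r → (rootF A r b f).2 x = f.2 x := fun x hx => Function.update_of_ne hx _ _
  refine ⟨⟨fun x hx => ?_, fun x hx => ?_⟩, ⟨fun x y hxy => ?_, fun x => if x = r then 0 else h x + 1,
    fun x y hxy => ?_⟩, r, hr, rootF_root, fun x hx hx' => ?_⟩
  · by_cases hxr : x = r
    · subst hxr; simpa [rootF] using hb
    · rw [hdec x hxr]; exact hd1 x (Finset.mem_erase.2 ⟨hxr, hx⟩)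
  · have hxr : x ≠ r := fun e => hx (e ▸ hr)
    rw [hdec x hxr]; exact hd2 x fun h => hx (Finset.mem_of_mem_erase h)
  · rcases (rootF_par_iff hF).1 hxy with h1 | ⟨h1, _, rfl⟩
    · exact ⟨Finset.mem_of_mem_erase (hf1 x y h1).1, Finset.mem_of_mem_erase (hf1 x y h1).2⟩
    · exact ⟨Finset.mem_of_mem_erase h1, hr⟩
  · rcases (rootF_par_iff hF).1 hxy with h1 | ⟨h1, _, rfl⟩
    · have h2 := Finset.ne_of_mem_erase (hf1 x y h1).1
      have h3 := Finset.ne_of_mem_erase (hf1 x y h1).2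
      simp only [if_neg h2, if_neg h3]
      have := hf2 x y h1
      omega
    · simp only [if_true, if_neg (Finset.ne_of_mem_erase h1)]
      omega
  · by_contra hxr
    simp [rootF, hxr, hx] at hx'

lemma sum_rootF {A : Finset V} {r : V} (hr : r ∈ A) (b : Deg l1 l2)
    (f : (V → Option V) × (V → Deg l1 l2)) :
    ∑ x ∈ A, (rootF A r b f).2 x = b + ∑ x ∈ A.erase r, f.2 x := by
  rw [← Finset.add_sum_erase A _ hr]
  congr 1
  · simp [rootF]
  · exact Finset.sum_congr rfl fun x hx => Function.update_of_ne (Finset.ne_of_mem_erase hx) _ _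

lemma forestWeight_rootF {A : Finset V} {r : V} (hr : r ∈ A) {b : Deg l1 l2} (hb : b ∈ posIic m)
    {f : (V → Option V) × (V → Deg l1 l2)} (hf : f ∈ forests m (A.erase r)) :
    forestWeight κ K A (rootF A r b f) = κ b (b + ∑ x ∈ A.erase r, f.2 x) *
      forestWeight (K b) K (A.erase r) f := by
  have hT := (mem_trees.1 (rootF_mem_trees hr hb hf)).2
  have hF := (mem_forests.1 hf).2
  unfold forestWeight
  rw [← Finset.mul_prod_erase A _ hr]
  have hb' : (rootF A r b f).2 r = b := by simp [rootF]
  congr 1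
  · rw [rootF_root]
    simp only
    rw [subSum, hT.desc_root hr rootF_root, sum_rootF hr, hb']
  · refine Finset.prod_congr rfl fun w hw => ?_
    have hsub : subSum (rootF A r b f) w = subSum f w := by
      rw [subSum, subSum, ← desc_congr (fun x y _ h => (hF.1 x y h).1)
        (fun x y hy => rootF_par_of_mem hF x y hy) hw]
      refine Finset.sum_congr rfl fun x hx => ?_
      have hxr : x ≠ r := Finset.ne_of_mem_erase (hF.desc_subset hw hx)
      simp only [rootF, Function.update_of_ne hxr]
    have hdw : (rootF A r b f).2 w = f.2 w :=
      Function.update_of_ne (Finset.ne_of_mem_erase hw) _ _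
    rw [hsub, hdw]
    cases hp : f.1 w with
    | none =>
      have h1 : (rootF A r b f).1 w = some r := (rootF_par_iff hF).2 (Or.inr ⟨hw, hp, rfl⟩)
      rw [h1]
      simp only [hb']
    | some u =>
      have h1 : (rootF A r b f).1 w = some u := (rootF_par_iff hF).2 (Or.inl hp)
      rw [h1]
      have hdu : (rootF A r b f).2 u = f.2 u :=
        Function.update_of_ne (Finset.ne_of_mem_erase (hF.1 w u hp).2) _ _
      simp only [hdu]

/-- Sums over trees as sums over the forests above the root. -/
theorem sum_trees (A : Finset V) (F : ((V → Option V) × (V → Deg l1 l2)) → Trunc m) :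
    ∑ f ∈ trees m A, F f =
      ∑ r ∈ A, ∑ b ∈ posIic m, ∑ f ∈ forests m (A.erase r), F (rootF A r b f) := by
  simp_rw [← Finset.sum_product']
  rw [Finset.sum_sigma']
  symm
  refine Finset.sum_bij (fun p _ => rootF A p.1 p.2.1 p.2.2) ?_ ?_ ?_ ?_
  · rintro ⟨r, b, f⟩ hp
    simp only [Finset.mem_sigma, Finset.mem_product] at hp
    exact rootF_mem_trees hp.1 hp.2.1 hp.2.2
  · rintro ⟨r, b, f⟩ hp ⟨r', b', f'⟩ hp' he
    simp only [Finset.mem_sigma, Finset.mem_product] at hp hp' he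
    have hrr : r = r' := by
      by_contra hne
      have h1 : (rootF A r' b' f').1 r = none := he ▸ rootF_root
      simp [rootF, hne, hp.1] at h1
    subst hrr
    have hbb : b = b' := by
      have h1 := congrFun (congrArg Prod.snd he) r
      simpa [rootF] using h1
    subst hbb
    have hF := (mem_forests.1 hp.2.2).2
    have hF' := (mem_forests.1 hp'.2.2).2
    have hff : f = f' := by
      refine Prod.ext (funext fun x => ?_) (funext fun x => ?_)
      · refine Option.ext fun y => ?_
        by_cases hy : y ∈ A.erase r
        · rw [rootF_par_of_mem (b := b) hF x y hy, rootF_par_of_mem (b := b) hF' x y hy, he]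
        · exact ⟨fun h => absurd (hF.1 x y h).2 hy, fun h => absurd (hF'.1 x y h).2 hy⟩
      · by_cases hx : x = r
        · subst hx
          rw [(mem_decs.1 (mem_forests.1 hp.2.2).1).2 x (Finset.notMem_erase x A),
            (mem_decs.1 (mem_forests.1 hp'.2.2).1).2 x (Finset.notMem_erase x A)]
        · have h1 := congrFun (congrArg Prod.snd he) x
          simpa [rootF, hx] using h1
    rw [hff]
  · intro g hg
    rw [mem_trees, mem_decs] at hg
    obtain ⟨⟨hd1, hd2⟩, ⟨hg1, h, hg2⟩, r, hr, hr1, hr2⟩ := hg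
    set f : (V → Option V) × (V → Deg l1 l2) :=
      (fun x => if g.1 x = some r then none else g.1 x, Function.update g.2 r 0) with hfdef
    have hfp : ∀ x y, f.1 x = some y ↔ g.1 x = some y ∧ y ≠ r := by
      intro x y
      simp only [hfdef]
      split_ifs with hx
      · rw [hx]
        constructor
        · intro h; cases h
        · rintro ⟨h1, h2⟩; exact absurd (Option.some.inj h1).symm h2
      · exact ⟨fun h => ⟨h, fun e => hx (e ▸ h)⟩, fun h => h.1⟩
    have hf : f ∈ forests m (A.erase r) := by
      rw [mem_forests, mem_decs]
      refine ⟨⟨fun x hx => ?_, fun x hx => ?_⟩, fun x y hxy => ?_, h,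
        fun x y hxy => hg2 x y ((hfp x y).1 hxy).1⟩
      · simp only [hfdef, Function.update_of_ne (Finset.ne_of_mem_erase hx)]
        exact hd1 x (Finset.mem_of_mem_erase hx)
      · by_cases hxr : x = r
        · subst hxr; simp [hfdef]
        · simp only [hfdef, Function.update_of_ne hxr]
          exact hd2 x fun h => hx (Finset.mem_erase.2 ⟨hxr, h⟩)
      · obtain ⟨h1, h2⟩ := (hfp x y).1 hxy
        refine ⟨Finset.mem_erase.2 ⟨?_, (hg1 x y h1).1⟩, Finset.mem_erase.2 ⟨h2, (hg1 x y h1).2⟩⟩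
        rintro rfl
        rw [hr1] at h1; cases h1
    refine ⟨⟨r, g.2 r, f⟩, ?_, ?_⟩
    · simp only [Finset.mem_sigma, Finset.mem_product]
      exact ⟨hr, hd1 r hr, hf⟩
    · refine Prod.ext (funext fun x => Option.ext fun y => ?_) (funext fun x => ?_)
      · change (rootF A r (g.2 r) f).1 x = some y ↔ _
        rw [rootF_par_iff (mem_forests.1 hf).2, hfp]
        constructor
        · rintro (h1 | ⟨h1, h2, rfl⟩)
          · exact h1.1
          · by_contra h3
            simp only [hfdef] at h2
            rw [if_neg h3] at h2
            exact Finset.ne_of_mem_erase h1 (hr2 x (Finset.mem_of_mem_erase h1) h2)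
        · intro h1
          by_cases hy : y = r
          · subst hy
            refine Or.inr ⟨Finset.mem_erase.2 ⟨?_, (hg1 x y h1).1⟩, ?_, rfl⟩
            · rintro rfl
              rw [hr1] at h1; cases h1
            · simp [hfdef, h1]
          · exact Or.inl ⟨h1, hy⟩
      · change (rootF A r (g.2 r) f).2 x = _
        by_cases hx : x = r
        · subst hx; simp [rootF]
        · simp [rootF, hx, hfdef]
  · intro _ _
    rfl

lemma pscale_smul_tmono (p : Deg l1 l2 → ℂ) (c : ℂ) (d : Deg l1 l2) :
    pscale p (c • tmono m d) = (p d * c) • tmono m d :=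
  trunc_ext fun e he => by
    rw [tcoeff_pscale _ _ he, map_smul, map_smul, tcoeff_tmono he]
    split_ifs with h
    · subst h; simp
    · simp

/-- `pscale` as a linear map. -/
def pscaleLin (p : Deg l1 l2 → ℂ) : Trunc m →ₗ[ℂ] Trunc m where
  toFun := pscale p
  map_add' x y := trunc_ext fun d hd => by
    rw [map_add, tcoeff_pscale _ _ hd, tcoeff_pscale _ _ hd, tcoeff_pscale _ _ hd, map_add, mul_add]
  map_smul' c x := trunc_ext fun d hd => by
    rw [RingHom.id_apply, map_smul, tcoeff_pscale _ _ hd, tcoeff_pscale _ _ hd, map_smul, smul_eq_mul,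
      smul_eq_mul]
    ring

lemma pscaleLin_apply (p : Deg l1 l2 → ℂ) (x : Trunc m) : pscaleLin p x = pscale p x := rfl

/-- The sum over trees in terms of the sums over the forests above the root. -/
theorem treeSum_eq (A : Finset V) :
    treeSum m κ K A = ∑ r ∈ A, ∑ b ∈ posIic m,
      pscale (κ b) (tmono m b * forestSum m (K b) K (A.erase r)) := by
  rw [treeSum, sum_trees]
  refine Finset.sum_congr rfl fun r hr => Finset.sum_congr rfl fun b hb => ?_
  rw [forestSum, Finset.mul_sum, ← pscaleLin_apply, map_sum]
  refine Finset.sum_congr rfl fun f hf => ?_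
  rw [pscaleLin_apply, mul_smul_comm, ← tmono_add, pscale_smul_tmono, sum_rootF hr,
    forestWeight_rootF hr hb hf]

/-! ### Relabelling -/

/-- A decorated forest relabelled along an embedding. -/
def mapF (e : V ↪ V') (f : (V → Option V) × (V → Deg l1 l2)) :
    (V' → Option V') × (V' → Deg l1 l2) :=
  (Function.extend e (fun x => (f.1 x).map e) fun _ => none, Function.extend e f.2 fun _ => 0)

lemma mapF_par_apply (e : V ↪ V') (f : (V → Option V) × (V → Deg l1 l2)) (x : V) :
    (mapF e f).1 (e x) = (f.1 x).map e := by
  simp only [mapF, e.injective.extend_apply]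

lemma mapF_dec_apply (e : V ↪ V') (f : (V → Option V) × (V → Deg l1 l2)) (x : V) :
    (mapF e f).2 (e x) = f.2 x := by
  simp only [mapF, e.injective.extend_apply]

lemma mapF_par_apply' {e : V ↪ V'} {f : (V → Option V) × (V → Deg l1 l2)} {x : V'}
    (hx : ¬ ∃ z, e z = x) : (mapF e f).1 x = none := by
  simp only [mapF, Function.extend_apply' _ _ _ hx]

lemma mapF_dec_apply' {e : V ↪ V'} {f : (V → Option V) × (V → Deg l1 l2)} {x : V'}
    (hx : ¬ ∃ z, e z = x) : (mapF e f).2 x = 0 := by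
  simp only [mapF, Function.extend_apply' _ _ _ hx]

lemma mapF_par_iff (e : V ↪ V') (f : (V → Option V) × (V → Deg l1 l2)) {x' y' : V'} :
    (mapF e f).1 x' = some y' ↔ ∃ x y, x' = e x ∧ y' = e y ∧ f.1 x = some y := by
  by_cases hx : ∃ x, e x = x'
  · obtain ⟨x, rfl⟩ := hx
    rw [mapF_par_apply, Option.map_eq_some_iff]
    constructor
    · rintro ⟨y, h1, h2⟩
      exact ⟨x, y, rfl, h2.symm, h1⟩
    · rintro ⟨z, y, h1, h2, h3⟩
      rw [e.injective h1]
      exact ⟨y, h3, h2.symm⟩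
  · constructor
    · intro h
      have h1 : (mapF e f).1 x' = none := mapF_par_apply' hx
      rw [h1] at h; cases h
    · rintro ⟨x, _, h, _⟩
      exact absurd ⟨x, h.symm⟩ hx

lemma desc_mapF (e : V ↪ V') (f : (V → Option V) × (V → Deg l1 l2)) (v : V) :
    desc (mapF e f).1 (e v) = (desc f.1 v).map e := by
  ext x'
  rw [mem_desc, Finset.mem_map]
  constructor
  · intro h
    induction h using Relation.ReflTransGen.head_induction_on with
    | refl => exact ⟨v, self_mem_desc _ _, rfl⟩
    | head h _ ih =>
      obtain ⟨y, hy, rfl⟩ := ih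
      obtain ⟨x, z, rfl, h2, h3⟩ := (mapF_par_iff e f).1 h
      rw [← e.injective h2] at h3
      exact ⟨x, mem_desc_iff.2 (Or.inr ⟨y, h3, hy⟩), rfl⟩
  · rintro ⟨x, hx, rfl⟩
    exact (mem_desc.1 hx).lift e fun a b h => (mapF_par_iff e f).2 ⟨a, b, rfl, rfl, h⟩

lemma sum_mapF (e : V ↪ V') (f : (V → Option V) × (V → Deg l1 l2)) (A : Finset V) :
    ∑ x ∈ A.map e, (mapF e f).2 x = ∑ x ∈ A, f.2 x := by
  rw [Finset.sum_map]
  exact Finset.sum_congr rfl fun x _ => mapF_dec_apply e f x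

lemma forestWeight_mapF (e : V ↪ V') (f : (V → Option V) × (V → Deg l1 l2)) (A : Finset V) :
    forestWeight κ K (A.map e) (mapF e f) = forestWeight κ K A f := by
  unfold forestWeight
  rw [Finset.prod_map]
  refine Finset.prod_congr rfl fun w _ => ?_
  have h1 : subSum (mapF e f) (e w) = subSum f w := by
    rw [subSum, desc_mapF, sum_mapF, subSum]
  rw [h1, mapF_par_apply, mapF_dec_apply]
  cases hp : f.1 w with
  | none => rfl
  | some u => simp only [Option.map_some, mapF_dec_apply]

theorem forestSum_map (e : V ↪ V') (A : Finset V) :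
    forestSum m κ K (A.map e) = forestSum m κ K A := by
  symm
  refine Finset.sum_bij (fun f _ => mapF e f) ?_ ?_ ?_ ?_
  · intro f hf
    rw [mem_forests, mem_decs] at hf ⊢
    obtain ⟨⟨hd1, hd2⟩, hf1, h, hf2⟩ := hf
    refine ⟨⟨fun x hx => ?_, fun x hx => ?_⟩, fun x y hxy => ?_, Function.extend e h fun _ => 0,
      fun x y hxy => ?_⟩
    · obtain ⟨z, hz, rfl⟩ := Finset.mem_map.1 hx
      rw [mapF_dec_apply]; exact hd1 z hz
    · by_cases hx' : ∃ z, e z = x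
      · obtain ⟨z, rfl⟩ := hx'
        rw [mapF_dec_apply]
        exact hd2 z fun h => hx (Finset.mem_map_of_mem e h)
      · exact mapF_dec_apply' hx'
    · obtain ⟨a, b, rfl, rfl, h1⟩ := (mapF_par_iff e f).1 hxy
      exact ⟨Finset.mem_map_of_mem e (hf1 a b h1).1, Finset.mem_map_of_mem e (hf1 a b h1).2⟩
    · obtain ⟨a, b, rfl, rfl, h1⟩ := (mapF_par_iff e f).1 hxy
      rw [e.injective.extend_apply, e.injective.extend_apply]
      exact hf2 a b h1
  · intro f _ f' _ he
    refine Prod.ext (funext fun x => ?_) (funext fun x => ?_)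
    · refine Option.map_injective e.injective ?_
      rw [← mapF_par_apply, ← mapF_par_apply, he]
    · rw [← mapF_dec_apply e, ← mapF_dec_apply e, he]
  · intro g hg
    rw [mem_forests, mem_decs] at hg
    obtain ⟨⟨hd1, hd2⟩, hg1, h, hg2⟩ := hg
    set f : (V → Option V) × (V → Deg l1 l2) :=
      (fun x => (g.1 (e x)).bind fun y => if h : ∃ z, e z = y then some h.choose else none,
        fun x => g.2 (e x)) with hfdef
    have hfp : ∀ x y, f.1 x = some y ↔ g.1 (e x) = some (e y) := by
      intro x y
      simp only [hfdef, Option.bind_eq_some_iff]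
      constructor
      · rintro ⟨z, h1, h2⟩
        split_ifs at h2 with h3
        rw [h1, ← h3.choose_spec, Option.some.inj h2]
      · intro h1
        refine ⟨e y, h1, ?_⟩
        have h2 : ∃ z, e z = e y := ⟨y, rfl⟩
        rw [dif_pos h2, e.injective h2.choose_spec]
    refine ⟨f, ?_, ?_⟩
    · rw [mem_forests, mem_decs]
      refine ⟨⟨fun x hx => hd1 _ (Finset.mem_map_of_mem e hx), fun x hx => hd2 _ fun h => hx ?_⟩,
        fun x y hxy => ?_, fun x => h (e x), fun x y hxy => hg2 _ _ ((hfp x y).1 hxy)⟩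
      · simpa using h
      · have := hg1 _ _ ((hfp x y).1 hxy)
        simpa using this
    · refine Prod.ext (funext fun x => Option.ext fun y => ?_) (funext fun x => ?_)
      · rw [mapF_par_iff]
        constructor
        · rintro ⟨a, b, rfl, rfl, h1⟩
          exact (hfp a b).1 h1
        · intro h1
          obtain ⟨a, _, rfl⟩ := Finset.mem_map.1 (hg1 x y h1).1
          obtain ⟨b, _, rfl⟩ := Finset.mem_map.1 (hg1 _ y h1).2
          exact ⟨a, b, rfl, rfl, (hfp a b).2 h1⟩
      · by_cases hx' : ∃ z, e z = x
        · obtain ⟨z, rfl⟩ := hx'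
          rw [mapF_dec_apply]
        · rw [hd2 x fun h => hx' ((Finset.mem_map.1 h).imp fun a ha => ha.2)]
          exact mapF_dec_apply' hx'
  · intro f _
    rw [forestWeight_mapF, sum_mapF]

/-- The sum over the forests with `n` labelled vertices. -/
def forestNum (m : Deg l1 l2) (κ : Deg l1 l2 → Deg l1 l2 → ℂ)
    (K : Deg l1 l2 → Deg l1 l2 → Deg l1 l2 → ℂ) (n : ℕ) : Trunc m :=
  forestSum m κ K (Finset.univ : Finset (Fin n))

/-- The sum over the trees with `n` labelled vertices. -/
def treeNum (m : Deg l1 l2) (κ : Deg l1 l2 → Deg l1 l2 → ℂ)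
    (K : Deg l1 l2 → Deg l1 l2 → Deg l1 l2 → ℂ) (n : ℕ) : Trunc m :=
  treeSum m κ K (Finset.univ : Finset (Fin n))

lemma forestSum_eq_num (A : Finset V) : forestSum m κ K A = forestNum m κ K A.card := by
  rw [forestNum, ← forestSum_map (A.equivFin.symm.toEmbedding.trans (Function.Embedding.subtype _))]
  congr 1
  ext x
  simp only [Finset.mem_map, Finset.mem_univ, true_and, Function.Embedding.trans_apply]
  constructor
  · intro hx
    exact ⟨A.equivFin ⟨x, hx⟩, by simp⟩
  · rintro ⟨a, rfl⟩
    exact (A.equivFin.symm a).2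

lemma treeSum_card (A : Finset V) : treeSum m κ K A = (A.card : ℂ) • ∑ b ∈ posIic m,
    pscale (κ b) (tmono m b * forestNum m (K b) K (A.card - 1)) := by
  rw [treeSum_eq, Finset.sum_congr rfl fun r hr => ?_, Finset.sum_const, ← Nat.cast_smul_eq_nsmul ℂ]
  refine Finset.sum_congr rfl fun b _ => ?_
  rw [forestSum_eq_num, Finset.card_erase_of_mem hr]

lemma treeNum_eq (n : ℕ) : treeNum m κ K n = (n : ℂ) • ∑ b ∈ posIic m,
    pscale (κ b) (tmono m b * forestNum m (K b) K (n - 1)) := by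
  rw [treeNum, treeSum_card, Finset.card_univ, Fintype.card_fin]

lemma treeSum_eq_num (A : Finset V) : treeSum m κ K A = treeNum m κ K A.card := by
  rw [treeSum_card, treeNum_eq]

lemma tderiv_forestSum_univ (l : Deg l1 l2 →+ ℂ) :
    tderiv m l (forestSum m κ K (Finset.univ : Finset V)) =
      ∑ j ∈ Finset.range (Fintype.card V + 1), ((Fintype.card V).choose j : ℂ) •
        (tderiv m l (treeNum m κ K j) * forestNum m κ K (Fintype.card V - j)) := by
  rw [tderiv_forestSum]
  have h1 : ∀ C ∈ (Finset.univ : Finset V).powerset,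
      tderiv m l (treeSum m κ K C) * forestSum m κ K (Finset.univ \ C) =
      (fun j => tderiv m l (treeNum m κ K j) * forestNum m κ K (Fintype.card V - j)) C.card := by
    intro C _
    rw [treeSum_eq_num, forestSum_eq_num, Finset.card_sdiff_of_subset (Finset.subset_univ C),
      Finset.card_univ]
  rw [Finset.sum_congr rfl h1,
    Finset.sum_powerset_apply_card
      (fun j => tderiv m l (treeNum m κ K j) * forestNum m κ K (Fintype.card V - j)),
    Finset.card_univ]
  refine Finset.sum_congr rfl fun j _ => ?_
  rw [Nat.cast_smul_eq_nsmul]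

lemma tderiv_forestNum (l : Deg l1 l2 →+ ℂ) (n : ℕ) :
    tderiv m l (forestNum m κ K n) = ∑ j ∈ Finset.range (n + 1),
      (n.choose j : ℂ) • (tderiv m l (treeNum m κ K j) * forestNum m κ K (n - j)) := by
  rw [forestNum, tderiv_forestSum_univ, Fintype.card_fin]

end ForestCount


/-! ### Generating functions of forests -/

section ForestGen

open Classical

variable {l1 l2 : ℕ} {m : Deg l1 l2}
  {κ : Deg l1 l2 → Deg l1 l2 → ℂ} {K : Deg l1 l2 → Deg l1 l2 → Deg l1 l2 → ℂ}

lemma le_degree_sum {V : Type*} [Fintype V] {A : Finset V} {dec : V → Deg l1 l2}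
    (h : dec ∈ decs m A) : A.card ≤ (∑ x ∈ A, dec x).degree := by
  have h1 : (∑ x ∈ A, dec x).degree = ∑ x ∈ A, (dec x).degree := map_sum Finsupp.degree _ _
  rw [h1, Finset.card_eq_sum_ones]
  exact Finset.sum_le_sum fun x hx =>
    degree_pos_of_ne (mem_posIic.1 ((mem_decs.1 h).1 x hx)).1

lemma forestNum_mem (n : ℕ) : forestNum m κ K n ∈ tfilt m n := by
  refine Ideal.sum_mem _ fun f hf => smul_mem_tfilt _ (tmono_mem_tfilt ?_)
  have := le_degree_sum (mem_forests.1 hf).1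
  rwa [Finset.card_univ, Fintype.card_fin] at this

lemma treeNum_mem (n : ℕ) : treeNum m κ K n ∈ tfilt m n := by
  refine Ideal.sum_mem _ fun f hf => smul_mem_tfilt _ (tmono_mem_tfilt ?_)
  have := le_degree_sum (mem_trees.1 hf).1
  rwa [Finset.card_univ, Fintype.card_fin] at this

lemma forestNum_zero : forestNum m κ K 0 = 1 := by
  have h1 : forests m (Finset.univ : Finset (Fin 0)) = {(Fin.elim0, Fin.elim0)} := by
    ext f
    rw [mem_forests, mem_decs, Finset.mem_singleton]
    constructor
    · intro _
      exact Prod.ext (funext fun x => x.elim0) (funext fun x => x.elim0)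
    · rintro rfl
      exact ⟨⟨fun x => x.elim0, fun x => x.elim0⟩, fun x => x.elim0, fun _ => 0, fun x => x.elim0⟩
  rw [forestNum, forestSum, h1, Finset.sum_singleton]
  simp [forestWeight, tmono_zero]

lemma treeNum_zero : treeNum m κ K 0 = 0 := by
  rw [treeNum_eq, Nat.cast_zero, zero_smul]

lemma tderiv_mem (l : Deg l1 l2 →+ ℂ) {x : Trunc m} {n : ℕ} (hx : x ∈ tfilt m n) :
    tderiv m l x ∈ tfilt m n := by
  intro d hd
  by_cases h : d ≤ m
  · rw [tcoeff_tderiv h, hx d hd, mul_zero]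
  · exact tcoeff_of_not_le h _

/-- The exponential generating function of the forests. -/
def forestGen (m : Deg l1 l2) (κ : Deg l1 l2 → Deg l1 l2 → ℂ)
    (K : Deg l1 l2 → Deg l1 l2 → Deg l1 l2 → ℂ) : Trunc m :=
  ∑ n ∈ Finset.range (m.degree + 1), ((n.factorial : ℂ)⁻¹) • forestNum m κ K n

/-- The exponential generating function of the trees. -/
def treeGen (m : Deg l1 l2) (κ : Deg l1 l2 → Deg l1 l2 → ℂ)
    (K : Deg l1 l2 → Deg l1 l2 → Deg l1 l2 → ℂ) : Trunc m :=
  ∑ n ∈ Finset.range (m.degree + 1), ((n.factorial : ℂ)⁻¹) • treeNum m κ K n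

lemma treeGen_mem : treeGen m κ K ∈ tfilt m 1 := by
  refine Ideal.sum_mem _ fun n _ => smul_mem_tfilt _ ?_
  rcases n with _ | n
  · rw [treeNum_zero]; exact Ideal.zero_mem _
  · exact tfilt_anti (by omega) (treeNum_mem (n + 1))

lemma tderiv_forestGen (l : Deg l1 l2 →+ ℂ) :
    tderiv m l (forestGen m κ K) = tderiv m l (treeGen m κ K) * forestGen m κ K := by
  set N := m.degree
  set a : ℕ → Trunc m := fun j => ((j.factorial : ℂ)⁻¹) • tderiv m l (treeNum m κ K j) with ha
  set w : ℕ → Trunc m := fun j => ((j.factorial : ℂ)⁻¹) • forestNum m κ K j with hw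
  set S := Finset.range (N + 1) ×ˢ Finset.range (N + 1)
  have h1 : tderiv m l (forestGen m κ K) =
      ∑ n ∈ Finset.range (N + 1), ∑ p ∈ S with p.1 + p.2 = n, a p.1 * w p.2 := by
    rw [forestGen, map_sum]
    refine Finset.sum_congr rfl fun n hn => ?_
    have hn' := Finset.mem_range.1 hn
    have h2 : S.filter (fun p => p.1 + p.2 = n) = Finset.HasAntidiagonal.antidiagonal n := by
      ext p
      simp only [S, Finset.mem_filter, Finset.mem_product, Finset.mem_range,
        Finset.HasAntidiagonal.mem_antidiagonal]
      omega
    rw [h2, Finset.Nat.sum_antidiagonal_eq_sum_range_succ (fun i j => a i * w j),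
      Derivation.map_smul, tderiv_forestNum, Finset.smul_sum]
    refine Finset.sum_congr rfl fun j hj => ?_
    have hj' : j ≤ n := by have := Finset.mem_range.1 hj; omega
    simp only [ha, hw]
    rw [smul_mul_smul_comm, smul_smul]
    congr 1
    have e1 : (n.factorial : ℂ) ≠ 0 := by exact_mod_cast n.factorial_ne_zero
    have e2 : (j.factorial : ℂ) ≠ 0 := by exact_mod_cast j.factorial_ne_zero
    have e3 : ((n - j).factorial : ℂ) ≠ 0 := by exact_mod_cast (n - j).factorial_ne_zero
    have e4 : ((n.choose j : ℕ) : ℂ) * j.factorial * (n - j).factorial = n.factorial := by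
      exact_mod_cast Nat.choose_mul_factorial_mul_factorial hj'
    rw [← e4]
    have e5 : ((n.choose j : ℕ) : ℂ) ≠ 0 := by
      intro h0
      rw [h0, zero_mul, zero_mul] at e4
      exact e1 e4.symm
    field_simp
  have h2 : tderiv m l (treeGen m κ K) * forestGen m κ K = ∑ p ∈ S, a p.1 * w p.2 := by
    rw [treeGen, forestGen, map_sum, Finset.sum_mul_sum, ← Finset.sum_product']
    refine Finset.sum_congr rfl fun p _ => ?_
    rw [Derivation.map_smul]
  have h3 : ∑ p ∈ S, a p.1 * w p.2 = ∑ p ∈ S with p.1 + p.2 ≤ N, a p.1 * w p.2 := by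
    rw [Finset.sum_filter]
    refine Finset.sum_congr rfl fun p _ => ?_
    split_ifs with h
    · rfl
    · refine eq_zero_of_mem_tfilt (n := p.1 + p.2) (by omega) (mul_mem_tfilt ?_ ?_)
      · exact smul_mem_tfilt _ (tderiv_mem l (treeNum_mem _))
      · exact smul_mem_tfilt _ (forestNum_mem _)
  have h4 : ∑ p ∈ S with p.1 + p.2 ≤ N, a p.1 * w p.2 =
      ∑ n ∈ Finset.range (N + 1), ∑ p ∈ S with p.1 + p.2 = n, a p.1 * w p.2 := by
    rw [← Finset.sum_fiberwise_of_maps_to (s := S.filter fun p => p.1 + p.2 ≤ N)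
      (t := Finset.range (N + 1)) (g := fun p => p.1 + p.2)]
    · refine Finset.sum_congr rfl fun n hn => Finset.sum_congr ?_ fun _ _ => rfl
      have hn' := Finset.mem_range.1 hn
      ext p
      simp only [Finset.mem_filter]
      constructor
      · rintro ⟨⟨h1, _⟩, h2⟩; exact ⟨h1, h2⟩
      · rintro ⟨h1, h2⟩; exact ⟨⟨h1, by omega⟩, h2⟩
    · intro p hp
      have := (Finset.mem_filter.1 hp).2
      exact Finset.mem_range.2 (by omega)
  rw [h1, h2, h3, h4]

lemma forestGen_sub_one_mem : forestGen m κ K - 1 ∈ tfilt m 1 := by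
  rw [forestGen, Finset.sum_range_succ', forestNum_zero]
  simp only [Nat.factorial_zero, Nat.cast_one, inv_one, one_smul, add_sub_cancel_right]
  exact Ideal.sum_mem _ fun n _ => smul_mem_tfilt _ (tfilt_anti (by omega) (forestNum_mem (n + 1)))

/-- The total degree. -/
def totalDeg (l1 l2 : ℕ) : Deg l1 l2 →+ ℂ :=
  (Nat.castAddMonoidHom ℂ).comp (Finsupp.degree : Deg l1 l2 →+ ℕ)

/-- The exponential formula. -/
theorem forestGen_eq_exp : forestGen m κ K = IsNilpotent.exp (treeGen m κ K) := by
  have hT := treeGen_mem (m := m) (κ := κ) (K := K)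
  have hT' : -treeGen m κ K ∈ tfilt m 1 := (tfilt m 1).neg_mem hT
  set y := forestGen m κ K * IsNilpotent.exp (-treeGen m κ K) with hy
  have h1 : tderiv m (totalDeg l1 l2) y = 0 := by
    rw [hy, Derivation.leibniz, tderiv_exp _ hT', tderiv_forestGen, map_neg, smul_eq_mul,
      smul_eq_mul]
    ring
  have hinv : IsNilpotent.exp (-treeGen m κ K) * IsNilpotent.exp (treeGen m κ K) = 1 := by
    rw [← texp_add hT' hT, neg_add_cancel, IsNilpotent.exp_zero]
  have h2 : y - 1 ∈ tfilt m 1 := by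
    have h3 : y - 1 = (forestGen m κ K - 1) * IsNilpotent.exp (-treeGen m κ K) +
        (IsNilpotent.exp (-treeGen m κ K) - 1) := by rw [hy]; ring
    rw [h3]
    exact Ideal.add_mem _ (Ideal.mul_mem_right _ _ forestGen_sub_one_mem) (texp_sub_one_mem hT')
  have h3 : y = 1 := by
    refine sub_eq_zero.1 (trunc_ext fun d hd => ?_)
    rw [map_zero]
    by_cases h0 : d = 0
    · exact h2 d (by rw [h0]; simp)
    · have h4 := congrArg (tcoeff d) h1
      rw [tcoeff_tderiv hd, map_zero] at h4
      have h5 : totalDeg l1 l2 d ≠ 0 := by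
        have := degree_pos_of_ne h0
        simp only [totalDeg, AddMonoidHom.comp_apply, Nat.coe_castAddMonoidHom]
        exact_mod_cast (by omega : d.degree ≠ 0)
      rw [map_sub, tcoeff_one hd, if_neg h0, sub_zero]
      exact (mul_eq_zero.1 h4).resolve_left h5
  calc forestGen m κ K = y * IsNilpotent.exp (treeGen m κ K) := by
        rw [hy, mul_assoc, hinv, mul_one]
    _ = _ := by rw [h3, one_mul]

theorem treeGen_eq : treeGen m κ K =
    ∑ b ∈ posIic m, pscale (κ b) (tmono m b * forestGen m (K b) K) := by
  rw [treeGen, Finset.sum_range_succ', treeNum_zero, smul_zero, add_zero]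
  have h1 : ∀ n, (((n + 1).factorial : ℂ)⁻¹) • treeNum m κ K (n + 1) =
      ∑ b ∈ posIic m, pscale (κ b) (tmono m b * ((n.factorial : ℂ)⁻¹ • forestNum m (K b) K n)) := by
    intro n
    rw [treeNum_eq, smul_smul, Nat.add_sub_cancel, Finset.smul_sum]
    refine Finset.sum_congr rfl fun b _ => ?_
    rw [mul_smul_comm, ← pscaleLin_apply, ← pscaleLin_apply, map_smul, Nat.factorial_succ]
    congr 1
    have : (n.factorial : ℂ) ≠ 0 := by exact_mod_cast n.factorial_ne_zero
    have h2 : ((n : ℂ) + 1) ≠ 0 := by exact_mod_cast Nat.succ_ne_zero n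
    push_cast
    field_simp
  rw [Finset.sum_congr rfl fun n _ => h1 n, Finset.sum_comm]
  refine Finset.sum_congr rfl fun b hb => ?_
  rw [forestGen, Finset.sum_range_succ, mul_add, Finset.mul_sum]
  have h2 : tmono m b * (((m.degree.factorial : ℂ)⁻¹) • forestNum m (K b) K m.degree) = 0 := by
    refine eq_zero_of_mem_tfilt (n := 1 + m.degree) (by omega) (mul_mem_tfilt (tmono_mem_one hb) ?_)
    exact smul_mem_tfilt _ (forestNum_mem _)
  rw [h2, add_zero, ← pscaleLin_apply, map_sum]
  rfl

/-- The factor of an edge from a vertex with decoration `b` to a vertex with decoration `b'`, above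
which lies a subtree of charge `d`. -/
def edgeCoef (m : Deg l1 l2) (c : Deg l1 l2 → ℂ) (ε : Deg l1 l2 → Deg l1 l2 → ℂ)
    (b b' d : Deg l1 l2) : ℂ := c b' * pr b' b * (upScalar m d + ε b' b)

/-- The solution of the scalar model as a sum over forests. -/
theorem scalarSol_eq_forestGen {c : Deg l1 l2 → ℂ} {ε : Deg l1 l2 → Deg l1 l2 → ℂ}
    {b : Deg l1 l2} (hb : b ∈ posIic m) :
    scalarSol m c ε b = tmono m b * forestGen m (edgeCoef m c ε b) (edgeCoef m c ε) := by
  refine IsSystemSol.unique (fun _ _ _ _ => ((pscale_filtered _).add (Filtered.id.smul _)).smul _)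
    (fun _ hb => tmono_mem_one hb) (scalarSol_spec m c ε)
    (X' := fun b => tmono m b * forestGen m (edgeCoef m c ε b) (edgeCoef m c ε))
    ⟨fun b hb => Ideal.mul_mem_right _ _ (tmono_mem_one hb), fun b hb => ?_⟩ hb
  change tmono m b * _ = tmono m b * _
  rw [forestGen_eq_exp, treeGen_eq]
  congr 2
  refine Finset.sum_congr rfl fun b' _ => trunc_ext fun d hd => ?_
  rw [tcoeff_pscale _ _ hd, map_smul, map_add, map_smul, tcoeff_pscale _ _ hd, edgeCoef, smul_eq_mul,
    smul_eq_mul]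
  ring

/-- The coefficient of the scalar model as a sum over labelled trees. -/
theorem sum_scalarSol_eq {c : Deg l1 l2 → ℂ} {ε : Deg l1 l2 → Deg l1 l2 → ℂ} (κ₀ : Deg l1 l2 → ℂ) :
    ∑ b ∈ posIic m, κ₀ b * tcoeff m (scalarSol m c ε b) =
      ∑ n ∈ Finset.range (m.degree + 1), ((n.factorial : ℂ)⁻¹) *
        ∑ f ∈ trees m (Finset.univ : Finset (Fin n)) with ∑ x, f.2 x = m,
          forestWeight (fun b _ => κ₀ b) (edgeCoef m c ε) Finset.univ f := by
  have h1 := congrArg (tcoeff m) (treeGen_eq (m := m) (κ := fun b _ => κ₀ b) (K := edgeCoef m c ε))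
  rw [map_sum] at h1
  have h2 : ∀ b ∈ posIic m, κ₀ b * tcoeff m (scalarSol m c ε b) = tcoeff m
      (pscale (fun _ => κ₀ b) (tmono m b * forestGen m (edgeCoef m c ε b) (edgeCoef m c ε))) := by
    intro b hb
    rw [tcoeff_pscale _ _ le_rfl, scalarSol_eq_forestGen hb]
  rw [Finset.sum_congr rfl h2, ← h1, treeGen, map_sum]
  refine Finset.sum_congr rfl fun n _ => ?_
  rw [map_smul, smul_eq_mul, treeNum, treeSum, map_sum, Finset.sum_filter]
  congr 1
  refine Finset.sum_congr rfl fun f _ => ?_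
  rw [map_smul, tcoeff_tmono le_rfl]
  by_cases h : ∑ x, f.2 x = m
  · rw [if_pos h, if_pos h.symm, smul_eq_mul, mul_one]
  · rw [if_neg h, if_neg (Ne.symm h), smul_zero]

end ForestGen


/-! ### Isomorphism classes of trees -/

section Classes

open Classical

variable {l1 l2 : ℕ} {m : Deg l1 l2}

/-- The degree with the given coordinates. -/
def degOf (a : Lat l1 l2) : Deg l1 l2 := Finsupp.equivFunOnFinite.symm fun v => (a v).toNat

lemma toLat_degOf {a : Lat l1 l2} (h : ∀ v, 0 ≤ a v) : toLat (degOf a) = a := by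
  funext v
  simp [toLat, degOf, h v]

lemma degOf_toLat (d : Deg l1 l2) : degOf (toLat d) = d := by
  ext v
  simp [toLat, degOf]

/-- The decorated forest underlying a labelled tree. -/
def LTree.toF (T : LTree l1 l2) : (Fin T.n → Option (Fin T.n)) × (Fin T.n → Deg l1 l2) :=
  (T.par, fun v => degOf (T.dec v))

lemma LTree.isTree (T : LTree l1 l2) : IsTree Finset.univ T.par := by
  refine ⟨⟨fun _ _ _ => ⟨Finset.mem_univ _, Finset.mem_univ _⟩, fun v => Nat.find (T.reach v),
    fun x y hxy => ?_⟩, T.root, Finset.mem_univ _, (T.par_eq_none _).2 rfl,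
    fun x _ hx => (T.par_eq_none x).1 hx⟩
  have h1 := Nat.find_spec (T.reach x)
  cases hn : Nat.find (T.reach x) with
  | zero =>
    rw [hn] at h1
    have h2 : x = T.root := Option.some.inj h1
    have h3 := (T.par_eq_none x).2 h2
    rw [hxy] at h3; cases h3
  | succ k =>
    rw [hn, Function.iterate_succ_apply] at h1
    have h2 : (some x).bind T.par = some y := hxy
    rw [h2] at h1
    have := Nat.find_min' (T.reach y) h1
    simp only [hn]
    omega

lemma iterate_of_mem_desc {V : Type*} [Fintype V] {par : V → Option V} {v r : V}
    (h : v ∈ desc par r) : ∃ k : ℕ, (fun o : Option V => o.bind par)^[k] (some v) = some r := by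
  rw [mem_desc] at h
  induction h using Relation.ReflTransGen.head_induction_on with
  | refl => exact ⟨0, rfl⟩
  | @head a c h _ ih =>
    obtain ⟨k, hk⟩ := ih
    refine ⟨k + 1, ?_⟩
    rw [Function.iterate_succ_apply]
    have h2 : (some a).bind par = some c := h
    rw [h2, hk]

/-- The labelled tree with a given underlying decorated forest. -/
def LTree.ofF {n : ℕ} (f : (Fin n → Option (Fin n)) × (Fin n → Deg l1 l2))
    (h : IsTree Finset.univ f.1) : LTree l1 l2 where
  n := n
  root := h.2.choose
  par := f.1
  dec v := toLat (f.2 v)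
  par_eq_none v := ⟨fun hv => h.2.choose_spec.2.2 v (Finset.mem_univ v) hv,
    fun hv => hv ▸ h.2.choose_spec.2.1⟩
  reach v := iterate_of_mem_desc (by
    rw [h.desc_root h.2.choose_spec.1 h.2.choose_spec.2.1]
    exact Finset.mem_univ v)

/-- Labelled decorated forests of all sizes. -/
abbrev LabF (l1 l2 : ℕ) : Type := Σ n : ℕ, (Fin n → Option (Fin n)) × (Fin n → Deg l1 l2)

/-- The labelled trees of charge `m`. -/
def labTrees (m : Deg l1 l2) : Finset (LabF l1 l2) :=
  (Finset.range (m.degree + 1)).sigma fun n =>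
    (trees m (Finset.univ : Finset (Fin n))).filter fun f => ∑ x, f.2 x = m

lemma mem_labTrees {n : ℕ} {f : (Fin n → Option (Fin n)) × (Fin n → Deg l1 l2)} :
    (⟨n, f⟩ : LabF l1 l2) ∈ labTrees m ↔
      (∀ x, f.2 x ≠ 0) ∧ IsTree Finset.univ f.1 ∧ ∑ x, f.2 x = m := by
  rw [labTrees, Finset.mem_sigma, Finset.mem_filter, mem_trees, mem_decs]
  constructor
  · rintro ⟨_, ⟨⟨h1, _⟩, h2⟩, h3⟩
    exact ⟨fun x => (mem_posIic.1 (h1 x (Finset.mem_univ x))).1, h2, h3⟩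
  · rintro ⟨h1, h2, h3⟩
    have h4 : f.2 ∈ decs m Finset.univ := mem_decs.2 ⟨fun x _ => mem_posIic.2 ⟨h1 x, by
      rw [← h3]
      exact Finset.single_le_sum (fun y _ => bot_le) (Finset.mem_univ x)⟩,
      fun x hx => absurd (Finset.mem_univ x) hx⟩
    have h5 := le_degree_sum h4
    rw [h3, Finset.card_univ, Fintype.card_fin] at h5
    exact ⟨Finset.mem_range.2 (Nat.lt_succ_of_le h5), ⟨mem_decs.1 h4, h2⟩, h3⟩

/-- The tree with one vertex. -/
def LTree.point (l1 l2 : ℕ) : LTree l1 l2 where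
  n := 1
  root := 0
  par _ := none
  dec _ := 0
  par_eq_none v := by simp [Subsingleton.elim v 0]
  reach v := ⟨0, by simp [Subsingleton.elim v 0]⟩

/-- The isomorphism class of a labelled tree. -/
def labClass (x : LabF l1 l2) : TreeClass l1 l2 :=
  if h : IsTree Finset.univ x.2.1 then Quotient.mk _ (LTree.ofF x.2 h)
  else Quotient.mk _ (LTree.point l1 l2)

lemma labClass_eq_iff {n : ℕ} {f : (Fin n → Option (Fin n)) × (Fin n → Deg l1 l2)}
    (h : IsTree Finset.univ f.1) {T : LTree l1 l2} :
    labClass ⟨n, f⟩ = Quotient.mk _ T ↔ ∃ σ : Fin n ≃ Fin T.n,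
      (∀ v, T.par (σ v) = (f.1 v).map σ) ∧ ∀ v, T.dec (σ v) = toLat (f.2 v) := by
  rw [labClass, dif_pos h, Quotient.eq]
  rfl

lemma mapF_trans {V V' V'' : Type*} [Fintype V] [Fintype V'] [Fintype V''] (e : V ↪ V')
    (e' : V' ↪ V'') (f : (V → Option V) × (V → Deg l1 l2)) :
    mapF e' (mapF e f) = mapF (e.trans e') f := by
  refine Prod.ext (funext fun x => Option.ext fun y => ?_) (funext fun x => ?_)
  · simp only [mapF_par_iff]
    constructor
    · rintro ⟨_, _, rfl, rfl, a, b, rfl, rfl, h⟩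
      exact ⟨a, b, rfl, rfl, h⟩
    · rintro ⟨a, b, rfl, rfl, h⟩
      exact ⟨e a, e b, rfl, rfl, a, b, rfl, rfl, h⟩
  · by_cases hx : ∃ z, e' z = x
    · obtain ⟨z, rfl⟩ := hx
      rw [mapF_dec_apply]
      by_cases hz : ∃ a, e a = z
      · obtain ⟨a, rfl⟩ := hz
        rw [mapF_dec_apply]
        exact (mapF_dec_apply (e.trans e') f a).symm
      · rw [mapF_dec_apply' hz, mapF_dec_apply']
        rintro ⟨a, ha⟩
        exact hz ⟨a, e'.injective ha⟩
    · rw [mapF_dec_apply' hx, mapF_dec_apply']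
      rintro ⟨a, ha⟩
      exact hx ⟨e a, ha⟩

lemma mapF_eq_iff {n : ℕ} (σ : Equiv.Perm (Fin n))
    (f g : (Fin n → Option (Fin n)) × (Fin n → Deg l1 l2)) :
    mapF σ.toEmbedding f = g ↔
      (∀ v, g.1 (σ v) = (f.1 v).map σ) ∧ ∀ v, g.2 (σ v) = f.2 v := by
  constructor
  · rintro rfl
    exact ⟨fun v => mapF_par_apply σ.toEmbedding f v, fun v => mapF_dec_apply σ.toEmbedding f v⟩
  · rintro ⟨h1, h2⟩
    refine Prod.ext (funext fun x => ?_) (funext fun x => ?_)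
    · obtain ⟨v, rfl⟩ := σ.surjective x
      exact (mapF_par_apply σ.toEmbedding f v).trans (h1 v).symm
    · obtain ⟨v, rfl⟩ := σ.surjective x
      exact (mapF_dec_apply σ.toEmbedding f v).trans (h2 v).symm

/-- The number of relabellings of a decorated forest times the number of its automorphisms. -/
lemma card_relabel {n : ℕ} (f : (Fin n → Option (Fin n)) × (Fin n → Deg l1 l2)) :
    (Finset.univ.image fun σ : Equiv.Perm (Fin n) => mapF σ.toEmbedding f).card *
      Nat.card {σ : Equiv.Perm (Fin n) // mapF σ.toEmbedding f = f} = n.factorial := by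
  have h1 := Finset.card_eq_sum_card_image (fun σ : Equiv.Perm (Fin n) => mapF σ.toEmbedding f)
    Finset.univ
  rw [Finset.card_univ, Fintype.card_perm, Fintype.card_fin] at h1
  rw [h1, ← smul_eq_mul, ← Finset.sum_const]
  refine Finset.sum_congr rfl fun g hg => ?_
  obtain ⟨σ₀, _, rfl⟩ := Finset.mem_image.1 hg
  rw [Nat.card_eq_fintype_card, Fintype.card_subtype]
  refine Finset.card_bij (fun τ _ => σ₀ * τ) ?_ ?_ ?_
  · intro τ hτ
    rw [Finset.mem_filter] at hτ ⊢
    refine ⟨Finset.mem_univ _, ?_⟩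
    conv_rhs => rw [← hτ.2]
    rw [mapF_trans]
    rfl
  · intro a _ b _ h
    exact mul_left_cancel h
  · intro σ hσ
    rw [Finset.mem_filter] at hσ
    refine ⟨σ₀⁻¹ * σ, ?_, by simp⟩
    rw [Finset.mem_filter]
    refine ⟨Finset.mem_univ _, ?_⟩
    have h2 : mapF (σ₀⁻¹ * σ).toEmbedding f = mapF (σ₀⁻¹).toEmbedding (mapF σ.toEmbedding f) := by
      rw [mapF_trans]; rfl
    rw [h2, hσ.2, mapF_trans]
    refine (mapF_eq_iff (σ₀⁻¹ * σ₀) f f).2 ?_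
    simp

lemma mapF_mem_labTrees {n : ℕ} {f : (Fin n → Option (Fin n)) × (Fin n → Deg l1 l2)}
    (hf : (⟨n, f⟩ : LabF l1 l2) ∈ labTrees m) (σ : Equiv.Perm (Fin n)) :
    (⟨n, mapF σ.toEmbedding f⟩ : LabF l1 l2) ∈ labTrees m := by
  rw [mem_labTrees] at hf ⊢
  obtain ⟨h1, ⟨⟨_, h, h3⟩, r, _, h4, h5⟩, h6⟩ := hf
  refine ⟨fun x => ?_, ⟨⟨fun _ _ _ => ⟨Finset.mem_univ _, Finset.mem_univ _⟩,
    fun x => h (σ.symm x), fun x y hxy => ?_⟩, σ r, Finset.mem_univ _, ?_, fun x _ hx => ?_⟩, ?_⟩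
  · obtain ⟨v, rfl⟩ := σ.surjective x
    exact (mapF_dec_apply σ.toEmbedding f v).trans_ne (h1 v)
  · obtain ⟨a, b, rfl, rfl, h7⟩ := (mapF_par_iff σ.toEmbedding f).1 hxy
    simpa using h3 a b h7
  · exact (mapF_par_apply σ.toEmbedding f r).trans (by rw [h4]; rfl)
  · obtain ⟨v, rfl⟩ := σ.surjective x
    have h7 := (mapF_par_apply σ.toEmbedding f v).symm.trans hx
    rw [Option.map_eq_none_iff] at h7
    rw [h5 v (Finset.mem_univ v) h7]
  · have h7 := sum_mapF σ.toEmbedding f Finset.univ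
    rw [Finset.map_univ_equiv] at h7
    rw [h7, h6]

/-- The classes of the trees of charge `m`. -/
def labClasses (m : Deg l1 l2) : Finset (TreeClass l1 l2) := (labTrees m).image labClass

lemma mem_labClasses {T : LTree l1 l2} : (Quotient.mk _ T : TreeClass l1 l2) ∈ labClasses m ↔
    (∀ v u, 0 ≤ T.dec v u) ∧ (⟨T.n, T.toF⟩ : LabF l1 l2) ∈ labTrees m := by
  rw [labClasses, Finset.mem_image]
  constructor
  · rintro ⟨⟨n, f⟩, hf, hc⟩
    obtain ⟨σ, h1, h2⟩ := (labClass_eq_iff (mem_labTrees.1 hf).2.1).1 hc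
    obtain rfl : n = T.n := by simpa using Fintype.card_congr σ
    have h3 : mapF σ.toEmbedding f = T.toF := by
      rw [mapF_eq_iff σ]
      exact ⟨h1, fun v => by simp only [LTree.toF]; rw [h2, degOf_toLat]⟩
    refine ⟨fun v u => ?_, h3 ▸ mapF_mem_labTrees hf σ⟩
    obtain ⟨w, rfl⟩ := σ.surjective v
    rw [h2, toLat]
    positivity
  · rintro ⟨h1, h2⟩
    refine ⟨_, h2, (labClass_eq_iff (mem_labTrees.1 h2).2.1).2 ⟨Equiv.refl _, fun v => ?_,
      fun v => ?_⟩⟩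
    · simp [LTree.toF]
    · simp only [Equiv.refl_apply, LTree.toF]
      rw [toLat_degOf (h1 v)]

lemma fiber_labClass {T : LTree l1 l2} (hT : (Quotient.mk _ T : TreeClass l1 l2) ∈ labClasses m) :
    (labTrees m).filter (fun x => labClass x = Quotient.mk _ T) =
      (Finset.univ.image fun σ : Equiv.Perm (Fin T.n) => mapF σ.toEmbedding T.toF).map
        (Function.Embedding.sigmaMk T.n) := by
  obtain ⟨hpos, hT'⟩ := mem_labClasses.1 hT
  ext ⟨n, f⟩
  rw [Finset.mem_filter, Finset.mem_map]
  constructor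
  · rintro ⟨hf, hc⟩
    obtain ⟨σ, h1, h2⟩ := (labClass_eq_iff (mem_labTrees.1 hf).2.1).1 hc
    obtain rfl : n = T.n := by simpa using Fintype.card_congr σ
    have h3 : mapF σ.toEmbedding f = T.toF := by
      rw [mapF_eq_iff σ]
      exact ⟨h1, fun v => by simp only [LTree.toF]; rw [h2, degOf_toLat]⟩
    refine ⟨f, Finset.mem_image.2 ⟨σ⁻¹, Finset.mem_univ _, ?_⟩, rfl⟩
    rw [← h3, mapF_trans]
    refine (mapF_eq_iff (σ⁻¹ * σ) f f).2 ?_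
    simp
  · rintro ⟨g, hg, he⟩
    obtain ⟨σ, _, rfl⟩ := Finset.mem_image.1 hg
    have h1 := mapF_mem_labTrees hT' σ
    rw [← he]
    refine ⟨h1, (labClass_eq_iff (mem_labTrees.1 h1).2.1).2 ⟨σ.symm, fun v => ?_, fun v => ?_⟩⟩
    · obtain ⟨w, rfl⟩ := σ.surjective v
      have h2 : (mapF σ.toEmbedding T.toF).1 (σ w) = _ := mapF_par_apply σ.toEmbedding T.toF w
      rw [h2, Equiv.symm_apply_apply, Option.map_map]
      simp [LTree.toF]
    · obtain ⟨w, rfl⟩ := σ.surjective v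
      have h2 : (mapF σ.toEmbedding T.toF).2 (σ w) = _ := mapF_dec_apply σ.toEmbedding T.toF w
      rw [h2, Equiv.symm_apply_apply, LTree.toF, toLat_degOf (hpos w)]

lemma autCard_eq {T : LTree l1 l2} (h : ∀ v u, 0 ≤ T.dec v u) : T.autCard =
    Nat.card {σ : Equiv.Perm (Fin T.n) // mapF σ.toEmbedding T.toF = T.toF} := by
  rw [LTree.autCard]
  refine Nat.card_congr (Equiv.subtypeEquivRight fun σ => ?_)
  rw [mapF_eq_iff σ]
  refine and_congr Iff.rfl (forall_congr' fun v => ?_)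
  simp only [LTree.toF]
  constructor
  · intro h1; rw [h1]
  · intro h1
    rw [← toLat_degOf (h (σ v)), h1, toLat_degOf (h v)]

/-- Sums over labelled trees as sums over isomorphism classes. -/
theorem sum_labTrees {κ : Deg l1 l2 → Deg l1 l2 → ℂ} {K : Deg l1 l2 → Deg l1 l2 → Deg l1 l2 → ℂ}
    (ν : TreeClass l1 l2 → LTree l1 l2) (hν : ∀ T, Quotient.mk _ (ν T) = T) :
    ∑ n ∈ Finset.range (m.degree + 1), ((n.factorial : ℂ)⁻¹) *
        ∑ f ∈ trees m (Finset.univ : Finset (Fin n)) with ∑ x, f.2 x = m,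
          forestWeight κ K Finset.univ f =
      ∑ T ∈ labClasses m, forestWeight κ K Finset.univ (ν T).toF / ((ν T).autCard : ℂ) := by
  have h1 : ∑ n ∈ Finset.range (m.degree + 1), ((n.factorial : ℂ)⁻¹) *
        ∑ f ∈ trees m (Finset.univ : Finset (Fin n)) with ∑ x, f.2 x = m,
          forestWeight κ K Finset.univ f =
      ∑ x ∈ labTrees m, ((x.1.factorial : ℂ)⁻¹) * forestWeight κ K Finset.univ x.2 := by
    rw [labTrees, Finset.sum_sigma]
    exact Finset.sum_congr rfl fun n _ => Finset.mul_sum _ _ _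
  rw [h1, ← Finset.sum_fiberwise_of_maps_to (t := labClasses m) (g := labClass)
    fun x hx => Finset.mem_image_of_mem _ hx]
  refine Finset.sum_congr rfl fun T hT => ?_
  have hT' := hT
  rw [← hν T] at hT'
  have hfib := fiber_labClass hT'
  rw [hν T] at hfib
  rw [hfib, Finset.sum_map]
  have h2 : ∀ f ∈ (Finset.univ.image fun σ : Equiv.Perm (Fin (ν T).n) =>
      mapF σ.toEmbedding (ν T).toF), ((((Function.Embedding.sigmaMk (ν T).n f : LabF l1 l2).1.factorial : ℕ) : ℂ)⁻¹) *
        forestWeight κ K Finset.univ (Function.Embedding.sigmaMk (ν T).n f : LabF l1 l2).2 =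
      (((ν T).n.factorial : ℂ)⁻¹) * forestWeight κ K Finset.univ (ν T).toF := by
    intro f hf
    obtain ⟨σ, _, rfl⟩ := Finset.mem_image.1 hf
    have h3 := forestWeight_mapF (κ := κ) (K := K) σ.toEmbedding (ν T).toF Finset.univ
    rw [Finset.map_univ_equiv] at h3
    rw [← h3]
    rfl
  rw [Finset.sum_congr rfl h2, Finset.sum_const, nsmul_eq_mul]
  have h4 := card_relabel (ν T).toF
  rw [← autCard_eq (mem_labClasses.1 hT').1] at h4
  rw [← h4]
  have h5 : (ν T).n.factorial ≠ 0 := Nat.factorial_ne_zero _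
  rw [← h4] at h5
  obtain ⟨h6, h7⟩ := Nat.mul_ne_zero_iff.1 h5
  have h6' : (((Finset.univ.image fun σ : Equiv.Perm (Fin (ν T).n) =>
    mapF σ.toEmbedding (ν T).toF).card : ℕ) : ℂ) ≠ 0 := by exact_mod_cast h6
  have h7' : ((ν T).autCard : ℂ) ≠ 0 := by exact_mod_cast h7
  push_cast
  field_simp

end Classes


section TreeFormula

open Classical

variable {l1 l2 : ℕ}

/-! ### The tree formula -/

/-- The coefficients of the system before the wall. -/
def plusCoef (b : Deg l1 l2) : ℂ := ((DT plusSpectrum (toLat b) : ℚ) : ℂ)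

/-- The coefficients of the system behind the wall. -/
def minusCoef (Ω : Lat l1 l2 → ℤ) (b : Deg l1 l2) : ℂ :=
  ((quadSign (toLat b) : ℤ) : ℂ) * ((DT Ω (toLat b) : ℚ) : ℂ)

lemma exists_of_DT_plus_ne {b : Lat l1 l2} (hb : ∀ v, 0 ≤ b v) (h : DT plusSpectrum b ≠ 0) :
    ∃ (u : Idx l1 l2) (p : ℕ), 0 < p ∧ b = p • basisVec u := by
  obtain ⟨q, hq, hq'⟩ := exists_ne_zero_of_finsum_mem_ne_zero h
  obtain ⟨h1, h2⟩ := hq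
  have h3 : plusSpectrum q.2 ≠ 0 := by
    intro h0
    rw [h0] at hq'
    simp at hq'
  unfold plusSpectrum at h3
  split_ifs at h3 with h4
  · obtain ⟨u, h5 | h5⟩ := h4
    · exact ⟨u, q.1, h1, by rw [← h2, h5]⟩
    · have h6 := hb u
      rw [← h2, h5] at h6
      simp [basisVec] at h6
      omega
  · exact absurd rfl h3

lemma subSum_eq {V : Type*} [Fintype V] {A : Finset V}
    {f : (V → Option V) × (V → Deg l1 l2)} (hf : IsForest A f.1) (v : V) {s : Finset V}
    (hs : ∀ x, x ∈ s ↔ f.1 x = some v) : subSum f v = f.2 v + ∑ x ∈ s, subSum f x := by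
  have hs' : s = Finset.univ.filter fun x => f.1 x = some v := by
    ext x
    simp [hs]
  subst hs'
  have h1 : desc f.1 v =
      insert v ((Finset.univ.filter fun x => f.1 x = some v).biUnion fun x => desc f.1 x) := by
    ext x
    rw [Finset.mem_insert, Finset.mem_biUnion]
    constructor
    · intro h
      rw [mem_desc] at h
      rcases Relation.ReflTransGen.cases_tail h with h2 | ⟨y, h2, h3⟩
      · exact Or.inl h2.symm
      · exact Or.inr ⟨y, Finset.mem_filter.2 ⟨Finset.mem_univ _, h3⟩, mem_desc.2 h2⟩
    · rintro (rfl | ⟨y, hy, h2⟩)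
      · exact self_mem_desc _ _
      · exact mem_desc.2 ((mem_desc.1 h2).tail (Finset.mem_filter.1 hy).2)
  obtain ⟨_, h, hlt⟩ := hf
  have hmono : ∀ {x y : V}, x ∈ desc f.1 y → h y ≤ h x := by
    intro x y hxy
    rw [mem_desc] at hxy
    induction hxy using Relation.ReflTransGen.head_induction_on with
    | refl => exact le_rfl
    | head h1 _ ih => exact ih.trans (hlt _ _ h1).le
  rw [subSum, h1, Finset.sum_insert, Finset.sum_biUnion]
  · rfl
  · intro x hx y hy hne
    simp only [Finset.coe_filter, Finset.mem_univ, true_and, Set.mem_setOf_eq] at hx hy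
    rw [Function.onFun, Finset.disjoint_left]
    intro z hz hz'
    rw [mem_desc] at hz hz'
    have key : ∀ {a b : V}, f.1 a = some v → f.1 b = some v →
        Relation.ReflTransGen (fun x y => f.1 x = some y) a b → a = b := by
      intro a b ha hb hab
      rcases Relation.ReflTransGen.cases_head hab with h2 | ⟨c, h2, h3⟩
      · exact h2
      · rw [ha] at h2
        obtain rfl := Option.some.inj h2
        have h4 := hmono (mem_desc.2 h3)
        have h5 := hlt _ _ hb
        omega
    rcases Relation.ReflTransGen.total_of_right_unique (fun a b c h1 h2 => by
      rw [h1] at h2; exact Option.some.inj h2) hz hz' with h2 | h2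
    · exact hne (key hx hy h2)
    · exact hne (key hy hx h2).symm
  · rw [Finset.mem_biUnion]
    rintro ⟨x, hx, hx'⟩
    have h2 := hmono hx'
    have h3 := hlt _ _ (Finset.mem_filter.1 hx).2
    omega

lemma subSum_ne_zero {V : Type*} [Fintype V] {f : (V → Option V) × (V → Deg l1 l2)}
    (hf : ∀ x, f.2 x ≠ 0) (v : V) : subSum f v ≠ 0 := by
  intro h0
  have h1 : f.2 v ≤ subSum f v :=
    Finset.single_le_sum (fun y _ => bot_le) (self_mem_desc f.1 v)
  rw [h0] at h1
  exact hf v (le_bot_iff.1 h1)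

lemma toLat_sum {V : Type*} (A : Finset V) (f : V → Deg l1 l2) :
    toLat (∑ x ∈ A, f x) = ∑ x ∈ A, toLat (f x) :=
  map_sum (⟨⟨toLat, toLat_zero⟩, toLat_add⟩ : Deg l1 l2 →+ Lat l1 l2) f A

lemma eq_of_mem_desc_of_root {V : Type*} [Fintype V] {par : V → Option V} {r v : V}
    (hr : par r = none) (h : r ∈ desc par v) : r = v := by
  rcases mem_desc_iff.1 h with h | ⟨y, h, _⟩
  · exact h
  · rw [hr] at h; cases h

/-- The factor of an edge in terms of the contraction process. -/
lemma edgeCoef_eq (P : ChargePair) {m b b' d : Deg l1 l2} {u u' : Idx l1 l2} {p p' : ℕ}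
    (hp : 0 < p) (hp' : 0 < p') (hb : toLat b = p • basisVec u) (hb' : toLat b' = p' • basisVec u') :
    edgeCoef m plusCoef plusEps b b' d =
      -((pairing (toLat b) (toLat b') : ℚ) * DT plusSpectrum (toLat b') : ℚ) *
      ((((if clock (P.plus (toLat b')) < clock (P.plus (toLat b)) then 0 else 1) -
        Stage.slopeInd (toLat m) (toLat d) : ℤ)) : ℂ) := by
  have hsw : pr b' b = -pairing (toLat b) (toLat b') := by rw [pr, Stage.pairing_swap]
  have hlt0 : clock P.gPlus < clock P.hPlus :=
    neg_lt_neg (P.arg_lt_one.trans (P.arg_lt_two.trans P.arg_lt_three))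
  by_cases h0 : pairing (toLat b) (toLat b') = 0
  · rw [edgeCoef, hsw, h0]; simp
  have hup : upScalar m d = -((Stage.slopeInd (toLat m) (toLat d) : ℤ) : ℂ) := by
    unfold upScalar Stage.slopeInd pr
    split_ifs <;> simp
  have heps : plusEps b' b =
      (((if clock (P.plus (toLat b')) < clock (P.plus (toLat b)) then 0 else 1 : ℤ)) : ℂ) := by
    have hpz : (0 : ℤ) < p := by exact_mod_cast hp
    have hpz' : (0 : ℤ) < p' := by exact_mod_cast hp'
    unfold plusEps
    rw [hsw]
    rw [hb, hb', clock_plus_smul_basis P hp, clock_plus_smul_basis P hp'] at *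
    rw [pairing] at h0 ⊢
    simp only [gPart_smul_basis, hPart_smul_basis] at h0 ⊢
    rcases u with u | u <;> rcases u' with u' | u'
    · simp at h0
    · rw [if_pos (by nlinarith), if_neg (not_lt.2 hlt0.le)]; simp
    · rw [if_neg (by nlinarith), if_pos hlt0]; simp
    · simp at h0
  rw [edgeCoef, hup, heps, hsw, plusCoef]
  push_cast
  ring

/-- The contribution of a tree in terms of its signed tropical types. -/
theorem forestWeight_eq (P : ChargePair) {m : Deg l1 l2}
    (hprim : ∀ d ∈ posIic m, d ≠ m → pr d m ≠ 0) {T : LTree l1 l2} (hT : T.Positive)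
    (hm : T.charge = toLat m) (v : Idx l1 l2) :
    forestWeight (fun b _ => plusCoef b * b v) (edgeCoef m plusCoef plusEps) Finset.univ T.toF =
      ((T.rootLabel v : ℚ) * (T.weight * T.autCard) *
        ((quadSign (toLat m) : ℤ) * T.signSum P : ℤ) : ℚ) := by
  have hpos : ∀ w u, 0 ≤ T.dec w u := fun w => (hT.isPos w).1
  have hdec : ∀ w, toLat (T.toF.2 w) = T.dec w := fun w => toLat_degOf (hpos w)
  have hne : ∀ w, T.toF.2 w ≠ 0 := by
    intro w h0
    have h1 := hdec w
    rw [h0, toLat_zero] at h1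
    exact (hT.isPos w).2 h1.symm
  have hsum : ∑ w, T.toF.2 w = m := by
    refine toLat_injective ?_
    rw [← hm, LTree.charge, ← Finset.sum_congr rfl fun w _ => hdec w]
    exact toLat_sum _ _
  have htree : IsTree Finset.univ T.toF.1 := T.isTree
  have hrootn : T.toF.1 T.root = none := (T.par_eq_none _).2 rfl
  have haut : (T.autCard : ℚ) ≠ 0 := by
    have : T.autCard ≠ 0 := by
      have : Nonempty {σ : Equiv.Perm (Fin T.n) // LTree.IsIso T T σ} :=
        ⟨⟨Equiv.refl _, by simp [LTree.IsIso]⟩⟩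
      exact Nat.card_pos.ne'
    exact_mod_cast this
  have hw : T.weight * T.autCard = DT plusSpectrum T.rootLabel *
      ∏ w ∈ Finset.univ.erase T.root, -(match T.par w with
      | none => 1
      | some v => (pairing (T.dec v) (T.dec w) : ℚ) * DT plusSpectrum (T.dec w)) := by
    rw [Finset.prod_neg, Finset.card_erase_of_mem (Finset.mem_univ _), Finset.card_univ,
      Fintype.card_fin, LTree.weight, ← Finset.mul_prod_erase _ _ (Finset.mem_univ T.root),
      (T.par_eq_none T.root).2 rfl]
    field_simp <;> rfl
  have hW : forestWeight (fun b _ => plusCoef b * b v) (edgeCoef m plusCoef plusEps)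
      Finset.univ T.toF = ((DT plusSpectrum T.rootLabel : ℚ) : ℂ) * ((T.rootLabel v : ℚ) : ℂ) *
      ∏ w ∈ Finset.univ.erase T.root, (match T.par w with
        | none => 1
        | some u => edgeCoef m plusCoef plusEps (T.toF.2 u) (T.toF.2 w) (subSum T.toF w)) := by
    unfold forestWeight
    rw [← Finset.mul_prod_erase _ _ (Finset.mem_univ T.root), hrootn]
    congr 1
    · simp only [plusCoef]
      rw [hdec]
      have h1 : ((T.toF.2 T.root v : ℕ) : ℤ) = T.rootLabel v := congrFun (hdec T.root) v
      rw [← h1]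
      rw [LTree.rootLabel]
      push_cast
      rfl
    · refine Finset.prod_congr rfl fun w hw => ?_
      have h1 : T.toF.1 w = T.par w := rfl
      rw [h1]
      cases hp : T.par w with
      | none => exact absurd ((T.par_eq_none w).1 hp) (Finset.ne_of_mem_erase hw)
      | some u => rfl
  have hle : ∀ s, ∑ x ∈ s, T.toF.2 x ≤ ∑ x, T.toF.2 x := fun s =>
    Finset.sum_le_sum_of_subset_of_nonneg (Finset.subset_univ s) fun _ _ _ => bot_le
  by_cases hadj : ∀ w u, T.par w = some u → pairing (T.dec u) (T.dec w) ≠ 0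
  · have hsign := LTree.signSum_eq (P := P) hT hm (sub := fun w => toLat (subSum T.toF w))
      (by
        rw [subSum, htree.desc_root (Finset.mem_univ _) hrootn, hsum])
      (by
        intro w
        rw [subSum_eq htree.1 w (s := Finset.univ.filter fun x => T.par x = some w)
          (by simp [LTree.toF]), toLat_add, hdec, toLat_sum])
      (by
        intro w
        refine ⟨fun u => by rw [toLat]; positivity, fun h0 => subSum_ne_zero hne w ?_⟩
        exact toLat_injective (h0.trans toLat_zero.symm))
      (by
        intro w hw
        refine hprim _ (mem_posIic.2 ⟨subSum_ne_zero hne w, ?_⟩) ?_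
        · rw [← hsum]
          exact hle _
        · have hr : T.root ∉ desc T.toF.1 w := by
            intro h1
            exact hw (eq_of_mem_desc_of_root hrootn h1).symm
          intro h1
          have h2 : T.toF.2 T.root + subSum T.toF w ≤ m := by
            rw [← hsum, subSum, ← Finset.sum_insert hr]
            exact hle _
          rw [h1] at h2
          have h3 : T.toF.2 T.root = 0 := by
            ext z
            have := h2 z
            simp at this
            simpa using this
          exact hne _ h3)
      hadj
    rw [hsign, hW, hw, ← Finset.mul_prod_erase _ _ (Finset.mem_univ T.root)]
    have hi : LTree.initVal P (toLat m) T (fun w => toLat (subSum T.toF w)) T.root = 1 := by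
      rw [LTree.initVal, (T.par_eq_none T.root).2 rfl]
    rw [hi, one_mul]
    have hprod : ∏ w ∈ Finset.univ.erase T.root, (match T.par w with
        | none => 1
        | some u => edgeCoef m plusCoef plusEps (T.toF.2 u) (T.toF.2 w) (subSum T.toF w)) =
        (((∏ w ∈ Finset.univ.erase T.root, -(match T.par w with
          | none => 1
          | some v => (pairing (T.dec v) (T.dec w) : ℚ) * DT plusSpectrum (T.dec w)) : ℚ)) : ℂ) *
        ((∏ w ∈ Finset.univ.erase T.root,
          LTree.initVal P (toLat m) T (fun w => toLat (subSum T.toF w)) w : ℤ) : ℂ) := by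
      push_cast
      rw [← Finset.prod_mul_distrib]
      refine Finset.prod_congr rfl fun w hw => ?_
      rw [LTree.initVal]
      cases hp : T.par w with
      | none => exact absurd ((T.par_eq_none w).1 hp) (Finset.ne_of_mem_erase hw)
      | some u =>
        obtain ⟨a, p, hp1, hp2⟩ := hT u
        obtain ⟨a', p', hp1', hp2'⟩ := hT w
        have h1 := edgeCoef_eq P (m := m) (d := subSum T.toF w) hp1 hp1'
          ((hdec u).trans hp2) ((hdec w).trans hp2')
        rw [hdec, hdec] at h1
        simp only
        rw [h1]
    rw [hprod]
    push_cast
    ring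
  · push Not at hadj
    obtain ⟨w, u, hwu, h0⟩ := hadj
    have hwr : w ∈ Finset.univ.erase T.root := Finset.mem_erase.2
      ⟨fun e => Option.some_ne_none u (hwu.symm.trans ((T.par_eq_none w).2 e)), Finset.mem_univ _⟩
    have h1 : T.weight * T.autCard = 0 := by
      rw [hw, Finset.prod_eq_zero hwr, mul_zero]
      rw [hwu]
      simp [h0]
    rw [h1, hW, Finset.prod_eq_zero hwr]
    · simp
    · rw [hwu]
      have h2 : pr (T.toF.2 w) (T.toF.2 u) = 0 := by
        rw [pr, hdec, hdec, Stage.pairing_swap, h0, neg_zero]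
      simp [edgeCoef, h2]

/-- The wall-crossing formula in terms of trees, for systems with the same jumps. -/
theorem tree_formula (P : ChargePair) {α : Lat l1 l2} (hα : ∀ v, 0 ≤ α v)
    (hprim : Int.gcd (proj α).1 (proj α).2 = 1) {Ω : Lat l1 l2 → ℤ} {i : Fin l1}
    (hi : 0 < α (Sum.inl i))
    (hC : ∀ ω ∈ ({gD, hD} : Set (Deg l1 l2 → ℤ)),
      numJump (degOf α) plusCoef plusEps ω = numJump (degOf α) (minusCoef Ω) minusEps ω)
    (ν : TreeClass l1 l2 → LTree l1 l2) (hν : ∀ T, Quotient.mk _ (ν T) = T) :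
    {T : TreeClass l1 l2 | (ν T).Positive ∧ (ν T).charge = α ∧
        ∃ p : ℕ, 0 < p ∧ (ν T).rootLabel = p • basisVec (Sum.inl i)}.Finite ∧
    DT Ω α =
      ∑ᶠ T ∈ {T : TreeClass l1 l2 | (ν T).Positive ∧ (ν T).charge = α ∧
        ∃ p : ℕ, 0 < p ∧ (ν T).rootLabel = p • basisVec (Sum.inl i)},
        ((ν T).rootLabel (Sum.inl i) : ℚ) / ((ν T).charge (Sum.inl i) : ℚ) *
          (ν T).weight * ((ν T).signSum P : ℚ) := by
  set S : Set (TreeClass l1 l2) := {T : TreeClass l1 l2 | (ν T).Positive ∧ (ν T).charge = α ∧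
        ∃ p : ℕ, 0 < p ∧ (ν T).rootLabel = p • basisVec (Sum.inl i)} with hS
  set m := degOf α with hmdef
  have hm : toLat m = α := toLat_degOf hα
  have hg : gD m ≠ 0 := by
    have h1 : 0 < gPart α :=
      Finset.sum_pos' (fun j _ => hα _) ⟨i, Finset.mem_univ i, hi⟩
    rw [gD, hm]
    exact h1.ne'
  have hprim' : ∀ d ∈ posIic m, d ≠ m → pr d m ≠ 0 := by
    intro d hd hdm h0
    obtain ⟨hd0, hdle⟩ := mem_posIic.1 hd
    have hco : IsCoprime (gD m) (hD m) := by
      rw [Int.isCoprime_iff_gcd_eq_one, Int.gcd_comm, gD, hD, hm]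
      exact hprim
    obtain ⟨e, hme⟩ : ∃ e, d + e = m := ⟨m - d, add_tsub_cancel_of_le hdle⟩
    have he0 : e ≠ 0 := by
      rintro rfl
      exact hdm (by rw [← hme, add_zero])
    have h1 : gD m = gD d + gD e := by rw [← hme, gD_add]
    have h2 : hD m = hD d + hD e := by rw [← hme, hD_add]
    have h3 : gD d * hD m = hD d * gD m := by
      rw [pr_eq] at h0; linarith
    have h4 : gD m ∣ gD d := hco.dvd_of_dvd_mul_right ⟨hD d, by rw [h3]; ring⟩
    have h5 : hD m ∣ hD d := hco.symm.dvd_of_dvd_mul_right ⟨gD d, by rw [← h3]; ring⟩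
    have hgd := gD_nonneg d
    have hhd := hD_nonneg d
    have hge := gD_nonneg e
    have hhe := hD_nonneg e
    have hdpos := gD_add_hD_pos hd0
    have hepos := gD_add_hD_pos he0
    obtain ⟨x, hx⟩ := h4
    have hgm : 0 < gD m := lt_of_le_of_ne (by linarith) (Ne.symm hg)
    have hx' : hD d = hD m * x := by
      have : gD m * (hD m * x) = gD m * hD d := by
        rw [mul_comm (gD m) (hD d), ← h3, hx]; ring
      exact (mul_left_cancel₀ hg this).symm
    have hx0 : 0 < x := by
      by_contra hx0
      have hx0 := not_lt.1 hx0
      nlinarith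
    have hx1 : x < 1 := by
      by_contra hx1
      have hx1 := not_lt.1 hx1
      nlinarith
    omega
  have key := coeff_eq_of_numJump_eq hprim' hg hC (Sum.inl i)
  rw [sum_scalarSol_eq (fun b => plusCoef b * b (Sum.inl i)), sum_labTrees ν hν] at key
  have hdec : ∀ T ∈ labClasses m, ∀ w, toLat ((ν T).toF.2 w) = (ν T).dec w := by
    intro T hT w
    rw [← hν T, mem_labClasses] at hT
    exact toLat_degOf (hT.1 w)
  have hcharge : ∀ T ∈ labClasses m, (ν T).charge = α := by
    intro T hT
    have hd := hdec T hT
    rw [← hν T, mem_labClasses, mem_labTrees] at hT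
    rw [LTree.charge, ← Finset.sum_congr rfl fun w _ => hd w, ← toLat_sum, hT.2.2.2, hm]
  have hsub : S ⊆ labClasses m := by
    rintro T ⟨hT, hc, _⟩
    have hpos : ∀ w u, 0 ≤ (ν T).dec w u := fun w => (hT.isPos w).1
    rw [Finset.mem_coe, ← hν T, mem_labClasses, mem_labTrees]
    refine ⟨hpos, fun w h0 => ?_, (ν T).isTree, toLat_injective ?_⟩
    · have h1 : toLat ((ν T).toF.2 w) = (ν T).dec w := toLat_degOf (hpos w)
      rw [h0, toLat_zero] at h1
      exact (hT.isPos w).2 h1.symm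
    · rw [toLat_sum, hm, ← hc, LTree.charge]
      exact Finset.sum_congr rfl fun w _ => toLat_degOf (hpos w)
  have hfin : S.Finite := (labClasses m).finite_toSet.subset hsub
  refine ⟨hfin, ?_⟩
  have hzero : ∀ T ∈ labClasses m, T ∉ S → forestWeight (fun b _ => plusCoef b * b (Sum.inl i))
      (edgeCoef m plusCoef plusEps) Finset.univ (ν T).toF = 0 := by
    intro T hT hTS
    by_contra hne
    have hfac := Finset.prod_ne_zero_iff.1 hne
    have hpure : ∀ w, plusCoef ((ν T).toF.2 w) ≠ 0 := by
      intro w h0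
      have h1 := hfac w (Finset.mem_univ w)
      cases hp : (ν T).toF.1 w with
      | none => rw [hp] at h1; simp [h0] at h1
      | some u => rw [hp] at h1; simp [h0, edgeCoef] at h1
    have hpure' : ∀ w, ∃ (u : Idx l1 l2) (p : ℕ), 0 < p ∧ (ν T).dec w = p • basisVec u := by
      intro w
      rw [← hdec T hT w]
      refine exists_of_DT_plus_ne (fun v => by rw [toLat]; positivity) fun h0 => hpure w ?_
      rw [plusCoef, h0, Rat.cast_zero]
    refine hTS ⟨hpure', hcharge T hT, ?_⟩
    obtain ⟨u, p, hp, hu⟩ := hpure' (ν T).root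
    have h1 := hfac (ν T).root (Finset.mem_univ _)
    have h2 : (ν T).toF.1 (ν T).root = none := ((ν T).par_eq_none _).2 rfl
    rw [h2] at h1
    have h3 : ((ν T).toF.2 (ν T).root) (Sum.inl i) ≠ 0 := by
      intro h0
      simp [h0] at h1
    have h4 : (((ν T).toF.2 (ν T).root) (Sum.inl i) : ℤ) = (ν T).dec (ν T).root (Sum.inl i) :=
      congrFun (hdec T hT (ν T).root) _
    have h5 : u = Sum.inl i := by
      by_contra hne'
      rw [hu] at h4
      simp [basisVec, Pi.single_apply, Ne.symm hne'] at h4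
      exact h3 h4
    exact ⟨p, hp, by rw [LTree.rootLabel, hu, h5]⟩
  have hαi : (α (Sum.inl i) : ℚ) ≠ 0 := by exact_mod_cast hi.ne'
  have hqq : ((quadSign α : ℤ) : ℚ) * ((quadSign α : ℤ) : ℚ) = 1 := by
    rw [← Int.cast_mul, ← Units.val_mul, Int.units_mul_self]; simp
  have hterm : ∀ T ∈ hfin.toFinset, forestWeight (fun b _ => plusCoef b * b (Sum.inl i))
      (edgeCoef m plusCoef plusEps) Finset.univ (ν T).toF / ((ν T).autCard : ℂ) =
      (((quadSign α : ℤ) * α (Sum.inl i) * (((ν T).rootLabel (Sum.inl i) : ℚ) /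
        ((ν T).charge (Sum.inl i) : ℚ) * (ν T).weight * ((ν T).signSum P : ℚ)) : ℚ) : ℂ) := by
    intro T hT
    obtain ⟨hT1, hT2, _⟩ := hfin.mem_toFinset.1 hT
    rw [forestWeight_eq P hprim' hT1 (hT2.trans hm.symm), hT2, hm]
    have haut : ((ν T).autCard : ℂ) ≠ 0 := by
      have : (ν T).autCard ≠ 0 := by
        have : Nonempty {σ : Equiv.Perm (Fin (ν T).n) // LTree.IsIso (ν T) (ν T) σ} :=
          ⟨⟨Equiv.refl _, by simp [LTree.IsIso]⟩⟩
        exact Nat.card_pos.ne'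
      exact_mod_cast this
    have hαi' : (α (Sum.inl i) : ℂ) ≠ 0 := by exact_mod_cast hi.ne'
    push_cast
    field_simp
  have hsum : ∑ T ∈ labClasses m, forestWeight (fun b _ => plusCoef b * b (Sum.inl i))
      (edgeCoef m plusCoef plusEps) Finset.univ (ν T).toF / ((ν T).autCard : ℂ) =
      (((quadSign α : ℤ) * α (Sum.inl i) * ∑ T ∈ hfin.toFinset,
        (((ν T).rootLabel (Sum.inl i) : ℚ) /
        ((ν T).charge (Sum.inl i) : ℚ) * (ν T).weight * ((ν T).signSum P : ℚ)) : ℚ) : ℂ) := by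
    have h1 : hfin.toFinset ⊆ labClasses m := fun T hT => hsub (hfin.mem_toFinset.1 hT)
    rw [← Finset.sum_subset h1, Finset.sum_congr rfl hterm, Finset.mul_sum, Rat.cast_sum]
    intro T hT hT'
    rw [hzero T hT fun h => hT' (hfin.mem_toFinset.2 h), zero_div]
  rw [hsum, minusCoef, hm] at key
  have hmi : ((m (Sum.inl i) : ℕ) : ℚ) = (α (Sum.inl i) : ℚ) := by
    have h1 : ((m (Sum.inl i) : ℕ) : ℤ) = α (Sum.inl i) := congrFun hm _
    exact_mod_cast congrArg (fun z : ℤ => (z : ℚ)) h1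
  have key' : ((quadSign α : ℤ) : ℚ) * α (Sum.inl i) * ∑ T ∈ hfin.toFinset,
        (((ν T).rootLabel (Sum.inl i) : ℚ) /
        ((ν T).charge (Sum.inl i) : ℚ) * (ν T).weight * ((ν T).signSum P : ℚ)) =
      (m (Sum.inl i) : ℚ) * (((quadSign α : ℤ) : ℚ) * DT Ω α) := by
    exact_mod_cast key
  rw [hmi] at key'
  rw [finsum_mem_eq_finite_toFinset_sum _ hfin]
  have h7 : (α (Sum.inl i) : ℚ) * (((quadSign α : ℤ) : ℚ) * (((quadSign α : ℤ) : ℚ) * DT Ω α)) =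
      (α (Sum.inl i) : ℚ) * (((quadSign α : ℤ) : ℚ) * (((quadSign α : ℤ) : ℚ) *
        ∑ T ∈ hfin.toFinset, (((ν T).rootLabel (Sum.inl i) : ℚ) /
        ((ν T).charge (Sum.inl i) : ℚ) * (ν T).weight * ((ν T).signSum P : ℚ)))) := by
    linear_combination -((quadSign α : ℤ) : ℚ) * key'
  have h8 := mul_left_cancel₀ hαi h7
  rwa [← mul_assoc, ← mul_assoc, hqq, one_mul, one_mul] at h8

end TreeFormula


/-! ### The propagator on lines in a strip -/

section Kernel

open Complex (I)

/-- The propagator in logarithmic coordinates. -/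
def kern (z : ℂ) : ℂ := 1 / (4 * Real.pi * I) * ((Complex.exp z + 1) / (Complex.exp z - 1))

lemma sq_norm_sub_one_ge {q : ℂ} {c : ℝ} (hc0 : 0 ≤ c) (h : q.re ≤ c * ‖q‖) :
    (1 - c) * (‖q‖ ^ 2 + 1) ≤ ‖q - 1‖ ^ 2 := by
  have h1 : ‖q - 1‖ ^ 2 = ‖q‖ ^ 2 + 1 - 2 * q.re := by
    rw [← Complex.normSq_eq_norm_sq, ← Complex.normSq_eq_norm_sq, Complex.normSq_apply,
      Complex.normSq_apply]
    simp
    ring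
  rw [h1]
  nlinarith [mul_nonneg hc0 (sq_nonneg (‖q‖ - 1))]

lemma sub_one_ne_of_re_le {q : ℂ} {c : ℝ} (hc : c < 1) (h : q.re ≤ c * ‖q‖) : q - 1 ≠ 0 := by
  intro h0
  rw [sub_eq_zero.1 h0] at h
  simp at h
  linarith

lemma norm_ratio_le {q : ℂ} {c : ℝ} (hc0 : 0 ≤ c) (hc : c < 1) (h : q.re ≤ c * ‖q‖) :
    ‖(q + 1) / (q - 1)‖ ≤ 2 / (1 - c) := by
  have h0 := sub_one_ne_of_re_le hc h
  have h1 := sq_norm_sub_one_ge hc0 h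
  have h2 : ‖q + 1‖ ^ 2 ≤ 2 * (‖q‖ ^ 2 + 1) := by
    have : ‖q + 1‖ ≤ ‖q‖ + 1 := by simpa using norm_add_le q 1
    nlinarith [norm_nonneg (q + 1), sq_nonneg (‖q‖ - 1)]
  have hc1 : 0 < 1 - c := by linarith
  rw [norm_div, div_le_div_iff₀ (norm_pos_iff.2 h0) hc1]
  refine abs_le_of_sq_le_sq' ?_ (by positivity) |>.2
  nlinarith [mul_le_mul_of_nonneg_left h2 (sq_nonneg (1 - c)), mul_le_mul_of_nonneg_left h1 hc1.le,
    sq_nonneg ‖q - 1‖, mul_nonneg hc0 (sq_nonneg ‖q-1‖)]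

lemma exp_re_le {z : ℂ} {c : ℝ} (h : Real.cos z.im ≤ c) :
    (Complex.exp z).re ≤ c * ‖Complex.exp z‖ := by
  rw [Complex.exp_re, Complex.norm_exp, mul_comm]
  exact mul_le_mul_of_nonneg_right h (Real.exp_pos _).le

lemma exp_sub_one_ne {z : ℂ} (h : Real.cos z.im < 1) : Complex.exp z - 1 ≠ 0 :=
  sub_one_ne_of_re_le h (exp_re_le le_rfl)

lemma norm_const_le : ‖1 / (4 * Real.pi * I)‖ ≤ 1 := by
  have : 3 < Real.pi := Real.pi_gt_three
  rw [norm_div, norm_mul, norm_mul, Complex.norm_I, Complex.norm_real]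
  simp only [norm_one, Complex.norm_ofNat, Real.norm_eq_abs, abs_of_pos Real.pi_pos, mul_one]
  rw [div_le_one (by positivity)]
  linarith

lemma norm_kern_le {z : ℂ} {c : ℝ} (hc0 : 0 ≤ c) (hc : c < 1) (h : Real.cos z.im ≤ c) :
    ‖kern z‖ ≤ 2 / (1 - c) := by
  rw [kern, norm_mul]
  have h1 := norm_ratio_le hc0 hc (exp_re_le h)
  have h2 := norm_const_le
  calc _ ≤ 1 * (2 / (1 - c)) := mul_le_mul h2 h1 (norm_nonneg _) zero_le_one
    _ = _ := one_mul _

/-- The derivative of the propagator. -/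
def kernDeriv (z : ℂ) : ℂ :=
  1 / (4 * Real.pi * I) * (-(2 * Complex.exp z) / (Complex.exp z - 1) ^ 2)

lemma hasDerivAt_kern {z : ℂ} (h : Real.cos z.im < 1) : HasDerivAt kern (kernDeriv z) z := by
  have h0 := exp_sub_one_ne h
  have he := Complex.hasDerivAt_exp z
  have := ((he.add_const 1).div (he.sub_const 1) h0).const_mul (1 / (4 * Real.pi * I))
  refine this.congr_deriv ?_
  rw [kernDeriv]
  congr 2
  ring

lemma norm_kernDeriv_le {z : ℂ} {c : ℝ} (hc0 : 0 ≤ c) (hc : c < 1) (h : Real.cos z.im ≤ c) :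
    ‖kernDeriv z‖ ≤ 1 / (1 - c) := by
  have h1 := sq_norm_sub_one_ge hc0 (exp_re_le h)
  have h0 := sub_one_ne_of_re_le hc (exp_re_le h)
  have hc1 : 0 < 1 - c := by linarith
  rw [kernDeriv, norm_mul]
  have h2 : ‖-(2 * Complex.exp z) / (Complex.exp z - 1) ^ 2‖ ≤ 1 / (1 - c) := by
    rw [norm_div, norm_neg, norm_mul, norm_pow, Complex.norm_ofNat,
      div_le_div_iff₀ (by positivity) hc1]
    nlinarith [sq_nonneg (‖Complex.exp z‖ - 1)]
  calc _ ≤ 1 * (1 / (1 - c)) := mul_le_mul norm_const_le h2 (norm_nonneg _) zero_le_one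
    _ = _ := one_mul _

lemma cos_lt_between {a : ℝ} (h : Real.cos a < 1) : ∃ c, 0 ≤ c ∧ c < 1 ∧ Real.cos a < c :=
  ⟨(max (Real.cos a) 0 + 1) / 2, by positivity,
    by have : max (Real.cos a) 0 < 1 := max_lt h one_pos
       linarith,
    by have h1 : max (Real.cos a) 0 < 1 := max_lt h one_pos
       have h2 := le_max_left (Real.cos a) 0
       linarith⟩

/-- The integral of a density on a real line against the propagator. -/
def cauchyInt (G : ℝ → ℂ) (w : ℂ) : ℂ := ∫ x : ℝ, kern (x - w) * G x

lemma continuous_kern_line {w : ℂ} (h : Real.cos w.im < 1) :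
    Continuous fun x : ℝ => kern (x - w) := by
  refine continuous_iff_continuousAt.2 fun x => ?_
  have h1 : ContinuousAt kern ((x : ℂ) - w) :=
    (hasDerivAt_kern (by simpa using h)).continuousAt
  exact h1.comp (f := fun x : ℝ => (x : ℂ) - w) (by fun_prop)

lemma integrable_cauchyInt {G : ℝ → ℂ} (hG : Integrable G) {w : ℂ} (h : Real.cos w.im < 1) :
    Integrable fun x : ℝ => kern (x - w) * G x := by
  obtain ⟨c, hc0, hc, hcw⟩ := cos_lt_between h
  exact hG.bdd_mul (continuous_kern_line h).aestronglyMeasurable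
    (Eventually.of_forall fun x => norm_kern_le hc0 hc (by simpa using hcw.le))

lemma norm_cauchyInt_le {G : ℝ → ℂ} (hG : Integrable G) {w : ℂ} {c : ℝ} (hc0 : 0 ≤ c)
    (hc : c < 1) (h : Real.cos w.im ≤ c) : ‖cauchyInt G w‖ ≤ 2 / (1 - c) * ∫ x, ‖G x‖ := by
  rw [← integral_const_mul]
  refine norm_integral_le_of_norm_le (hG.norm.const_mul _) (Eventually.of_forall fun x => ?_)
  rw [norm_mul]
  exact mul_le_mul_of_nonneg_right (norm_kern_le hc0 hc (by simpa using h)) (norm_nonneg _)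

lemma differentiableAt_cauchyInt {G : ℝ → ℂ} (hG : Integrable G) {w : ℂ}
    (h : Real.cos w.im < 1) : DifferentiableAt ℂ (cauchyInt G) w := by
  obtain ⟨c, hc0, hc, hcw⟩ := cos_lt_between h
  have hs : {w' : ℂ | Real.cos w'.im < c} ∈ 𝓝 w :=
    (isOpen_lt (Real.continuous_cos.comp Complex.continuous_im) continuous_const).mem_nhds hcw
  have hkd : ∀ w' : ℂ, Real.cos w'.im < c → ∀ x : ℝ,
      HasDerivAt (fun w => kern (x - w) * G x) (-kernDeriv (x - w') * G x) w' := by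
    intro w' hw' x
    have h1 : HasDerivAt kern (kernDeriv (x - w')) ((x : ℂ) - w') :=
      hasDerivAt_kern (by simpa using hw'.trans hc)
    have h2 := (h1.comp w' ((hasDerivAt_id w').const_sub (x : ℂ))).mul_const (G x)
    simpa using h2
  refine (hasDerivAt_integral_of_dominated_loc_of_deriv_le (μ := volume)
    (F := fun w (x : ℝ) => kern (x - w) * G x) (F' := fun w (x : ℝ) => -kernDeriv (x - w) * G x)
    (bound := fun x => 1 / (1 - c) * ‖G x‖) hs ?_ ?_ ?_ ?_ ?_ ?_).2.differentiableAt
  · filter_upwards [hs] with w' hw'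
    exact (integrable_cauchyInt hG (lt_trans hw' hc)).aestronglyMeasurable
  · exact integrable_cauchyInt hG h
  · refine AEStronglyMeasurable.mul (Continuous.aestronglyMeasurable ?_) hG.aestronglyMeasurable
    have hne : ∀ x : ℝ, (Complex.exp (x - w) - 1) ^ 2 ≠ 0 := fun x =>
      pow_ne_zero _ (exp_sub_one_ne (by simpa using h))
    unfold kernDeriv
    refine (continuous_const.mul (Continuous.div ?_ ?_ hne)).neg <;> fun_prop
  · refine Eventually.of_forall fun x w' hw' => ?_
    rw [norm_mul, norm_neg]
    exact mul_le_mul_of_nonneg_right (norm_kernDeriv_le hc0 hc (by simpa using (le_of_lt hw')))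
      (norm_nonneg _)
  · exact hG.norm.const_mul _
  · exact Eventually.of_forall fun x w' hw' => hkd w' hw' x

end Kernel

section Shift

open Complex (I)

lemma re_line (x t : ℝ) : ((x : ℂ) + t * I).re = x := by simp
lemma im_line (x t : ℝ) : ((x : ℂ) + t * I).im = t := by simp

lemma integrable_of_decay {G : ℝ → ℂ} (hc : Continuous G) {C : ℝ}
    (hb : ∀ x, ‖G x‖ ≤ C * (1 + x ^ 2)⁻¹) : Integrable G :=
  (integrable_inv_one_add_sq.const_mul C).mono' hc.aestronglyMeasurable (Eventually.of_forall hb)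

lemma continuous_line {h : ℂ → ℂ} {S : Set ℂ} (hh : ContinuousOn h S) {t : ℝ}
    (ht : ∀ x : ℝ, (x : ℂ) + t * I ∈ S) : Continuous fun x : ℝ => h (x + t * I) :=
  hh.comp_continuous (by fun_prop) ht

/-- The integral of a holomorphic function does not depend on the horizontal line, if the function
decays at the ends of the strip. -/
theorem integral_line_eq_of_far {h : ℂ → ℂ} {s t C T₀ : ℝ}
    (hd : DifferentiableOn ℂ h {z | z.im ∈ Set.uIcc s t})
    (hs : Integrable fun x : ℝ => h (x + s * I)) (ht : Integrable fun x : ℝ => h (x + t * I))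
    (hb : ∀ z : ℂ, T₀ ≤ |z.re| → z.im ∈ Set.uIcc s t → ‖h z‖ ≤ C * (1 + z.re ^ 2)⁻¹) :
    ∫ x : ℝ, h (x + s * I) = ∫ x : ℝ, h (x + t * I) := by
  have lim : ∀ a : ℝ, (Integrable fun x : ℝ => h (x + a * I)) →
      Tendsto (fun T : ℝ => ∫ x in (-T)..T, h (x + a * I)) atTop
      (𝓝 (∫ x : ℝ, h (x + a * I))) := fun a ha =>
    intervalIntegral_tendsto_integral ha tendsto_neg_atTop_atBot tendsto_id
  have hzero : Tendsto (fun T : ℝ => (∫ x in (-T)..T, h (x + s * I)) -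
      ∫ x in (-T)..T, h (x + t * I)) atTop (𝓝 0) := by
    have hbound : ∀ᶠ T : ℝ in atTop,
        ‖(∫ x in (-T)..T, h (x + s * I)) - ∫ x in (-T)..T, h (x + t * I)‖ ≤
        2 * (C * (1 + T ^ 2)⁻¹ * |t - s|) := by
      filter_upwards [eventually_ge_atTop T₀] with T hT
      have hr := Complex.integral_boundary_rect_eq_zero_of_differentiableOn h
        ((-T : ℝ) + s * I) ((T : ℝ) + t * I) (hd.mono fun z hz => by
          simpa [Complex.mem_reProdIm] using hz.2)
      simp only [re_line, im_line] at hr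
      have h1 : ∀ T' : ℝ, T₀ ≤ |T'| → T' ^ 2 = T ^ 2 →
          ‖∫ y in s..t, h ((T' : ℂ) + y * I)‖ ≤ C * (1 + T ^ 2)⁻¹ * |t - s| := by
        intro T' hT1 hT'
        refine intervalIntegral.norm_integral_le_of_norm_le_const fun y hy => ?_
        have := hb (T' + y * I) (by simpa using hT1) (by simpa using Set.uIoc_subset_uIcc hy)
        rwa [re_line, hT'] at this
      have h2 := h1 T (hT.trans (le_abs_self T)) rfl
      have h3 := h1 (-T) (by rw [abs_neg]; exact hT.trans (le_abs_self T)) (by ring)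
      have h4 : (∫ x in (-T)..T, h (x + s * I)) - ∫ x in (-T)..T, h (x + t * I) =
          I • (∫ y in s..t, h (((-T : ℝ) : ℂ) + y * I)) - I • ∫ y in s..t, h ((T : ℂ) + y * I) := by
        linear_combination hr
      rw [h4]
      refine (norm_sub_le _ _).trans ?_
      rw [norm_smul, norm_smul, Complex.norm_I, one_mul, one_mul]
      linarith
    refine squeeze_zero_norm' hbound ?_
    have h5 : Tendsto (fun T : ℝ => (1 + T ^ 2)⁻¹) atTop (𝓝 0) :=
      tendsto_inv_atTop_zero.comp (tendsto_atTop_add_const_left _ _ (tendsto_pow_atTop two_ne_zero))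
    have := ((h5.const_mul C).mul_const |t - s|).const_mul 2
    simpa using this
  exact sub_eq_zero.1 (tendsto_nhds_unique ((lim s hs).sub (lim t ht)) hzero)

/-- The integral of a decaying holomorphic function does not depend on the horizontal line. -/
theorem integral_line_eq {h : ℂ → ℂ} {s t C : ℝ}
    (hd : DifferentiableOn ℂ h {z | z.im ∈ Set.uIcc s t})
    (hb : ∀ z : ℂ, z.im ∈ Set.uIcc s t → ‖h z‖ ≤ C * (1 + z.re ^ 2)⁻¹) :
    ∫ x : ℝ, h (x + s * I) = ∫ x : ℝ, h (x + t * I) := by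
  have hint : ∀ a ∈ Set.uIcc s t, Integrable fun x : ℝ => h (x + a * I) := fun a ha =>
    integrable_of_decay (continuous_line hd.continuousOn fun x => by simpa using ha) fun x => by
      simpa using hb (x + a * I) (by simpa using ha)
  exact integral_line_eq_of_far (T₀ := 0) hd (hint s Set.left_mem_uIcc) (hint t Set.right_mem_uIcc)
    fun z _ hz => hb z hz

end Shift


section Plemelj

open Complex (I)

/-- The integral of `g` against the propagator on the line of height `t`. -/
def line (t : ℝ) (g : ℂ → ℂ) (w : ℂ) : ℂ := cauchyInt (fun x => g (x + t * I)) (w - t * I)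

lemma line_eq_integral (t : ℝ) (g : ℂ → ℂ) (w : ℂ) :
    line t g w = ∫ x : ℝ, kern ((x + t * I) - w) * g (x + t * I) := by
  simp only [line, cauchyInt]
  congr 1
  ext x
  congr 2
  ring

lemma line_eq_line {g : ℂ → ℂ} {s t C : ℝ} {w : ℂ}
    (hd : DifferentiableOn ℂ g {z | z.im ∈ Set.uIcc s t})
    (hb : ∀ z : ℂ, z.im ∈ Set.uIcc s t → ‖g z‖ ≤ C * (1 + z.re ^ 2)⁻¹)
    (hw : ∀ y ∈ Set.uIcc s t, Real.cos (y - w.im) < 1) : line s g w = line t g w := by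
  obtain ⟨y₀, hy₀, hmax⟩ := (isCompact_uIcc (a := s) (b := t)).exists_isMaxOn ⟨s, Set.left_mem_uIcc⟩
    (f := fun y => Real.cos (y - w.im)) (by fun_prop)
  obtain ⟨c, hc0, hc, hcw⟩ := cos_lt_between (hw y₀ hy₀)
  rw [line_eq_integral, line_eq_integral]
  refine integral_line_eq (h := fun z => kern (z - w) * g z) (C := 2 / (1 - c) * C) ?_ ?_
  · intro z hz
    refine DifferentiableWithinAt.mul (DifferentiableAt.differentiableWithinAt ?_) (hd z hz)
    have h1 : DifferentiableAt ℂ kern (z - w) :=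
      (hasDerivAt_kern (by simpa using hw _ hz)).differentiableAt
    exact DifferentiableAt.comp (g := kern) (f := fun z => z - w) z h1 (by fun_prop)
  · intro z hz
    rw [norm_mul, mul_assoc]
    have h1 : Real.cos (z - w).im ≤ c := by
      rw [Complex.sub_im]
      exact (hmax hz).trans hcw.le
    exact mul_le_mul (norm_kern_le hc0 hc h1) (hb z hz) (norm_nonneg _)
      (div_nonneg zero_le_two (by linarith))

lemma cosh_ge (x : ℝ) : (1 + x ^ 2) / 2 ≤ Real.cosh x := by
  have h1 : (x / 2) ^ 2 ≤ Real.sinh (x / 2) ^ 2 := by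
    rw [← sq_abs (x / 2), ← sq_abs (Real.sinh (x / 2)), Real.abs_sinh]
    exact pow_le_pow_left₀ (abs_nonneg _) (Real.self_le_sinh_iff.2 (abs_nonneg _)) 2
  have h2 := Real.cosh_sq (x / 2)
  have h3 := Real.cosh_two_mul (x / 2)
  rw [mul_div_cancel₀ x two_ne_zero] at h3
  nlinarith

lemma inv_cosh_le (x : ℝ) : (Real.cosh x)⁻¹ ≤ 2 * (1 + x ^ 2)⁻¹ := by
  have h := inv_anti₀ (by positivity) (cosh_ge x)
  rwa [inv_div, div_eq_mul_inv] at h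

lemma normSq_sinh (x y : ℝ) :
    ‖Complex.sinh (x + y * I)‖ ^ 2 = Real.cosh x ^ 2 - Real.cos y ^ 2 := by
  rw [← Complex.normSq_eq_norm_sq, Complex.sinh_add, Complex.sinh_mul_I, Complex.cosh_mul_I,
    ← Complex.ofReal_sinh, ← Complex.ofReal_cosh, ← Complex.ofReal_sin, ← Complex.ofReal_cos,
    Complex.normSq_apply]
  simp only [Complex.add_re, Complex.add_im, Complex.mul_re, Complex.mul_im, Complex.ofReal_re,
    Complex.ofReal_im, Complex.I_re, Complex.I_im, mul_zero, mul_one, zero_mul, sub_zero, add_zero,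
    zero_add, sub_self]
  have h1 := Real.cosh_sq x
  have h2 := Real.sin_sq_add_cos_sq y
  nlinarith

lemma norm_inv_sinh_le {x y c : ℝ} (hc : 0 < c) (hy : c ≤ Real.sin y) :
    ‖(Complex.sinh (x + y * I))⁻¹‖ ≤ 2 / c * (1 + x ^ 2)⁻¹ := by
  have h1 : c * Real.cosh x ≤ ‖Complex.sinh (x + y * I)‖ := by
    refine abs_le_of_sq_le_sq' ?_ (norm_nonneg _) |>.2
    rw [normSq_sinh]
    have h2 := Real.sin_sq_add_cos_sq y
    have h3 := Real.one_le_cosh x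
    nlinarith [mul_nonneg (sub_nonneg.2 (one_le_pow₀ h3 : (1 : ℝ) ≤ Real.cosh x ^ 2))
      (sq_nonneg (Real.cos y)), mul_nonneg (sub_nonneg.2 (pow_le_pow_left₀ hc.le hy 2))
      (sq_nonneg (Real.cosh x))]
  rw [norm_inv]
  have h4 := inv_anti₀ (mul_pos hc (Real.cosh_pos x)) h1
  refine h4.trans ?_
  rw [mul_inv, div_eq_mul_inv, mul_comm 2, mul_assoc]
  exact mul_le_mul_of_nonneg_left (inv_cosh_le x) (inv_nonneg.2 hc.le)

lemma integral_inv_cosh : ∫ x : ℝ, (Real.cosh x)⁻¹ = Real.pi := by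
  have hd : ∀ x : ℝ, HasDerivAt (fun x => Real.arctan (Real.sinh x)) (Real.cosh x)⁻¹ x := by
    intro x
    have h1 := (Real.hasDerivAt_arctan (Real.sinh x)).comp x (Real.hasDerivAt_sinh x)
    refine h1.congr_deriv ?_
    have h2 := Real.cosh_sq x
    rw [add_comm, ← h2]
    have := (Real.cosh_pos x).ne'
    field_simp
  have hint : Integrable fun x : ℝ => (Real.cosh x)⁻¹ := by
    refine (integrable_inv_one_add_sq.const_mul 2).mono'
      (Continuous.aestronglyMeasurable (Real.continuous_cosh.inv₀ fun x => (Real.cosh_pos x).ne'))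
      (Eventually.of_forall fun x => ?_)
    rw [Real.norm_eq_abs, abs_of_pos (inv_pos.2 (Real.cosh_pos x))]
    exact inv_cosh_le x
  have htop : Tendsto Real.sinh atTop atTop := by
    refine tendsto_atTop_mono' atTop ?_ tendsto_id
    filter_upwards [eventually_ge_atTop 0] with x hx
    exact Real.self_le_sinh_iff.2 hx
  have hbot : Tendsto Real.sinh atBot atBot := by
    have := tendsto_neg_atTop_atBot.comp (htop.comp tendsto_neg_atBot_atTop)
    refine this.congr fun x => ?_
    simp
  have h := integral_of_hasDerivAt_of_tendsto hd hint
    ((Real.tendsto_arctan_atBot.mono_right nhdsWithin_le_nhds).comp hbot)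
    ((Real.tendsto_arctan_atTop.mono_right nhdsWithin_le_nhds).comp htop)
  rw [h]
  ring

lemma integral_inv_sinh_pos {a : ℝ} (h0 : 0 < a) (h1 : a ≤ Real.pi / 2) :
    ∫ x : ℝ, (Complex.sinh (x + a * I))⁻¹ = -(Real.pi * I) := by
  have hsin : ∀ y ∈ Set.uIcc a (Real.pi / 2), Real.sin a ≤ Real.sin y := by
    intro y hy
    rw [Set.uIcc_of_le h1] at hy
    exact Real.sin_le_sin_of_le_of_le_pi_div_two (by linarith [Real.pi_pos]) hy.2 hy.1
  have hpos : 0 < Real.sin a := Real.sin_pos_of_pos_of_lt_pi h0 (by linarith [Real.pi_pos])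
  have hne : ∀ z : ℂ, z.im ∈ Set.uIcc a (Real.pi / 2) → Complex.sinh z ≠ 0 := by
    intro z hz h
    have h2 := normSq_sinh z.re z.im
    rw [Complex.re_add_im, h, norm_zero] at h2
    have h3 := hsin _ hz
    have h4 := Real.one_le_cosh z.re
    nlinarith [Real.sin_sq_add_cos_sq z.im]
  have h := integral_line_eq (h := fun z => (Complex.sinh z)⁻¹) (s := a) (t := Real.pi / 2)
    (C := 2 / Real.sin a)
    (fun z hz => (Complex.differentiable_sinh z).differentiableWithinAt.inv (hne z hz))
    (fun z hz => by
      have := norm_inv_sinh_le (x := z.re) hpos (hsin _ hz)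
      rwa [Complex.re_add_im] at this)
  rw [h]
  have h2 : ∀ x : ℝ, (Complex.sinh (x + ((Real.pi / 2 : ℝ) : ℂ) * I))⁻¹ =
      -I * (((Real.cosh x)⁻¹ : ℝ) : ℂ) := by
    intro x
    rw [Complex.sinh_add, Complex.sinh_mul_I, Complex.cosh_mul_I, ← Complex.ofReal_sin,
      ← Complex.ofReal_cos, Real.sin_pi_div_two, Real.cos_pi_div_two]
    simp [mul_comm]
  simp only [h2]
  rw [integral_const_mul, integral_complex_ofReal, integral_inv_cosh]
  ring

lemma integral_inv_sinh_neg {a : ℝ} (h0 : a < 0) (h1 : -(Real.pi / 2) ≤ a) :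
    ∫ x : ℝ, (Complex.sinh (x + a * I))⁻¹ = Real.pi * I := by
  have h := integral_inv_sinh_pos (a := -a) (by linarith) (by linarith)
  rw [← integral_neg_eq_self] at h
  rw [← neg_eq_iff_eq_neg, ← integral_neg] at h
  rw [← h]
  congr 1
  ext x
  rw [← inv_neg, ← Complex.sinh_neg]
  congr 2
  push_cast
  ring

end Plemelj


section Residue

open Complex (I)

/-- A cut-off with `bump 0 = 1` whose product with the propagator is a multiple of `1 / sinh`. -/
def bump (z : ℂ) : ℂ := 4 * Complex.exp z / (Complex.exp z + 1) ^ 2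

lemma bump_zero : bump 0 = 1 := by norm_num [bump]

lemma exp_add_one_ne {z : ℂ} (h : 0 ≤ Real.cos z.im) : Complex.exp z + 1 ≠ 0 := by
  intro h0
  have h1 := congrArg Complex.re h0
  rw [Complex.add_re, Complex.exp_re, Complex.one_re, Complex.zero_re] at h1
  have := mul_nonneg (Real.exp_pos z.re).le h
  linarith

lemma differentiableAt_bump {z : ℂ} (h : 0 ≤ Real.cos z.im) : DifferentiableAt ℂ bump z := by
  have h1 := pow_ne_zero 2 (exp_add_one_ne h)
  unfold bump
  exact DifferentiableAt.div (by fun_prop) (by fun_prop) h1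

lemma norm_bump_le {z : ℂ} (h : 0 ≤ Real.cos z.im) : ‖bump z‖ ≤ 4 * (1 + z.re ^ 2)⁻¹ := by
  have h1 : Real.exp z.re ^ 2 + 1 ≤ ‖Complex.exp z + 1‖ ^ 2 := by
    rw [← Complex.normSq_eq_norm_sq, Complex.normSq_apply, Complex.add_re, Complex.add_im,
      Complex.exp_re, Complex.exp_im, Complex.one_re, Complex.one_im]
    nlinarith [Real.sin_sq_add_cos_sq z.im, mul_nonneg (Real.exp_pos z.re).le h,
      sq_nonneg (Real.exp z.re)]
  have h2 : ‖bump z‖ ≤ 2 * (Real.cosh z.re)⁻¹ := by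
    rw [bump, norm_div, norm_mul, norm_pow, Complex.norm_exp, Complex.norm_ofNat,
      div_le_iff₀ (by nlinarith [Real.exp_pos z.re])]
    have h3 : 2 * Real.cosh z.re * Real.exp z.re = Real.exp z.re ^ 2 + 1 := by
      rw [Real.cosh_eq]
      have : Real.exp (-z.re) * Real.exp z.re = 1 := by rw [← Real.exp_add]; simp
      nlinarith
    have h4 := Real.cosh_pos z.re
    have h5 : 2 * (Real.cosh z.re)⁻¹ * (2 * Real.cosh z.re * Real.exp z.re) =
      4 * Real.exp z.re := by field_simp; norm_num
    rw [← h5, h3]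
    exact mul_le_mul_of_nonneg_left h1 (by positivity)
  linarith [inv_cosh_le z.re]

lemma kern_mul_bump {z : ℂ} (h0 : Complex.exp z - 1 ≠ 0) (h1 : Complex.exp z + 1 ≠ 0) :
    kern z * bump z = (2 * Real.pi * I)⁻¹ * (Complex.sinh z)⁻¹ := by
  have he := Complex.exp_ne_zero z
  have h2 : Complex.sinh z = (Complex.exp z - 1) * (Complex.exp z + 1) / (2 * Complex.exp z) := by
    rw [Complex.sinh, Complex.exp_neg]
    field_simp
    ring
  have hpi : (Real.pi : ℂ) ≠ 0 := by exact_mod_cast Real.pi_ne_zero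
  have hI := Complex.I_ne_zero
  rw [h2, kern, bump]
  field_simp

lemma norm_kern_le_of_far {z : ℂ} (h : 1 ≤ |z.re|) : ‖kern z‖ ≤ 3 := by
  have hq : ‖Complex.exp z + 1‖ ≤ 3 * ‖Complex.exp z - 1‖ := by
    have h1 : ‖Complex.exp z + 1‖ ≤ ‖Complex.exp z‖ + 1 := by simpa using norm_add_le (Complex.exp z) 1
    have h2 := abs_norm_sub_norm_le (Complex.exp z) 1
    rw [norm_one, Complex.norm_exp] at h2
    rw [Complex.norm_exp] at h1
    have h3 := abs_le.1 h2
    have hpos := Real.exp_pos z.re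
    rcases le_abs.1 h with h4 | h4
    · have h5 := Real.add_one_le_exp z.re
      linarith [h3.2]
    · have h5 := Real.add_one_le_exp (-z.re)
      have h6 : Real.exp z.re * Real.exp (-z.re) = 1 := by rw [← Real.exp_add]; simp
      nlinarith [h3.1]
  have hne : Complex.exp z - 1 ≠ 0 := by
    intro h0
    rw [h0, norm_zero, mul_zero] at hq
    have h1 := norm_le_zero_iff.1 hq
    have : (2 : ℂ) = 0 := by linear_combination h1 - h0
    norm_num at this
  rw [kern, norm_mul, norm_div (Complex.exp z + 1)]
  calc _ ≤ 1 * 3 := mul_le_mul norm_const_le ((div_le_iff₀ (norm_pos_iff.2 hne)).2 hq)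
        (by positivity) zero_le_one
    _ = 3 := one_mul _

lemma inv_shift_le (x a : ℝ) : (1 + (x - a) ^ 2)⁻¹ ≤ 2 * (1 + a ^ 2) * (1 + x ^ 2)⁻¹ := by
  rw [← div_eq_mul_inv, inv_eq_one_div, div_le_div_iff₀ (by positivity) (by positivity)]
  nlinarith [sq_nonneg (x - 2 * a), mul_nonneg (sq_nonneg a) (sq_nonneg (x - a))]

/-- The jump of the integral across its line. -/
theorem line_sub_line {g : ℂ → ℂ} {s t s' t' C : ℝ} {w : ℂ} (hs' : s' < s) (hs : s < w.im)
    (ht : w.im < t) (ht' : t < t') (hs2 : w.im - s ≤ Real.pi / 2) (ht2 : t - w.im ≤ Real.pi / 2)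
    (hd : DifferentiableOn ℂ g {z | z.im ∈ Set.Ioo s' t'})
    (hb : ∀ z : ℂ, z.im ∈ Set.Icc s t → ‖g z‖ ≤ C * (1 + z.re ^ 2)⁻¹) :
    line s g w - line t g w = g w := by
  have hpi := Real.pi_pos
  set S : Set ℂ := {z | z.im ∈ Set.Icc s t} with hS
  have hSV : S ⊆ {z | z.im ∈ Set.Ioo s' t'} := fun z hz => ⟨by linarith [hz.1], by linarith [hz.2]⟩
  have hcos : ∀ z ∈ S, 0 ≤ Real.cos (z - w).im := fun z hz =>
    Real.cos_nonneg_of_mem_Icc ⟨by rw [Complex.sub_im]; linarith [hz.1],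
      by rw [Complex.sub_im]; linarith [hz.2]⟩
  have hSw : S ∈ 𝓝 w := mem_of_superset
    ((isOpen_Ioo.preimage Complex.continuous_im).mem_nhds (show w.im ∈ Set.Ioo s t from ⟨hs, ht⟩))
    fun z hz => ⟨hz.1.le, hz.2.le⟩
  set G : ℂ → ℂ := fun z => g z - g w * bump (z - w) with hG
  have hGd : DifferentiableOn ℂ G S := by
    intro z hz
    refine ((hd.mono hSV) z hz).sub (DifferentiableAt.differentiableWithinAt ?_)
    exact ((differentiableAt_bump (hcos z hz)).comp z (f := fun z => z - w) (by fun_prop)).const_mul _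
  set B : ℝ := ‖g w‖ * (4 * (2 * (1 + w.re ^ 2))) with hB
  have hbump : ∀ z ∈ S, ‖g w * bump (z - w)‖ ≤ B * (1 + z.re ^ 2)⁻¹ := by
    intro z hz
    rw [norm_mul, hB, mul_assoc, mul_assoc]
    refine mul_le_mul_of_nonneg_left ((norm_bump_le (hcos z hz)).trans ?_) (norm_nonneg _)
    exact mul_le_mul_of_nonneg_left (inv_shift_le z.re w.re) (by norm_num)
  have hGb : ∀ z ∈ S, ‖G z‖ ≤ (C + B) * (1 + z.re ^ 2)⁻¹ := by
    intro z hz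
    rw [add_mul]
    exact (norm_sub_le _ _).trans (add_le_add (hb z hz) (hbump z hz))
  set N : ℂ → ℂ := fun z => G z * (Complex.exp (z - w) + 1) with hN
  set D : ℂ → ℂ := fun z => Complex.exp (z - w) - 1 with hD
  have hNw : N w = 0 := by simp [hN, hG, bump_zero]
  have hDw : D w = 0 := by simp [hD]
  have hDz : ∀ z ∈ S, z ≠ w → D z ≠ 0 := by
    intro z hz hzw h0
    obtain ⟨n, hn⟩ := Complex.exp_eq_one_iff.1 (sub_eq_zero.1 h0)
    have him := congrArg Complex.im hn
    simp at him
    have hn0 : n = 0 := by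
      have h1 : (-1 : ℝ) < n := by nlinarith [hz.1]
      have h2 : (n : ℝ) < 1 := by nlinarith [hz.2]
      have h1' : -1 < n := by exact_mod_cast h1
      have h2' : n < 1 := by exact_mod_cast h2
      omega
    rw [hn0] at hn
    simp at hn
    exact hzw (sub_eq_zero.1 hn)
  have hDd : HasDerivAt D 1 w := by
    have h1 := (((hasDerivAt_id w).sub_const w).cexp).sub_const 1
    simpa [hD] using h1
  have hds : ∀ z, z ≠ w → dslope N w z / dslope D w z = N z / D z := by
    intro z hz
    rw [dslope_of_ne _ hz, dslope_of_ne _ hz, slope_def_field, slope_def_field, hNw, hDw, sub_zero,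
      sub_zero, div_div_div_cancel_right₀ (sub_ne_zero.2 hz)]
  set h : ℂ → ℂ := fun z => 1 / (4 * Real.pi * I) * (dslope N w z / dslope D w z) with hh
  have hhz : ∀ z, z ≠ w → h z = kern (z - w) * G z := by
    intro z hz
    simp only [hh]
    rw [hds z hz]
    simp only [kern, hN, hD]
    ring
  have hhd : DifferentiableOn ℂ h S := by
    refine DifferentiableOn.const_mul (DifferentiableOn.div ?_ ?_ fun z hz => ?_) _
    · exact (Complex.differentiableOn_dslope hSw).2 (hGd.mul (by fun_prop))
    · exact (Complex.differentiableOn_dslope hSw).2 (by fun_prop)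
    · by_cases hzw : z = w
      · rw [hzw, dslope_same, hDd.deriv]
        exact one_ne_zero
      · rw [dslope_of_ne _ hzw, slope_def_field, hDw, sub_zero]
        exact div_ne_zero (hDz z hz hzw) (sub_ne_zero.2 hzw)
  have hst : s ≤ t := by linarith
  have hne : ∀ a : ℝ, a ≠ w.im → ∀ x : ℝ, (x : ℂ) + a * I ≠ w := fun a ha x hx => ha (by
    rw [← hx, im_line])
  have hcos1 : ∀ a ∈ Set.Icc s t, a ≠ w.im → Real.cos (w - a * I).im < 1 := by
    intro a ha haw
    have h1 : (w - a * I).im = w.im - a := by simp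
    rw [h1]
    refine lt_of_le_of_ne (Real.cos_le_one _) fun h0 => haw ?_
    have := (Real.cos_eq_one_iff_of_lt_of_lt (by linarith [ha.2]) (by linarith [ha.1])).1 h0
    linarith
  have hint : ∀ f : ℂ → ℂ, ∀ C', DifferentiableOn ℂ f S →
      (∀ z ∈ S, ‖f z‖ ≤ C' * (1 + z.re ^ 2)⁻¹) → ∀ a ∈ Set.Icc s t, a ≠ w.im →
      Integrable fun x : ℝ => kern ((x + a * I) - w) * f (x + a * I) := by
    intro f C' hfd hfb a ha haw
    have h1 : Integrable fun x : ℝ => f (x + a * I) :=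
      integrable_of_decay (C := C') (continuous_line hfd.continuousOn fun x => by simpa [hS] using ha)
        fun x => by simpa using hfb (x + a * I) (by simpa [hS] using ha)
    refine (integrable_cauchyInt h1 (hcos1 a ha haw)).congr (Eventually.of_forall fun x => ?_)
    simp only
    congr 2
    ring
  have hline : ∀ a ∈ Set.Icc s t, a ≠ w.im → ∫ x : ℝ, h (x + a * I) =
      line a g w - g w * ((2 * Real.pi * I)⁻¹ *
        ∫ x : ℝ, (Complex.sinh (x + ((a - w.im : ℝ) : ℂ) * I))⁻¹) := by
    intro a ha haw
    have hbd : DifferentiableOn ℂ (fun z => g w * bump (z - w)) S := fun z hz =>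
      (((differentiableAt_bump (hcos z hz)).comp z (f := fun z => z - w)
        (by fun_prop)).const_mul _).differentiableWithinAt
    have h1 : ∀ x : ℝ, h (x + a * I) = kern ((x + a * I) - w) * g (x + a * I) -
        kern ((x + a * I) - w) * (g w * bump ((x + a * I) - w)) := fun x => by
      rw [hhz _ (hne a haw x), hG, mul_sub]
    have h2 : ∀ x : ℝ, kern ((x + a * I) - w) * (g w * bump ((x + a * I) - w)) =
        g w * ((2 * Real.pi * I)⁻¹ *
          (Complex.sinh (((x - w.re : ℝ) : ℂ) + ((a - w.im : ℝ) : ℂ) * I))⁻¹) := by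
      intro x
      have hz : (x : ℂ) + a * I ∈ S := by simpa [hS] using ha
      rw [mul_left_comm, kern_mul_bump (hDz _ hz (hne a haw x)) (exp_add_one_ne (hcos _ hz))]
      congr 4
      apply Complex.ext <;> simp
    simp only [h1]
    rw [integral_sub (hint g C (hd.mono hSV) hb a ha haw) (hint _ B hbd hbump a ha haw),
      ← line_eq_integral]
    simp only [h2]
    rw [integral_const_mul, integral_const_mul,
      integral_sub_right_eq_self (fun x : ℝ => (Complex.sinh ((x : ℂ) + ((a - w.im : ℝ) : ℂ) * I))⁻¹)]
  have hIs : s ∈ Set.Icc s t := ⟨le_rfl, hst⟩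
  have hIt : t ∈ Set.Icc s t := ⟨hst, le_rfl⟩
  have hhi : ∀ a ∈ Set.Icc s t, a ≠ w.im → Integrable fun x : ℝ => h (x + a * I) := by
    intro a ha haw
    refine (hint G (C + B) hGd hGb a ha haw).congr (Eventually.of_forall fun x => ?_)
    exact (hhz _ (hne a haw x)).symm
  have key := integral_line_eq_of_far (h := h) (s := s) (t := t) (C := 3 * (C + B))
    (T₀ := |w.re| + 1) (by rw [Set.uIcc_of_le hst]; exact hhd) (hhi s hIs hs.ne) (hhi t hIt ht.ne')
    (by
      intro z hz1 hz2
      rw [Set.uIcc_of_le hst] at hz2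
      have h1 : 1 ≤ |(z - w).re| := by
        rw [Complex.sub_re]
        linarith [abs_sub_abs_le_abs_sub z.re w.re]
      have h2 : z ≠ w := by
        rintro rfl
        simp at h1
        linarith
      rw [hhz z h2, norm_mul, mul_assoc]
      exact mul_le_mul (norm_kern_le_of_far h1) (hGb z hz2) (norm_nonneg _) (by norm_num))
  rw [hline s hIs hs.ne, hline t hIt ht.ne', integral_inv_sinh_neg (by linarith) (by linarith),
    integral_inv_sinh_pos (by linarith) (by linarith)] at key
  have hpi' : (Real.pi : ℂ) ≠ 0 := by exact_mod_cast Real.pi_ne_zero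
  have hI := Complex.I_ne_zero
  field_simp at key
  linear_combination key / 2

end Residue


/-! ### Families of holomorphic functions on a strip -/

section Families

open Complex (I)

/-- A family of holomorphic functions on the strip `|Im w| < δ`, parametrised by `T`, which is
bounded by multiples of `ω` on smaller strips and continuous at `τ₀`. -/
structure Fam (T : Set ℝ) (τ₀ δ : ℝ) (ω : ℝ → ℝ) (g : ℝ × ℂ → ℂ) : Prop where
  hol : ∀ τ ∈ T, DifferentiableOn ℂ (fun w => g (τ, w)) {w | |w.im| < δ}
  bdd : ∀ r < δ, ∃ C, 0 ≤ C ∧ ∀ τ ∈ T, ∀ w : ℂ, |w.im| ≤ r → ‖g (τ, w)‖ ≤ C * ω w.re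
  cts : ∀ w : ℂ, |w.im| < δ → ContinuousWithinAt (fun τ => g (τ, w)) T τ₀

/-- The weight of decaying families. -/
def decayW (x : ℝ) : ℝ := (1 + x ^ 2)⁻¹

lemma decayW_nonneg (x : ℝ) : 0 ≤ decayW x := by unfold decayW; positivity

lemma decayW_le_one (x : ℝ) : decayW x ≤ 1 := inv_le_one_of_one_le₀ (by nlinarith [sq_nonneg x])

variable {T : Set ℝ} {τ₀ δ : ℝ} {ω : ℝ → ℝ} {f g h : ℝ × ℂ → ℂ}

namespace Fam

lemma mono {T' : Set ℝ} (hT : T' ⊆ T) (hf : Fam T τ₀ δ ω f) : Fam T' τ₀ δ ω f where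
  hol τ hτ := hf.hol τ (hT hτ)
  bdd r hr := by
    obtain ⟨C, hC, h⟩ := hf.bdd r hr
    exact ⟨C, hC, fun τ hτ => h τ (hT hτ)⟩
  cts w hw := (hf.cts w hw).mono hT

lemma add (hf : Fam T τ₀ δ ω f) (hg : Fam T τ₀ δ ω g) : Fam T τ₀ δ ω (f + g) where
  hol τ hτ := (hf.hol τ hτ).add (hg.hol τ hτ)
  bdd r hr := by
    obtain ⟨C, hC, h⟩ := hf.bdd r hr
    obtain ⟨C', hC', h'⟩ := hg.bdd r hr
    refine ⟨C + C', add_nonneg hC hC', fun τ hτ w hw => ?_⟩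
    rw [add_mul]
    exact (norm_add_le _ _).trans (add_le_add (h τ hτ w hw) (h' τ hτ w hw))
  cts w hw := (hf.cts w hw).add (hg.cts w hw)

lemma mul (hf : Fam T τ₀ δ ω f) (hg : Fam T τ₀ δ (fun _ => 1) g) : Fam T τ₀ δ ω (f * g) where
  hol τ hτ := (hf.hol τ hτ).mul (hg.hol τ hτ)
  bdd r hr := by
    obtain ⟨C, hC, h⟩ := hf.bdd r hr
    obtain ⟨C', hC', h'⟩ := hg.bdd r hr
    refine ⟨C * C', mul_nonneg hC hC', fun τ hτ w hw => ?_⟩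
    have h1 := h τ hτ w hw
    have h2 := h' τ hτ w hw
    rw [mul_one] at h2
    rw [Pi.mul_apply, norm_mul, mul_right_comm]
    exact mul_le_mul h1 h2 (norm_nonneg _) ((norm_nonneg _).trans h1)
  cts w hw := (hf.cts w hw).mul (hg.cts w hw)

lemma const (c : ℂ) : Fam T τ₀ δ (fun _ => 1) fun _ => c where
  hol τ hτ := differentiableOn_const c
  bdd r hr := ⟨‖c‖, norm_nonneg _, fun τ hτ w hw => by simp⟩
  cts w hw := continuousWithinAt_const

lemma zero : Fam T τ₀ δ decayW fun _ => 0 where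
  hol τ hτ := differentiableOn_const 0
  bdd r hr := ⟨0, le_rfl, fun τ hτ w hw => by simp⟩
  cts w hw := continuousWithinAt_const

lemma smul (c : ℂ) (hf : Fam T τ₀ δ ω f) : Fam T τ₀ δ ω fun p => c * f p := by
  have := hf.mul (const c)
  rwa [mul_comm] at this

lemma sum {κ : Type*} {s : Finset κ} {F : κ → ℝ × ℂ → ℂ} (hF : ∀ i ∈ s, Fam T τ₀ δ decayW (F i)) :
    Fam T τ₀ δ decayW fun p => ∑ i ∈ s, F i p := by
  classical
  induction s using Finset.induction_on with
  | empty => simpa using zero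
  | insert a s ha ih =>
    have h1 := (hF a (Finset.mem_insert_self a s)).add
      (ih fun i hi => hF i (Finset.mem_insert_of_mem hi))
    refine cast (congrArg _ ?_) h1
    ext p
    simp [Finset.sum_insert ha]

lemma bounded (hf : Fam T τ₀ δ decayW f) : Fam T τ₀ δ (fun _ => 1) f where
  hol := hf.hol
  bdd r hr := by
    obtain ⟨C, hC, h⟩ := hf.bdd r hr
    exact ⟨C, hC, fun τ hτ w hw => (h τ hτ w hw).trans
      (mul_le_mul_of_nonneg_left (decayW_le_one _) hC)⟩
  cts := hf.cts

lemma integrable (hf : Fam T τ₀ δ decayW f) {τ t : ℝ} (hτ : τ ∈ T) (ht : |t| < δ) :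
    Integrable fun x : ℝ => f (τ, x + t * I) := by
  obtain ⟨C, hC, h⟩ := hf.bdd |t| ht
  exact integrable_of_decay (C := C) (continuous_line (h := fun w => f (τ, w))
    (hf.hol τ hτ).continuousOn fun x => by simpa using ht) fun x => by
      simpa [decayW] using h τ hτ (x + t * I) (by simp)

end Fam

/-- Bounded families form an algebra. -/
def boundedFam (T : Set ℝ) (τ₀ δ : ℝ) : Subalgebra ℂ (ℝ × ℂ → ℂ) where
  carrier := {g | Fam T τ₀ δ (fun _ => 1) g}
  mul_mem' hf hg := Fam.mul hf hg
  add_mem' hf hg := Fam.add hf hg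
  algebraMap_mem' c := Fam.const c

lemma line_cts (hf : Fam T τ₀ δ decayW f) (h0 : τ₀ ∈ T) {t : ℝ} (ht : |t| < δ) {w : ℂ}
    (hw : Real.cos (w.im - t) < 1) :
    ContinuousWithinAt (fun τ => line t (fun z => f (τ, z)) w) T τ₀ := by
  obtain ⟨C, hC, h⟩ := hf.bdd |t| ht
  have hw' : Real.cos (w - t * I).im < 1 := by simpa using hw
  obtain ⟨c, hc0, hc, hcw⟩ := cos_lt_between hw'
  unfold line cauchyInt
  refine continuousWithinAt_of_dominated (bound := fun x => 2 / (1 - c) * (C * decayW x)) ?_ ?_ ?_ ?_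
  · filter_upwards [self_mem_nhdsWithin] with τ hτ
    exact (integrable_cauchyInt (hf.integrable hτ ht) hw').aestronglyMeasurable
  · filter_upwards [self_mem_nhdsWithin] with τ hτ
    refine Eventually.of_forall fun x => ?_
    rw [norm_mul]
    have hx : ((x : ℂ) - (w - t * I)).im = -(w - t * I).im := by simp
    refine mul_le_mul (norm_kern_le hc0 hc (by rw [hx, Real.cos_neg]; exact hcw.le)) ?_ (norm_nonneg _)
      (div_nonneg zero_le_two (by linarith))
    simpa using h τ hτ (x + t * I) (by simp)
  · exact (integrable_inv_one_add_sq.const_mul C).const_mul _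
  · exact Eventually.of_forall fun x => continuousWithinAt_const.mul
      (hf.cts (x + t * I) (by simpa using ht))

lemma cos_lt_one_of_mem {a : ℝ} (h0 : 0 < a) (h1 : a < 2 * Real.pi) : Real.cos a < 1 :=
  lt_of_le_of_ne (Real.cos_le_one _) fun h =>
    h0.ne' ((Real.cos_eq_one_iff_of_lt_of_lt (by linarith [Real.pi_pos]) h1).1 h)

/-- The integral against the propagator on a line above `w`, in a strip of width `2 δ`. -/
def up (δ : ℝ) (g : ℂ → ℂ) (w : ℂ) : ℂ := line ((w.im + δ) / 2) g w

lemma abs_le_of_mem_uIcc {s t y : ℝ} (hy : y ∈ Set.uIcc s t) : |y| ≤ max |s| |t| := by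
  obtain ⟨h1, h2⟩ := hy
  have h3 := le_max_left |s| |t|
  have h4 := le_max_right |s| |t|
  refine abs_le.2 ⟨le_trans (le_min ?_ ?_) h1, h2.trans (max_le ?_ ?_)⟩
  · linarith [neg_abs_le s]
  · linarith [neg_abs_le t]
  · exact (le_abs_self s).trans h3
  · exact (le_abs_self t).trans h4

lemma Fam.line_eq_line (hf : Fam T τ₀ δ decayW f) {τ : ℝ} (hτ : τ ∈ T) {s t : ℝ} (hs : |s| < δ)
    (ht : |t| < δ) {w : ℂ} (hw : ∀ y ∈ Set.uIcc s t, Real.cos (y - w.im) < 1) :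
    line s (fun z => f (τ, z)) w = line t (fun z => f (τ, z)) w := by
  have hsub : ∀ y ∈ Set.uIcc s t, |y| ≤ max |s| |t| := fun y hy => abs_le_of_mem_uIcc hy
  obtain ⟨C, hC, h⟩ := hf.bdd (max |s| |t|) (max_lt hs ht)
  refine InstantonTBA.line_eq_line (C := C) ((hf.hol τ hτ).mono fun z hz =>
    (hsub _ hz).trans_lt (max_lt hs ht)) (fun z hz => h τ hτ z (hsub _ hz)) hw

variable (hδ : δ ≤ Real.pi / 4)
include hδ

lemma up_eq_line (hf : Fam T τ₀ δ decayW f) {τ : ℝ} (hτ : τ ∈ T) {t : ℝ} {w : ℂ}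
    (hw : |w.im| < δ) (hwt : w.im < t) (ht : t < δ) :
    up δ (fun z => f (τ, z)) w = line t (fun z => f (τ, z)) w := by
  have hpi := Real.pi_pos
  have hw' := abs_lt.1 hw
  refine hf.line_eq_line hτ (abs_lt.2 ⟨by linarith, by linarith⟩) (abs_lt.2 ⟨by linarith, ht⟩)
    fun y hy => ?_
  obtain ⟨h1, h2⟩ := hy
  have h3 : w.im < min ((w.im + δ) / 2) t := lt_min (by linarith) hwt
  have h4 : max ((w.im + δ) / 2) t < δ := max_lt (by linarith) ht
  exact cos_lt_one_of_mem (by linarith) (by linarith)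

/-- The integral on a line below `w` exceeds the one on a line above `w` by the residue. -/
lemma line_eq_up_add (hf : Fam T τ₀ δ decayW f) {τ : ℝ} (hτ : τ ∈ T) {t : ℝ} {w : ℂ}
    (hw : |w.im| < δ) (hwt : t < w.im) (ht : -δ < t) :
    line t (fun z => f (τ, z)) w = up δ (fun z => f (τ, z)) w + f (τ, w) := by
  have hpi := Real.pi_pos
  have hw' := abs_lt.1 hw
  have hr : max |t| |(w.im + δ) / 2| < δ :=
    max_lt (abs_lt.2 ⟨ht, by linarith⟩) (abs_lt.2 ⟨by linarith, by linarith⟩)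
  obtain ⟨C, hC, h⟩ := hf.bdd _ hr
  have := line_sub_line (g := fun z => f (τ, z)) (s' := -δ) (t' := δ) (s := t)
    (t := (w.im + δ) / 2) (C := C) (w := w) ht hwt (by linarith) (by linarith) (by linarith)
    (by linarith) ((hf.hol τ hτ).mono fun z hz => abs_lt.2 hz)
    (fun z hz => h τ hτ z (abs_le_of_mem_uIcc (Set.Icc_subset_uIcc hz)))
  rw [up]
  linear_combination this

lemma Fam.up (hf : Fam T τ₀ δ decayW f) (h0 : τ₀ ∈ T) :
    Fam T τ₀ δ (fun _ => 1) fun p => up δ (fun z => f (p.1, z)) p.2 := by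
  have hpi := Real.pi_pos
  have key : ∀ r < δ, ∀ w : ℂ, |w.im| ≤ r → |(r + δ) / 2| < δ ∧ w.im < (r + δ) / 2 ∧
      Real.cos (w.im - (r + δ) / 2) ≤ Real.cos ((δ - r) / 2) := by
    intro r hr w hw
    have hw' := abs_le.1 hw
    have hr0 := (abs_nonneg _).trans hw
    refine ⟨abs_lt.2 ⟨by linarith, by linarith⟩, by linarith, ?_⟩
    rw [← Real.cos_neg]
    exact Real.cos_le_cos_of_nonneg_of_le_pi (by linarith) (by linarith) (by linarith)
  refine ⟨fun τ hτ w hw => ?_, fun r hr => ?_, fun w hw => ?_⟩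
  · obtain ⟨r, hr1, hr2⟩ := exists_between (show |w.im| < δ from hw)
    obtain ⟨h1, h2, h3⟩ := key r hr2 w hr1.le
    have hd : DifferentiableAt ℂ (line ((r + δ) / 2) fun z => f (τ, z)) w := by
      refine DifferentiableAt.comp (g := cauchyInt _) (f := fun w : ℂ => w - ((r + δ) / 2 : ℝ) * I) w
        (differentiableAt_cauchyInt (hf.integrable hτ h1) ?_) (by fun_prop)
      have h5 : (w - ((r + δ) / 2 : ℝ) * I).im = w.im - (r + δ) / 2 := by simp
      rw [h5]
      exact h3.trans_lt (cos_lt_one_of_mem (by linarith) (by linarith [(abs_nonneg w.im)]))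
    refine (hd.congr_of_eventuallyEq ?_).differentiableWithinAt
    have hop : {w' : ℂ | |w'.im| < r} ∈ 𝓝 w :=
      (isOpen_lt (continuous_abs.comp Complex.continuous_im) continuous_const).mem_nhds hr1
    filter_upwards [hop] with w' hw'
    obtain ⟨h1', h2', _⟩ := key r hr2 w' (le_of_lt hw')
    exact up_eq_line hδ hf hτ (lt_trans hw' hr2) h2' (by linarith)
  · by_cases hr0 : 0 ≤ r
    · obtain ⟨h1, _, _⟩ := key r hr 0 (by simpa using hr0)
      obtain ⟨C, hC, h⟩ := hf.bdd _ h1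
      set c := max (Real.cos ((δ - r) / 2)) 0 with hc
      have hc1 : c < 1 := max_lt (cos_lt_one_of_mem (by linarith) (by linarith)) one_pos
      refine ⟨2 / (1 - c) * ∫ x, C * decayW x, mul_nonneg (div_nonneg zero_le_two (by linarith))
        (integral_nonneg fun x => mul_nonneg hC (decayW_nonneg x)), fun τ hτ w hw => ?_⟩
      obtain ⟨_, h2, h3⟩ := key r hr w hw
      simp only
      rw [up_eq_line hδ hf hτ (hw.trans_lt hr) h2 (by linarith), mul_one]
      refine (norm_cauchyInt_le (hf.integrable hτ h1) (le_max_right _ _) hc1 ?_).trans ?_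
      · have h5 : (w - ((r + δ) / 2 : ℝ) * I).im = w.im - (r + δ) / 2 := by simp
        rw [h5]
        exact h3.trans (le_max_left _ _)
      · refine mul_le_mul_of_nonneg_left ?_ (div_nonneg zero_le_two (by linarith))
        refine integral_mono (hf.integrable hτ h1).norm (integrable_inv_one_add_sq.const_mul C)
          fun x => ?_
        have h6 := h τ hτ (x + ((r + δ) / 2 : ℝ) * I) (by rw [im_line])
        rwa [re_line] at h6
    · exact ⟨0, le_rfl, fun τ hτ w hw => absurd ((abs_nonneg _).trans hw) hr0⟩
  · have hw' := abs_lt.1 hw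
    have h1 : |(w.im + δ) / 2| < δ := abs_lt.2 ⟨by linarith, by linarith⟩
    have h2 : Real.cos (w.im - (w.im + δ) / 2) < 1 := by
      rw [← Real.cos_neg]
      exact cos_lt_one_of_mem (by linarith) (by linarith)
    exact line_cts hf h0 h1 h2

end Families


/-! ### The system of integral equations on a strip -/

section Strip

open Complex (I)

variable {ι : Type*} [Fintype ι] [DecidableEq ι] {m : ι →₀ ℕ} {T : Set ℝ} {τ₀ δ : ℝ}

/-- All coefficients are decaying families. -/
def CoeffDecay (T : Set ℝ) (τ₀ δ : ℝ) (f : ℝ × ℂ → Trunc m) : Prop :=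
  ∀ d ≤ m, Fam T τ₀ δ decayW fun p => tcoeff d (f p)

lemma CoeffDecay.coeffIn {f : ℝ × ℂ → Trunc m} (hf : CoeffDecay T τ₀ δ f) :
    CoeffIn (boundedFam T τ₀ δ) f := fun d hd => (hf d hd).bounded

lemma CoeffDecay.fun_smul {e : ℝ × ℂ → ℂ} {f : ℝ × ℂ → Trunc m} (he : Fam T τ₀ δ decayW e)
    (hf : CoeffIn (boundedFam T τ₀ δ) f) : CoeffDecay T τ₀ δ fun p => e p • f p := by
  intro d hd
  simp only [map_smul, smul_eq_mul]
  exact he.mul (hf d hd)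

/-- The coefficientwise integral on the line of height `t`. -/
def tline (m : ι →₀ ℕ) (t : ℝ) (f : ℂ → Trunc m) (w : ℂ) : Trunc m :=
  tof m fun d => line t (fun z => tcoeff d (f z)) w

/-- The coefficientwise version of `up`. -/
def tup (δ : ℝ) (f : ℂ → Trunc m) (w : ℂ) : Trunc m := tline m ((w.im + δ) / 2) f w

lemma tcoeff_tline {d : ι →₀ ℕ} (hd : d ≤ m) (t : ℝ) (f : ℂ → Trunc m) (w : ℂ) :
    tcoeff d (tline m t f w) = line t (fun z => tcoeff d (f z)) w := tcoeff_tof hd _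

lemma line_congr {t : ℝ} {g h : ℂ → ℂ} (H : ∀ z : ℂ, z.im = t → g z = h z) (w : ℂ) :
    line t g w = line t h w := by
  unfold line
  congr 1
  ext x
  exact H _ (im_line x t)

lemma line_zero (t : ℝ) (w : ℂ) : line t (fun _ => 0) w = 0 := by simp [line, cauchyInt]

lemma tline_sub_mem {n : ℕ} {t : ℝ} {f g : ℂ → Trunc m}
    (h : ∀ z : ℂ, z.im = t → f z - g z ∈ tfilt m n) (w : ℂ) :
    tline m t f w - tline m t g w ∈ tfilt m n := by
  rw [mem_tfilt]
  intro d hd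
  by_cases hdm : d ≤ m
  · rw [map_sub, tcoeff_tline hdm, tcoeff_tline hdm, sub_eq_zero]
    refine line_congr (fun z hz => ?_) w
    have := mem_tfilt.1 (h z hz) d hd
    rwa [map_sub, sub_eq_zero] at this
  · exact tcoeff_of_not_le hdm _

lemma tline_zero (t : ℝ) (w : ℂ) : tline m t (fun _ => 0) w = 0 :=
  trunc_ext fun d hd => by
    rw [tcoeff_tline hd]
    simp [line_zero]

lemma tline_mem {n : ℕ} {t : ℝ} {f : ℂ → Trunc m} (h : ∀ z : ℂ, z.im = t → f z ∈ tfilt m n) (w : ℂ) :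
    tline m t f w ∈ tfilt m n := by
  have := tline_sub_mem (g := fun _ => 0) (fun z hz => by simpa using h z hz) w
  rwa [tline_zero, sub_zero] at this

lemma CoeffDecay.tup (hδ : δ ≤ Real.pi / 4) {f : ℝ × ℂ → Trunc m} (hf : CoeffDecay T τ₀ δ f)
    (h0 : τ₀ ∈ T) : CoeffIn (boundedFam T τ₀ δ) fun p => tup δ (fun z => f (p.1, z)) p.2 := by
  intro d hd
  simp only [InstantonTBA.tup, tcoeff_tline hd]
  exact (hf d hd).up hδ h0

lemma line_sum {κ : Type*} {s : Finset κ} {F : κ → ℝ × ℂ → ℂ} (hF : ∀ i ∈ s, Fam T τ₀ δ decayW (F i))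
    (a : κ → ℂ) {τ t : ℝ} (hτ : τ ∈ T) (ht : |t| < δ) {w : ℂ} (hw : Real.cos (w.im - t) < 1) :
    line t (fun z => ∑ i ∈ s, a i * F i (τ, z)) w =
      ∑ i ∈ s, a i * line t (fun z => F i (τ, z)) w := by
  have hw' : Real.cos (w - t * I).im < 1 := by simpa using hw
  simp only [line, cauchyInt, Finset.mul_sum]
  rw [integral_finsetSum]
  · refine Finset.sum_congr rfl fun i _ => ?_
    rw [← integral_const_mul]
    congr 1
    ext x
    ring
  · intro i hi
    refine ((integrable_cauchyInt ((hF i hi).integrable hτ ht) hw').const_mul (a i)).congr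
      (Eventually.of_forall fun x => ?_)
    simp only
    ring

lemma tline_sum {κ : Type*} {s : Finset κ} {F : κ → ℝ × ℂ → Trunc m}
    (hF : ∀ i ∈ s, CoeffDecay T τ₀ δ (F i))
    (a : κ → ℂ) {τ t : ℝ} (hτ : τ ∈ T) (ht : |t| < δ) {w : ℂ} (hw : Real.cos (w.im - t) < 1) :
    tline m t (fun z => ∑ i ∈ s, a i • F i (τ, z)) w =
      ∑ i ∈ s, a i • tline m t (fun z => F i (τ, z)) w :=
  trunc_ext fun d hd => by
    rw [tcoeff_tline hd, map_sum]
    simp only [map_sum, map_smul, smul_eq_mul, tcoeff_tline hd]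
    exact line_sum (fun i hi => hF i hi d hd) a hτ ht hw

variable {l1 l2 : ℕ} {m : Deg l1 l2} {E : Deg l1 l2 → ℝ × ℂ → ℂ} {c c' : Deg l1 l2 → ℂ}
  {ε ε' : Deg l1 l2 → Deg l1 l2 → ℂ}

/-- The exponent of the strip equation. -/
def stripExponent (m : Deg l1 l2) (δ : ℝ) (c : Deg l1 l2 → ℂ) (ε : Deg l1 l2 → Deg l1 l2 → ℂ)
    (X : Deg l1 l2 → ℝ × ℂ → Trunc m) (b : Deg l1 l2) (p : ℝ × ℂ) : Trunc m :=
  ∑ b' ∈ posIic m, (c b' * pr b' b) •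
    (tup δ (fun z => X b' (p.1, z)) p.2 + ε b' b • X b' p)

/-- The iterates of the strip equation, starting from `0`. -/
def stripIter (m : Deg l1 l2) (δ : ℝ) (E : Deg l1 l2 → ℝ × ℂ → ℂ) (c : Deg l1 l2 → ℂ)
    (ε : Deg l1 l2 → Deg l1 l2 → ℂ) : ℕ → Deg l1 l2 → ℝ × ℂ → Trunc m
  | 0 => fun _ _ => 0
  | n + 1 => fun b p => E b p • (tmono m b *
      IsNilpotent.exp (stripExponent m δ c ε (stripIter m δ E c ε n) b p))

lemma stripExponent_mem {X : Deg l1 l2 → ℝ × ℂ → Trunc m}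
    (hX : ∀ b ∈ posIic m, ∀ p, X b p ∈ tfilt m 1) (b : Deg l1 l2) (p : ℝ × ℂ) :
    stripExponent m δ c ε X b p ∈ tfilt m 1 :=
  Ideal.sum_mem _ fun b' hb' => smul_mem_tfilt _
    (Ideal.add_mem _ (tline_mem (fun z _ => hX b' hb' _) _) (smul_mem_tfilt _ (hX b' hb' p)))

lemma stripIter_mem (n : ℕ) : ∀ b ∈ posIic m, ∀ p, stripIter m δ E c ε n b p ∈ tfilt m 1 := by
  intro b hb p
  cases n with
  | zero => exact Ideal.zero_mem _
  | succ n => exact smul_mem_tfilt _ (Ideal.mul_mem_right _ _ (tmono_mem_one hb))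

lemma stripIter_succ_sub_mem (n : ℕ) : ∀ b ∈ posIic m, ∀ p,
    stripIter m δ E c ε (n + 1) b p - stripIter m δ E c ε n b p ∈ tfilt m n := by
  induction n with
  | zero => exact fun b _ p => mem_tfilt_zero _
  | succ n ih =>
    intro b hb p
    have h1 : stripExponent m δ c ε (stripIter m δ E c ε (n + 1)) b p -
        stripExponent m δ c ε (stripIter m δ E c ε n) b p ∈ tfilt m n := by
      rw [stripExponent, stripExponent, ← Finset.sum_sub_distrib]
      refine Ideal.sum_mem _ fun b' hb' => ?_
      rw [← smul_sub, add_sub_add_comm, ← smul_sub]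
      exact smul_mem_tfilt _ (Ideal.add_mem _ (tline_sub_mem (fun z _ => ih b' hb' _) _)
        (smul_mem_tfilt _ (ih b' hb' p)))
    have h2 := texp_sub_mem (stripExponent_mem (stripIter_mem (δ := δ) (E := E) (c := c) (ε := ε)
      (n + 1)) b p) (stripExponent_mem (stripIter_mem n) b p) h1
    have h3 := mul_mem_tfilt (tmono_mem_one hb) h2
    rw [stripIter, stripIter, ← smul_sub, ← mul_sub]
    rw [add_comm n 1]
    exact smul_mem_tfilt _ h3

lemma stripIter_stable {n : ℕ} (hn : m.degree < n) {b : Deg l1 l2} (hb : b ∈ posIic m) (p : ℝ × ℂ) :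
    stripIter m δ E c ε (n + 1) b p = stripIter m δ E c ε n b p :=
  sub_eq_zero.1 (eq_zero_of_mem_tfilt hn (stripIter_succ_sub_mem n b hb p))

lemma stripExponent_coeffIn (hδ : δ ≤ Real.pi / 4) (h0 : τ₀ ∈ T)
    {X : Deg l1 l2 → ℝ × ℂ → Trunc m} (hX : ∀ b ∈ posIic m, CoeffDecay T τ₀ δ (X b))
    (b : Deg l1 l2) : CoeffIn (boundedFam T τ₀ δ) (stripExponent m δ c ε X b) :=
  CoeffIn.sum fun b' hb' =>
    (((hX b' hb').tup hδ h0).add ((hX b' hb').coeffIn.smul _)).smul _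

lemma stripIter_decay (hδ : δ ≤ Real.pi / 4) (h0 : τ₀ ∈ T)
    (hE : ∀ b ∈ posIic m, Fam T τ₀ δ decayW (E b)) (n : ℕ) :
    ∀ b ∈ posIic m, CoeffDecay T τ₀ δ (stripIter m δ E c ε n b) := by
  induction n with
  | zero =>
    intro b _ d _
    simpa [stripIter] using Fam.zero
  | succ n ih =>
    intro b hb
    exact CoeffDecay.fun_smul (hE b hb) ((CoeffIn.const _).mul
      ((stripExponent_coeffIn hδ h0 ih b).exp (stripExponent_mem (stripIter_mem n) b)))

/-- The solution of the strip equation. -/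
def stripSol (m : Deg l1 l2) (δ : ℝ) (E : Deg l1 l2 → ℝ × ℂ → ℂ) (c : Deg l1 l2 → ℂ)
    (ε : Deg l1 l2 → Deg l1 l2 → ℂ) : Deg l1 l2 → ℝ × ℂ → Trunc m :=
  stripIter m δ E c ε (m.degree + 1)

lemma stripSol_decay (hδ : δ ≤ Real.pi / 4) (h0 : τ₀ ∈ T)
    (hE : ∀ b ∈ posIic m, Fam T τ₀ δ decayW (E b)) :
    ∀ b ∈ posIic m, CoeffDecay T τ₀ δ (stripSol m δ E c ε b) :=
  stripIter_decay hδ h0 hE _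

/-- The solution at `τ₀`, as a model over the strip. -/
def stripModel (m : Deg l1 l2) (τ₀ δ : ℝ) (E : Deg l1 l2 → ℝ × ℂ → ℂ) (c : Deg l1 l2 → ℂ)
    (ε : Deg l1 l2 → Deg l1 l2 → ℂ) :
    TBAModel m (fun b (w : {w : ℂ // |w.im| < δ}) => E b (τ₀, w)) c ε where
  X b w := stripSol m δ E c ε b (τ₀, w)
  L b w := tup δ (fun z => stripSol m δ E c ε b (τ₀, z)) w
  memX b hb w := stripIter_mem _ b hb _
  memL b hb w := tline_mem (fun z _ => stripIter_mem _ b hb _) _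
  eq b hb w := by
    rw [stripSol, ← stripIter_stable (Nat.lt_succ_self _) hb, stripIter, smul_mul_assoc]
    rfl

lemma cos_up_line (hδ : δ ≤ Real.pi / 4) {w : ℂ} (hw : |w.im| < δ) :
    |(w.im + δ) / 2| < δ ∧ Real.cos (w.im - (w.im + δ) / 2) < 1 := by
  have hw' := abs_lt.1 hw
  refine ⟨abs_lt.2 ⟨by linarith, by linarith⟩, ?_⟩
  rw [← Real.cos_neg]
  exact cos_lt_one_of_mem (by linarith) (by linarith [Real.pi_pos])

lemma stripModel_prop (hδ : δ ≤ Real.pi / 4) (hE : ∀ b ∈ posIic m, Fam {τ₀} τ₀ δ decayW (E b))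
    (ω : Deg l1 l2 → ℤ) (w : {w : ℂ // |w.im| < δ}) :
    (stripModel m τ₀ δ E c ε).prop ω w = tline m ((w.1.im + δ) / 2)
      (fun z => ∑ b ∈ posIic m, (c b * ω b) • stripSol m δ E c ε b (τ₀, z)) w := by
  obtain ⟨h1, h2⟩ := cos_up_line hδ w.2
  rw [tline_sum (T := {τ₀}) (τ₀ := τ₀) (stripSol_decay hδ (Set.mem_singleton τ₀) hE) _ rfl h1 h2]
  rfl

lemma stripModel_compat (hδ : δ ≤ Real.pi / 4) (hE : ∀ b ∈ posIic m, Fam {τ₀} τ₀ δ decayW (E b)) :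
    TBAModel.PropCompat (stripModel m τ₀ δ E c ε) (stripModel m τ₀ δ E c' ε') := by
  intro ω n h w
  rw [stripModel_prop hδ hE, stripModel_prop hδ hE]
  refine tline_sub_mem (fun z hz => ?_) _
  exact h ⟨z, by rw [hz]; exact (cos_up_line hδ w.2).1⟩

/-- If the integrals of the jumps at an external point agree, then so do the numerical jumps. -/
theorem numJump_eq_of_external (hδ0 : 0 < δ) (hδ : δ ≤ Real.pi / 4)
    (hE : ∀ b ∈ posIic m, Fam {τ₀} τ₀ δ decayW (E b)) (hE0 : ∀ w, E 0 (τ₀, w) = 1)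
    (hEadd : ∀ d e w, E (d + e) (τ₀, w) = E d (τ₀, w) * E e (τ₀, w)) {w₀ : ℂ}
    (hw₀ : Real.cos w₀.im < 1)
    (hne : ∀ d ∈ posIic m, line 0 (fun z => E d (τ₀, z)) w₀ ≠ 0)
    (hJ : ∀ ω ∈ ({gD, hD} : Set (Deg l1 l2 → ℤ)),
      ∑ b ∈ posIic m, (c b * ω b) • tline m 0 (fun z => stripSol m δ E c ε b (τ₀, z)) w₀ =
      ∑ b ∈ posIic m, (c' b * ω b) • tline m 0 (fun z => stripSol m δ E c' ε' b (τ₀, z)) w₀) :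
    ∀ ω ∈ ({gD, hD} : Set (Deg l1 l2 → ℤ)), numJump m c ε ω = numJump m c' ε' ω := by
  have h0δ : |(0 : ℝ)| < δ := by simpa using hδ0
  have hw₀' : Real.cos (w₀.im - 0) < 1 := by simpa using hw₀
  refine TBAModel.numJump_eq (stripModel m τ₀ δ E c ε) (stripModel m τ₀ δ E c' ε')
    (fun w => hE0 w) (fun d e w => hEadd d e w) (stripModel_compat hδ hE) ?_
  intro ω hω d hd κ hκ
  have hdm := (mem_posIic.1 hd).2
  have h1 := congrArg (tcoeff d) (hJ ω hω)
  rw [← tline_sum (T := {τ₀}) (τ₀ := τ₀) (stripSol_decay hδ (Set.mem_singleton τ₀) hE) _ rfl h0δ hw₀',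
    ← tline_sum (T := {τ₀}) (τ₀ := τ₀) (stripSol_decay hδ (Set.mem_singleton τ₀) hE) _ rfl h0δ hw₀',
    tcoeff_tline hdm, tcoeff_tline hdm] at h1
  have hJd : ∀ (c : Deg l1 l2 → ℂ) (ε : Deg l1 l2 → Deg l1 l2 → ℂ), Fam {τ₀} τ₀ δ decayW
      fun p => tcoeff d (∑ b ∈ posIic m, (c b * ω b) • stripSol m δ E c ε b p) := by
    intro c ε
    simp only [map_sum, map_smul, smul_eq_mul]
    exact Fam.sum fun b hb => (stripSol_decay hδ (Set.mem_singleton τ₀) hE b hb d hdm).smul _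
  have h2 := line_sum (s := Finset.univ) (a := ![1, -1, -κ]) (τ := τ₀) (t := 0) (w := w₀)
    (T := {τ₀}) (τ₀ := τ₀) (δ := δ) (F := ![fun p => tcoeff d (∑ b ∈ posIic m, (c b * ω b) •
      stripSol m δ E c ε b p), fun p => tcoeff d (∑ b ∈ posIic m, (c' b * ω b) •
      stripSol m δ E c' ε' b p), E d]) (by
        intro i _
        fin_cases i
        exacts [hJd c ε, hJd c' ε', hE d hd]) rfl h0δ hw₀'
  simp only [Fin.sum_univ_three, Matrix.cons_val_zero, Matrix.cons_val_one, Matrix.cons_val] at h2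
  rw [h1] at h2
  rw [line_congr (h := fun _ => 0) (fun z hz => by
    have := hκ ⟨z, by rw [hz]; exact h0δ⟩
    simp only [TBAModel.jump] at this
    have h3 : ∀ x y e : ℂ, x - y = κ * e → 1 * x + -1 * y + -κ * e = 0 := fun x y e h => by
      linear_combination h
    exact h3 _ _ _ this), line_zero] at h2
  have h3 : κ * line 0 (fun z => E d (τ₀, z)) w₀ = 0 := by linear_combination h2
  exact (mul_eq_zero.1 h3).resolve_right (hne d hd)

end Strip


/-! ### Weak integrals -/

section WeakIntegral

variable {V V' : Type*} [AddCommGroup V] [Module ℂ V] [AddCommGroup V'] [Module ℂ V']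

/-- `y` is the integral of `F`, tested on all linear functionals. -/
def HasWeakIntegral (F : ℝ → V) (y : V) : Prop :=
  ∀ φ : V →ₗ[ℂ] ℂ, Integrable (fun x => φ (F x)) ∧ ∫ x, φ (F x) = φ y

lemma HasWeakIntegral.eq {F : ℝ → V} {y : V} (h : HasWeakIntegral F y) : weakIntegral F = y := by
  have hex : ∃ y : V, ∀ φ : V →ₗ[ℂ] ℂ,
      Integrable (fun x => φ (F x)) ∧ ∫ x, φ (F x) = φ y := ⟨y, h⟩
  rw [weakIntegral, dif_pos hex, ← sub_eq_zero, ← Module.forall_dual_apply_eq_zero_iff ℂ]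
  intro φ
  rw [map_sub, ← (hex.choose_spec φ).2, ← (h φ).2, sub_self]

lemma HasWeakIntegral.zero : HasWeakIntegral (fun _ => (0 : V)) 0 := fun φ => by simp

lemma HasWeakIntegral.add {F G : ℝ → V} {y z : V} (hF : HasWeakIntegral F y)
    (hG : HasWeakIntegral G z) : HasWeakIntegral (fun x => F x + G x) (y + z) := fun φ => by
  simp only [map_add]
  exact ⟨(hF φ).1.add (hG φ).1, by rw [integral_add (hF φ).1 (hG φ).1, (hF φ).2, (hG φ).2]⟩

lemma HasWeakIntegral.smul {F : ℝ → V} {y : V} (hF : HasWeakIntegral F y) (c : ℂ) :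
    HasWeakIntegral (fun x => c • F x) (c • y) := fun φ => by
  simp only [map_smul, smul_eq_mul]
  exact ⟨(hF φ).1.const_mul c, by rw [integral_const_mul, (hF φ).2]⟩

lemma HasWeakIntegral.smul_const {e : ℝ → ℂ} (he : Integrable e) (g : V) :
    HasWeakIntegral (fun x => e x • g) ((∫ x, e x) • g) := fun φ => by
  simp only [map_smul, smul_eq_mul]
  exact ⟨he.mul_const _, integral_mul_const _ _⟩

lemma weakIntegral_mem (W : Submodule ℂ V) {F : ℝ → V} (hF : ∀ x, F x ∈ W) :
    weakIntegral F ∈ W := by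
  by_cases h : ∃ y : V, ∀ φ : V →ₗ[ℂ] ℂ, Integrable (fun x => φ (F x)) ∧ ∫ x, φ (F x) = φ y
  · obtain ⟨y, hy⟩ := h
    rw [HasWeakIntegral.eq hy]
    by_contra hn
    obtain ⟨φ, hφ, hW⟩ := Submodule.exists_dual_map_eq_bot_of_notMem hn inferInstance
    refine hφ ?_
    have h0 : ∀ x, φ (F x) = 0 := fun x => by
      have : φ (F x) ∈ W.map φ := Submodule.mem_map_of_mem (hF x)
      rwa [hW, Submodule.mem_bot] at this
    rw [← (hy φ).2]
    simp [h0]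
  · rw [weakIntegral, dif_neg h]
    exact W.zero_mem

end WeakIntegral

/-! ### Functions with a finite representation -/

section Rep

/-- Bounded continuous functions. -/
def bddCont : Subalgebra ℂ (ℝ → ℂ) where
  carrier := {d | Continuous d ∧ ∃ C, ∀ x, ‖d x‖ ≤ C}
  mul_mem' := by
    rintro d e ⟨hd, C, hC⟩ ⟨he, C', hC'⟩
    refine ⟨hd.mul he, C * C', fun x => ?_⟩
    rw [Pi.mul_apply, norm_mul]
    exact mul_le_mul (hC x) (hC' x) (norm_nonneg _) ((norm_nonneg _).trans (hC x))
  add_mem' := by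
    rintro d e ⟨hd, C, hC⟩ ⟨he, C', hC'⟩
    exact ⟨hd.add he, C + C', fun x => (norm_add_le _ _).trans (add_le_add (hC x) (hC' x))⟩
  algebraMap_mem' c := ⟨continuous_const, ‖c‖, fun _ => le_rfl⟩

variable {A : Type*} [CommRing A] [Algebra ℂ A]

/-- The functions `x ↦ d x • g` with `d` bounded and continuous. -/
def simpleRep (A : Type*) [CommRing A] [Algebra ℂ A] : Set (ℝ → A) :=
  {F | ∃ d ∈ bddCont, ∃ g : A, F = fun x => d x • g}

/-- Finite sums of functions `x ↦ d x • g` with `d` bounded and continuous. -/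
def finRep (A : Type*) [CommRing A] [Algebra ℂ A] : Subalgebra ℂ (ℝ → A) :=
  (Submodule.span ℂ (simpleRep A)).toSubalgebra
    (Submodule.subset_span ⟨1, bddCont.one_mem, 1, by ext; simp⟩)
    (fun F G hF hG => by
      have h := Submodule.mul_mem_mul hF hG
      rw [Submodule.span_mul_span] at h
      refine Submodule.span_mono ?_ h
      rintro _ ⟨_, ⟨d, hd, g, rfl⟩, _, ⟨e, he, g', rfl⟩, rfl⟩
      refine ⟨d * e, bddCont.mul_mem hd he, g * g', ?_⟩
      ext x
      simp only [Pi.mul_apply, smul_mul_smul_comm])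

lemma finRep_const (g : A) : (fun _ => g) ∈ finRep A :=
  Submodule.subset_span ⟨1, bddCont.one_mem, g, by ext; simp⟩

lemma finRep_induction {p : (ℝ → A) → Prop} (hs : ∀ d ∈ bddCont, ∀ g : A, p fun x => d x • g)
    (h0 : p 0) (hadd : ∀ F G, p F → p G → p (F + G)) (hsmul : ∀ (c : ℂ) F, p F → p (c • F))
    {F : ℝ → A} (hF : F ∈ finRep A) : p F := by
  have hF' : F ∈ Submodule.span ℂ (simpleRep A) := hF
  induction hF' using Submodule.span_induction with
  | mem x h =>
    obtain ⟨d, hd, g, rfl⟩ := h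
    exact hs d hd g
  | zero => exact h0
  | add x y hx hy h1 h2 => exact hadd x y (h1 hx) (h2 hy)
  | smul c x hx h1 => exact hsmul c x (h1 hx)

lemma finRep_exp {F : ℝ → A} (hF : F ∈ finRep A) [Module ℚ A] {N : ℕ} (hN : ∀ x, F x ^ N = 0) :
    (fun x => IsNilpotent.exp (F x)) ∈ finRep A := by
  have h : (fun x => IsNilpotent.exp (F x)) =
      ∑ i ∈ Finset.range N, ((i.factorial : ℂ)⁻¹) • F ^ i := by
    ext x
    rw [nexp_eq_sum (hN x), Finset.sum_apply]
    rfl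
  rw [h]
  exact Subalgebra.sum_mem _ fun i _ => Subalgebra.smul_mem _ (Subalgebra.pow_mem _ hF i) _

/-- The integral of a representable function against an integrable density and a translate of a
bounded continuous kernel is representable. -/
lemma finRep_conv {κ e : ℝ → ℂ} (hκ : κ ∈ bddCont) (he : Integrable e) {F : ℝ → A}
    (hF : F ∈ finRep A) :
    ∃ H ∈ finRep A, ∀ x, HasWeakIntegral (fun y => (κ (y - x) * e y) • F y) (H x) := by
  obtain ⟨hκc, C, hC⟩ := hκ
  refine finRep_induction (p := fun F => ∃ H ∈ finRep A,
    ∀ x, HasWeakIntegral (fun y => (κ (y - x) * e y) • F y) (H x)) ?_ ?_ ?_ ?_ hF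
  · rintro d ⟨hd, C', hC'⟩ g
    have hed : Integrable fun y => e y * d y := by
      refine (he.bdd_mul hd.aestronglyMeasurable (Eventually.of_forall hC')).congr
        (Eventually.of_forall fun y => mul_comm _ _)
    have hint : ∀ x, Integrable fun y => κ (y - x) * (e y * d y) := fun x =>
      hed.bdd_mul (by fun_prop : Continuous fun y => κ (y - x)).aestronglyMeasurable
        (Eventually.of_forall fun y => hC _)
    have hle : ∀ x y, ‖κ (y - x) * (e y * d y)‖ ≤ C * ‖e y * d y‖ := fun x y => by
      rw [norm_mul]
      exact mul_le_mul_of_nonneg_right (hC _) (norm_nonneg _)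
    refine ⟨fun x => (∫ y, κ (y - x) * (e y * d y)) • g, Submodule.subset_span
      ⟨fun x => ∫ y, κ (y - x) * (e y * d y), ⟨?_, ∫ y, C * ‖e y * d y‖, fun x => ?_⟩, g, rfl⟩,
      fun x => ?_⟩
    · exact continuous_of_dominated (fun x => (hint x).aestronglyMeasurable)
        (fun x => Eventually.of_forall (hle x)) (hed.norm.const_mul C)
        (Eventually.of_forall fun y => by fun_prop)
    · exact norm_integral_le_of_norm_le (hed.norm.const_mul C) (Eventually.of_forall (hle x))
    · have := HasWeakIntegral.smul_const (hint x) g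
      simpa only [smul_smul, mul_assoc] using this
  · exact ⟨0, Subalgebra.zero_mem _, fun x => by simpa using HasWeakIntegral.zero⟩
  · rintro F G ⟨H, hH, h⟩ ⟨H', hH', h'⟩
    refine ⟨H + H', Subalgebra.add_mem _ hH hH', fun x => ?_⟩
    have := (h x).add (h' x)
    simpa only [Pi.add_apply, smul_add] using this
  · rintro c F ⟨H, hH, h⟩
    refine ⟨c • H, Subalgebra.smul_mem _ hH c, fun x => ?_⟩
    have := (h x).smul c
    simpa only [Pi.smul_apply, smul_comm c] using this

end Rep

/-! ### The propagator between rays -/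

section RayKernel

open Complex (I)

/-- The propagator between the points `ζ` and `ζ q`. -/
def ratioKern (q : ℂ) : ℂ := 1 / (4 * Real.pi * I) * ((q + 1) / (q - 1))

lemma rho_eq_ratioKern {ζ : ℂ} (hζ : ζ ≠ 0) (ζ' : ℂ) : rho ζ ζ' = ratioKern (ζ' / ζ) := by
  rw [rho, ratioKern]
  congr 1
  have h1 : ζ' / ζ + 1 = (ζ' + ζ) / ζ := by field_simp
  have h2 : ζ' / ζ - 1 = (ζ' - ζ) / ζ := by field_simp
  rw [h1, h2, div_div_div_cancel_right₀ hζ]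

lemma kern_eq_ratioKern (z : ℂ) : kern z = ratioKern (Complex.exp z) := rfl

/-- The ray through `q` from the origin does not contain `1`. -/
def OffRay (q : ℂ) : Prop := q.re < ‖q‖

lemma OffRay.mul_exp {q : ℂ} (hq : OffRay q) :
    ∃ c, 0 ≤ c ∧ c < 1 ∧ ∀ x : ℝ, ((Real.exp x : ℂ) * q).re ≤ c * ‖(Real.exp x : ℂ) * q‖ := by
  have hq0 : 0 < ‖q‖ := by
    refine norm_pos_iff.2 fun h => ?_
    rw [h, OffRay] at hq
    simp at hq
  refine ⟨max (q.re / ‖q‖) 0, le_max_right _ _, max_lt ((div_lt_one hq0).2 hq) one_pos, fun x => ?_⟩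
  rw [Complex.re_ofReal_mul, norm_mul, Complex.norm_real, Real.norm_eq_abs,
    abs_of_pos (Real.exp_pos x), mul_left_comm]
  refine mul_le_mul_of_nonneg_left ?_ (Real.exp_pos x).le
  rw [← div_le_iff₀ hq0]
  exact le_max_left _ _

lemma OffRay.ratioKern_mem {q : ℂ} (hq : OffRay q) :
    (fun x : ℝ => ratioKern ((Real.exp x : ℂ) * q)) ∈ bddCont := by
  obtain ⟨c, hc0, hc1, hc⟩ := hq.mul_exp
  refine ⟨?_, 1 * (2 / (1 - c)), fun x => ?_⟩
  · unfold ratioKern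
    exact continuous_const.mul (Continuous.div (by fun_prop) (by fun_prop)
      fun x => sub_one_ne_of_re_le hc1 (hc x))
  · simp only [ratioKern]
    rw [norm_mul]
    exact mul_le_mul norm_const_le (norm_ratio_le hc0 hc1 (hc x)) (norm_nonneg _) zero_le_one

end RayKernel


/-! ### The iterates of the TBA operator -/

section Iterates

open Complex (I)

variable {l1 l2 : ℕ} {k : ℕ} {R : ℝ} {Z : Lat l1 l2 → ℂ} {Ω : Lat l1 l2 → ℤ}

/-- The scalar semiflat factor. -/
def semiE (R : ℝ) (z ζ : ℂ) : ℂ :=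
  Complex.exp (Real.pi * R * (ζ⁻¹ * z + ζ * (starRingEnd ℂ) z))

lemma exp_neg_le_inv {t : ℝ} (ht : 0 < t) : Real.exp (-t) ≤ t⁻¹ := by
  rw [Real.exp_neg]
  exact inv_anti₀ ht (by linarith [Real.add_one_le_exp t])

lemma norm_semiE_ray (R : ℝ) {z : ℂ} (hz : z ≠ 0) (x : ℝ) :
    ‖semiE R z (-(Real.exp x : ℂ) * z)‖ =
      Real.exp (-(Real.pi * R * (Real.exp (-x) + Real.exp x * ‖z‖ ^ 2))) := by
  rw [semiE, Complex.norm_exp]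
  congr 1
  have he : (Real.exp x : ℂ) ≠ 0 := by exact_mod_cast (Real.exp_pos x).ne'
  have h1 : (-(Real.exp x : ℂ) * z)⁻¹ * z + -(Real.exp x : ℂ) * z * (starRingEnd ℂ) z =
      ((-(Real.exp (-x) + Real.exp x * ‖z‖ ^ 2) : ℝ) : ℂ) := by
    rw [mul_assoc, Complex.mul_conj, Complex.normSq_eq_norm_sq, Real.exp_neg]
    push_cast
    field_simp
    ring
  rw [h1, ← Complex.ofReal_mul, ← Complex.ofReal_mul, Complex.ofReal_re]
  ring

lemma integrable_semiE (hR : 0 < R) {z : ℂ} (hz : z ≠ 0) :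
    Integrable fun x : ℝ => semiE R z (-(Real.exp x : ℂ) * z) := by
  have hz2 : 0 < ‖z‖ ^ 2 := pow_pos (norm_pos_iff.2 hz) 2
  set μ := min 1 (‖z‖ ^ 2) with hμ
  have hμ0 : 0 < μ := lt_min one_pos hz2
  have hA : 0 < Real.pi * R * μ := by have := Real.pi_pos; positivity
  refine integrable_of_decay (C := (Real.pi * R * μ)⁻¹) ?_ fun x => ?_
  · have hne : ∀ x : ℝ, -(Real.exp x : ℂ) * z ≠ 0 := fun x =>
      mul_ne_zero (neg_ne_zero.2 (by exact_mod_cast (Real.exp_pos x).ne')) hz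
    unfold semiE
    refine Complex.continuous_exp.comp (continuous_const.mul (Continuous.add
      (Continuous.mul (Continuous.inv₀ (by fun_prop) hne) continuous_const) (by fun_prop)))
  · rw [norm_semiE_ray R hz, ← mul_inv]
    have h1 : Real.pi * R * μ * (1 + x ^ 2) ≤
        Real.pi * R * (Real.exp (-x) + Real.exp x * ‖z‖ ^ 2) := by
      rw [mul_assoc]
      refine mul_le_mul_of_nonneg_left ?_ (by have := Real.pi_pos; positivity)
      have h2 := cosh_ge x
      rw [Real.cosh_eq] at h2
      have h3 := Real.exp_pos x
      have h4 := Real.exp_pos (-x)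
      calc μ * (1 + x ^ 2) ≤ μ * (Real.exp x + Real.exp (-x)) :=
            mul_le_mul_of_nonneg_left (by linarith) hμ0.le
        _ = μ * Real.exp (-x) + μ * Real.exp x := by ring
        _ ≤ 1 * Real.exp (-x) + ‖z‖ ^ 2 * Real.exp x := add_le_add
            (mul_le_mul_of_nonneg_right (min_le_left _ _) h4.le)
            (mul_le_mul_of_nonneg_right (min_le_right _ _) h3.le)
        _ = _ := by ring
    have h5 : 0 < Real.pi * R * μ * (1 + x ^ 2) := by positivity
    exact (Real.exp_le_exp.2 (neg_le_neg h1)).trans (exp_neg_le_inv h5)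

/-- The exponent in the TBA operator. -/
def tbaExponent (k : ℕ) (Z : Lat l1 l2 → ℂ) (Ω : Lat l1 l2 → ℤ)
    (ψ : Lat l1 l2 → ℂ → GHat l1 l2 k) (a : Lat l1 l2) (ζ : ℂ) : GHat l1 l2 k :=
  ∑ᶠ b : Lat l1 l2, ((DT Ω b : ℂ) * (pairing b a : ℂ)) •
    rayIntegral (Z b) fun ζ' => rho ζ ζ' • (stMonomial k b • ψ b ζ')

/-- The iterates of the TBA operator. -/
def tbaIter (k : ℕ) (R : ℝ) (Z : Lat l1 l2 → ℂ) (Ω : Lat l1 l2 → ℤ) (n : ℕ) :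
    Lat l1 l2 → ℂ → GHat l1 l2 k :=
  (tbaOp k R Z Ω)^[n] (semiflat k R Z)

/-- The iterates without the semiflat factor. -/
def dress (k : ℕ) (R : ℝ) (Z : Lat l1 l2 → ℂ) (Ω : Lat l1 l2 → ℤ) :
    ℕ → Lat l1 l2 → ℂ → GHat l1 l2 k
  | 0 => fun _ _ => 1
  | n + 1 => fun a ζ => IsNilpotent.exp (tbaExponent k Z Ω (tbaIter k R Z Ω n) a ζ)

lemma tbaIter_eq (n : ℕ) (a : Lat l1 l2) (ζ : ℂ) :
    tbaIter k R Z Ω n a ζ = semiE R (Z a) ζ • (basisE k a * dress k R Z Ω n a ζ) := by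
  cases n with
  | zero => rw [dress, mul_one]; rfl
  | succ n =>
    rw [tbaIter, Function.iterate_succ_apply', dress, ← smul_mul_assoc]
    rfl

lemma artin_smul (r : ArtinR l1 l2 k) (x : GHat l1 l2 k) :
    r • x = AddMonoidAlgebra.single (0 : Lat l1 l2) r * x := by
  ext c
  rw [AddMonoidAlgebra.coeff_single_zero_mul, AddMonoidAlgebra.coeff_smul]
  rfl

/-- The lattice elements on which `stMonomial k` does not vanish. -/
def stBox (l1 l2 k : ℕ) : Finset (Lat l1 l2) := Finset.Icc (fun _ => -(k : ℤ)) fun _ => (k : ℤ)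

lemma stMonomial_eq_zero {b : Lat l1 l2} (hb : b ∉ stBox l1 l2 k) : stMonomial k b = 0 := by
  have h : ∃ v, k + 1 ≤ (b v).natAbs := by
    by_contra hn
    push Not at hn
    refine hb (Finset.mem_Icc.2 ⟨fun v => ?_, fun v => ?_⟩) <;> have := hn v <;> simp only <;> omega
  obtain ⟨v, hv⟩ := h
  rw [stMonomial, Ideal.Quotient.eq_zero_iff_mem, ← Finset.mul_prod_erase _ _ (Finset.mem_univ v)]
  refine Ideal.mul_mem_right _ _ ?_
  rw [← Nat.sub_add_cancel hv, pow_add]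
  exact Ideal.mul_mem_left _ _ (Ideal.subset_span ⟨v, rfl⟩)

lemma rayIntegral_zero {V : Type*} [AddCommGroup V] [Module ℂ V] (z : ℂ) :
    rayIntegral z (fun _ => (0 : V)) = 0 := HasWeakIntegral.zero.eq

lemma tbaExponent_eq_sum (ψ : Lat l1 l2 → ℂ → GHat l1 l2 k) (a : Lat l1 l2) (ζ : ℂ) :
    tbaExponent k Z Ω ψ a ζ = ∑ b ∈ stBox l1 l2 k, ((DT Ω b : ℂ) * (pairing b a : ℂ)) •
      rayIntegral (Z b) fun ζ' => rho ζ ζ' • (stMonomial k b • ψ b ζ') := by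
  refine finsum_eq_sum_of_support_subset _ fun b hb => ?_
  by_contra hn
  refine hb ?_
  have h0 : ∀ ζ', rho ζ ζ' • (stMonomial k b • ψ b ζ') = 0 := fun ζ' => by
    have h1 : stMonomial k b • ψ b ζ' = 0 := by
      rw [stMonomial_eq_zero hn, artin_smul, AddMonoidAlgebra.single_zero, zero_mul]
    rw [h1, smul_zero]
  simp only [h0]
  rw [rayIntegral_zero, smul_zero]

/-- The ideal generated by the variables. -/
def varIdeal (l1 l2 k : ℕ) : @Ideal (GHat l1 l2 k) CommSemiring.toSemiring :=
  Ideal.span (Set.range fun v : Idx l1 l2 => AddMonoidAlgebra.single (0 : Lat l1 l2)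
    (Ideal.Quotient.mk _ (MvPowerSeries.X v) : ArtinR l1 l2 k))

lemma exists_varIdeal_pow (l1 l2 k : ℕ) : ∃ N, ∀ x ∈ varIdeal l1 l2 k, x ^ N = 0 := by
  have hfg : (varIdeal l1 l2 k).FG := Submodule.fg_span (Set.finite_range _)
  have hnil : varIdeal l1 l2 k ≤ nilradical (GHat l1 l2 k) := by
    refine Ideal.span_le.2 ?_
    rintro _ ⟨v, rfl⟩
    refine ⟨k + 1, ?_⟩
    rw [AddMonoidAlgebra.single_pow, ← map_pow]
    have h0 : (Ideal.Quotient.mk _ ((MvPowerSeries.X v) ^ (k + 1)) : ArtinR l1 l2 k) = 0 :=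
      Ideal.Quotient.eq_zero_iff_mem.2 (Ideal.subset_span ⟨v, rfl⟩)
    rw [h0]
    simp
  obtain ⟨N, hN⟩ := hfg.isNilpotent_iff_le_nilradical.2 hnil
  refine ⟨N, fun x hx => ?_⟩
  have := Ideal.pow_mem_pow hx N
  rwa [hN] at this

lemma stMonomial_smul_mem {b : Lat l1 l2} (hb : b ≠ 0) (x : GHat l1 l2 k) :
    stMonomial k b • x ∈ varIdeal l1 l2 k := by
  obtain ⟨v, hv⟩ := Function.ne_iff.1 hb
  have hv' : (b v).natAbs ≠ 0 := Int.natAbs_ne_zero.2 hv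
  have h : ∃ r : ArtinR l1 l2 k, stMonomial k b = Ideal.Quotient.mk _ (MvPowerSeries.X v) * r := by
    refine ⟨Ideal.Quotient.mk _ ((MvPowerSeries.X v) ^ ((b v).natAbs - 1) *
      ∏ u ∈ Finset.univ.erase v, (MvPowerSeries.X u : MvPowerSeries _ ℂ) ^ (b u).natAbs), ?_⟩
    rw [stMonomial, ← map_mul, ← Finset.mul_prod_erase _ _ (Finset.mem_univ v), ← mul_assoc,
      ← pow_succ', Nat.sub_add_cancel (Nat.pos_of_ne_zero hv')]
  obtain ⟨r, hr⟩ := h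
  rw [artin_smul, hr, ← zero_add (0 : Lat l1 l2), ← AddMonoidAlgebra.single_mul_single, mul_assoc]
  exact Ideal.mul_mem_right _ _ (Ideal.subset_span ⟨v, rfl⟩)

lemma pairing_zero_left (a : Lat l1 l2) : pairing 0 a = 0 := by simp [pairing, gPart, hPart]

lemma tbaExponent_mem (ψ : Lat l1 l2 → ℂ → GHat l1 l2 k) (a : Lat l1 l2) (ζ : ℂ) :
    tbaExponent k Z Ω ψ a ζ ∈ varIdeal l1 l2 k := by
  rw [tbaExponent_eq_sum]
  refine Ideal.sum_mem _ fun b _ => ?_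
  by_cases hb : b = 0
  · rw [hb, pairing_zero_left, Int.cast_zero, mul_zero, zero_smul]
    exact Ideal.zero_mem _
  · refine Submodule.smul_mem ((varIdeal l1 l2 k).restrictScalars ℂ) _ ?_
    exact weakIntegral_mem ((varIdeal l1 l2 k).restrictScalars ℂ) fun x =>
      Submodule.smul_mem ((varIdeal l1 l2 k).restrictScalars ℂ) _ (stMonomial_smul_mem hb _)

/-- The integrand of the ray integral on the ray of `b`, without the propagator. -/
def rayTerm (k : ℕ) (R : ℝ) (Z : Lat l1 l2 → ℂ) (Ω : Lat l1 l2 → ℤ) (n : ℕ) (b : Lat l1 l2)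
    (y : ℝ) : GHat l1 l2 k :=
  stMonomial k b • tbaIter k R Z Ω n b (-(Real.exp y : ℂ) * Z b)

/-- On its own ray, each iterate has a finite representation. -/
def HasRep (k : ℕ) (R : ℝ) (Z : Lat l1 l2 → ℂ) (Ω : Lat l1 l2 → ℤ) (n : ℕ) : Prop :=
  ∀ a : Lat l1 l2, Z a ≠ 0 →
    (fun x : ℝ => dress k R Z Ω n a (-(Real.exp x : ℂ) * Z a)) ∈ finRep (GHat l1 l2 k)

lemma rayTerm_eq (n : ℕ) (b : Lat l1 l2) (y : ℝ) :
    rayTerm k R Z Ω n b y = semiE R (Z b) (-(Real.exp y : ℂ) * Z b) •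
      ((stMonomial k b • basisE k b) * dress k R Z Ω n b (-(Real.exp y : ℂ) * Z b)) := by
  rw [rayTerm, tbaIter_eq, artin_smul, artin_smul, mul_smul_comm, mul_assoc]

lemma HasRep.conv {n : ℕ} (h : HasRep k R Z Ω n) (hR : 0 < R) {b : Lat l1 l2} (hb : Z b ≠ 0)
    {q : ℂ} (hq : OffRay q) : ∃ H ∈ finRep (GHat l1 l2 k), ∀ x : ℝ, HasWeakIntegral
      (fun y => ratioKern ((Real.exp (y - x) : ℂ) * q) • rayTerm k R Z Ω n b y) (H x) := by
  obtain ⟨H, hH, hw⟩ := finRep_conv hq.ratioKern_mem (integrable_semiE hR hb)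
    (Subalgebra.mul_mem _ (finRep_const (stMonomial k b • basisE k b)) (h b hb))
  refine ⟨H, hH, fun x => ?_⟩
  have h3 := hw x
  simp only [mul_smul] at h3
  simp only [rayTerm_eq]
  exact h3

lemma offRay_div {z w : ℂ} (h : cross z w ≠ 0) : OffRay (w / z) := by
  have hz : z ≠ 0 := by
    rintro rfl
    simp [cross] at h
  have h1 : (w / z).im ≠ 0 := by
    have : (w / z).im = cross z w / Complex.normSq z := by
      rw [Complex.div_im, cross]
      ring
    rw [this]
    exact div_ne_zero h (Complex.normSq_pos.2 hz).ne'
  exact (le_abs_self _).trans_lt (Complex.abs_re_lt_norm.2 h1)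

lemma hasRep (hR : 0 < R) (hZ : ∀ a b : Lat l1 l2, pairing a b ≠ 0 → cross (Z a) (Z b) ≠ 0)
    (n : ℕ) : HasRep k R Z Ω n := by
  induction n with
  | zero => exact fun a _ => finRep_const 1
  | succ n ih =>
    intro a ha
    obtain ⟨N, hN⟩ := exists_varIdeal_pow l1 l2 k
    refine finRep_exp ?_ fun x => hN _ (tbaExponent_mem _ a _)
    have key : ∀ b : Lat l1 l2, ∃ H ∈ finRep (GHat l1 l2 k), ∀ x : ℝ,
        ((DT Ω b : ℂ) * (pairing b a : ℂ)) • (rayIntegral (Z b) fun ζ' =>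
          rho (-(Real.exp x : ℂ) * Z a) ζ' • (stMonomial k b • tbaIter k R Z Ω n b ζ')) = H x := by
      intro b
      by_cases hp : pairing b a = 0
      · exact ⟨0, Subalgebra.zero_mem _, fun x => by simp [hp]⟩
      · have hc : cross (Z a) (Z b) ≠ 0 := hZ a b fun h0 => hp (by
          rw [Stage.pairing_swap, h0, neg_zero])
        have hb : Z b ≠ 0 := by
          intro h0
          rw [h0] at hc
          simp [cross] at hc
        obtain ⟨H, hH, hw⟩ := ih.conv hR hb (offRay_div hc)
        refine ⟨((DT Ω b : ℂ) * (pairing b a : ℂ)) • H, Subalgebra.smul_mem _ hH _, fun x => ?_⟩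
        have hne : -(Real.exp x : ℂ) * Z a ≠ 0 :=
          mul_ne_zero (neg_ne_zero.2 (by exact_mod_cast (Real.exp_pos x).ne')) ha
        rw [Pi.smul_apply, ← (hw x).eq, rayIntegral]
        congr 2
        ext1 y
        rw [rayTerm, rho_eq_ratioKern hne]
        congr 2
        rw [Real.exp_sub]
        push_cast
        have : (Real.exp x : ℂ) ≠ 0 := by exact_mod_cast (Real.exp_pos x).ne'
        push_cast at this
        field_simp
    choose H hH hHe using key
    have : (fun x : ℝ => tbaExponent k Z Ω (tbaIter k R Z Ω n) a (-(Real.exp x : ℂ) * Z a)) =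
        ∑ b ∈ stBox l1 l2 k, H b := by
      ext1 x
      rw [tbaExponent_eq_sum, Finset.sum_apply]
      exact Finset.sum_congr rfl fun b _ => hHe b x
    rw [this]
    exact Subalgebra.sum_mem _ fun b _ => hH b

/-- The ray integrals exist for points off the ray. -/
lemma hasWeakIntegral_ray (hR : 0 < R)
    (hZ : ∀ a b : Lat l1 l2, pairing a b ≠ 0 → cross (Z a) (Z b) ≠ 0) (n : ℕ) {b : Lat l1 l2}
    (hb : Z b ≠ 0) {ζ : ℂ} (hζ : ζ ≠ 0) (hq : OffRay (-Z b / ζ)) :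
    HasWeakIntegral (fun y : ℝ => rho ζ (-(Real.exp y : ℂ) * Z b) • rayTerm k R Z Ω n b y)
      (rayIntegral (Z b) fun ζ' => rho ζ ζ' • (stMonomial k b • tbaIter k R Z Ω n b ζ')) := by
  obtain ⟨H, _, hw⟩ := (hasRep (k := k) (Ω := Ω) hR hZ n).conv hR hb hq
  have h1 := hw 0
  have h2 : (fun y : ℝ => ratioKern ((Real.exp (y - 0) : ℂ) * (-Z b / ζ)) •
      rayTerm k R Z Ω n b y) =
      fun y : ℝ => rho ζ (-(Real.exp y : ℂ) * Z b) • rayTerm k R Z Ω n b y := by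
    ext1 y
    rw [rho_eq_ratioKern hζ, sub_zero]
    congr 2
    ring
  rw [h2] at h1
  have h3 := h1.eq
  rw [show rayIntegral (Z b) (fun ζ' => rho ζ ζ' • (stMonomial k b • tbaIter k R Z Ω n b ζ')) =
    H 0 from h3]
  exact h1

end Iterates


/-! ### Leading parts -/

section Leading

variable {l1 l2 : ℕ} {k : ℕ} {m : Deg l1 l2}

/-- The projection from `R_k` to power series truncated at `m`. -/
def artinToTrunc (hm : ∀ v, m v ≤ k) : ArtinR l1 l2 k →ₐ[ℂ] Trunc m :=
  Ideal.Quotient.factorₐ ℂ (by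
    refine Ideal.span_le.2 ?_
    rintro _ ⟨v, rfl⟩ d hd
    classical
    simp only
    rw [MvPowerSeries.X_pow_eq, MvPowerSeries.coeff_monomial, if_neg]
    intro h
    have h1 := hd v
    rw [h, Finsupp.single_eq_same] at h1
    have := hm v
    omega)

/-- The absolute values of the coordinates. -/
def absDeg (b : Lat l1 l2) : Deg l1 l2 := Finsupp.equivFunOnFinite.symm fun v => (b v).natAbs

lemma absDeg_toLat (d : Deg l1 l2) : absDeg (toLat d) = d := by
  ext v
  simp [absDeg, toLat]

lemma le_toLat_absDeg (b : Lat l1 l2) : b ≤ toLat (absDeg b) := fun v => by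
  simp only [toLat, absDeg, Finsupp.equivFunOnFinite_symm_apply_apply]
  omega

lemma artinToTrunc_stMonomial (hm : ∀ v, m v ≤ k) (b : Lat l1 l2) :
    artinToTrunc hm (stMonomial k b) = tmono m (absDeg b) := by
  have h1 : (∏ v, (MvPowerSeries.X v : MvPowerSeries (Idx l1 l2) ℂ) ^ (b v).natAbs) =
      MvPowerSeries.monomial (absDeg b) 1 := by
    have h2 : absDeg b = ∑ v, Finsupp.single v (b v).natAbs :=
      (Finsupp.univ_sum_single (absDeg b)).symm
    rw [h2]
    simp only [MvPowerSeries.X_pow_eq]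
    induction (Finset.univ : Finset (Idx l1 l2)) using Finset.induction_on with
    | empty => simp
    | insert a s ha ih =>
      rw [Finset.prod_insert ha, Finset.sum_insert ha, ih, MvPowerSeries.monomial_mul_monomial,
        one_mul]
  rw [stMonomial, h1]
  rfl

/-- The coefficient of `x^d e_c`. -/
def lcoeff (hm : ∀ v, m v ≤ k) (d : Deg l1 l2) (c : Lat l1 l2) : GHat l1 l2 k →ₗ[ℂ] ℂ where
  toFun x := tcoeff d (artinToTrunc hm (x.coeff c))
  map_add' x y := by rw [AddMonoidAlgebra.coeff_add, Finsupp.add_apply, map_add, map_add]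
  map_smul' a x := by
    rw [AddMonoidAlgebra.coeff_smul, Finsupp.smul_apply, map_smul, map_smul, RingHom.id_apply]

variable (hm : ∀ v, m v ≤ k)

lemma lcoeff_single (d : Deg l1 l2) (b c : Lat l1 l2) (r : ArtinR l1 l2 k) :
    lcoeff hm d c (AddMonoidAlgebra.single b r) =
      if b = c then tcoeff d (artinToTrunc hm r) else 0 := by
  change tcoeff d (artinToTrunc hm ((AddMonoidAlgebra.single b r).coeff c)) = _
  rw [AddMonoidAlgebra.coeff_single, Finsupp.single_apply]
  split_ifs
  · rfl
  · rw [map_zero, map_zero]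

lemma coeff_mul_lat (x y : GHat l1 l2 k) (c : Lat l1 l2) :
    (x * y).coeff c = ∑ a ∈ x.coeff.support, x.coeff a * y.coeff (c - a) := by
  classical
  rw [AddMonoidAlgebra.coeff_mul, Finsupp.sum]
  refine Finset.sum_congr rfl fun a _ => ?_
  simp only [← eq_sub_iff_add_eq']
  rw [Finsupp.sum_ite_eq']
  split_ifs with h
  · rfl
  · rw [Finsupp.notMem_support_iff.1 h, mul_zero]

lemma lcoeff_mul {d : Deg l1 l2} (hd : d ≤ m) (c : Lat l1 l2) (x y : GHat l1 l2 k) :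
    lcoeff hm d c (x * y) = ∑ p ∈ Finset.HasAntidiagonal.antidiagonal d,
      ∑ a ∈ x.coeff.support, lcoeff hm p.1 a x * lcoeff hm p.2 (c - a) y := by
  change tcoeff d (artinToTrunc hm ((x * y).coeff c)) = _
  rw [coeff_mul_lat, map_sum, map_sum, Finset.sum_comm]
  refine Finset.sum_congr rfl fun a _ => ?_
  rw [map_mul, tcoeff_mul hd]
  rfl

/-- Elements in which `x^d e_c` occurs only for `c ≤ d`. -/
def lowAlg : Subalgebra ℂ (GHat l1 l2 k) where
  carrier := {x | ∀ d ≤ m, ∀ c : Lat l1 l2, ¬ c ≤ toLat d → lcoeff hm d c x = 0}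
  add_mem' hx hy d hd c hc := by rw [map_add, hx d hd c hc, hy d hd c hc, add_zero]
  mul_mem' {x y} hx hy d hd c hc := by
    rw [lcoeff_mul hm hd]
    refine Finset.sum_eq_zero fun p hp => Finset.sum_eq_zero fun a _ => ?_
    have hp' : p.1 + p.2 = d := Finset.HasAntidiagonal.mem_antidiagonal.1 hp
    by_cases h1 : a ≤ toLat p.1
    · rw [hy p.2 (le_trans (by rw [← hp']; exact le_add_self) hd), mul_zero]
      intro h2
      refine hc ?_
      rw [← hp', toLat_add]
      have := add_le_add h1 h2
      rwa [add_sub_cancel] at this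
    · rw [hx p.1 (le_trans (by rw [← hp']; exact le_self_add) hd) a h1, zero_mul]
  algebraMap_mem' r d hd c hc := by
    have h : algebraMap ℂ (GHat l1 l2 k) r =
        AddMonoidAlgebra.single (0 : Lat l1 l2) (algebraMap ℂ (ArtinR l1 l2 k) r) := rfl
    rw [h, lcoeff_single, if_neg]
    rintro rfl
    exact hc fun v => by simp [toLat]

/-- The part of an element which consists of the `x^d e_d`. -/
def leadPart : GHat l1 l2 k →ₗ[ℂ] Trunc m where
  toFun x := tof m fun d => lcoeff hm d (toLat d) x
  map_add' x y := trunc_ext fun d hd => by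
    rw [map_add, tcoeff_tof hd, tcoeff_tof hd, tcoeff_tof hd, map_add]
  map_smul' a x := trunc_ext fun d hd => by
    rw [map_smul, tcoeff_tof hd, tcoeff_tof hd, map_smul, RingHom.id_apply]

lemma tcoeff_leadPart {d : Deg l1 l2} (hd : d ≤ m) (x : GHat l1 l2 k) :
    tcoeff d (leadPart hm x) = lcoeff hm d (toLat d) x := tcoeff_tof hd _

lemma leadPart_mul {x y : GHat l1 l2 k} (hx : x ∈ lowAlg hm) (hy : y ∈ lowAlg hm) :
    leadPart hm (x * y) = leadPart hm x * leadPart hm y := by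
  refine trunc_ext fun d hd => ?_
  rw [tcoeff_leadPart hm hd, lcoeff_mul hm hd, tcoeff_mul hd]
  refine Finset.sum_congr rfl fun p hp => ?_
  have hp' : p.1 + p.2 = d := Finset.HasAntidiagonal.mem_antidiagonal.1 hp
  have hp1 : p.1 ≤ m := le_trans (by rw [← hp']; exact le_self_add) hd
  have hp2 : p.2 ≤ m := le_trans (by rw [← hp']; exact le_add_self) hd
  rw [tcoeff_leadPart hm hp1, tcoeff_leadPart hm hp2]
  have hsub : toLat d - toLat p.1 = toLat p.2 := by rw [← hp', toLat_add, add_sub_cancel_left]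
  rw [Finset.sum_eq_single (toLat p.1), hsub]
  · intro a _ ha
    by_cases h1 : a ≤ toLat p.1
    · rw [hy p.2 hp2, mul_zero]
      intro h2
      refine ha (le_antisymm h1 ?_)
      rw [← hp', toLat_add] at h2
      intro v
      have := h2 v
      simp only [Pi.sub_apply, Pi.add_apply] at this
      change toLat p.1 v ≤ a v
      omega
    · rw [hx p.1 hp1 a h1, zero_mul]
  · intro h
    have h0 : lcoeff hm p.1 (toLat p.1) x = 0 := by
      change tcoeff p.1 (artinToTrunc hm (x.coeff (toLat p.1))) = 0
      rw [Finsupp.notMem_support_iff.1 h, map_zero, map_zero]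
    rw [h0, zero_mul]

lemma leadPart_one : leadPart hm (1 : GHat l1 l2 k) = 1 := by
  classical
  refine trunc_ext fun d hd => ?_
  rw [tcoeff_leadPart hm hd, AddMonoidAlgebra.one_def, lcoeff_single, map_one, tcoeff_one hd]
  by_cases h : d = 0
  · rw [if_pos (by rw [h, toLat_zero])]
  · rw [if_neg h, if_neg fun h' => h (toLat_injective (by rw [← h', toLat_zero]))]

lemma leadPart_pow {x : GHat l1 l2 k} (hx : x ∈ lowAlg hm) (n : ℕ) :
    leadPart hm (x ^ n) = leadPart hm x ^ n := by
  induction n with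
  | zero => rw [pow_zero, pow_zero, leadPart_one]
  | succ n ih => rw [pow_succ, pow_succ, leadPart_mul hm (Subalgebra.pow_mem _ hx n) hx, ih]

lemma exp_mem_subalgebra {A : Type*} [CommRing A] [Algebra ℂ A] [Module ℚ A] (S : Subalgebra ℂ A)
    {x : A} {n : ℕ} (hx : x ∈ S) (hn : x ^ n = 0) : IsNilpotent.exp x ∈ S := by
  rw [nexp_eq_sum hn]
  exact Subalgebra.sum_mem _ fun i _ => Subalgebra.smul_mem _ (Subalgebra.pow_mem _ hx i) _

lemma map_exp_of_pow {A B : Type*} [CommRing A] [Algebra ℂ A] [Module ℚ A] [CommRing B]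
    [Algebra ℂ B] [Module ℚ B] (L : A →ₗ[ℂ] B) {x : A} {n : ℕ} (hn : x ^ n = 0)
    (hL : ∀ i : ℕ, L (x ^ i) = L x ^ i) : L (IsNilpotent.exp x) = IsNilpotent.exp (L x) := by
  rw [nexp_eq_sum hn, nexp_eq_sum (n := n) (by rw [← hL, hn, map_zero]), map_sum]
  refine Finset.sum_congr rfl fun i _ => ?_
  rw [map_smul, hL]

lemma exp_mem_lowAlg {x : GHat l1 l2 k} (hx : x ∈ lowAlg hm) {n : ℕ} (hn : x ^ n = 0) :
    IsNilpotent.exp x ∈ lowAlg hm :=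
  exp_mem_subalgebra (A := GHat l1 l2 k) (lowAlg hm) hx hn

lemma leadPart_exp {x : GHat l1 l2 k} (hx : x ∈ lowAlg hm) {n : ℕ} (hn : x ^ n = 0) :
    leadPart hm (IsNilpotent.exp x) = IsNilpotent.exp (leadPart hm x) :=
  map_exp_of_pow (A := GHat l1 l2 k) (leadPart hm) hn (leadPart_pow hm hx)

lemma st_basisE (b : Lat l1 l2) : stMonomial k b • basisE k b =
    AddMonoidAlgebra.single b (stMonomial k b * (((quadSign b : ℤˣ) : ℤ) : ArtinR l1 l2 k)) := by
  rw [artin_smul, basisE, AddMonoidAlgebra.single_mul_single, zero_add]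
  rfl

lemma artinToTrunc_st_sign (b : Lat l1 l2) :
    artinToTrunc hm (stMonomial k b * (((quadSign b : ℤˣ) : ℤ) : ArtinR l1 l2 k)) =
      ((quadSign b : ℤ) : ℂ) • tmono m (absDeg b) := by
  rw [map_mul, artinToTrunc_stMonomial, map_intCast, mul_comm, Int.cast_smul_eq_zsmul,
    zsmul_eq_mul]

lemma st_basisE_mem (b : Lat l1 l2) : stMonomial k b • basisE k b ∈ lowAlg hm := by
  classical
  intro d hd c hc
  rw [st_basisE, lcoeff_single, artinToTrunc_st_sign]
  split_ifs with h
  · rw [map_smul, tcoeff_tmono hd, if_neg, smul_zero]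
    rintro rfl
    exact hc (h ▸ le_toLat_absDeg b)
  · rfl

lemma leadPart_st_basisE (b : Deg l1 l2) :
    leadPart hm (stMonomial k (toLat b) • basisE k (toLat b)) =
      ((quadSign (toLat b) : ℤ) : ℂ) • tmono m b := by
  classical
  refine trunc_ext fun d hd => ?_
  rw [tcoeff_leadPart hm hd, st_basisE, lcoeff_single, artinToTrunc_st_sign, absDeg_toLat, map_smul,
    tcoeff_tmono hd]
  by_cases h : d = b
  · rw [if_pos (by rw [h])]
  · rw [if_neg h, if_neg (fun h' => h (toLat_injective h').symm), smul_zero]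

lemma leadPart_st_basisE_of_neg {b : Lat l1 l2} (hb : ∀ d : Deg l1 l2, b ≠ toLat d) :
    leadPart hm (stMonomial k b • basisE k b) = 0 :=
  trunc_ext fun d hd => by
    rw [tcoeff_leadPart hm hd, st_basisE, lcoeff_single, if_neg (hb d), map_zero]

end Leading

section LeadIter

variable {l1 l2 : ℕ} {k : ℕ} {m : Deg l1 l2} (hm : ∀ v, m v ≤ k) {R : ℝ} {Z : Lat l1 l2 → ℂ}
  {Ω : Lat l1 l2 → ℤ}

lemma dress_mem (n : ℕ) : ∀ (a : Lat l1 l2) (ζ : ℂ), dress k R Z Ω n a ζ ∈ lowAlg hm ∧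
    tbaExponent k Z Ω (tbaIter k R Z Ω n) a ζ ∈ lowAlg hm := by
  have key : ∀ n, (∀ (a : Lat l1 l2) (ζ : ℂ), dress k R Z Ω n a ζ ∈ lowAlg hm) →
      ∀ (a : Lat l1 l2) (ζ : ℂ), tbaExponent k Z Ω (tbaIter k R Z Ω n) a ζ ∈ lowAlg hm := by
    intro n ih a ζ
    rw [tbaExponent_eq_sum]
    refine Subalgebra.sum_mem _ fun b _ => Subalgebra.smul_mem _ ?_ _
    refine weakIntegral_mem (Subalgebra.toSubmodule (lowAlg hm)) fun y => ?_
    refine Subalgebra.smul_mem _ ?_ _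
    change rayTerm k R Z Ω n b y ∈ lowAlg hm
    rw [rayTerm_eq]
    exact Subalgebra.smul_mem _ (Subalgebra.mul_mem _ (st_basisE_mem hm b) (ih _ _)) _
  suffices h : ∀ (a : Lat l1 l2) (ζ : ℂ), dress k R Z Ω n a ζ ∈ lowAlg hm from
    fun a ζ => ⟨h a ζ, key n h a ζ⟩
  induction n with
  | zero => exact fun _ _ => Subalgebra.one_mem _
  | succ n ih =>
    intro a ζ
    obtain ⟨N, hN⟩ := exists_varIdeal_pow l1 l2 k
    exact exp_mem_lowAlg hm (key n ih a ζ) (hN _ (tbaExponent_mem _ a ζ))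

lemma leadPart_rayTerm (n : ℕ) (b : Lat l1 l2) (y : ℝ) :
    leadPart hm (rayTerm k R Z Ω n b y) = semiE R (Z b) (-(Real.exp y : ℂ) * Z b) •
      (leadPart hm (stMonomial k b • basisE k b) *
        leadPart hm (dress k R Z Ω n b (-(Real.exp y : ℂ) * Z b))) := by
  rw [rayTerm_eq, map_smul, leadPart_mul hm (st_basisE_mem hm b) (dress_mem hm _ _ _).1]

/-- The coefficientwise ray integral. -/
def tray (m : Deg l1 l2) (R : ℝ) (z ζ : ℂ) (b : Deg l1 l2) (V : ℂ → Trunc m) : Trunc m :=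
  tof m fun d => ∫ y : ℝ, rho ζ (-(Real.exp y : ℂ) * z) *
    (semiE R z (-(Real.exp y : ℂ) * z) * tcoeff d (tmono m b * V (-(Real.exp y : ℂ) * z)))

/-- The recursion of the leading parts of the iterates. -/
theorem leadPart_dress_succ (hR : 0 < R)
    (hZ : ∀ a b : Lat l1 l2, pairing a b ≠ 0 → cross (Z a) (Z b) ≠ 0) (n : ℕ) (a : Lat l1 l2) {ζ : ℂ}
    (hζ : ζ ≠ 0) (hb : ∀ b ∈ posIic m, pairing (toLat b) a ≠ 0 →
      Z (toLat b) ≠ 0 ∧ OffRay (-Z (toLat b) / ζ)) :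
    leadPart hm (dress k R Z Ω (n + 1) a ζ) = IsNilpotent.exp (∑ b ∈ posIic m,
      (minusCoef Ω b * (pairing (toLat b) a : ℂ)) •
        tray m R (Z (toLat b)) ζ b fun ζ' => leadPart hm (dress k R Z Ω n (toLat b) ζ')) := by
  classical
  obtain ⟨N, hN⟩ := exists_varIdeal_pow l1 l2 k
  rw [dress, leadPart_exp hm (dress_mem hm n a ζ).2 (hN _ (tbaExponent_mem _ a ζ))]
  congr 1
  refine trunc_ext fun d hd => ?_
  rw [tcoeff_leadPart hm hd, tbaExponent_eq_sum, map_sum, map_sum]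
  simp only [map_smul, smul_eq_mul]
  have hsub : (posIic m).image toLat ⊆ stBox l1 l2 k := by
    intro b hb
    obtain ⟨e, he, rfl⟩ := Finset.mem_image.1 hb
    have h1 := (mem_posIic.1 he).2
    refine Finset.mem_Icc.2 ⟨fun v => ?_, fun v => ?_⟩ <;> simp only [toLat]
    · omega
    · exact_mod_cast (h1 v).trans (hm v)
  rw [← Finset.sum_subset hsub, Finset.sum_image fun x _ y _ h => toLat_injective h]
  · refine Finset.sum_congr rfl fun b hbm => ?_
    by_cases hp : pairing (toLat b) a = 0
    · simp [hp]
    · obtain ⟨hb0, hoff⟩ := hb b hbm hp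
      rw [← ((hasWeakIntegral_ray (k := k) (Ω := Ω) hR hZ n hb0 hζ hoff)
        (lcoeff hm d (toLat d))).2, tray, tcoeff_tof hd, minusCoef]
      have h1 : ∀ y : ℝ, (lcoeff hm d (toLat d)) (rho ζ (-(Real.exp y : ℂ) * Z (toLat b)) •
          rayTerm k R Z Ω n (toLat b) y) = ((quadSign (toLat b) : ℤ) : ℂ) *
          (rho ζ (-(Real.exp y : ℂ) * Z (toLat b)) *
            (semiE R (Z (toLat b)) (-(Real.exp y : ℂ) * Z (toLat b)) * tcoeff d (tmono m b *
              leadPart hm (dress k R Z Ω n (toLat b) (-(Real.exp y : ℂ) * Z (toLat b)))))) := by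
        intro y
        rw [map_smul, ← tcoeff_leadPart hm hd, leadPart_rayTerm, leadPart_st_basisE, map_smul,
          smul_mul_assoc, map_smul]
        simp only [smul_eq_mul]
        ring
      simp only [h1]
      rw [integral_const_mul]
      push_cast
      ring
  · intro b _ hbn
    by_cases hb0 : b = 0
    · rw [hb0, pairing_zero_left, Int.cast_zero, mul_zero, zero_mul]
    have h2 : leadPart hm (stMonomial k b • basisE k b) = 0 := by
      by_cases hex : ∃ e : Deg l1 l2, b = toLat e
      · obtain ⟨e, rfl⟩ := hex
        rw [leadPart_st_basisE, tmono_eq_zero, smul_zero]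
        intro he
        refine hbn (Finset.mem_image_of_mem _ (mem_posIic.2 ⟨?_, he⟩))
        rintro rfl
        exact hb0 toLat_zero
      · push Not at hex
        exact leadPart_st_basisE_of_neg hm hex
    have h3 : lcoeff hm d (toLat d) (rayIntegral (Z b) fun ζ' =>
        rho ζ ζ' • (stMonomial k b • tbaIter k R Z Ω n b ζ')) = 0 := by
      refine weakIntegral_mem (LinearMap.ker (lcoeff hm d (toLat d))) fun y => ?_
      change lcoeff hm d (toLat d) (_ • rayTerm k R Z Ω n b y) = 0
      rw [map_smul, ← tcoeff_leadPart hm hd, leadPart_rayTerm, h2, zero_mul, smul_zero, map_zero,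
        smul_zero]
    rw [h3, mul_zero]

end LeadIter


/-! ### Comparison of the ray equation with the strip equation -/

section Compare

open Complex (I)

/-- The semiflat factor in logarithmic coordinates. -/
def stripE (R : ℝ) (z w : ℂ) : ℂ :=
  Complex.exp (-(Real.pi * R * (Complex.exp (-w) * z + Complex.exp w * (starRingEnd ℂ) z)))

lemma conj_mul_self_of_unit {u : ℂ} (hu : ‖u‖ = 1) : (starRingEnd ℂ) u * u = 1 := by
  rw [mul_comm, Complex.mul_conj, Complex.normSq_eq_norm_sq, hu]
  norm_num

lemma ne_zero_of_unit {u : ℂ} (hu : ‖u‖ = 1) : u ≠ 0 := by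
  rintro rfl
  simp at hu

lemma semiE_eq_stripE (R : ℝ) {u : ℂ} (hu : ‖u‖ = 1) (Z w : ℂ) :
    semiE R Z (-(u * Complex.exp w)) = stripE R ((starRingEnd ℂ) u * Z) w := by
  have h1 := conj_mul_self_of_unit hu
  have hu0 := ne_zero_of_unit hu
  have hinv : u⁻¹ = (starRingEnd ℂ) u := by
    field_simp
    rw [mul_comm]
    exact h1.symm
  rw [semiE, stripE, inv_neg, mul_inv, hinv, ← Complex.exp_neg, map_mul, Complex.conj_conj]
  congr 1
  ring

lemma rho_log {u : ℂ} (hu : ‖u‖ = 1) (w w' : ℂ) :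
    rho (-(u * Complex.exp w)) (-(u * Complex.exp w')) = kern (w' - w) := by
  have hu0 := ne_zero_of_unit hu
  rw [rho_eq_ratioKern (neg_ne_zero.2 (mul_ne_zero hu0 (Complex.exp_ne_zero w))), kern_eq_ratioKern,
    neg_div_neg_eq, mul_div_mul_left _ _ hu0, ← Complex.exp_sub]

lemma ray_point {u : ℂ} (hu : ‖u‖ = 1) {Z : ℂ} (hz : (starRingEnd ℂ) u * Z ≠ 0) (y : ℝ) :
    -(Real.exp y : ℂ) * Z =
      -(u * Complex.exp (y + Complex.log ((starRingEnd ℂ) u * Z))) := by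
  rw [Complex.exp_add, Complex.exp_log hz, ← Complex.ofReal_exp]
  linear_combination (Real.exp y : ℂ) * Z * conj_mul_self_of_unit hu

lemma offRay_exp {v : ℂ} (h : Real.cos v.im < 1) : OffRay (Complex.exp v) := by
  rw [OffRay, Complex.exp_re, Complex.norm_exp]
  nlinarith [Real.exp_pos v.re]

variable {l1 l2 : ℕ} {m : Deg l1 l2} {T : Set ℝ} {τ₀ δ R : ℝ}

/-- A ray integral is a line integral in logarithmic coordinates. -/
lemma tray_eq_tline {u : ℂ} (hu : ‖u‖ = 1) {Z : ℂ} (hz : (starRingEnd ℂ) u * Z ≠ 0) (b : Deg l1 l2)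
    {V : ℂ → Trunc m} {X : ℂ → Trunc m}
    (hX : ∀ w : ℂ, w.im = ((starRingEnd ℂ) u * Z).arg → X w =
      stripE R ((starRingEnd ℂ) u * Z) w • (tmono m b * V (-(u * Complex.exp w)))) (w : ℂ) :
    tray m R Z (-(u * Complex.exp w)) b V = tline m ((starRingEnd ℂ) u * Z).arg X w := by
  set z := (starRingEnd ℂ) u * Z with hzdef
  refine trunc_ext fun d hd => ?_
  rw [tray, tcoeff_tof hd, tcoeff_tline hd, line_eq_integral,
    ← integral_add_right_eq_self
      (fun x : ℝ => kern ((x + z.arg * I) - w) * tcoeff d (X (x + z.arg * I))) (Real.log ‖z‖)]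
  congr 1
  ext y
  have h1 : ((y + Real.log ‖z‖ : ℝ) : ℂ) + z.arg * I = y + Complex.log z := by
    rw [Complex.log]
    push_cast
    ring
  rw [ray_point hu hz, rho_log hu, semiE_eq_stripE R hu, h1, hX _ (by
    rw [← h1, im_line]), map_smul, smul_eq_mul]

variable {k : ℕ} (hm : ∀ v, m v ≤ k) {Z : Lat l1 l2 → ℂ} {Ω : Lat l1 l2 → ℤ}
  {E : Deg l1 l2 → ℝ × ℂ → ℂ} {ε : Deg l1 l2 → Deg l1 l2 → ℂ}

/-- The position of the rays at a point `τ`, in a strip around the ray of direction `u`. -/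
structure RayData (m : Deg l1 l2) (R δ : ℝ) (u : ℂ) (Z : Lat l1 l2 → ℂ)
    (ε : Deg l1 l2 → Deg l1 l2 → ℂ) : Prop where
  unit : ‖u‖ = 1
  cross_ne : ∀ a b : Lat l1 l2, pairing a b ≠ 0 → cross (Z a) (Z b) ≠ 0
  ne_zero : ∀ b ∈ posIic m, (starRingEnd ℂ) u * Z (toLat b) ≠ 0
  arg_lt : ∀ b ∈ posIic m, |((starRingEnd ℂ) u * Z (toLat b)).arg| < δ
  side : ∀ b ∈ posIic m, ∀ b' ∈ posIic m, pr b' b ≠ 0 →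
    (ε b' b = 0 ∧ ((starRingEnd ℂ) u * Z (toLat b)).arg < ((starRingEnd ℂ) u * Z (toLat b')).arg) ∨
    (ε b' b = 1 ∧ ((starRingEnd ℂ) u * Z (toLat b')).arg < ((starRingEnd ℂ) u * Z (toLat b)).arg)

variable {u : ℂ}

lemma RayData.dress_succ (D : RayData m R δ u Z ε) (hR : 0 < R) {n : ℕ}
    {X : Deg l1 l2 → ℂ → Trunc m}
    (hX : ∀ b ∈ posIic m, ∀ w : ℂ, w.im = ((starRingEnd ℂ) u * Z (toLat b)).arg → X b w =
      stripE R ((starRingEnd ℂ) u * Z (toLat b)) w •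
        (tmono m b * leadPart hm (dress k R Z Ω n (toLat b) (-(u * Complex.exp w)))))
    (a : Lat l1 l2) {w : ℂ}
    (hw : ∀ b ∈ posIic m, pairing (toLat b) a ≠ 0 →
      Real.cos (((starRingEnd ℂ) u * Z (toLat b)).arg - w.im) < 1) :
    leadPart hm (dress k R Z Ω (n + 1) a (-(u * Complex.exp w))) = IsNilpotent.exp
      (∑ b ∈ posIic m, (minusCoef Ω b * (pairing (toLat b) a : ℂ)) •
        tline m ((starRingEnd ℂ) u * Z (toLat b)).arg (X b) w) := by
  have hu0 := ne_zero_of_unit D.unit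
  rw [leadPart_dress_succ hm hR D.cross_ne n a
    (neg_ne_zero.2 (mul_ne_zero hu0 (Complex.exp_ne_zero w)))]
  · congr 1
    refine Finset.sum_congr rfl fun b hb => ?_
    congr 1
    exact tray_eq_tline D.unit (D.ne_zero b hb) b (fun w hw => hX b hb w hw) w
  · intro b hb hp
    have hz := D.ne_zero b hb
    refine ⟨fun h0 => hz (by rw [h0, mul_zero]), ?_⟩
    have h1 : -Z (toLat b) / -(u * Complex.exp w) =
        Complex.exp (Complex.log ((starRingEnd ℂ) u * Z (toLat b)) - w) := by
      rw [Complex.exp_sub, Complex.exp_log hz, neg_div_neg_eq,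
        div_eq_div_iff (mul_ne_zero hu0 (Complex.exp_ne_zero w)) (Complex.exp_ne_zero w)]
      linear_combination -Complex.exp w * Z (toLat b) * conj_mul_self_of_unit D.unit
    rw [h1]
    refine offRay_exp ?_
    rw [Complex.sub_im, Complex.log_im]
    exact hw b hb hp

lemma stripIter_one (c : Deg l1 l2 → ℂ) (b : Deg l1 l2) (p : ℝ × ℂ) :
    stripIter m δ E c ε 1 b p = E b p • tmono m b := by
  have h : stripExponent m δ c ε (stripIter m δ E c ε 0) b p = 0 := by
    refine Finset.sum_eq_zero fun b' _ => ?_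
    simp only [stripIter, tup, tline_zero, smul_zero, add_zero]
  change E b p • (tmono m b *
    IsNilpotent.exp (stripExponent m δ c ε (stripIter m δ E c ε 0) b p)) = _
  rw [h, IsNilpotent.exp_zero, mul_one]

variable (hδ : δ ≤ Real.pi / 4) (h0 : τ₀ ∈ T) (hE : ∀ b ∈ posIic m, Fam T τ₀ δ decayW (E b)) {τ : ℝ}
  (hτ : τ ∈ T) (hEτ : ∀ b w, E b (τ, w) = stripE R ((starRingEnd ℂ) u * Z (toLat b)) w)

include hδ h0 hE hτ hEτ

/-- On their own rays, the leading parts of the iterates solve the strip equation. -/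
lemma RayData.iter_eq (D : RayData m R δ u Z ε) (hR : 0 < R) (n : ℕ) :
    ∀ b ∈ posIic m, ∀ w : ℂ, w.im = ((starRingEnd ℂ) u * Z (toLat b)).arg →
      stripIter m δ E (minusCoef Ω) ε (n + 1) b (τ, w) =
        stripE R ((starRingEnd ℂ) u * Z (toLat b)) w •
        (tmono m b * leadPart hm (dress k R Z Ω n (toLat b) (-(u * Complex.exp w)))) := by
  have hpi := Real.pi_pos
  induction n with
  | zero =>
    intro b hb w _
    rw [stripIter_one, dress, leadPart_one, mul_one, hEτ]
  | succ n ih =>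
    intro b hb w hw
    change E b (τ, w) • (tmono m b * IsNilpotent.exp
      (stripExponent m δ (minusCoef Ω) ε
        (stripIter m δ E (minusCoef Ω) ε (n + 1)) b (τ, w))) = _
    rw [hEτ, D.dress_succ hm hR (X := fun b w =>
      stripIter m δ E (minusCoef Ω) ε (n + 1) b (τ, w)) ih (toLat b)]
    · congr 3
      refine Finset.sum_congr rfl fun b' hb' => ?_
      by_cases hp : pr b' b = 0
      · have hp' : pairing (toLat b') (toLat b) = 0 := hp
        rw [hp, hp', Int.cast_zero, mul_zero, zero_smul, zero_smul]
      · change _ = (minusCoef Ω b' * (pr b' b : ℂ)) • _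
        congr 1
        have hdec := stripIter_decay (c := minusCoef Ω) (ε := ε) hδ h0 hE (n + 1) b' hb'
        have hwδ : |w.im| < δ := by rw [hw]; exact D.arg_lt b hb
        have hb'δ := abs_lt.1 (D.arg_lt b' hb')
        refine trunc_ext fun d hd => ?_
        rw [map_add, map_smul, tup, tcoeff_tline hd, tcoeff_tline hd]
        rcases D.side b hb b' hb' hp with ⟨h1, h2⟩ | ⟨h1, h2⟩
        · rw [h1, zero_smul, add_zero]
          exact up_eq_line hδ (hdec d hd) hτ hwδ (by rw [hw]; exact h2) hb'δ.2
        · rw [h1, one_smul]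
          exact (line_eq_up_add hδ (hdec d hd) hτ hwδ (by rw [hw]; exact h2) hb'δ.1).symm
    · intro b' hb' hp
      have h1 := abs_lt.1 (D.arg_lt b hb)
      have h2 := abs_lt.1 (D.arg_lt b' hb')
      rw [hw]
      rcases D.side b hb b' hb' hp with ⟨_, h3⟩ | ⟨_, h3⟩
      · exact cos_lt_one_of_mem (by linarith) (by linarith)
      · rw [← Real.cos_neg]
        exact cos_lt_one_of_mem (by linarith) (by linarith)

/-- The leading part of the solution at an external point. -/
theorem RayData.dress_external (D : RayData m R δ u Z ε) (hR : 0 < R) (a : Lat l1 l2) {w : ℂ}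
    (hw : ∀ y : ℝ, |y| < δ → Real.cos (y - w.im) < 1) {n : ℕ} (hn : m.degree < n) :
    leadPart hm (dress k R Z Ω (n + 1) a (-(u * Complex.exp w))) = IsNilpotent.exp
      (∑ b ∈ posIic m, (minusCoef Ω b * (pairing (toLat b) a : ℂ)) •
        tline m 0 (fun z => stripSol m δ E (minusCoef Ω) ε b (τ, z)) w) := by
  have hst : ∀ n : ℕ, m.degree < n → ∀ b ∈ posIic m, ∀ p,
      stripIter m δ E (minusCoef Ω) ε n b p = stripSol m δ E (minusCoef Ω) ε b p := by
    intro n hn b hb p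
    induction n, hn using Nat.le_induction with
    | base => rfl
    | succ n hn ih => rw [stripIter_stable hn hb, ih]
  rw [D.dress_succ hm hR (D.iter_eq hm hδ h0 hE hτ hEτ hR n) a fun b hb _ => hw _ (D.arg_lt b hb)]
  congr 1
  refine Finset.sum_congr rfl fun b hb => ?_
  congr 1
  have hdec := stripSol_decay (c := minusCoef Ω) (ε := ε) hδ h0 hE b hb
  refine trunc_ext fun d hd => ?_
  rw [tcoeff_tline hd, tcoeff_tline hd]
  simp only [hst (n + 1) (by omega) b hb]
  have h1 := D.arg_lt b hb
  have h00 : |(0 : ℝ)| < δ := by rw [abs_zero]; exact (abs_nonneg _).trans_lt h1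
  refine (hdec d hd).line_eq_line hτ h1 h00 fun y hy => hw y ?_
  exact (abs_le_of_mem_uIcc hy).trans_lt (max_lt h1 h00)

end Compare


/-! ### Central charges near the wall -/

section NearWall

open Complex (I)

lemma cross_eq_im (z w : ℂ) : cross z w = ((starRingEnd ℂ) z * w).im := by
  simp [cross]
  ring

lemma cross_conj_mul {u : ℂ} (hu : ‖u‖ = 1) (z w : ℂ) :
    cross ((starRingEnd ℂ) u * z) ((starRingEnd ℂ) u * w) = cross z w := by
  rw [cross_eq_im, cross_eq_im, map_mul, Complex.conj_conj]
  congr 1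
  linear_combination (starRingEnd ℂ) z * w * conj_mul_self_of_unit hu

lemma arg_lt_arg_of_cross {z w : ℂ} (hz : 0 < z.re) (hw : 0 < w.re) (h : 0 < cross z w) :
    z.arg < w.arg := by
  have hz' := abs_lt.1 (Complex.abs_arg_lt_pi_div_two_iff.2 (Or.inl hz))
  have hw' := abs_lt.1 (Complex.abs_arg_lt_pi_div_two_iff.2 (Or.inl hw))
  by_contra hn
  rw [cross_eq_sin] at h
  exact h.not_ge (mul_nonpos_of_nonneg_of_nonpos (by positivity)
    (Real.sin_nonpos_of_nonpos_of_neg_pi_le (by linarith) (by linarith)))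

/-- A narrow cone around the positive real axis. -/
def NearReal (r s : ℝ) (z : ℂ) : Prop := r ≤ z.re ∧ |z.im| ≤ s * z.re

lemma NearReal.abs_arg_lt {r s δ : ℝ} {z : ℂ} (h : NearReal r s z) (hr : 0 < r)
    (hs : s < Real.sin δ) (hδ0 : 0 < δ) (hδ : δ ≤ Real.pi / 4) : |z.arg| < δ := by
  have hz : 0 < z.re := hr.trans_le h.1
  have hzn : 0 < ‖z‖ := norm_pos_iff.2 fun h0 => by simp [h0] at hz
  have hs0 : 0 ≤ s := by
    by_contra hneg
    have := mul_neg_of_neg_of_pos (not_le.1 hneg) hz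
    linarith [abs_nonneg z.im, h.2]
  have hb : |z.im / ‖z‖| < Real.sin δ := by
    rw [abs_div, abs_of_pos hzn, div_lt_iff₀ hzn]
    calc |z.im| ≤ s * z.re := h.2
      _ ≤ s * ‖z‖ := mul_le_mul_of_nonneg_left (Complex.re_le_norm z) hs0
      _ < Real.sin δ * ‖z‖ := mul_lt_mul_of_pos_right hs hzn
  have hpi := Real.pi_pos
  have hb' := abs_lt.1 hb
  rw [Complex.arg_of_re_nonneg hz.le, abs_lt]
  constructor
  · rw [Real.lt_arcsin_iff_sin_lt' ⟨by linarith, by linarith⟩, Real.sin_neg]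
    exact hb'.1
  · rw [Real.arcsin_lt_iff_lt_sin' ⟨by linarith, by linarith⟩]
    exact hb'.2

lemma norm_stripE (R : ℝ) (z w : ℂ) : ‖stripE R z w‖ =
    Real.exp (-(2 * Real.pi * R * Real.cosh w.re *
      (Real.cos w.im * z.re + Real.sin w.im * z.im))) := by
  rw [stripE, Complex.norm_exp, Real.cosh_eq]
  congr 1
  rw [Complex.neg_re, ← Complex.ofReal_mul, Complex.re_ofReal_mul, Complex.add_re, Complex.mul_re,
    Complex.mul_re, Complex.exp_re, Complex.exp_re, Complex.exp_im, Complex.exp_im, Complex.neg_re,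
    Complex.neg_im, Complex.conj_re, Complex.conj_im, Real.cos_neg, Real.sin_neg]
  ring

lemma NearReal.norm_stripE_le {r R : ℝ} {z : ℂ} (h : NearReal r (1 / 5) z) (hr : 0 < r)
    (hR : 0 < R) {w : ℂ} (hw : |w.im| ≤ Real.pi / 4) :
    ‖stripE R z w‖ ≤ 2 / (Real.pi * R * r) * decayW w.re := by
  have hpi := Real.pi_pos
  have hz : 0 < z.re := hr.trans_le h.1
  have hw' := abs_le.1 hw
  have hcos : Real.cos (Real.pi / 4) ≤ Real.cos w.im := by
    rw [← Real.cos_abs w.im]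
    exact Real.cos_le_cos_of_nonneg_of_le_pi (abs_nonneg _) (by linarith) hw
  have h2 : (7 : ℝ) / 10 ≤ Real.cos (Real.pi / 4) := by
    rw [Real.cos_pi_div_four]
    have : (7 : ℝ) / 5 ≤ √2 := Real.le_sqrt_of_sq_le (by norm_num)
    linarith
  have h3 : |Real.sin w.im * z.im| ≤ 1 / 5 * z.re := by
    rw [abs_mul]
    calc _ ≤ 1 * |z.im| := mul_le_mul_of_nonneg_right (Real.abs_sin_le_one _) (abs_nonneg _)
      _ ≤ _ := by rw [one_mul]; exact h.2
  have h4 : r / 2 ≤ Real.cos w.im * z.re + Real.sin w.im * z.im := by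
    have := (abs_le.1 h3).1
    have h5 : 7 / 10 * z.re ≤ Real.cos w.im * z.re :=
      mul_le_mul_of_nonneg_right (h2.trans hcos) hz.le
    linarith [h.1]
  have hc := cosh_ge w.re
  have h6 : Real.pi * R * r * ((1 + w.re ^ 2) / 2) ≤ 2 * Real.pi * R * Real.cosh w.re *
      (Real.cos w.im * z.re + Real.sin w.im * z.im) := by
    calc Real.pi * R * r * ((1 + w.re ^ 2) / 2) ≤ Real.pi * R * r * Real.cosh w.re :=
          mul_le_mul_of_nonneg_left hc (by positivity)
      _ = 2 * Real.pi * R * Real.cosh w.re * (r / 2) := by ring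
      _ ≤ _ := mul_le_mul_of_nonneg_left h4 (by positivity)
  rw [norm_stripE]
  have h7 : 0 < Real.pi * R * r * ((1 + w.re ^ 2) / 2) := by positivity
  refine (Real.exp_le_exp.2 (neg_le_neg h6)).trans ((exp_neg_le_inv h7).trans (le_of_eq ?_))
  rw [decayW]
  field_simp

lemma stripE_fam {T : Set ℝ} {τ₀ δ r R : ℝ} (hδ : δ ≤ Real.pi / 4) (hr : 0 < r) (hR : 0 < R)
    {z : ℝ → ℂ} (hz : Continuous z) (h : ∀ τ ∈ T, NearReal r (1 / 5) (z τ)) :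
    Fam T τ₀ δ decayW fun p => stripE R (z p.1) p.2 where
  hol τ _ := by
    simp only [stripE]
    exact Differentiable.differentiableOn (by fun_prop)
  bdd ρ hρ := ⟨2 / (Real.pi * R * r), by positivity, fun τ hτ w hw =>
    (h τ hτ).norm_stripE_le hr hR (hw.trans (hρ.le.trans hδ))⟩
  cts w _ := by
    simp only [stripE]
    have h1 := Complex.continuous_conj.comp hz
    refine Continuous.continuousWithinAt ?_
    simp only [Function.comp_def] at h1
    fun_prop

/-- The integral of a real exponential against the propagator does not vanish. -/
lemma line_stripE_ne {r R : ℝ} (hr : 0 < r) (hR : 0 < R) {w : ℂ} (hw : Real.sin w.im ≠ 0) :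
    line 0 (fun z => stripE R r z) w ≠ 0 := by
  have hpi := Real.pi_pos
  have hcos : Real.cos w.im < 1 := by
    refine lt_of_le_of_ne (Real.cos_le_one _) fun h => hw ?_
    have := Real.sin_sq_add_cos_sq w.im
    rw [h] at this
    nlinarith
  have hE : ∀ x : ℝ, stripE R r x = (Real.exp (-(2 * Real.pi * R * r * Real.cosh x)) : ℝ) := by
    intro x
    rw [stripE, Complex.conj_ofReal, Complex.ofReal_exp, Real.cosh_eq]
    congr 1
    push_cast
    ring
  have hfam := stripE_fam (T := {0}) (τ₀ := 0) (δ := Real.pi / 4) le_rfl hr hR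
    (z := fun _ => (r : ℂ)) continuous_const fun _ _ => ⟨by simp, by simp; positivity⟩
  have hint := hfam.integrable (τ := 0) (t := 0) (Set.mem_singleton _) (by simp [hpi])
  simp only [Complex.ofReal_zero, zero_mul, add_zero] at hint
  have hint' := integrable_cauchyInt hint hcos
  rw [line_eq_integral]
  simp only [Complex.ofReal_zero, zero_mul, add_zero]
  intro h0
  set F : ℝ → ℝ := fun x => Real.sin w.im * (kern (x - w) * stripE R r x).re with hF
  have hpos : ∀ x, 0 < F x := by
    intro x
    rw [hF]
    simp only
    rw [hE, Complex.re_mul_ofReal, ← mul_assoc]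
    refine mul_pos ?_ (Real.exp_pos _)
    set q := Complex.exp (x - w) with hq
    have hq1 : q - 1 ≠ 0 := exp_sub_one_ne (by simpa using hcos)
    have him : q.im = -(Real.exp (x - w.re) * Real.sin w.im) := by
      rw [hq, Complex.exp_im]
      simp
    have hk : (kern (x - w)).re = -q.im / (2 * Real.pi * Complex.normSq (q - 1)) := by
      have hn : Complex.normSq (q - 1) ≠ 0 := by simpa using hq1
      have h1 : kern (x - w) = ((1 / (4 * Real.pi) / Complex.normSq (q - 1) : ℝ) : ℂ) *
          (-I * ((q + 1) * (starRingEnd ℂ) (q - 1))) := by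
        rw [kern, ← hq, div_eq_mul_inv (q + 1), Complex.inv_def]
        push_cast
        field_simp
        rw [Complex.I_sq]
        ring
      rw [h1, Complex.re_ofReal_mul]
      simp
      field_simp
      ring
    rw [hk, him, neg_neg]
    have hn : 0 < Complex.normSq (q - 1) := Complex.normSq_pos.2 hq1
    have : 0 < Real.sin w.im * Real.sin w.im := mul_self_pos.2 hw
    rw [mul_div_assoc', mul_left_comm]
    have he := Real.exp_pos (x - w.re)
    positivity
  have hFint : Integrable F := hint'.re.const_mul _
  have hz : ∫ x, F x = 0 := by
    rw [hF, integral_const_mul]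
    have : ∫ x : ℝ, (kern (x - w) * stripE R r x).re =
        (∫ x : ℝ, kern (x - w) * stripE R r x).re := integral_re hint'
    rw [this, h0, Complex.zero_re, mul_zero]
  have hp := (integral_pos_iff_support_of_nonneg (fun x => (hpos x).le) hFint).2 (by
    have : Function.support F = Set.univ := Set.eq_univ_of_forall fun x => (hpos x).ne'
    rw [this]
    simp)
  exact hp.ne' hz

end NearWall


/-! ### The family of central charges across the wall -/

section Wall

open Complex (I)

variable {l1 l2 : ℕ}

namespace ChargePair

variable (P : ChargePair)

/-- The value of `Z^τ` on the `γ_i`. -/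
def gAt (τ : ℝ) : ℂ := (1 - (τ : ℂ)) * P.gPlus + τ * P.gMinus

/-- The value of `Z^τ` on the `η_j`. -/
def hAt (τ : ℝ) : ℂ := (1 - (τ : ℂ)) * P.hPlus + τ * P.hMinus

lemma interp_eq (τ : ℝ) (a : Lat l1 l2) : P.interp τ a = central (P.gAt τ) (P.hAt τ) a := by
  rw [interp, plus, minus, central, central, central, gAt, hAt]
  ring

lemma continuous_gAt : Continuous P.gAt := by unfold gAt; fun_prop

lemma continuous_hAt : Continuous P.hAt := by unfold hAt; fun_prop

lemma re_gAt (τ : ℝ) : (P.gAt τ).re = (1 - τ) * P.gPlus.re + τ * P.gMinus.re := by simp [gAt]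

lemma im_gAt (τ : ℝ) : (P.gAt τ).im = (1 - τ) * P.gPlus.im + τ * P.gMinus.im := by simp [gAt]

lemma re_hAt (τ : ℝ) : (P.hAt τ).re = (1 - τ) * P.hPlus.re + τ * P.hMinus.re := by simp [hAt]

lemma im_hAt (τ : ℝ) : (P.hAt τ).im = (1 - τ) * P.hPlus.im + τ * P.hMinus.im := by simp [hAt]

lemma cross_gAt_hAt_identity (τ τ₀ : ℝ) :
    τ₀ * (1 - τ₀) * cross (P.gAt τ) (P.hAt τ) - τ * (1 - τ) * cross (P.gAt τ₀) (P.hAt τ₀) =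
      (τ - τ₀) * (cross P.gMinus P.hMinus * τ * τ₀ +
        cross P.hPlus P.gPlus * (1 - τ) * (1 - τ₀)) := by
  simp only [cross, re_gAt, im_gAt, re_hAt, im_hAt]
  ring

/-- A point on the wall. -/
structure OnWall (τ₀ : ℝ) : Prop where
  mem : τ₀ ∈ Set.Ioo (0 : ℝ) 1
  cross_eq : cross (P.gAt τ₀) (P.hAt τ₀) = 0

lemma onWall_of_line {τ₀ : ℝ} (hl1 : 0 < l1) (hl2 : 0 < l2) (hτ₀ : τ₀ ∈ Set.Icc (0 : ℝ) 1)
    (hwall : ∃ u : ℂ, ∀ b : Lat l1 l2, ∃ r : ℝ, P.interp τ₀ b = r * u) : P.OnWall τ₀ := by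
  obtain ⟨u, hu⟩ := hwall
  have hc : cross (P.gAt τ₀) (P.hAt τ₀) = 0 := by
    obtain ⟨r, hr⟩ := hu (1 • basisVec (Sum.inl ⟨0, hl1⟩))
    obtain ⟨r', hr'⟩ := hu (1 • basisVec (Sum.inr ⟨0, hl2⟩))
    rw [interp_eq, central, gPart_smul_basis, hPart_smul_basis] at hr hr'
    simp only [Nat.cast_one, Int.cast_one, one_mul, Int.cast_zero, zero_mul, add_zero,
      zero_add] at hr hr'
    rw [hr, hr']
    simp [cross]
    ring
  have h1 := P.cross_minus
  have h2 := P.cross_plus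
  refine ⟨⟨lt_of_le_of_ne hτ₀.1 ?_, lt_of_le_of_ne hτ₀.2 ?_⟩, hc⟩
  · rintro rfl
    simp only [cross, re_gAt, im_gAt, re_hAt, im_hAt] at hc h2
    linarith
  · rintro rfl
    simp only [cross, re_gAt, im_gAt, re_hAt, im_hAt] at hc h1
    linarith

namespace OnWall

variable {P} {τ₀ : ℝ} (H : P.OnWall τ₀)

include H

lemma cross_aux {τ : ℝ} (hτ : τ ∈ Set.Icc (0 : ℝ) 1) : ∃ p > 0, ∃ q > 0,
    p * cross (P.gAt τ) (P.hAt τ) = (τ - τ₀) * q := by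
  obtain ⟨h1, h2⟩ := H.mem
  have h3 := P.cross_minus
  have h4 := P.cross_plus
  refine ⟨τ₀ * (1 - τ₀), mul_pos h1 (by linarith), cross P.gMinus P.hMinus * τ * τ₀ +
        cross P.hPlus P.gPlus * (1 - τ) * (1 - τ₀), ?_, ?_⟩
  · rcases hτ.1.eq_or_lt with h | h
    · subst h
      simp only [mul_zero, zero_mul, zero_add, sub_zero, mul_one]
      exact mul_pos h4 (by linarith)
    · have h5 : 0 < cross P.gMinus P.hMinus * τ * τ₀ := by positivity
      have h6 : 0 ≤ cross P.hPlus P.gPlus * (1 - τ) * (1 - τ₀) :=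
        mul_nonneg (mul_nonneg h4.le (by linarith [hτ.2])) (by linarith)
      linarith
  · rw [← cross_gAt_hAt_identity, H.cross_eq, mul_zero, sub_zero]

lemma cross_neg {τ : ℝ} (hτ : τ ∈ Set.Icc (0 : ℝ) 1) (h : τ < τ₀) :
    cross (P.gAt τ) (P.hAt τ) < 0 := by
  obtain ⟨p, hp, q, hq, e⟩ := H.cross_aux hτ
  by_contra hc
  have := mul_nonneg hp.le (not_lt.1 hc)
  nlinarith [mul_pos hq (sub_pos.2 h)]

lemma cross_pos {τ : ℝ} (hτ : τ ∈ Set.Icc (0 : ℝ) 1) (h : τ₀ < τ) :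
    0 < cross (P.gAt τ) (P.hAt τ) := by
  obtain ⟨p, hp, q, hq, e⟩ := H.cross_aux hτ
  by_contra hc
  have := mul_nonneg hp.le (neg_nonneg.2 (not_lt.1 hc))
  nlinarith [mul_pos hq (sub_pos.2 h)]

lemma re_im_nonneg : (0 ≤ (P.gAt τ₀).re ∧ 0 ≤ (P.gAt τ₀).im) ∧
    (0 ≤ (P.hAt τ₀).re ∧ 0 ≤ (P.hAt τ₀).im) := by
  obtain ⟨⟨a1, a2⟩, ⟨b1, b2⟩, ⟨c1, c2⟩, d1, d2⟩ := P.quadrant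
  obtain ⟨h1, h2⟩ := H.mem
  have h3 : 0 ≤ 1 - τ₀ := by linarith
  rw [re_gAt, im_gAt, re_hAt, im_hAt]
  refine ⟨⟨?_, ?_⟩, ?_, ?_⟩ <;> positivity

lemma combination_ne {z w : ℂ} (hz : 0 ≤ z.re ∧ 0 ≤ z.im) (hw : 0 ≤ w.re ∧ 0 ≤ w.im)
    (hw0 : w ≠ 0) : (1 - (τ₀ : ℂ)) * z + τ₀ * w ≠ 0 := by
  obtain ⟨h1, h2⟩ := H.mem
  have h3 : 0 ≤ 1 - τ₀ := by linarith
  intro h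
  have hr := congrArg Complex.re h
  have hi := congrArg Complex.im h
  simp at hr hi
  have e1 := mul_nonneg h3 hz.1
  have e2 := mul_nonneg h3 hz.2
  have e3 := mul_nonneg h1.le hw.1
  have e4 := mul_nonneg h1.le hw.2
  refine hw0 (Complex.ext ?_ ?_)
  · exact (mul_eq_zero.1 (show τ₀ * w.re = 0 by linarith)).resolve_left h1.ne'
  · exact (mul_eq_zero.1 (show τ₀ * w.im = 0 by linarith)).resolve_left h1.ne'

lemma gAt_ne : P.gAt τ₀ ≠ 0 := H.combination_ne P.quadrant.1 P.quadrant.2.2.1 P.gMinus_ne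

lemma hAt_ne : P.hAt τ₀ ≠ 0 := H.combination_ne P.quadrant.2.1 P.quadrant.2.2.2 P.hMinus_ne

/-- The common direction of the central charges at the wall. -/
lemma exists_direction : ∃ u : ℂ, ‖u‖ = 1 ∧ (∃ t : ℝ, u = t * P.gAt τ₀) ∧
    (∃ x > 0, (starRingEnd ℂ) u * P.gAt τ₀ = (x : ℝ)) ∧
    ∃ y > 0, (starRingEnd ℂ) u * P.hAt τ₀ = (y : ℝ) := by
  have hg := H.gAt_ne
  have hn : 0 < ‖P.gAt τ₀‖ := norm_pos_iff.2 hg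
  obtain ⟨⟨a1, a2⟩, b1, b2⟩ := H.re_im_nonneg
  have hgh : (starRingEnd ℂ) (P.gAt τ₀) * P.hAt τ₀ =
      (((P.gAt τ₀).re * (P.hAt τ₀).re + (P.gAt τ₀).im * (P.hAt τ₀).im : ℝ) : ℂ) := by
    apply Complex.ext
    · rw [Complex.ofReal_re]
      simp
    · rw [← cross_eq_im, H.cross_eq, Complex.ofReal_im]
  refine ⟨((‖P.gAt τ₀‖⁻¹ : ℝ) : ℂ) * P.gAt τ₀, ?_, ⟨_, rfl⟩, ⟨‖P.gAt τ₀‖, hn, ?_⟩,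
    ‖P.gAt τ₀‖⁻¹ * ((P.gAt τ₀).re * (P.hAt τ₀).re + (P.gAt τ₀).im * (P.hAt τ₀).im), ?_, ?_⟩
  · rw [norm_mul, Complex.norm_real, norm_inv, norm_norm, inv_mul_cancel₀ hn.ne']
  · rw [map_mul, Complex.conj_ofReal, mul_assoc, mul_comm ((starRingEnd ℂ) _), Complex.mul_conj,
      Complex.normSq_eq_norm_sq, ← Complex.ofReal_mul]
    congr 1
    field_simp
  · refine mul_pos (inv_pos.2 hn) (lt_of_le_of_ne (by positivity) fun h0 => ?_)
    rw [← h0, Complex.ofReal_zero, mul_eq_zero] at hgh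
    rcases hgh with h | h
    · exact hg ((map_eq_zero _).1 h)
    · exact H.hAt_ne h
  · rw [map_mul, Complex.conj_ofReal, mul_assoc, hgh, Complex.ofReal_mul]

/-- The line of `Z^{τ₀}` lies in the cones. -/
lemma real_mul_gAt_mem (t : ℝ) : (t : ℂ) * P.gAt τ₀ ∈ P.cones := by
  obtain ⟨q1, q2, q3, q4⟩ := P.quadrant
  obtain ⟨h1, h2⟩ := H.mem
  have hD := P.cross_plus
  have e1 : 0 < cross P.hPlus P.gMinus :=
    (arg_lt_arg_iff P.hPlus_ne P.gMinus_ne q2.1 q2.2 q3.1 q3.2).1 P.arg_lt_one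
  have e2 : 0 < cross P.gMinus P.gPlus :=
    (arg_lt_arg_iff P.gMinus_ne P.gPlus_ne q3.1 q3.2 q1.1 q1.2).1
      (P.arg_lt_two.trans P.arg_lt_three)
  set x := (1 - τ₀) + τ₀ * (cross P.hPlus P.gMinus / cross P.hPlus P.gPlus) with hx
  set y := τ₀ * (cross P.gMinus P.gPlus / cross P.hPlus P.gPlus) with hy
  have h3 : 0 ≤ 1 - τ₀ := by linarith
  have hx0 : 0 ≤ x := by positivity
  have hy0 : 0 ≤ y := by positivity
  have hz : P.gAt τ₀ = x * P.gPlus + y * P.hPlus := by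
    have hD' := hD.ne'
    have k1 : P.gMinus.re = cross P.hPlus P.gMinus / cross P.hPlus P.gPlus * P.gPlus.re +
        cross P.gMinus P.gPlus / cross P.hPlus P.gPlus * P.hPlus.re := by
      field_simp
      simp only [cross]
      ring
    have k2 : P.gMinus.im = cross P.hPlus P.gMinus / cross P.hPlus P.gPlus * P.gPlus.im +
        cross P.gMinus P.gPlus / cross P.hPlus P.gPlus * P.hPlus.im := by
      field_simp
      simp only [cross]
      ring
    apply Complex.ext
    · rw [re_gAt, Complex.add_re, Complex.re_ofReal_mul, Complex.re_ofReal_mul]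
      linear_combination τ₀ * k1
    · rw [im_gAt, Complex.add_im, Complex.im_ofReal_mul, Complex.im_ofReal_mul]
      linear_combination τ₀ * k2
  refine ⟨t * x, t * y, ?_, by rw [hz]; push_cast; ring⟩
  rcases le_total 0 t with ht | ht
  · exact Or.inl ⟨mul_nonneg ht hx0, mul_nonneg ht hy0⟩
  · exact Or.inr ⟨mul_nonpos_of_nonpos_of_nonneg ht hx0, mul_nonpos_of_nonpos_of_nonneg ht hy0⟩

end OnWall

end ChargePair

lemma NearReal.combination {r s : ℝ} {zg zh : ℂ} (hg : NearReal r s zg) (hh : NearReal r s zh)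
    (hr : 0 < r) (u : ℂ) {d : Deg l1 l2} (hd : d ≠ 0) {wg wh : ℂ} (eg : u * wg = zg)
    (eh : u * wh = zh) : NearReal r s (u * central wg wh (toLat d)) := by
  have e : u * central wg wh (toLat d) = (gD d : ℝ) * zg + (hD d : ℝ) * zh := by
    rw [central, ← eg, ← eh, gD, hD]
    push_cast
    ring
  have h1 : (0 : ℝ) ≤ gD d := by exact_mod_cast gD_nonneg d
  have h2 : (0 : ℝ) ≤ hD d := by exact_mod_cast hD_nonneg d
  have h3 : (1 : ℝ) ≤ gD d + hD d := by exact_mod_cast gD_add_hD_pos hd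
  rw [e]
  constructor
  · rw [Complex.add_re, Complex.re_ofReal_mul, Complex.re_ofReal_mul]
    nlinarith [mul_le_mul_of_nonneg_left hg.1 h1, mul_le_mul_of_nonneg_left hh.1 h2]
  · rw [Complex.add_re, Complex.re_ofReal_mul, Complex.re_ofReal_mul, Complex.add_im,
      Complex.im_ofReal_mul, Complex.im_ofReal_mul]
    refine (abs_add_le _ _).trans ?_
    rw [abs_mul, abs_mul, abs_of_nonneg h1, abs_of_nonneg h2]
    nlinarith [mul_le_mul_of_nonneg_left hg.2 h1, mul_le_mul_of_nonneg_left hh.2 h2]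

lemma eventually_nearReal {z : ℝ → ℂ} (hz : Continuous z) {τ₀ x r s : ℝ} (h : z τ₀ = x)
    (hrx : r < x) (hr : 0 < r) (hs : 0 < s) : ∀ᶠ τ in 𝓝 τ₀, NearReal r s (z τ) := by
  have h1 : ContinuousAt (fun τ => (z τ).re) τ₀ := by fun_prop
  have h2 : ContinuousAt (fun τ => s * (z τ).re - |(z τ).im|) τ₀ := by
    have : Continuous fun τ => s * (z τ).re - |(z τ).im| := by fun_prop
    exact this.continuousAt
  have h3 := h1.eventually (lt_mem_nhds (a := r) (by
    simp only [h, Complex.ofReal_re]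
    exact hrx))
  have h4 := h2.eventually (lt_mem_nhds (a := 0) (by
    simp only [h, Complex.ofReal_re, Complex.ofReal_im, abs_zero, sub_zero]
    exact mul_pos hs (hr.trans hrx)))
  filter_upwards [h3, h4] with τ a b
  exact ⟨a.le, by linarith⟩

/-- Data for the comparison of the two sides of the wall in a strip around the common ray. -/
structure WallData (P : ChargePair) (τ₀ : ℝ) (ζ u w₀ : ℂ) (δ η r s : ℝ) : Prop where
  onWall : P.OnWall τ₀
  unit : ‖u‖ = 1
  ζ_eq : ζ = -(u * Complex.exp w₀)
  δ_pos : 0 < δ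
  δ_le : δ ≤ Real.pi / 4
  cos_lt : ∀ y : ℝ, |y| < δ → Real.cos (y - w₀.im) < 1
  sin_ne : Real.sin w₀.im ≠ 0
  η_pos : 0 < η
  sub : Set.Icc (τ₀ - η) (τ₀ + η) ⊆ Set.Icc 0 1
  r_pos : 0 < r
  s_lt : s < Real.sin δ
  s_le : s ≤ 1 / 5
  near : ∀ τ ∈ Set.Icc (τ₀ - η) (τ₀ + η), NearReal r s ((starRingEnd ℂ) u * P.gAt τ) ∧
    NearReal r s ((starRingEnd ℂ) u * P.hAt τ)
  real : (∃ x > 0, (starRingEnd ℂ) u * P.gAt τ₀ = (x : ℝ)) ∧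
    ∃ y > 0, (starRingEnd ℂ) u * P.hAt τ₀ = (y : ℝ)

lemma exists_wallData {P : ChargePair} {τ₀ : ℝ} (H : P.OnWall τ₀) {ζ : ℂ} (hζ : ζ ∉ P.cones) :
    ∃ u w₀ δ η r s, WallData P τ₀ ζ u w₀ δ η r s := by
  obtain ⟨u, hu, ⟨t, ht⟩, ⟨x, hx, hgx⟩, y, hy, hhy⟩ := H.exists_direction
  have hpi := Real.pi_pos
  have huu := conj_mul_self_of_unit hu
  set q := -((starRingEnd ℂ) u * ζ) with hq
  have hqi : q.im ≠ 0 := by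
    intro h0
    refine hζ ?_
    have h1 : ((starRingEnd ℂ) u * ζ) = (((starRingEnd ℂ) u * ζ).re : ℝ) := by
      apply Complex.ext
      · rw [Complex.ofReal_re]
      · rw [Complex.ofReal_im]
        rw [hq, Complex.neg_im] at h0
        linarith
    have h2 : ζ = ((((starRingEnd ℂ) u * ζ).re * t : ℝ) : ℂ) * P.gAt τ₀ := by
      rw [Complex.ofReal_mul, mul_assoc, ← ht, ← h1]
      linear_combination (-ζ) * huu
    rw [h2]
    exact H.real_mul_gAt_mem _
  have hq0 : q ≠ 0 := fun h => hqi (by rw [h, Complex.zero_im])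
  have harg0 : q.arg ≠ 0 := fun h => hqi (by
    rw [Complex.arg_eq_zero_iff] at h; exact h.2)
  have hargpi : q.arg ≠ Real.pi := fun h => hqi (by
    rw [Complex.arg_eq_pi_iff] at h; exact h.2)
  have harg1 : q.arg < Real.pi := lt_of_le_of_ne (Complex.arg_le_pi q) hargpi
  have harg2 := Complex.neg_pi_lt_arg q
  set δ := min (Real.pi / 4) |q.arg| with hδ
  have hδ0 : 0 < δ := lt_min (by linarith) (abs_pos.2 harg0)
  have hδ1 : δ ≤ Real.pi / 4 := min_le_left _ _
  have hδ2 : δ ≤ |q.arg| := min_le_right _ _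
  have hsin : 0 < Real.sin δ := Real.sin_pos_of_pos_of_lt_pi hδ0 (by linarith)
  set s := min (1 / 5) (Real.sin δ / 2) with hs
  have hs0 : 0 < s := lt_min (by norm_num) (by linarith)
  set r := min x y / 2 with hr
  have hr0 : 0 < r := by have := lt_min hx hy; linarith
  have hrx : r < x := by have := lt_min hx hy; have := min_le_left x y; linarith
  have hry : r < y := by have := lt_min hx hy; have := min_le_right x y; linarith
  have hev := ((eventually_nearReal (continuous_const.mul P.continuous_gAt) hgx hrx hr0 hs0).and
    (eventually_nearReal (continuous_const.mul P.continuous_hAt) hhy hry hr0 hs0)).and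
    (Icc_mem_nhds H.mem.1 H.mem.2)
  obtain ⟨η, hη, hball⟩ := Metric.eventually_nhds_iff.1 hev
  have hin : ∀ τ ∈ Set.Icc (τ₀ - η / 2) (τ₀ + η / 2), dist τ τ₀ < η := by
    intro τ hτ
    rw [Real.dist_eq, abs_lt]
    constructor <;> linarith [hτ.1, hτ.2]
  refine ⟨u, Complex.log q, δ, η / 2, r, s, H, hu, ?_, hδ0, hδ1, ?_, ?_, by linarith,
    fun τ hτ => (hball (hin τ hτ)).2, hr0, ?_, min_le_left _ _, fun τ hτ => (hball (hin τ hτ)).1,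
    ⟨x, hx, hgx⟩, y, hy, hhy⟩
  · rw [Complex.exp_log hq0, hq]
    linear_combination (-ζ) * huu
  · intro z hz
    have hz' := abs_lt.1 hz
    rw [Complex.log_im]
    rcases le_total 0 q.arg with h | h
    · rw [abs_of_nonneg h] at hδ2
      rw [← Real.cos_neg]
      exact cos_lt_one_of_mem (by linarith) (by linarith)
    · rw [abs_of_nonpos h] at hδ2
      exact cos_lt_one_of_mem (by linarith) (by linarith)
  · rw [Complex.log_im, Complex.sin_arg]
    exact div_ne_zero hqi (norm_ne_zero_iff.2 hq0)
  · exact (min_le_right _ _).trans_lt (by linarith)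

end Wall


/-! ### Continuity across the wall -/

section Limit

variable {l1 l2 : ℕ} {k : ℕ} {m : Deg l1 l2}

lemma minusCoef_plusSpectrum : minusCoef (plusSpectrum (l1 := l1) (l2 := l2)) = plusCoef := by
  funext b
  rw [minusCoef, plusCoef]
  by_cases h : DT plusSpectrum (toLat b) = 0
  · rw [h, Rat.cast_zero, mul_zero]
  · obtain ⟨u, p, _, hu⟩ := exists_of_DT_plus_ne (fun v => by rw [toLat]; positivity) h
    have h1 : quadSign (toLat b) = 1 := by
      rw [hu, quadSign, gPart_smul_basis, hPart_smul_basis]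
      rcases u with i | j <;> simp
    rw [h1, Units.val_one, Int.cast_one, one_mul]

lemma basisE_neg_mul (a : Lat l1 l2) : basisE k (-a) * basisE k a = 1 := by
  have h1 : pairing (-a) a = 0 := by
    have hg : gPart (-a) = -gPart a := by simp [gPart]
    have hh : hPart (-a) = -hPart a := by simp [hPart]
    rw [pairing, hg, hh]
    ring
  rw [basisE_mul, h1, neg_add_cancel, basisE]
  have hg : gPart (0 : Lat l1 l2) = 0 := by simp [gPart]
  rw [hg, zero_mul, Int.negOnePow_zero, Units.val_one, Int.cast_one, one_smul,
    AddMonoidAlgebra.one_def]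

lemma le_of_stMonomial_ne {α : Lat l1 l2} (hk : stMonomial k α ≠ 0) (v : Idx l1 l2) :
    degOf α v ≤ k := by
  by_contra h
  refine hk (stMonomial_eq_zero fun h1 => ?_)
  have h2 := (Finset.mem_Icc.1 h1).2 v
  have h3 : degOf α v = (α v).toNat := rfl
  simp only at h2
  omega

/-- The functions continuous at `τ₀` within `T`. -/
def continuousWithinAlg (T : Set ℝ) (τ₀ : ℝ) : Subalgebra ℂ (ℝ → ℂ) where
  carrier := {f | ContinuousWithinAt f T τ₀}
  mul_mem' hf hg := ContinuousWithinAt.mul hf hg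
  add_mem' hf hg := ContinuousWithinAt.add hf hg
  algebraMap_mem' _ := continuousWithinAt_const

lemma eq_exp_of_limit {T : Set ℝ} {τ₀ : ℝ} [(𝓝[T \ {τ₀}] τ₀).NeBot] {N S : ℝ → Trunc m}
    (hN : CoeffIn (continuousWithinAlg T τ₀) N) (hS : CoeffIn (continuousWithinAlg T τ₀) S)
    (hS1 : ∀ τ, S τ ∈ tfilt m 1) (h : ∀ τ ∈ T, τ ≠ τ₀ → N τ = IsNilpotent.exp (S τ)) :
    N τ₀ = IsNilpotent.exp (S τ₀) := by
  refine trunc_ext fun d hd => ?_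
  have h1 : ContinuousWithinAt (fun τ => tcoeff d (N τ)) T τ₀ := hN d hd
  have h2 : ContinuousWithinAt (fun τ => tcoeff d (IsNilpotent.exp (S τ))) T τ₀ :=
    hS.exp hS1 d hd
  have h3 := (h1.mono Set.sdiff_subset (t := T) (s := T \ {τ₀})).tendsto
  have h4 := (h2.mono Set.sdiff_subset (t := T) (s := T \ {τ₀})).tendsto
  refine tendsto_nhds_unique (h3.congr' ?_) h4
  filter_upwards [self_mem_nhdsWithin] with τ hτ
  rw [h τ hτ.1 hτ.2]

/-- The family `Z^τ` in a strip. -/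
def wallE (P : ChargePair) (R : ℝ) (u : ℂ) (b : Deg l1 l2) (p : ℝ × ℂ) : ℂ :=
  stripE R ((starRingEnd ℂ) u * P.interp p.1 (toLat b)) p.2

lemma sum_tline_mem {δ : ℝ} (f : Deg l1 l2 → ℂ) (E : Deg l1 l2 → ℝ × ℂ → ℂ) (c : Deg l1 l2 → ℂ)
    (ε : Deg l1 l2 → Deg l1 l2 → ℂ) (τ : ℝ) (w : ℂ) :
    ∑ b ∈ posIic m, f b • tline m 0 (fun z => stripSol m δ E c ε b (τ, z)) w ∈ tfilt m 1 := by
  refine Ideal.sum_mem _ fun b hb => smul_mem_tfilt (f b) ?_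
  exact tline_mem (fun z _ => stripIter_mem (m.degree + 1) b hb (τ, z)) w

namespace WallData

variable {P : ChargePair} {τ₀ : ℝ} {ζ u w₀ : ℂ} {δ η r s R : ℝ}
  (W : WallData P τ₀ ζ u w₀ δ η r s)

include W

lemma near_interp {τ : ℝ} (hτ : τ ∈ Set.Icc (τ₀ - η) (τ₀ + η)) {d : Deg l1 l2} (hd : d ≠ 0) :
    NearReal r s ((starRingEnd ℂ) u * P.interp τ (toLat d)) := by
  rw [P.interp_eq]
  exact (W.near τ hτ).1.combination (W.near τ hτ).2 W.r_pos _ hd rfl rfl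

lemma fam (hR : 0 < R) {d : Deg l1 l2} (hd : d ∈ posIic m) :
    Fam (Set.Icc (τ₀ - η) (τ₀ + η)) τ₀ δ decayW (wallE P R u d) := by
  refine stripE_fam (z := fun τ => (starRingEnd ℂ) u * P.interp τ (toLat d)) W.δ_le W.r_pos hR ?_
    fun τ hτ => ?_
  · unfold ChargePair.interp
    fun_prop
  · obtain ⟨h1, h2⟩ := W.near_interp hτ (mem_posIic.1 hd).1
    exact ⟨h1, h2.trans (mul_le_mul_of_nonneg_right W.s_le (W.r_pos.le.trans h1))⟩

lemma rayData {τ : ℝ} (hτ : τ ∈ Set.Icc (τ₀ - η) (τ₀ + η)) (hne : τ ≠ τ₀)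
    {ε : Deg l1 l2 → Deg l1 l2 → ℂ} (hε : ∀ b b' : Deg l1 l2, pr b' b ≠ 0 →
      (ε b' b = 0 ∧ 0 < pr b b' * cross (P.gAt τ) (P.hAt τ)) ∨
      (ε b' b = 1 ∧ 0 < pr b' b * cross (P.gAt τ) (P.hAt τ))) :
    RayData m R δ u (P.interp τ) ε := by
  have hpos : ∀ b ∈ posIic m, 0 < ((starRingEnd ℂ) u * P.interp τ (toLat b)).re :=
    fun b hb => W.r_pos.trans_le (W.near_interp hτ (mem_posIic.1 hb).1).1
  have hcross : ∀ b b' : Lat l1 l2, cross (P.interp τ b) (P.interp τ b') =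
      pairing b b' * cross (P.gAt τ) (P.hAt τ) := fun b b' => by
    rw [P.interp_eq, P.interp_eq, cross_central]
  refine ⟨W.unit, ?_, ?_, ?_, ?_⟩
  · intro a b hab
    rw [hcross]
    refine mul_ne_zero (by exact_mod_cast hab) ?_
    rcases lt_or_gt_of_ne hne with h | h
    · exact (W.onWall.cross_neg (W.sub hτ) h).ne
    · exact (W.onWall.cross_pos (W.sub hτ) h).ne'
  · intro b hb h0
    have := hpos b hb
    rw [h0] at this
    exact lt_irrefl _ this
  · intro b hb
    exact (W.near_interp hτ (mem_posIic.1 hb).1).abs_arg_lt W.r_pos W.s_lt W.δ_pos W.δ_le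
  · intro b hb b' hb' hp
    refine (hε b b' hp).imp (fun h => ⟨h.1, ?_⟩) (fun h => ⟨h.1, ?_⟩)
    · refine arg_lt_arg_of_cross (hpos b hb) (hpos b' hb') ?_
      rw [cross_conj_mul W.unit, hcross]
      exact h.2
    · refine arg_lt_arg_of_cross (hpos b' hb') (hpos b hb) ?_
      rw [cross_conj_mul W.unit, hcross]
      exact h.2

lemma rayData_left {τ : ℝ} (hτ : τ ∈ Set.Icc (τ₀ - η) (τ₀ + η)) (h : τ < τ₀) :
    RayData m R δ u (P.interp τ (l1 := l1) (l2 := l2)) plusEps := by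
  have hc := W.onWall.cross_neg (W.sub hτ) h
  refine W.rayData hτ h.ne fun b b' hp => ?_
  rcases lt_or_gt_of_ne hp with h1 | h1
  · exact Or.inr ⟨if_pos h1, mul_pos_of_neg_of_neg (by exact_mod_cast h1) hc⟩
  · refine Or.inl ⟨if_neg h1.not_gt, mul_pos_of_neg_of_neg ?_ hc⟩
    rw [pr_swap]
    exact_mod_cast neg_neg_of_pos h1

lemma rayData_right {τ : ℝ} (hτ : τ ∈ Set.Icc (τ₀ - η) (τ₀ + η)) (h : τ₀ < τ) :
    RayData m R δ u (P.interp τ (l1 := l1) (l2 := l2)) minusEps := by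
  have hc := W.onWall.cross_pos (W.sub hτ) h
  refine W.rayData hτ h.ne' fun b b' hp => ?_
  rcases lt_or_gt_of_ne hp with h1 | h1
  · refine Or.inl ⟨if_neg h1.not_gt, mul_pos ?_ hc⟩
    rw [pr_swap]
    exact_mod_cast neg_pos_of_neg h1
  · exact Or.inr ⟨if_pos h1, mul_pos (by exact_mod_cast h1) hc⟩

lemma cos_lt_zero : Real.cos (w₀.im - 0) < 1 := by
  have := W.cos_lt 0 (by simpa using W.δ_pos)
  rwa [← Real.cos_neg, neg_sub, sub_zero, zero_sub, Real.cos_neg, ← sub_zero w₀.im] at *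

/-- The value at the wall of a continuous family which is given by the iterates on one side. -/
lemma limit_eq (hm : ∀ v, m v ≤ k) (hR : 0 < R) {T : Set ℝ} [(𝓝[T \ {τ₀}] τ₀).NeBot]
    (hT : T ⊆ Set.Icc (τ₀ - η) (τ₀ + η)) (h0 : τ₀ ∈ T) {Ω : Lat l1 l2 → ℤ}
    {ε : Deg l1 l2 → Deg l1 l2 → ℂ}
    (hray : ∀ τ ∈ T, τ ≠ τ₀ → RayData m R δ u (P.interp τ) ε) (a : Lat l1 l2)
    {N : ℝ → Trunc m} (hN : CoeffIn (continuousWithinAlg T τ₀) N)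
    (hdress : ∀ τ ∈ T, τ ≠ τ₀ → ∃ n, m.degree < n ∧
      N τ = leadPart hm (dress k R (P.interp τ) Ω (n + 1) a ζ)) :
    N τ₀ = IsNilpotent.exp (∑ b ∈ posIic m, (minusCoef Ω b * (pairing (toLat b) a : ℂ)) •
      tline m 0 (fun z => stripSol m δ (wallE P R u) (minusCoef Ω) ε b (τ₀, z)) w₀) := by
  have hE : ∀ b ∈ posIic m, Fam T τ₀ δ decayW (wallE P R u b) := fun b hb => (W.fam hR hb).mono hT
  refine eq_exp_of_limit (T := T) hN (S := fun τ => ∑ b ∈ posIic m,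
    (minusCoef Ω b * (pairing (toLat b) a : ℂ)) •
      tline m 0 (fun z => stripSol m δ (wallE P R u) (minusCoef Ω) ε b (τ, z)) w₀) ?_ ?_ ?_
  · refine CoeffIn.sum fun b hb => CoeffIn.smul (minusCoef Ω b * (pairing (toLat b) a : ℂ))
      (f := fun τ => tline m 0
        (fun z => stripSol m δ (wallE P R u) (minusCoef Ω) ε b (τ, z)) w₀) fun d hd => ?_
    simp only [tcoeff_tline hd]
    exact line_cts (f := fun p => tcoeff d (stripSol m δ (wallE P R u) (minusCoef Ω) ε b p))
      (stripSol_decay W.δ_le h0 hE b hb d hd) h0 (by simpa using W.δ_pos)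
      W.cos_lt_zero
  · exact fun τ => sum_tline_mem _ _ _ _ _ _
  · intro τ hτ hne
    obtain ⟨n, hn, h⟩ := hdress τ hτ hne
    rw [h, W.ζ_eq]
    have hEτ : ∀ (b : Deg l1 l2) (w : ℂ), wallE P R u b (τ, w) =
        stripE R ((starRingEnd ℂ) u * P.interp τ (toLat b)) w := fun _ _ => rfl
    exact RayData.dress_external hm W.δ_le h0 hE hτ hEτ (hray τ hτ hne) hR a W.cos_lt hn

lemma line_ne (hR : 0 < R) {d : Deg l1 l2} (hd : d ≠ 0) :
    line 0 (fun z => wallE P R u d (τ₀, z)) w₀ ≠ 0 := by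
  obtain ⟨⟨x, hx, hgx⟩, y, hy, hhy⟩ := W.real
  have h1 : (starRingEnd ℂ) u * P.interp τ₀ (toLat d) = ((gD d * x + hD d * y : ℝ) : ℂ) := by
    rw [P.interp_eq, central, mul_add, mul_left_comm, hgx, mul_left_comm, hhy, gD, hD]
    push_cast
    ring
  have h2 : (0 : ℝ) ≤ gD d := by exact_mod_cast gD_nonneg d
  have h3 : (0 : ℝ) ≤ hD d := by exact_mod_cast hD_nonneg d
  have h4 : (0 : ℝ) < gD d + hD d := by exact_mod_cast gD_add_hD_pos hd
  have h5 : 0 < gD d * x + hD d * y := by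
    rcases h2.eq_or_lt with h | h
    · rw [← h, zero_add] at h4
      have := mul_nonneg h2 hx.le
      have := mul_pos h4 hy
      linarith
    · have := mul_pos h hx
      have := mul_nonneg h3 hy.le
      linarith
  simp only [wallE, h1]
  exact line_stripE_ne h5 hR W.sin_ne

end WallData

/-- A solution of the wall-crossing problem has the same jumps as the system before the wall. -/
theorem numJump_eq_of_solvesWallCrossing {P : ChargePair} {τ₀ : ℝ} {ζ : ℂ}
    (hl1 : 0 < l1) (hl2 : 0 < l2) (hm : ∀ v, m v ≤ k) (H : P.OnWall τ₀) (hζ : ζ ∉ P.cones)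
    {Ω : Lat l1 l2 → ℤ} (hΩ : SolvesWallCrossing P τ₀ ζ k Ω) :
    ∀ ω ∈ ({gD, hD} : Set (Deg l1 l2 → ℤ)),
      numJump m plusCoef plusEps ω = numJump m (minusCoef Ω) minusEps ω := by
  obtain ⟨u, w₀, δ, η, r, s, W⟩ := exists_wallData H hζ
  obtain ⟨R, ⟨Ψ, hΨc, hΨ⟩, hR⟩ := (hΩ.2.and (eventually_gt_atTop (0 : ℝ))).exists
  set N : Lat l1 l2 → ℝ → Trunc m := fun a τ => leadPart hm
    ((semiE R (P.interp τ a) ζ)⁻¹ • (basisE k (-a) * Ψ τ (basisE k a))) with hNdef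
  have hη := W.η_pos
  have hN : ∀ a, ∀ T ⊆ Set.Icc (τ₀ - η) (τ₀ + η), τ₀ ∈ T →
      CoeffIn (continuousWithinAlg T τ₀) (N a) := by
    intro a T hT h0 d hd
    obtain ⟨n, ρ, b, c, hc, hsum⟩ := hΨc a
    have h1 : ContinuousWithinAt (fun τ => (semiE R (P.interp τ a) ζ)⁻¹ *
        ∑ j, c j τ * tcoeff d (leadPart hm (basisE k (-a) * (ρ j • basisE k (b j))))) T τ₀ := by
      refine ContinuousWithinAt.mul ?_ ?_
      · have h2 : Continuous fun τ => semiE R (P.interp τ a) ζ := by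
          unfold semiE ChargePair.interp
          have := Complex.continuous_conj
          fun_prop
        exact (h2.inv₀ fun τ => Complex.exp_ne_zero _).continuousWithinAt
      · refine tendsto_finsetSum _ fun j _ => ?_
        exact ((hc j τ₀ (W.sub (hT h0))).mono (hT.trans W.sub)).mul continuousWithinAt_const
    have h3 : ∀ τ ∈ T, tcoeff d (N a τ) = (semiE R (P.interp τ a) ζ)⁻¹ *
        ∑ j, c j τ * tcoeff d (leadPart hm (basisE k (-a) * (ρ j • basisE k (b j)))) := by
      intro τ hτ
      rw [hNdef]
      simp only
      rw [hsum τ (W.sub (hT hτ)), map_smul, map_smul, smul_eq_mul, Finset.mul_sum, map_sum, map_sum]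
      congr 1
      refine Finset.sum_congr rfl fun j _ => ?_
      rw [mul_smul_comm, map_smul, map_smul, smul_eq_mul]
    exact h1.congr h3 (h3 τ₀ h0)
  have hdress : ∀ a, ∀ τ ∈ Set.Icc (τ₀ - η) (τ₀ + η), τ ≠ τ₀ → ∃ n, m.degree < n ∧
      N a τ = leadPart hm
        (dress k R (P.interp τ) (if τ < τ₀ then plusSpectrum else Ω) (n + 1) a ζ) := by
    intro a τ hτ hne
    obtain ⟨M, hM⟩ := eventually_atTop.1 (hΨ τ (W.sub hτ) hne a)
    refine ⟨max M (m.degree + 1), by omega, ?_⟩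
    have h1 := hM (max M (m.degree + 1) + 1) (by omega)
    have h2 := tbaIter_eq (k := k) (R := R) (Z := P.interp τ)
      (Ω := if τ < τ₀ then plusSpectrum else Ω) (max M (m.degree + 1) + 1) a ζ
    rw [tbaIter] at h2
    rw [hNdef]
    simp only
    rw [← h1, h2, mul_smul_comm, smul_smul, inv_mul_cancel₀ (by exact Complex.exp_ne_zero _),
      one_smul, ← mul_assoc, basisE_neg_mul, one_mul]
  have hpair : ∀ a : Lat l1 l2, ∑ b ∈ posIic m, (plusCoef b * (pairing (toLat b) a : ℂ)) •
      tline m 0 (fun z => stripSol m δ (wallE P R u) plusCoef plusEps b (τ₀, z)) w₀ =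
      ∑ b ∈ posIic m, (minusCoef Ω b * (pairing (toLat b) a : ℂ)) •
      tline m 0 (fun z => stripSol m δ (wallE P R u) (minusCoef Ω) minusEps b (τ₀, z)) w₀ := by
    intro a
    have hsubL : Set.Icc (τ₀ - η) τ₀ ⊆ Set.Icc (τ₀ - η) (τ₀ + η) :=
      Set.Icc_subset_Icc_right (by linarith)
    have hsubR : Set.Icc τ₀ (τ₀ + η) ⊆ Set.Icc (τ₀ - η) (τ₀ + η) :=
      Set.Icc_subset_Icc_left (by linarith)
    have h0L : τ₀ ∈ Set.Icc (τ₀ - η) τ₀ := ⟨by linarith, le_rfl⟩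
    have h0R : τ₀ ∈ Set.Icc τ₀ (τ₀ + η) := ⟨le_rfl, by linarith⟩
    have i1 : (𝓝[Set.Icc (τ₀ - η) τ₀ \ {τ₀}] τ₀).NeBot := by
      rw [Set.Icc_sdiff_right]
      exact right_nhdsWithin_Ico_neBot (by linarith)
    have i2 : (𝓝[Set.Icc τ₀ (τ₀ + η) \ {τ₀}] τ₀).NeBot := by
      rw [Set.Icc_sdiff_left]
      exact left_nhdsWithin_Ioc_neBot (by linarith)
    have hL := W.limit_eq hm hR hsubL h0L (Ω := plusSpectrum) (ε := plusEps)
      (fun τ hτ hne => W.rayData_left (hsubL hτ) (lt_of_le_of_ne hτ.2 hne)) a (hN a _ hsubL h0L)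
      (fun τ hτ hne => by
        have := hdress a τ (hsubL hτ) hne
        rwa [if_pos (lt_of_le_of_ne hτ.2 hne)] at this)
    have hRt := W.limit_eq hm hR hsubR h0R (Ω := Ω) (ε := minusEps)
      (fun τ hτ hne => W.rayData_right (hsubR hτ) (lt_of_le_of_ne hτ.1 hne.symm)) a
      (hN a _ hsubR h0R)
      (fun τ hτ hne => by
        have := hdress a τ (hsubR hτ) hne
        rwa [if_neg hτ.1.not_gt] at this)
    rw [minusCoef_plusSpectrum] at hL
    exact texp_injective (sum_tline_mem _ _ _ _ _ _) (sum_tline_mem _ _ _ _ _ _)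
      (hL.symm.trans hRt)
  have hτ0 : τ₀ ∈ Set.Icc (τ₀ - η) (τ₀ + η) := ⟨by linarith, by linarith⟩
  refine numJump_eq_of_external (E := wallE P R u) (τ₀ := τ₀) W.δ_pos W.δ_le
    (fun b hb => (W.fam hR hb).mono (Set.singleton_subset_iff.2 hτ0)) ?_ ?_ (w₀ := w₀) ?_
    (fun d hd => W.line_ne hR (mem_posIic.1 hd).1) ?_
  · intro w
    have h1 : P.interp τ₀ (toLat (0 : Deg l1 l2)) = 0 := by
      rw [P.interp_eq, central]
      change (gD (0 : Deg l1 l2) : ℂ) * _ + (hD (0 : Deg l1 l2) : ℂ) * _ = 0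
      rw [gD_zero, hD_zero, Int.cast_zero, zero_mul, zero_mul, add_zero]
    rw [wallE, h1, mul_zero, stripE, map_zero, mul_zero, mul_zero, add_zero, mul_zero, neg_zero,
      Complex.exp_zero]
  · intro d e w
    have h1 : P.interp τ₀ (toLat (d + e)) = P.interp τ₀ (toLat d) + P.interp τ₀ (toLat e) := by
      rw [toLat_add, P.interp_eq, P.interp_eq, P.interp_eq, central, central, central, gPart_add,
        hPart_add]
      push_cast
      ring
    rw [wallE, wallE, wallE, h1, stripE, stripE, stripE, ← Complex.exp_add,
      mul_add ((starRingEnd ℂ) u), map_add]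
    congr 1
    simp only
    ring
  · simpa using W.cos_lt_zero
  · intro ω hω
    rcases hω with rfl | rfl
    · have h1 : ∀ b : Deg l1 l2, pairing (toLat b) (1 • basisVec (Sum.inr ⟨0, hl2⟩)) = gD b := by
        intro b
        rw [pairing, gPart_smul_basis, hPart_smul_basis, gD]
        simp
      have := hpair (1 • basisVec (Sum.inr ⟨0, hl2⟩))
      simpa only [h1] using this
    · have h1 : ∀ b : Deg l1 l2, pairing (toLat b) (1 • basisVec (Sum.inl ⟨0, hl1⟩)) = -hD b := by
        intro b
        rw [pairing, gPart_smul_basis, hPart_smul_basis, hD]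
        simp
      have := hpair (1 • basisVec (Sum.inl ⟨0, hl1⟩))
      simp only [h1, Int.cast_neg, mul_neg, neg_smul, Finset.sum_neg_distrib, neg_inj] at this
      exact this

end Limit

end InstantonTBA

end

open InstantonTBA in
theorem mainTheorem3 (l1 l2 : ℕ) (hl2 : 0 < l2)
    (P : ChargePair) (τ₀ : ℝ) (hτ₀ : τ₀ ∈ Set.Icc (0 : ℝ) 1)
    (hwall : ∃ u : ℂ, ∀ b : Lat l1 l2, ∃ r : ℝ, P.interp τ₀ b = r * u)
    (ζ : ℂ) (hζ : ζ ∉ P.cones)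
    (α : Lat l1 l2) (hα : ∀ v, 0 ≤ α v) (hprim : Int.gcd (proj α).1 (proj α).2 = 1)
    (k : ℕ) (hk : stMonomial k α ≠ 0)
    (Ω : Lat l1 l2 → ℤ) (hΩ : SolvesWallCrossing P τ₀ ζ k Ω)
    (i : Fin l1) (hi : 0 < α (Sum.inl i))
    (ν : TreeClass l1 l2 → LTree l1 l2) (hν : ∀ T, Quotient.mk _ (ν T) = T) :
    {T : TreeClass l1 l2 | (ν T).Positive ∧ (ν T).charge = α ∧
        ∃ p : ℕ, 0 < p ∧ (ν T).rootLabel = p • basisVec (Sum.inl i)}.Finite ∧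
    DT Ω α =
      ∑ᶠ T ∈ {T : TreeClass l1 l2 | (ν T).Positive ∧ (ν T).charge = α ∧
        ∃ p : ℕ, 0 < p ∧ (ν T).rootLabel = p • basisVec (Sum.inl i)},
        ((ν T).rootLabel (Sum.inl i) : ℚ) / ((ν T).charge (Sum.inl i) : ℚ) *
          (ν T).weight * ((ν T).signSum P : ℚ) := by
  have hl1 : 0 < l1 := Fin.pos i
  exact tree_formula P hα hprim hi (numJump_eq_of_solvesWallCrossing hl1 hl2
    (le_of_stMonomial_ne hk) (P.onWall_of_line hl1 hl2 hτ₀ hwall) hζ hΩ) ν hν
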